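/- **Setting.** Let $\sigma=-1$ (focusing case), $\delta\in\{1,-1\}$, $q_-\in\mathbb R\setminus\{0\}$, $q_+=\delta q_-$, $q_0=|q_\pm|$, $\varepsilon=\delta\sigma$. Let $q:\mathbb R^2\to\mathbb R$ be a $C^3$ solution of the nonlocal mKdV equation $$q_t(x,t)-6\sigma q(x,t)q(-x,-t)q_x(x,t)+q_{xxx}(x,t)=0$$ such that, locally uniformly in $t$, $q\to q_\pm$ and $q_x,q_{xx}\to0$ as $x\to\pm\infty$, and $(1+|x|)(q(\cdot,t)-q_\pm)\in L^1(\mathbb R^\pm)$ for every $t$. Put $k=\frac12(z+\varepsilon q_0^2/z)$, $\lambda=\frac12(z-\varepsilon q_0^2/z)$, $\theta(x,t,z)=\lambda\,[x+(4k^2+2\varepsilon q_0^2)t]$, and $D^\pm=\{\pm\operatorname{Im}z>0\}$ if $\varepsilon=1$, $D^\pm=\{\pm(|z|-q_0)\operatorname{Im}z>0\}$ if $\varepsilon=-1$. Let $\Sigma$ be the set of $z\ne0$ with $z\in\mathbb R$, or (if $\varepsilon=-1$) $|z|=q_0$, without the branch points $z^2=\varepsilon q_0^2$. Let $\Phi_\pm=(\Phi_{\pm,1},\Phi_{\pm,2})$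 be the Jost solutions (all columns for $z\in\Sigma$; also $\Phi_{+,1},\Phi_{-,2}$ for $z\in D^+$ and $\Phi_{-,1},\Phi_{+,2}$ for $z\in D^-$, each column being normalized by its own asymptotics for every fixed $t$) of $$\Phi_x=\begin{pmatrix}ik&q(x,t)\\ \sigma q(-x,-t)&-ik\end{pmatrix}\Phi,\qquad \Phi_\pm e^{-i\theta\sigma_3}\to E_\pm=\begin{pmatrix}1&iq_\pm/z\\-\varepsilon iq_\pm/z&1\end{pmatrix}\quad(x\to\pm\infty),$$ where $\sigma_3=\mathrm{diag}(1,-1)$, and define the scattering coefficients by $\Phi_+=\Phi_-S$, that is, with $\gamma(z)=1-\varepsilon q_0^2/z^2$, $$s_{11}=\tfrac{\det(\Phi_{+,1},\Phi_{-,2})}{\gamma},\quad s_{22}=\tfrac{\det(\Phi_{-,1},\Phi_{+,2})}{\gamma},\quad s_{12}=\tfrac{\det(\Phi_{+,2},\Phi_{-,2})}{\gamma},\quad s_{21}=\tfrac{\det(\Phi_{-,1},\Phi_{+,1})}{\gamma}.$$ Suppose that $q$ is a soliton potential, i.e. the reflection coefficients vanish: $s_{12}=s_{21}=0$ on $\Sigma$.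 **Discrete spectrum.** Suppose that the zeros of $s_{11}$ in $D^+$ are exactly the points $v_1^k=z_k$ and $-v_1^{k*}$, $k=1,\dots,N$, where $z_k$ has order $n_k\ge1$ and the $z_k$ are distinct and $z_j\neq -z_k^*$ for $j\ne k$ (a purely imaginary $z_k$ is allowed). Put $a_{k,1}=v_1^k$, $a_{k,2}=-v_1^{k*}$, $v_2^k=\varepsilon q_0^2/v_1^k$, $b_{k,1}=v_2^k$, $b_{k,2}=-v_2^{k*}$. **Laurent and Taylor data.** Complex constants $r^{k,c}_m$, $\tilde r^{k,c}_m$ ($1\le k\le N$, $c=1,2$, $1\le m\le n_k$) are called Laurent data of the reflection coefficients if, with $r(z)=\sum_{k,c,m}r^{k,c}_m(z-a_{k,c})^{-m}$ and $\tilde r(z)=\sum_{k,c,m}\tilde r^{k,c}_m(z-b_{k,c})^{-m}$, for all $x,t$ the function $\Phi_{+,1}/s_{11}-r\,\Phi_{-,2}$ is analytic at every $a_{k,c}$ and $\Phi_{+,2}/s_{22}-\tilde r\,\Phi_{-,1}$ is analytic at every $b_{k,c}$ (after removal of the singularity). Let $f^{k,c}_\ell$ and $\tilde f^{k,c}_\ell$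 be the Taylor coefficients of order $\ell$ of $e^{-2i\theta(x,t,z)}$ at $z=a_{k,c}$ and of $e^{2i\theta(x,t,z)}$ at $z=b_{k,c}$. On the index set $\{(k,c,p):1\le k\le N,\ c\in\{1,2\},\ 1\le p\le n_k\}$ put $$\Xi_{(k,c,p),(k',c',p')}=\sum_{j=p}^{n_k}\sum_{s=0}^{j-p}\binom{p'+s-1}{s}\frac{(-1)^s\,r^{k,c}_j f^{k,c}_{j-p-s}}{(a_{k,c}-b_{k',c'})^{s+p'}},$$ $$\widetilde\Xi_{(k,c,p),(k',c',p')}=\sum_{j=p}^{n_k}\sum_{s=0}^{j-p}\binom{p'+s-1}{s}\frac{(-1)^s\,\tilde r^{k,c}_j\tilde f^{k,c}_{j-p-s}}{(b_{k,c}-a_{k',c'})^{s+p'}},$$ $$(\Gamma_1)_{(k,c,p)}=\sum_{j=p}^{n_k}\sum_{\ell=0}^{j-p}r^{k,c}_jf^{k,c}_{j-p-\ell}\frac{(-1)^\ell iq_-}{a_{k,c}^{\ell+1}},\qquad(\Gamma_2)_{(k,c,p)}=\sum_{j=p}^{n_k}\tilde r^{k,c}_j\tilde f^{k,c}_{j-p},$$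 and let $\langle W_0|$ be the row vector with entry $1$ if $p=1$ and $0$ otherwise; $I_\varepsilon$ is the identity matrix. **Theorem.** Laurent data of the reflection coefficients exist, and for any such data: for every $t$ the set of $x$ with $\det(I_\varepsilon-\widetilde\Xi\Xi)\ne0$ is dense in $\mathbb R$, and at every $(x,t)$ with $\det(I_\varepsilon-\widetilde\Xi\Xi)\neq0$ $$q(x,t)=q_--i\left[\frac{\det\big((I_\varepsilon-\widetilde\Xi\Xi)+\Gamma_2\langle W_0|\big)+\det\big((I_\varepsilon-\widetilde\Xi\Xi)+\widetilde\Xi\Gamma_1\langle W_0|\big)}{\det(I_\varepsilon-\widetilde\Xi\Xi)}-2\right].$$ -/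

import Mathlib

open Filter Topology Matrix

noncomputable section

namespace NonlocalMKdV

/-- The constants of the problem: the sign `σ` of the equation (`σ = 1` defocusing, `σ = -1`
focusing), the relative sign `δ` of the two boundary values, and the left boundary value `q₋`. -/
structure Background where
  σ : ℝ
  δ : ℝ
  qMinus : ℝ
  σ_eq : σ = 1 ∨ σ = -1
  δ_eq : δ = 1 ∨ δ = -1
  qMinus_ne : qMinus ≠ 0

namespace Background

/-- The right boundary value `q₊ = δ q₋`. -/
def qPlus (B : Background) : ℝ := B.δ * B.qMinus

/-- The amplitude `q₀ = |q₋| = |q₊| > 0`. -/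
def q₀ (B : Background) : ℝ := |B.qMinus|

/-- The sign `ε = δ σ`. -/
def ε (B : Background) : ℝ := B.δ * B.σ

/-- The spectral parameter `k(z) = (z + δσ q₀² / z) / 2`. -/
def k (B : Background) (z : ℂ) : ℂ := (z + (B.ε : ℂ) * (B.q₀ : ℂ) ^ 2 / z) / 2

/-- `λ(z) = (z - δσ q₀² / z) / 2`, so that `λ² = k² - δσ q₀²`. -/
def lam (B : Background) (z : ℂ) : ℂ := (z - (B.ε : ℂ) * (B.q₀ : ℂ) ^ 2 / z) / 2

/-- The phase `θ(x,t,z) = λ (x + (4 k² + 2 δσ q₀²) t)`. -/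
def θ (B : Background) (x t : ℝ) (z : ℂ) : ℂ :=
  B.lam z * ((x : ℂ) + (4 * B.k z ^ 2 + 2 * (B.ε : ℂ) * (B.q₀ : ℂ) ^ 2) * (t : ℂ))

/-- The region `D⁺`, where `Im λ > 0`. -/
def DPlus (B : Background) : Set ℂ :=
  {z | (B.ε = 1 ∧ 0 < z.im) ∨ (B.ε = -1 ∧ 0 < (‖z‖ - B.q₀) * z.im)}

/-- The continuous spectrum `Σ`, without `z = 0` and the branch points `z² = δσ q₀²`. -/
def Sigma₀ (B : Background) : Set ℂ :=
  {z | z ≠ 0 ∧ (z.im = 0 ∨ (B.ε = -1 ∧ ‖z‖ = B.q₀)) ∧ z ^ 2 ≠ (B.ε : ℂ) * (B.q₀ : ℂ) ^ 2}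

end Background

/-- `q` is a classical real solution of the nonlocal mKdV equation
`q_t(x,t) - 6 σ q(x,t) q(-x,-t) q_x(x,t) + q_xxx(x,t) = 0` with the nonzero boundary conditions
`q → q_±` as `x → ±∞`. The limits of `q`, `q_x`, `q_xx` are locally uniform in `t`, and
`(1 + |x|) (q - q_±)` is integrable on `ℝ^±` for every `t`. -/
structure IsSolution (B : Background) (q : ℝ → ℝ → ℝ) : Prop where
  contDiff : ContDiff ℝ 3 (Function.uncurry q)
  eqn : ∀ x t : ℝ, deriv (fun τ => q x τ) t
    - 6 * B.σ * q x t * q (-x) (-t) * deriv (fun y => q y t) x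
    + iteratedDeriv 3 (fun y => q y t) x = 0
  tendsto_plus : ∀ t : ℝ,
    Tendsto (fun p : ℝ × ℝ => q p.1 p.2) (atTop ×ˢ 𝓝 t) (𝓝 B.qPlus)
  tendsto_minus : ∀ t : ℝ,
    Tendsto (fun p : ℝ × ℝ => q p.1 p.2) (atBot ×ˢ 𝓝 t) (𝓝 B.qMinus)
  tendsto_deriv_plus : ∀ t : ℝ, ∀ j ∈ ({1, 2} : Set ℕ),
    Tendsto (fun p : ℝ × ℝ => iteratedDeriv j (fun y => q y p.2) p.1) (atTop ×ˢ 𝓝 t) (𝓝 0)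
  tendsto_deriv_minus : ∀ t : ℝ, ∀ j ∈ ({1, 2} : Set ℕ),
    Tendsto (fun p : ℝ × ℝ => iteratedDeriv j (fun y => q y p.2) p.1) (atBot ×ˢ 𝓝 t) (𝓝 0)
  integrable_plus : ∀ t : ℝ,
    MeasureTheory.IntegrableOn (fun x : ℝ => (1 + |x|) * (q x t - B.qPlus)) (Set.Ici 0)
  integrable_minus : ∀ t : ℝ,
    MeasureTheory.IntegrableOn (fun x : ℝ => (1 + |x|) * (q x t - B.qMinus)) (Set.Iic 0)

/-! ### Direct scattering -/

/-- The matrix `X = i k σ₃ + Q` of the spatial part `Φ_x = X Φ` of the Lax pair. -/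
def laxX (B : Background) (q : ℝ → ℝ → ℝ) (x t : ℝ) (z : ℂ) : Matrix (Fin 2) (Fin 2) ℂ :=
  !![Complex.I * B.k z, (q x t : ℂ);
     (B.σ : ℂ) * (q (-x) (-t) : ℂ), -(Complex.I * B.k z)]

/-- The matrix `E_±(z)`, where `qs = q_±`. -/
def asymE (B : Background) (qs : ℝ) (z : ℂ) : Matrix (Fin 2) (Fin 2) ℂ :=
  !![1, Complex.I * (qs : ℂ) / z;
     -((B.ε : ℂ) * Complex.I * (qs : ℂ) / z), 1]

/-- `φ` is the `j`-th column (`j = 0, 1`) of a Jost solution at time `t`: it solves `Φ_x = X Φ`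
and `Φ ∼ E_± e^{iθσ₃}` at the end `F` of the real line (`F = atTop`, `qs = q₊` or
`F = atBot`, `qs = q₋`). -/
def IsJost (B : Background) (q : ℝ → ℝ → ℝ) (F : Filter ℝ) (qs : ℝ) (j : Fin 2) (t : ℝ) (z : ℂ)
    (φ : ℝ → Fin 2 → ℂ) : Prop :=
  (∀ x : ℝ, HasDerivAt φ (laxX B q x t z *ᵥ φ x) x) ∧
  Tendsto (fun x : ℝ =>
      Complex.exp (-((![1, -1] : Fin 2 → ℂ) j * Complex.I * B.θ x t z)) • φ x)
    F (𝓝 (fun i => asymE B qs z i j))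

/-- The column `Φ_{+,j+1}(x,t,z)`. For `z` in `D⁺` or `Σ₀` the first column is determined by
`IsJost`; for `z` in `D⁻` or `Σ₀` the second one is. -/
def jostPlus (B : Background) (q : ℝ → ℝ → ℝ) (j : Fin 2) (x t : ℝ) (z : ℂ) : Fin 2 → ℂ :=
  Classical.epsilon (IsJost B q atTop B.qPlus j t z) x

/-- The column `Φ_{-,j+1}(x,t,z)`. For `z` in `D⁻` or `Σ₀` the first column is determined by
`IsJost`; for `z` in `D⁺` or `Σ₀` the second one is. -/
def jostMinus (B : Background) (q : ℝ → ℝ → ℝ) (j : Fin 2) (x t : ℝ) (z : ℂ) : Fin 2 → ℂ :=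
  Classical.epsilon (IsJost B q atBot B.qMinus j t z) x

/-- The Wronskian `det (u, v)`. -/
def wr (u v : Fin 2 → ℂ) : ℂ := u 0 * v 1 - u 1 * v 0

/-- `det E_±(z) = 1 - δσ q₀² / z²`. -/
def detE (B : Background) (z : ℂ) : ℂ := 1 - (B.ε : ℂ) * (B.q₀ : ℂ) ^ 2 / z ^ 2

/-- The scattering coefficients, given by `Φ₊ = Φ₋ S`. The Wronskians do not depend on `(x,t)`
and are evaluated at `(0,0)`. -/
def s₁₁ (B : Background) (q : ℝ → ℝ → ℝ) (z : ℂ) : ℂ :=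
  wr (jostPlus B q 0 0 0 z) (jostMinus B q 1 0 0 z) / detE B z

def s₁₂ (B : Background) (q : ℝ → ℝ → ℝ) (z : ℂ) : ℂ :=
  wr (jostPlus B q 1 0 0 z) (jostMinus B q 1 0 0 z) / detE B z

def s₂₁ (B : Background) (q : ℝ → ℝ → ℝ) (z : ℂ) : ℂ :=
  wr (jostMinus B q 0 0 0 z) (jostPlus B q 0 0 0 z) / detE B z

def s₂₂ (B : Background) (q : ℝ → ℝ → ℝ) (z : ℂ) : ℂ :=
  wr (jostMinus B q 0 0 0 z) (jostPlus B q 1 0 0 z) / detE B z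

/-- Soliton potentials: the reflection coefficients `s₂₁ / s₁₁` and `s₁₂ / s₂₂` vanish on the
continuous spectrum. -/
def Reflectionless (B : Background) (q : ℝ → ℝ → ℝ) : Prop :=
  ∀ z ∈ B.Sigma₀, s₂₁ B q z = 0 ∧ s₁₂ B q z = 0

/-! ### Discrete spectrum and Laurent data of the reflection coefficients -/

variable {N : ℕ}

/-- The zeros `v₁ᵏ = z_k` and `-(v₁ᵏ)^*` of `s₁₁` in `D⁺`. -/
def poles₁ (z : Fin N → ℂ) (k : Fin N) : Fin 2 → ℂ :=
  ![z k, -(starRingEnd ℂ) (z k)]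

/-- The zeros `v₂ᵏ = δσ q₀² / z_k` and `-(v₂ᵏ)^*` of `s₂₂` in `D⁻`. -/
def poles₂ (B : Background) (z : Fin N → ℂ) (k : Fin N) : Fin 2 → ℂ :=
  ![(B.ε : ℂ) * (B.q₀ : ℂ) ^ 2 / z k, -(starRingEnd ℂ) ((B.ε : ℂ) * (B.q₀ : ℂ) ^ 2 / z k)]

/-- The rational function `∑_{k,c} ∑_{m=1}^{n_k} r_m^{k,c} / (w - a_{k,c})^m`. -/
def principalPart (n : Fin N → ℕ) (a : Fin N → Fin 2 → ℂ) (r : Fin N → Fin 2 → ℕ → ℂ)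
    (w : ℂ) : ℂ :=
  ∑ k, ∑ c, ∑ m ∈ Finset.Icc 1 (n k), r k c m / (w - a k c) ^ m

/-- At every point `a_{k,c}` and for all `(x,t)`, the vector function
`φ(x,t,·) / s - R ψ(x,t,·)`, with `R` the rational function with coefficients `r`, extends
analytically. -/
def CancelsPoles (s : ℂ → ℂ) (φ ψ : ℝ → ℝ → ℂ → Fin 2 → ℂ) (n : Fin N → ℕ)
    (a : Fin N → Fin 2 → ℂ) (r : Fin N → Fin 2 → ℕ → ℂ) : Prop :=
  ∀ k c, ∀ x t : ℝ, ∃ g : ℂ → Fin 2 → ℂ, AnalyticAt ℂ g (a k c) ∧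
    ∀ᶠ w in 𝓝[≠] (a k c), (s w)⁻¹ • φ x t w - principalPart n a r w • ψ x t w = g w

/-- `r` and `r'` are the Laurent data of the reflection coefficients at the discrete spectrum:
`Φ₊₁ / s₁₁` and `r(z) Φ₋₂` have the same principal parts at the zeros of `s₁₁` in `D⁺`, and
`Φ₊₂ / s₂₂` and `r'(z) Φ₋₁` have the same principal parts at the zeros of `s₂₂` in `D⁻`. -/
def IsReflectionData (B : Background) (q : ℝ → ℝ → ℝ) (z : Fin N → ℂ) (n : Fin N → ℕ)
    (r r' : Fin N → Fin 2 → ℕ → ℂ) : Prop :=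
  CancelsPoles (s₁₁ B q) (jostPlus B q 0) (jostMinus B q 1) n (poles₁ z) r ∧
  CancelsPoles (s₂₂ B q) (jostPlus B q 1) (jostMinus B q 0) n (poles₂ B z) r'

/-! ### The matrices of the determinant formula -/

/-- Indices of the `(2n₁ + ⋯ + 2n_N)`-dimensional space: `⟨k, c, p⟩` is position `p + 1` in the
`c`-th half (the pole `v^k` or `-(v^k)^*`) of the `k`-th block. -/
abbrev Idx (n : Fin N → ℕ) : Type := (k : Fin N) × (Fin 2 × Fin (n k))

/-- The Taylor coefficients of `e^{-2iθ(x,t,·)}` (sign `-1`) and `e^{2iθ(x,t,·)}` (sign `1`). -/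
def oscCoeff (B : Background) (sgn : ℂ) (a : Fin N → Fin 2 → ℂ) (x t : ℝ)
    (k : Fin N) (c : Fin 2) (ℓ : ℕ) : ℂ :=
  iteratedDeriv ℓ (fun w => Complex.exp (sgn * 2 * Complex.I * B.θ x t w)) (a k c)
    / (ℓ.factorial : ℂ)

/-- The block matrix with entries, for `p, p' ≥ 1`,
`∑_{j=p}^{n_k} ∑_{s=0}^{j-p} C(p'+s-1, s) (-1)^s r_j f_{j-p-s} / (a_{k,c} - b_{k',c'})^{s+p'}`. -/
def xiMatrix (n : Fin N → ℕ) (a b : Fin N → Fin 2 → ℂ) (r f : Fin N → Fin 2 → ℕ → ℂ) :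
    Matrix (Idx n) (Idx n) ℂ :=
  Matrix.of fun u v =>
    let p : ℕ := u.2.2 + 1
    let p' : ℕ := v.2.2 + 1
    ∑ j ∈ Finset.Icc p (n u.1), ∑ s ∈ Finset.range (j - p + 1),
      ((p' + s - 1).choose s : ℂ) * (-1) ^ s * r u.1 u.2.1 j * f u.1 u.2.1 (j - p - s)
        / (a u.1 u.2.1 - b v.1 v.2.1) ^ (s + p')

/-- The vector `Γ₁`. -/
def gamma₁ (B : Background) (n : Fin N → ℕ) (a : Fin N → Fin 2 → ℂ)
    (r f : Fin N → Fin 2 → ℕ → ℂ) : Idx n → ℂ := fun u =>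
  let p : ℕ := u.2.2 + 1
  ∑ j ∈ Finset.Icc p (n u.1), ∑ ℓ ∈ Finset.range (j - p + 1),
    r u.1 u.2.1 j * f u.1 u.2.1 (j - p - ℓ)
      * ((-1) ^ ℓ * Complex.I * (B.qMinus : ℂ) / (a u.1 u.2.1) ^ (ℓ + 1))

/-- The vector `Γ₂`. -/
def gamma₂ (n : Fin N → ℕ) (r f : Fin N → Fin 2 → ℕ → ℂ) : Idx n → ℂ := fun u =>
  let p : ℕ := u.2.2 + 1
  ∑ j ∈ Finset.Icc p (n u.1), r u.1 u.2.1 j * f u.1 u.2.1 (j - p)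

/-- The row vector `⟨W₀|`, whose blocks are `(1,0,…,0,1,0,…,0)`. -/
def w₀ (n : Fin N → ℕ) : Idx n → ℂ := fun u => if (u.2.2 : ℕ) = 0 then 1 else 0

/-- The matrix `Ξ(x,t)`. -/
def Xi (B : Background) (z : Fin N → ℂ) (n : Fin N → ℕ) (r : Fin N → Fin 2 → ℕ → ℂ) (x t : ℝ) :
    Matrix (Idx n) (Idx n) ℂ :=
  xiMatrix n (poles₁ z) (poles₂ B z) r (oscCoeff B (-1) (poles₁ z) x t)

/-- The matrix `Ξ̃(x,t)`. -/
def XiTilde (B : Background) (z : Fin N → ℂ) (n : Fin N → ℕ) (r' : Fin N → Fin 2 → ℕ → ℂ)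
    (x t : ℝ) : Matrix (Idx n) (Idx n) ℂ :=
  xiMatrix n (poles₂ B z) (poles₁ z) r' (oscCoeff B 1 (poles₂ B z) x t)

/-- The vector `Γ₁(x,t)`. -/
def Gamma₁ (B : Background) (z : Fin N → ℂ) (n : Fin N → ℕ) (r : Fin N → Fin 2 → ℕ → ℂ)
    (x t : ℝ) : Idx n → ℂ :=
  gamma₁ B n (poles₁ z) r (oscCoeff B (-1) (poles₁ z) x t)

/-- The vector `Γ₂(x,t)`. -/
def Gamma₂ (B : Background) (z : Fin N → ℂ) (n : Fin N → ℕ) (r' : Fin N → Fin 2 → ℕ → ℂ)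
    (x t : ℝ) : Idx n → ℂ :=
  gamma₂ n r' (oscCoeff B 1 (poles₂ B z) x t)

/-- The matrix `I - Ξ̃ Ξ`. -/
def mainMatrix (B : Background) (z : Fin N → ℂ) (n : Fin N → ℕ) (r r' : Fin N → Fin 2 → ℕ → ℂ)
    (x t : ℝ) : Matrix (Idx n) (Idx n) ℂ :=
  1 - XiTilde B z n r' x t * Xi B z n r x t

end NonlocalMKdV

end

noncomputable section

namespace NonlocalMKdV

open MeasureTheory Set

/-! ### Volterra integral equations on a half line -/

section Volterra

variable {E : Type*} [NormedAddCommGroup E] [NormedSpace ℂ E]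

/-! For σ = -1 one vector function carries the whole scattering problem: the first Jost column at +∞
multiplied by e^{-iθ}, called `colA`. Put κ = ε q₀². The inversion z ↦ κ/z fixes k and changes the
sign of λ, so it exchanges the two columns at the same end of the line. The reversal (x,t) ↦
(-x,-t), followed by an exchange of the components, maps solutions to solutions and exchanges the
two ends. All four columns and both diagonal scattering coefficients are therefore expressed through
`colA`. This column is the Neumann series of a Volterra equation. The series gives continuity in z
for Im λ ≥ 0, holomorphy for Im λ > 0 and the behaviour for large z; in particular
`JostPotential.tendsto_ray` recovers the potential from the term of order 1/z. Behaviour at z = 0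
follows by inversion.

Each column is normalized separately at every time. That it also solves the time part of the Lax
pair is proved in `IsSolution.isLax_jost`: a common solution of both equations keeps its
normalization at +∞ (`tendsto_zero_of_perturbed`), and Jost solutions are unique. Hence Wronskians
are constant in (x,t).

Vanishing reflection means Φ₊₁ = s₁₁ Φ₋₁ on the continuous spectrum (`colA_eq_smul_colC`). So the
first component of Φ₊₁ e^{-iθ}/s₁₁, where Im λ ≥ 0, and that of Φ₋₁ e^{-iθ}, where Im λ < 0, glue to
one function `solF`. A Morera argument makes it holomorphic across the spectrum. The branch points
need more care, since det E vanishes there and 1/s₁₁ is not known to be bounded: a ratio of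
components is continued instead, which shows that `solF` has at most a pole, and boundedness from
one side excludes the pole (`solF_HE_branch`). Thus, up to removable singularities, `solF` is
singular only at the zeros of s₁₁, and it tends to 1 at infinity. Its inverted copy `solG` tends to
0 at infinity and behaves like i q₋/z at 0.

The Laurent data say that `solF` has the principal parts of r e^{-2iθ} `solG` at the points a, and
`solG` those of r̃ e^{2iθ} `solF` at the points b. By Liouville's theorem both are the rational
functions with these principal parts (`eventually_eq_add_poleSum`). Inserting one into the other
gives a finite linear system with matrices Ξ and Ξ̃; elimination yields (I - Ξ̃Ξ) H = Γ₂ + Ξ̃Γ₁ for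
the pole coefficients H of `solG` (`mulVec_eq_of_system`). Comparing the coefficients of 1/z at
infinity gives i q = i q₋ + ⟨W₀|H⟩, and the matrix determinant lemma turns this into the quotient of
determinants.

Density: the entries of Ξ and Ξ̃ are combinations of polynomials in x times exponentials that decay
as x → -∞. So det(I - Ξ̃Ξ) is real-analytic in x with limit 1 at -∞ and cannot vanish on an open
set.

Existence of the data: at (x,t) = (0,0) Cramer's rule splits Φ₊₁/s₁₁ into a scalar multiple of Φ₋₂
and a holomorphic part. The principal part of that scalar works at every (x,t), because the
remainder solves the Lax pair and boundedness near the pole is transported from (0,0) by Gronwall's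
inequality (`IsSolution.exists_principalPart`). -/

theorem hasDerivAt_integral_Ioi [CompleteSpace E] {u : ℝ → E} (hu : Continuous u)
    (hi : ∀ a, IntegrableOn u (Ioi a)) (x : ℝ) :
    HasDerivAt (fun x => ∫ y in Ioi x, u y) (-u x) x := by
  have h1 : (fun x => ∫ y in Ioi x, u y) = fun x => (∫ y in Ioi 0, u y) - ∫ y in (0)..x, u y := by
    funext x
    rw [← intervalIntegral.integral_interval_add_Ioi (hi 0) (hi x)]
    abel
  rw [h1]
  simpa using (intervalIntegral.integral_hasDerivAt_right (hu.intervalIntegrable _ _)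
    hu.aestronglyMeasurable.stronglyMeasurableAtFilter hu.continuousAt).const_sub
      (∫ y in Ioi 0, u y)

/-- The data of the Volterra equation `m(x) = e - ∫_x^∞ K(y - x) D(y) m(y) dy`, where
`K(τ) = exp(-τ N)` grows at most linearly. -/
structure VolterraData (K : ℝ → E →L[ℂ] E) (N : E →L[ℂ] E) (D : ℝ → E →L[ℂ] E) (e : E)
    (C : ℝ) : Prop where
  deriv : ∀ τ, HasDerivAt K (-(N ∘L K τ)) τ
  add : ∀ s t, K (s + t) = K s ∘L K t
  zero : K 0 = ContinuousLinearMap.id ℂ E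
  bound : ∀ τ, 0 ≤ τ → ‖K τ‖ ≤ C * (1 + τ)
  nonneg : 0 ≤ C
  contD : Continuous D
  intD : ∀ a, IntegrableOn (fun y => (1 + |y|) * ‖D y‖) (Ioi a)
  map_e : N e = 0

/-- The terms of the Neumann series of the Volterra equation. -/
def volterraTerm (K : ℝ → E →L[ℂ] E) (D : ℝ → E →L[ℂ] E) (e : E) : ℕ → ℝ → E
  | 0, _ => e
  | n + 1, x => -∫ y in Ioi x, K (y - x) (D y (volterraTerm K D e n y))

/-- The solution of the Volterra equation. -/
def volterraSol (K : ℝ → E →L[ℂ] E) (D : ℝ → E →L[ℂ] E) (e : E) (x : ℝ) : E :=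
  ∑' n, volterraTerm K D e n x

/-- The weight that controls the Volterra equation on `[a, ∞)`. -/
def volterraWeight (D : ℝ → E →L[ℂ] E) (a x : ℝ) : ℝ := (1 + |x| + |a|) * ‖D x‖

/-- The tail integral of the weight. -/
def volterraTail (D : ℝ → E →L[ℂ] E) (a x : ℝ) : ℝ := ∫ y in Ioi x, volterraWeight D a y

namespace VolterraData

variable {K : ℝ → E →L[ℂ] E} {N : E →L[ℂ] E} {D : ℝ → E →L[ℂ] E} {e : E} {C : ℝ}

theorem weight_nonneg (a x : ℝ) : 0 ≤ volterraWeight D a x := by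
  unfold volterraWeight; positivity

theorem weight_cont (h : VolterraData K N D e C) (a : ℝ) : Continuous (volterraWeight D a) := by
  have := h.contD
  unfold volterraWeight
  fun_prop

theorem weight_int (h : VolterraData K N D e C) (a b : ℝ) :
    IntegrableOn (volterraWeight D a) (Ioi b) := by
  refine Integrable.mono' (g := fun y => (1 + |a|) * ((1 + |y|) * ‖D y‖))
    ((h.intD b).const_mul _) (h.weight_cont a).aestronglyMeasurable (ae_of_all _ fun y => ?_)
  rw [Real.norm_of_nonneg (weight_nonneg a y), volterraWeight, ← mul_assoc]
  gcongr
  nlinarith [abs_nonneg a, abs_nonneg y]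

theorem tail_nonneg (a x : ℝ) : 0 ≤ volterraTail D a x :=
  integral_nonneg fun y => weight_nonneg a y

theorem tail_anti (h : VolterraData K N D e C) (a : ℝ) {x y : ℝ} (hxy : x ≤ y) :
    volterraTail D a y ≤ volterraTail D a x :=
  setIntegral_mono_set (h.weight_int a x) (ae_of_all _ fun y => weight_nonneg a y)
    (Ioi_subset_Ioi hxy).eventuallyLE

theorem tail_tendsto (a : ℝ) : Tendsto (volterraTail D a) atTop (𝓝 0) :=
  tendsto_integral_Ioi_zero tendsto_id

theorem tail_deriv (h : VolterraData K N D e C) (a x : ℝ) :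
    HasDerivAt (volterraTail D a) (-volterraWeight D a x) x := by
  have h1 : (fun x => ∫ y in Ioi x, volterraWeight D a y) =
      fun x => (∫ y in Ioi 0, volterraWeight D a y) - ∫ y in (0)..x, volterraWeight D a y := by
    funext x
    rw [← intervalIntegral.integral_interval_add_Ioi (h.weight_int a 0) (h.weight_int a x)]
    abel
  have hu := h.weight_cont a
  change HasDerivAt (fun x => ∫ y in Ioi x, volterraWeight D a y) _ x
  rw [h1]
  simpa using (intervalIntegral.integral_hasDerivAt_right (hu.intervalIntegrable _ _)
    hu.aestronglyMeasurable.stronglyMeasurableAtFilter hu.continuousAt).const_sub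
      (∫ y in Ioi 0, volterraWeight D a y)

/-- The tail has derivative minus the weight, so these powers are antiderivatives of the bounds met
when the Volterra operator is iterated. Each integration raises the exponent by one and produces the
next factorial. -/
theorem tail_pow_deriv (h : VolterraData K N D e C) (a : ℝ) (n : ℕ) (x : ℝ) :
    HasDerivAt (fun x => (C * volterraTail D a x) ^ (n + 1) / (n + 1).factorial)
      (-(C * volterraWeight D a x * ((C * volterraTail D a x) ^ n / n.factorial))) x := by
  have h1 := (((h.tail_deriv a x).const_mul C).pow (n + 1)).div_const ((n + 1).factorial : ℝ)
  refine h1.congr_deriv ?_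
  rw [Nat.factorial_succ]
  push_cast
  have : (n.factorial : ℝ) ≠ 0 := by positivity
  field_simp

theorem tail_pow_tendsto (a : ℝ) (n : ℕ) :
    Tendsto (fun x => (C * volterraTail D a x) ^ (n + 1) / (n + 1).factorial) atTop (𝓝 0) := by
  have := (((tail_tendsto (D := D) a).const_mul C).pow (n + 1)).div_const ((n + 1).factorial : ℝ)
  simpa using this

theorem tail_pow_int (h : VolterraData K N D e C) (a : ℝ) (n : ℕ) (x : ℝ) :
    IntegrableOn (fun x => C * volterraWeight D a x * ((C * volterraTail D a x) ^ n / n.factorial))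
      (Ioi x) ∧
    ∫ y in Ioi x, C * volterraWeight D a y * ((C * volterraTail D a y) ^ n / n.factorial) =
      (C * volterraTail D a x) ^ (n + 1) / (n + 1).factorial := by
  have hC := h.nonneg
  have h0 : ∀ y ∈ Ioi x,
      -(C * volterraWeight D a y * ((C * volterraTail D a y) ^ n / n.factorial)) ≤ 0 := by
    intro y _
    have h1 := weight_nonneg (D := D) a y
    have h2 := tail_nonneg (D := D) a y
    rw [neg_nonpos]
    positivity
  have hi := integrableOn_Ioi_deriv_of_nonpos' (a := x) (fun y _ => h.tail_pow_deriv a n y) h0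
    (tail_pow_tendsto a n)
  have he := integral_Ioi_of_hasDerivAt_of_nonpos' (a := x) (fun y _ => h.tail_pow_deriv a n y) h0
    (tail_pow_tendsto a n)
  rw [integral_neg] at he
  exact ⟨by simpa using hi.neg, by linarith⟩

/-- For a ≤ x ≤ y the linear growth in y - x is at most that in |y| + |a|. The bound is thus
independent of x, and the first moment of `D` pays for it. -/
theorem kernel_bound (h : VolterraData K N D e C) {a x y : ℝ} (hax : a ≤ x) (hxy : x ≤ y)
    (v : E) : ‖K (y - x) (D y v)‖ ≤ C * volterraWeight D a y * ‖v‖ := by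
  have hC := h.nonneg
  have h1 : y - x ≤ |y| + |a| := by
    have := le_abs_self y
    have := neg_abs_le a
    linarith
  calc ‖K (y - x) (D y v)‖ ≤ ‖K (y - x)‖ * (‖D y‖ * ‖v‖) :=
        (K (y - x)).le_opNorm_of_le ((D y).le_opNorm v)
    _ ≤ (C * (1 + (|y| + |a|))) * (‖D y‖ * ‖v‖) := by
        gcongr
        exact (h.bound _ (by linarith)).trans (by gcongr)
    _ = _ := by unfold volterraWeight; ring

theorem contK (h : VolterraData K N D e C) : Continuous K :=
  continuous_iff_continuousAt.2 fun τ => (h.deriv τ).continuousAt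

/-- The group law of `K` frees the integrand of x, so the terms can be differentiated by the
fundamental theorem of calculus. -/
theorem term_succ [CompleteSpace E] (h : VolterraData K N D e C) (n : ℕ) (x : ℝ) :
    volterraTerm K D e (n + 1) x =
      -K (-x) (∫ y in Ioi x, K y (D y (volterraTerm K D e n y))) := by
  have h0 : ∀ y v, K (y - x) v = K (-x) (K y v) := fun y v => by
    rw [sub_eq_neg_add, h.add]; rfl
  have h1 : ∀ v, K x (K (-x) v) = v := fun v => by
    have := h.add x (-x)
    rw [add_neg_cancel, h.zero] at this
    exact (DFunLike.congr_fun this v).symm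
  have h2 : ∀ v, K (-x) (K x v) = v := fun v => by
    have := h.add (-x) x
    rw [neg_add_cancel, h.zero] at this
    exact (DFunLike.congr_fun this v).symm
  -- An invertible operator commutes with the integral without any integrability assumption.
  let L : E ≃L[ℂ] E := ContinuousLinearEquiv.equivOfInverse (K (-x)) (K x) h1 h2
  rw [volterraTerm]
  simp_rw [h0]
  exact congrArg Neg.neg (L.integral_comp_comm (μ := volume.restrict (Ioi x))
    (fun y => K y (D y (volterraTerm K D e n y))))

theorem term_props [CompleteSpace E] (h : VolterraData K N D e C) (n : ℕ) :
    Continuous (volterraTerm K D e n) ∧ ∀ a x, a ≤ x →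
      ‖volterraTerm K D e n x‖ ≤ ‖e‖ * ((C * volterraTail D a x) ^ n / n.factorial) := by
  induction n with
  | zero => exact ⟨continuous_const, fun a x _ => by simp [volterraTerm]⟩
  | succ n ih =>
    obtain ⟨hc, hb⟩ := ih
    have hcont : Continuous fun y => K y (D y (volterraTerm K D e n y)) :=
      h.contK.clm_apply (h.contD.clm_apply hc)
    have hbd : ∀ a x y, a ≤ x → x ≤ y → ‖K (y - x) (D y (volterraTerm K D e n y))‖ ≤
        ‖e‖ * (C * volterraWeight D a y * ((C * volterraTail D a y) ^ n / n.factorial)) := by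
      intro a x y hax hxy
      have hC := h.nonneg
      have := weight_nonneg (D := D) a y
      refine (h.kernel_bound hax hxy _).trans ?_
      calc _ ≤ C * volterraWeight D a y *
            (‖e‖ * ((C * volterraTail D a y) ^ n / n.factorial)) := by
            gcongr; exact hb a y (hax.trans hxy)
        _ = _ := by ring
    have hint : ∀ a, IntegrableOn (fun y => K y (D y (volterraTerm K D e n y))) (Ioi a) := by
      intro a
      refine Integrable.mono' (((h.tail_pow_int a n a).1.const_mul ‖e‖).const_mul ‖K a‖)
        hcont.aestronglyMeasurable ?_
      filter_upwards [self_mem_ae_restrict measurableSet_Ioi] with y hy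
      -- The linear bound on `K` is for nonnegative arguments only, and y may be negative; the fixed
      -- factor `K a` is split off.
      have : K y (D y (volterraTerm K D e n y)) =
          K a (K (y - a) (D y (volterraTerm K D e n y))) := by
        conv_lhs => rw [show y = a + (y - a) by ring, h.add]
        simp
      rw [this]
      exact (K a).le_opNorm_of_le (hbd a a y le_rfl (le_of_lt hy))
    constructor
    · have h1 : volterraTerm K D e (n + 1) = fun x =>
          -K (-x) (∫ y in Ioi x, K y (D y (volterraTerm K D e n y))) :=
        funext fun x => h.term_succ n x
      rw [h1]
      have h2 : Continuous fun x => ∫ y in Ioi x, K y (D y (volterraTerm K D e n y)) :=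
        continuous_iff_continuousAt.2 fun x => (hasDerivAt_integral_Ioi hcont hint x).continuousAt
      exact ((h.contK.comp continuous_neg).clm_apply h2).neg
    · intro a x hax
      rw [volterraTerm, norm_neg]
      refine (norm_integral_le_of_norm_le ((h.tail_pow_int a n x).1.const_mul ‖e‖) ?_).trans ?_
      · filter_upwards [self_mem_ae_restrict measurableSet_Ioi] with y hy
        exact hbd a x y hax (le_of_lt hy)
      · rw [integral_const_mul, (h.tail_pow_int a n x).2]

theorem term_int [CompleteSpace E] (h : VolterraData K N D e C) (n : ℕ) (a : ℝ) :
    IntegrableOn (fun y => K y (D y (volterraTerm K D e n y))) (Ioi a) := by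
  have hC := h.nonneg
  refine Integrable.mono' (((h.tail_pow_int a n a).1.const_mul ‖e‖).const_mul ‖K a‖)
    (h.contK.clm_apply (h.contD.clm_apply (h.term_props n).1)).aestronglyMeasurable ?_
  filter_upwards [self_mem_ae_restrict measurableSet_Ioi] with y hy
  have h1 : K y (D y (volterraTerm K D e n y)) =
      K a (K (y - a) (D y (volterraTerm K D e n y))) := by
    conv_lhs => rw [show y = a + (y - a) by ring, h.add]
    simp
  have := weight_nonneg (D := D) a y
  rw [h1]
  refine (K a).le_opNorm_of_le ((h.kernel_bound le_rfl (le_of_lt hy) _).trans ?_)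
  calc _ ≤ C * volterraWeight D a y *
        (‖e‖ * ((C * volterraTail D a y) ^ n / n.factorial)) := by
        gcongr; exact (h.term_props n).2 a y (le_of_lt hy)
    _ = _ := by ring

/-- Differentiating the kernel reproduces the term with a factor `N`; the lower endpoint contributes
`D` applied to the preceding term. Summation over n then gives the differential equation. -/
theorem term_deriv [CompleteSpace E] (h : VolterraData K N D e C) (n : ℕ) (x : ℝ) :
    HasDerivAt (volterraTerm K D e (n + 1))
      (N (volterraTerm K D e (n + 1) x) + D x (volterraTerm K D e n x)) x := by
  have hcont : Continuous fun y => K y (D y (volterraTerm K D e n y)) :=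
    h.contK.clm_apply (h.contD.clm_apply (h.term_props n).1)
  have h1 := hasDerivAt_integral_Ioi hcont (h.term_int n) x
  have h2 : HasDerivAt (fun x => K (-x)) (N ∘L K (-x)) x := by
    have := (h.deriv (-x)).scomp x (hasDerivAt_neg x)
    rw [neg_one_smul, neg_neg] at this
    exact this
  have h2' := (ContinuousLinearMap.restrictScalarsL ℂ E E ℝ ℝ).hasFDerivAt.comp_hasDerivAt x h2
  have h3 := (h2'.clm_apply h1).neg
  have h4 : volterraTerm K D e (n + 1) = fun x =>
      -K (-x) (∫ y in Ioi x, K y (D y (volterraTerm K D e n y))) := funext fun x => h.term_succ n x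
  have h5 : ∀ v, K (-x) (K x v) = v := fun v => by
    have := h.add (-x) x
    rw [neg_add_cancel, h.zero] at this
    exact (DFunLike.congr_fun this v).symm
  rw [h4]
  refine h3.congr_deriv ?_
  simp [h5, add_comm]

theorem term_bound [CompleteSpace E] (h : VolterraData K N D e C) (n : ℕ) {a x : ℝ} (hax : a ≤ x) :
    ‖volterraTerm K D e n x‖ ≤ ‖e‖ * ((C * volterraTail D a a) ^ n / n.factorial) := by
  have hC := h.nonneg
  have := tail_nonneg (D := D) a x
  refine ((h.term_props n).2 a x hax).trans ?_
  gcongr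
  exact h.tail_anti a hax

theorem bound_summable (c T : ℝ) : Summable fun n : ℕ => c * (T ^ n / n.factorial) :=
  (Real.summable_pow_div_factorial T).mul_left c

theorem summable_term [CompleteSpace E] (h : VolterraData K N D e C) (x : ℝ) :
    Summable fun n => volterraTerm K D e n x :=
  Summable.of_norm_bounded (bound_summable _ _) fun n => h.term_bound n le_rfl

theorem norm_sol_le [CompleteSpace E] (h : VolterraData K N D e C) {a x : ℝ} (hax : a ≤ x) :
    ‖volterraSol K D e x‖ ≤ ‖e‖ * Real.exp (C * volterraTail D a a) := by
  have h1 : HasSum (fun n : ℕ => ‖e‖ * ((C * volterraTail D a a) ^ n / n.factorial))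
      (‖e‖ * Real.exp (C * volterraTail D a a)) := by
    have := NormedSpace.expSeries_div_hasSum_exp (C * volterraTail D a a)
    rw [← Real.exp_eq_exp_ℝ] at this
    exact this.mul_left _
  exact tsum_of_norm_bounded h1 fun n => h.term_bound n hax

theorem sol_deriv [CompleteSpace E] (h : VolterraData K N D e C) (x : ℝ) :
    HasDerivAt (volterraSol K D e) (N (volterraSol K D e x) + D x (volterraSol K D e x)) x := by
  -- These are the derivatives of the terms. For n = 0 the value is `N e = 0`, which agrees with the
  -- constant term.
  set g' : ℕ → ℝ → E := fun n x => N (volterraTerm K D e n x) +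
    (match n with
      | 0 => 0
      | n + 1 => D x (volterraTerm K D e n x)) with hg'
  have hC := h.nonneg
  obtain ⟨M, hM⟩ := (isCompact_Icc (a := x - 1) (b := x + 1)).exists_bound_of_continuousOn
    h.contD.continuousOn
  have hM0 : 0 ≤ M := (norm_nonneg _).trans (hM x (by constructor <;> linarith))
  set b : ℕ → ℝ := fun n =>
    ‖e‖ * ((C * volterraTail D (x - 1) (x - 1)) ^ n / n.factorial) with hb
  set u : ℕ → ℝ := fun n => ‖N‖ * b n + M * (match n with
      | 0 => 0
      | n + 1 => b n) with hu
  have hbs : Summable b := bound_summable _ _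
  have hus : Summable u := by
    refine (hbs.mul_left _).add (Summable.mul_left _ ?_)
    rw [← summable_nat_add_iff 1]
    exact hbs
  have hd : ∀ n y, y ∈ Ioo (x - 1) (x + 1) → HasDerivAt (volterraTerm K D e n) (g' n y) y := by
    intro n y _
    cases n with
    | zero =>
      have : volterraTerm K D e 0 = fun _ => e := rfl
      rw [this]
      exact (hasDerivAt_const y e).congr_deriv (by simp [hg', volterraTerm, h.map_e])
    | succ n => exact h.term_deriv n y
  have hbd : ∀ n y, y ∈ Ioo (x - 1) (x + 1) → ‖g' n y‖ ≤ u n := by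
    intro n y hy
    refine (norm_add_le _ _).trans (add_le_add ?_ ?_)
    · exact N.le_opNorm_of_le (h.term_bound n hy.1.le)
    · cases n with
      | zero => simp
      | succ n =>
        refine ((D y).le_opNorm _).trans ?_
        exact mul_le_mul (hM y ⟨hy.1.le, hy.2.le⟩) (h.term_bound n hy.1.le) (norm_nonneg _) hM0
  have hx : x ∈ Ioo (x - 1) (x + 1) := by constructor <;> linarith
  have key := hasDerivAt_tsum_of_isPreconnected hus isOpen_Ioo isPreconnected_Ioo hd hbd hx
    (h.summable_term x) hx
  refine key.congr_deriv ?_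
  have hs := (h.summable_term x).hasSum
  have hs1 := hs.mapL N
  have hs2 : HasSum (fun n => (match n with
      | 0 => 0
      | n + 1 => D x (volterraTerm K D e n x) : E)) (D x (volterraSol K D e x)) := by
    rw [← hasSum_nat_add_iff' 1]
    simpa [volterraSol] using hs.mapL (D x)
  exact (hs1.add hs2).tsum_eq

/-- Each term beyond the first is bounded by a positive power of the tail, and the series is
dominated uniformly for x ≥ 0. -/
theorem sol_tendsto [CompleteSpace E] (h : VolterraData K N D e C) :
    Tendsto (volterraSol K D e) atTop (𝓝 e) := by
  have hC := h.nonneg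
  have h1 : Tendsto (fun x => ∑' n, volterraTerm K D e n x) atTop
      (𝓝 (∑' n, if n = 0 then e else 0)) := by
    refine tendsto_tsum_of_dominated_convergence
      (bound_summable ‖e‖ (C * volterraTail D 0 0)) (fun n => ?_) ?_
    · cases n with
      | zero => simp [volterraTerm]
      | succ n =>
        simp only [Nat.succ_ne_zero, if_false]
        refine squeeze_zero_norm' (a := fun x => ‖e‖ *
          ((C * volterraTail D 0 x) ^ (n + 1) / (n + 1).factorial)) ?_ ?_
        · filter_upwards [eventually_ge_atTop 0] with x hx
          exact (h.term_props (n + 1)).2 0 x hx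
        · simpa using (tail_pow_tendsto (D := D) (C := C) 0 n).const_mul ‖e‖
    · filter_upwards [eventually_ge_atTop 0] with x hx n
      exact h.term_bound n hx
  simpa using! h1

end VolterraData

/-! ### Dependence on a parameter -/

/-- Cauchy's estimate turns the uniform bound on `F` into a bound on its derivative in z, so nothing
has to be assumed about the derivative. -/
theorem differentiableOn_integral_of_bound [CompleteSpace E] {μ : Measure ℝ} {U : Set ℂ}
    (hU : IsOpen U)
    {F : ℂ → ℝ → E} {b : ℝ → ℝ} (hb : Integrable b μ)
    (hmeas : ∀ z ∈ U, AEStronglyMeasurable (F z) μ) (hbd : ∀ᵐ y ∂μ, ∀ z ∈ U, ‖F z y‖ ≤ b y)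
    (hd : ∀ᵐ y ∂μ, DifferentiableOn ℂ (fun z => F z y) U) :
    DifferentiableOn ℂ (fun z => ∫ y, F z y ∂μ) U := by
  intro z0 hz0
  obtain ⟨R, hR, hRU⟩ := Metric.isOpen_iff.1 hU z0 hz0
  -- Since 1/2 + 1/3 < 1, the Cauchy discs of radius R/3 around points of the half-size ball stay
  -- inside `U`.
  have hsub : ∀ z ∈ Metric.ball z0 (R / 2), Metric.closedBall z (R / 3) ⊆ U := by
    intro z hz w hw
    refine hRU ?_
    rw [Metric.mem_ball] at hz ⊢
    rw [Metric.mem_closedBall] at hw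
    have := dist_triangle w z z0
    linarith
  -- The derivative is a pointwise limit of difference quotients along a fixed sequence, hence
  -- measurable.
  have hmeas' : AEStronglyMeasurable (fun y => deriv (fun z => F z y) z0) μ := by
    obtain ⟨s, hs0, hs1⟩ : ∃ s : ℕ → ℂ, (∀ n, s n ≠ 0 ∧ z0 + s n ∈ U) ∧
        Tendsto s atTop (𝓝 0) := by
      refine ⟨fun n => ((R / (n + 2) : ℝ) : ℂ), fun n => ⟨?_, ?_⟩, ?_⟩
      · have : R / (n + 2) ≠ 0 := by positivity
        exact Complex.ofReal_ne_zero.2 this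
      · apply hRU
        rw [Metric.mem_ball, dist_eq_norm]
        simp only [add_sub_cancel_left]
        rw [Complex.norm_real, Real.norm_of_nonneg (by positivity)]
        rw [div_lt_iff₀ (by positivity)]
        nlinarith [(Nat.cast_nonneg n : (0 : ℝ) ≤ n)]
      · have h1 : Tendsto (fun n : ℕ => R / ((n : ℝ) + 2)) atTop (𝓝 0) :=
          tendsto_const_nhds.div_atTop (tendsto_atTop_add_const_right _ _
            tendsto_natCast_atTop_atTop)
        exact (Complex.continuous_ofReal.tendsto 0).comp h1
    refine aestronglyMeasurable_of_tendsto_ae (u := (atTop : Filter ℕ))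
      (f := fun n y => (s n)⁻¹ • (F (z0 + s n) y - F z0 y))
      (fun n => ((hmeas _ (hs0 n).2).sub (hmeas _ hz0)).const_smul _) ?_
    filter_upwards [hd] with y hy
    have h1 := ((hy z0 hz0).differentiableAt (hU.mem_nhds hz0)).hasDerivAt
    rw [hasDerivAt_iff_tendsto_slope_zero] at h1
    refine h1.comp (tendsto_nhdsWithin_iff.2 ⟨hs1, Eventually.of_forall fun n => (hs0 n).1⟩)
  have key := hasDerivAt_integral_of_dominated_loc_of_deriv_le (𝕜 := ℂ) (μ := μ)
    (F := F) (x₀ := z0) (s := Metric.ball z0 (R / 2)) (bound := fun y => b y / (R / 3))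
    (F' := fun z y => deriv (fun z => F z y) z)
    (Metric.ball_mem_nhds _ (by positivity))
    (by filter_upwards [hU.mem_nhds hz0] with z hz using hmeas z hz)
    (hb.mono' (hmeas z0 hz0) (by filter_upwards [hbd] with y hy using hy z0 hz0))
    hmeas'
    (by
      filter_upwards [hbd, hd] with y hy hdy z hz
      refine Complex.norm_deriv_le_of_forall_mem_sphere_norm_le (by positivity) ?_ ?_
      · refine DifferentiableOn.diffContOnCl (hdy.mono ?_)
        exact closure_minimal Metric.ball_subset_closedBall Metric.isClosed_closedBall |>.trans
          (hsub z hz)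
      · intro w hw
        exact hy w (hsub z hz (Metric.sphere_subset_closedBall hw)))
    (hb.div_const _)
    (by
      filter_upwards [hd] with y hy z hz
      have hzU : z ∈ U := hsub z hz (Metric.mem_closedBall_self (by positivity))
      exact ((hy z hzU).differentiableAt (hU.mem_nhds hzU)).hasDerivAt)
  exact key.2.differentiableAt.differentiableWithinAt

variable {K : ℂ → ℝ → E →L[ℂ] E} {N : ℂ → E →L[ℂ] E} {D : ℝ → E →L[ℂ] E} {e : ℂ → E} {C Ce : ℝ}
  {S : Set ℂ}

theorem volterraTerm_continuousOn [CompleteSpace E]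
    (h : ∀ z ∈ S, VolterraData (K z) (N z) D (e z) C)
    (hK : ∀ τ, ContinuousOn (fun z => K z τ) S) (he : ContinuousOn e S)
    (hCe : ∀ z ∈ S, ‖e z‖ ≤ Ce) (n : ℕ) :
    ∀ x, ContinuousOn (fun z => volterraTerm (K z) D (e z) n x) S := by
  induction n with
  | zero => exact fun x => he
  | succ n ih =>
    intro x z0 hz0
    have hC := (h z0 hz0).nonneg
    simp only [volterraTerm]
    refine ContinuousWithinAt.neg ?_
    refine continuousWithinAt_of_dominated (bound := fun y => Ce *
      (C * volterraWeight D x y * ((C * volterraTail D x y) ^ n / n.factorial))) ?_ ?_ ?_ ?_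
    · filter_upwards [self_mem_nhdsWithin] with z hz
      exact ((((h z hz).contK.comp (continuous_sub_right x)).clm_apply
        ((h z hz).contD.clm_apply ((h z hz).term_props n).1))).aestronglyMeasurable
    · filter_upwards [self_mem_nhdsWithin] with z hz
      filter_upwards [self_mem_ae_restrict measurableSet_Ioi] with y hy
      have h1 := VolterraData.weight_nonneg (D := D) x y
      have h2 := VolterraData.tail_nonneg (D := D) x y
      refine ((h z hz).kernel_bound le_rfl (le_of_lt hy) _).trans ?_
      calc _ ≤ C * volterraWeight D x y *
            (‖e z‖ * ((C * volterraTail D x y) ^ n / n.factorial)) := by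
            gcongr; exact ((h z hz).term_props n).2 x y (le_of_lt hy)
        _ ≤ C * volterraWeight D x y *
            (Ce * ((C * volterraTail D x y) ^ n / n.factorial)) := by
            gcongr; exact hCe z hz
        _ = _ := by ring
    · exact ((h z0 hz0).tail_pow_int x n x).1.const_mul _
    · refine ae_of_all _ fun y => ?_
      exact (hK (y - x) z0 hz0).clm_apply (continuousWithinAt_const.clm_apply (ih y z0 hz0))

theorem volterraSol_continuousOn [CompleteSpace E]
    (h : ∀ z ∈ S, VolterraData (K z) (N z) D (e z) C)
    (hK : ∀ τ, ContinuousOn (fun z => K z τ) S) (he : ContinuousOn e S)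
    (hCe : ∀ z ∈ S, ‖e z‖ ≤ Ce) (x : ℝ) :
    ContinuousOn (fun z => volterraSol (K z) D (e z) x) S := by
  refine continuousOn_tsum (fun n => volterraTerm_continuousOn h hK he hCe n x)
    (VolterraData.bound_summable Ce (C * volterraTail D x x)) fun n z hz => ?_
  have hC := (h z hz).nonneg
  have := VolterraData.tail_nonneg (D := D) x x
  refine ((h z hz).term_bound n le_rfl).trans ?_
  gcongr
  exact hCe z hz

theorem volterraTerm_differentiableOn [CompleteSpace E] (hS : IsOpen S)
    (h : ∀ z ∈ S, VolterraData (K z) (N z) D (e z) C)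
    (hK : ∀ τ, DifferentiableOn ℂ (fun z => K z τ) S) (he : DifferentiableOn ℂ e S)
    (hCe : ∀ z ∈ S, ‖e z‖ ≤ Ce) (n : ℕ) :
    ∀ x, DifferentiableOn ℂ (fun z => volterraTerm (K z) D (e z) n x) S := by
  rcases S.eq_empty_or_nonempty with rfl | ⟨z0, hz0⟩
  · exact fun x => differentiableOn_empty
  have hC := (h z0 hz0).nonneg
  induction n with
  | zero => exact fun x => he
  | succ n ih =>
    intro x
    simp only [volterraTerm]
    refine DifferentiableOn.neg ?_
    refine differentiableOn_integral_of_bound hS (b := fun y => Ce *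
      (C * volterraWeight D x y * ((C * volterraTail D x y) ^ n / n.factorial)))
      (((h z0 hz0).tail_pow_int x n x).1.const_mul _) ?_ ?_ ?_
    · intro z hz
      exact ((((h z hz).contK.comp (continuous_sub_right x)).clm_apply
        ((h z hz).contD.clm_apply ((h z hz).term_props n).1))).aestronglyMeasurable
    · filter_upwards [self_mem_ae_restrict measurableSet_Ioi] with y hy z hz
      have h1 := VolterraData.weight_nonneg (D := D) x y
      have h2 := VolterraData.tail_nonneg (D := D) x y
      refine ((h z hz).kernel_bound le_rfl (le_of_lt hy) _).trans ?_
      calc _ ≤ C * volterraWeight D x y *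
            (‖e z‖ * ((C * volterraTail D x y) ^ n / n.factorial)) := by
            gcongr; exact ((h z hz).term_props n).2 x y (le_of_lt hy)
        _ ≤ C * volterraWeight D x y *
            (Ce * ((C * volterraTail D x y) ^ n / n.factorial)) := by
            gcongr; exact hCe z hz
        _ = _ := by ring
    · refine ae_of_all _ fun y => ?_
      exact (hK (y - x)).clm_apply ((differentiableOn_const _).clm_apply (ih y))

theorem volterraSol_differentiableOn [CompleteSpace E] (hS : IsOpen S)
    (h : ∀ z ∈ S, VolterraData (K z) (N z) D (e z) C)
    (hK : ∀ τ, DifferentiableOn ℂ (fun z => K z τ) S) (he : DifferentiableOn ℂ e S)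
    (hCe : ∀ z ∈ S, ‖e z‖ ≤ Ce) (x : ℝ) :
    DifferentiableOn ℂ (fun z => volterraSol (K z) D (e z) x) S := by
  refine Complex.differentiableOn_tsum_of_summable_norm
    (VolterraData.bound_summable Ce (C * volterraTail D x x))
    (fun n => volterraTerm_differentiableOn hS h hK he hCe n x) hS fun n z hz => ?_
  have hC := (h z hz).nonneg
  have := VolterraData.tail_nonneg (D := D) x x
  refine ((h z hz).term_bound n le_rfl).trans ?_
  gcongr
  exact hCe z hz

end Volterra

end NonlocalMKdV

end

noncomputable section

namespace NonlocalMKdV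

open MeasureTheory Set

/-! ### Linear differential equations -/

section LinearODE

variable {E : Type*} [NormedAddCommGroup E] [NormedSpace ℂ E]

/-- To the left of `x₀` the usual inequality is applied to the reflected function. -/
theorem norm_le_gronwall_uIcc {f f' : ℝ → E} {x₀ x K ε : ℝ}
    (hf : ∀ s ∈ uIcc x₀ x, HasDerivAt f (f' s) s)
    (hb : ∀ s ∈ uIcc x₀ x, ‖f' s‖ ≤ K * ‖f s‖ + ε) :
    ‖f x‖ ≤ gronwallBound ‖f x₀‖ K ε |x - x₀| := by
  rcases le_total x₀ x with h | h
  · rw [uIcc_of_le h] at hf hb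
    rw [abs_of_nonneg (sub_nonneg.2 h)]
    exact norm_le_gronwallBound_of_norm_deriv_right_le
      (fun s hs => (hf s hs).continuousAt.continuousWithinAt)
      (fun s hs => (hf s ⟨hs.1, hs.2.le⟩).hasDerivWithinAt) le_rfl
      (fun s hs => hb s ⟨hs.1, hs.2.le⟩) x ⟨h, le_rfl⟩
  · rw [uIcc_of_ge h] at hf hb
    have hg : ∀ s ∈ Icc (-x₀) (-x), HasDerivAt (fun s => f (-s)) (-f' (-s)) s := by
      intro s hs
      have := (hf (-s) ⟨by linarith [hs.2], by linarith [hs.1]⟩).scomp s (hasDerivAt_neg s)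
      rw [neg_one_smul] at this
      exact this
    have := norm_le_gronwallBound_of_norm_deriv_right_le (f := fun s => f (-s))
      (f' := fun s => -f' (-s)) (δ := ‖f x₀‖) (K := K) (ε := ε) (a := -x₀) (b := -x)
      (fun s hs => (hg s hs).continuousAt.continuousWithinAt)
      (fun s hs => (hg s ⟨hs.1, hs.2.le⟩).hasDerivWithinAt) (by simp)
      (fun s hs => by
        rw [norm_neg]
        exact hb (-s) ⟨by linarith [hs.2], by linarith [hs.1]⟩) (-x) ⟨by linarith, le_rfl⟩
    rw [neg_neg] at this
    rwa [abs_of_nonpos (sub_nonpos.2 h), show -(x - x₀) = -x - -x₀ by ring]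

theorem eq_zero_of_linearODE {B : ℝ → E →L[ℂ] E} (hB : Continuous B) {f : ℝ → E}
    (hf : ∀ s, HasDerivAt f (B s (f s)) s) {x₀ : ℝ} (h0 : f x₀ = 0) (x : ℝ) : f x = 0 := by
  obtain ⟨M, hM⟩ := (isCompact_uIcc (a := x₀) (b := x)).exists_bound_of_continuousOn hB.continuousOn
  have := norm_le_gronwall_uIcc (x := x) (x₀ := x₀) (K := M) (ε := 0) (fun s _ => hf s)
    (fun s hs => by
      rw [add_zero]
      exact (B s).le_of_opNorm_le (hM s hs) _)
  rw [h0, norm_zero, gronwallBound_ε0_δ0] at this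
  simpa using this

/-- The terms of the Picard series of a linear differential equation. -/
def linearODETerm (B : ℝ → E →L[ℂ] E) (x₀ : ℝ) (c : E) : ℕ → ℝ → E
  | 0, _ => c
  | n + 1, x => ∫ y in x₀..x, B y (linearODETerm B x₀ c n y)

theorem linearODETerm_continuous [CompleteSpace E] {B : ℝ → E →L[ℂ] E} (hB : Continuous B)
    (x₀ : ℝ) (c : E) (n : ℕ) : Continuous (linearODETerm B x₀ c n) := by
  induction n with
  | zero => exact continuous_const
  | succ n ih =>
    exact intervalIntegral.continuous_primitive
      (fun a b => (hB.clm_apply ih).intervalIntegrable a b) x₀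

theorem linearODETerm_bound [CompleteSpace E] {B : ℝ → E →L[ℂ] E} (hB : Continuous B)
    (x₀ : ℝ) (c : E) {L M : ℝ} (hM : ∀ s ∈ Icc (x₀ - L) (x₀ + L), ‖B s‖ ≤ M) (hM0 : 0 ≤ M) (n : ℕ) :
    ∀ x ∈ Icc (x₀ - L) (x₀ + L),
      ‖linearODETerm B x₀ c n x‖ ≤ ‖c‖ * (M ^ n * |x - x₀| ^ n / n.factorial) := by
  induction n with
  | zero => intro x _; simp [linearODETerm]
  | succ n ih =>
    intro x hx
    have hsub : uIoc x₀ x ⊆ Icc (x₀ - L) (x₀ + L) := by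
      refine uIoc_subset_uIcc.trans (uIcc_subset_Icc ⟨?_, ?_⟩ hx) <;>
        linarith [hx.1, hx.2]
    rw [linearODETerm]
    refine (intervalIntegral.norm_integral_le_integral_norm_uIoc).trans ?_
    have h1 : ∀ y ∈ uIoc x₀ x, ‖B y (linearODETerm B x₀ c n y)‖ ≤
        ‖c‖ * M ^ (n + 1) / n.factorial * |y - x₀| ^ n := by
      intro y hy
      refine ((B y).le_of_opNorm_le (hM y (hsub hy)) _).trans ?_
      calc _ ≤ M * (‖c‖ * (M ^ n * |y - x₀| ^ n / n.factorial)) := by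
            gcongr; exact ih y (hsub hy)
        _ = _ := by ring
    refine (setIntegral_mono_on ?_ ?_ measurableSet_uIoc h1).trans ?_
    · rw [← intervalIntegrable_iff]
      exact ((hB.clm_apply (linearODETerm_continuous hB x₀ c n)).norm).intervalIntegrable _ _
    · rw [← intervalIntegrable_iff]
      apply Continuous.intervalIntegrable
      fun_prop
    · rw [integral_const_mul, integral_pow_abs_sub_uIoc, Nat.factorial_succ]
      push_cast
      apply le_of_eq
      have : (n.factorial : ℝ) ≠ 0 := by positivity
      field_simp

/-- On every bounded interval the Picard series is dominated by an exponential series, so the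
solution exists on the whole line without a continuation argument. -/
theorem exists_linearODE [CompleteSpace E] {B : ℝ → E →L[ℂ] E} (hB : Continuous B)
    (x₀ : ℝ) (c : E) : ∃ f : ℝ → E, (∀ x, HasDerivAt f (B x (f x)) x) ∧ f x₀ = c := by
  have hbound : ∀ L : ℝ, 0 ≤ L → ∃ M, 0 ≤ M ∧ (∀ s ∈ Icc (x₀ - L) (x₀ + L), ‖B s‖ ≤ M) ∧
      ∀ n, ∀ x ∈ Icc (x₀ - L) (x₀ + L),
        ‖linearODETerm B x₀ c n x‖ ≤ ‖c‖ * ((M * L) ^ n / n.factorial) := by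
    intro L hL
    obtain ⟨M, hM⟩ := (isCompact_Icc (a := x₀ - L) (b := x₀ + L)).exists_bound_of_continuousOn
      hB.continuousOn
    have hM0 : 0 ≤ M := (norm_nonneg _).trans (hM x₀ (by constructor <;> linarith))
    refine ⟨M, hM0, hM, fun n x hx => (linearODETerm_bound hB x₀ c hM hM0 n x hx).trans ?_⟩
    rw [mul_pow]
    have : |x - x₀| ≤ L := abs_le.2 ⟨by linarith [hx.1], by linarith [hx.2]⟩
    gcongr
  have hsum : ∀ x, Summable fun n => linearODETerm B x₀ c n x := by
    intro x
    obtain ⟨M, _, _, h⟩ := hbound |x - x₀| (abs_nonneg _)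
    refine Summable.of_norm_bounded ((Real.summable_pow_div_factorial _).mul_left ‖c‖)
      fun n => h n x ⟨?_, ?_⟩
    · linarith [neg_abs_le (x - x₀)]
    · linarith [le_abs_self (x - x₀)]
  refine ⟨fun x => ∑' n, linearODETerm B x₀ c n x, fun x => ?_, ?_⟩
  · obtain ⟨M, hM0, hM, h⟩ := hbound (|x - x₀| + 1) (by positivity)
    set L := |x - x₀| + 1
    set b : ℕ → ℝ := fun n => ‖c‖ * ((M * L) ^ n / n.factorial) with hb
    have hbs : Summable b := (Real.summable_pow_div_factorial _).mul_left ‖c‖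
    set g' : ℕ → ℝ → E := fun n x => match n with
      | 0 => 0
      | n + 1 => B x (linearODETerm B x₀ c n x) with hg'
    set u : ℕ → ℝ := fun n => match n with
      | 0 => 0
      | n + 1 => M * b n with hu
    have hus : Summable u := by
      rw [← summable_nat_add_iff 1]
      exact hbs.mul_left M
    have hx : x ∈ Ioo (x₀ - L) (x₀ + L) := by
      constructor
      · linarith [neg_abs_le (x - x₀)]
      · linarith [le_abs_self (x - x₀)]
    have key := hasDerivAt_tsum_of_isPreconnected (g := fun n x => linearODETerm B x₀ c n x)
      (g' := g') (u := u) hus (isOpen_Ioo (a := x₀ - L) (b := x₀ + L)) isPreconnected_Ioo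
      (fun n y _ => by
        cases n with
        | zero => exact hasDerivAt_const y c
        | succ n =>
          have hc := hB.clm_apply (linearODETerm_continuous hB x₀ c n)
          exact intervalIntegral.integral_hasDerivAt_right (hc.intervalIntegrable _ _)
            hc.aestronglyMeasurable.stronglyMeasurableAtFilter hc.continuousAt)
      (fun n y hy => by
        cases n with
        | zero => simp [hg', hu]
        | succ n =>
          refine ((B y).le_opNorm _).trans ?_
          exact mul_le_mul (hM y ⟨hy.1.le, hy.2.le⟩) (h n y ⟨hy.1.le, hy.2.le⟩) (norm_nonneg _) hM0)
      hx (hsum x) hx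
    refine key.congr_deriv ?_
    have hs2 : HasSum (fun n => g' n x) (B x (∑' n, linearODETerm B x₀ c n x)) := by
      rw [← hasSum_nat_add_iff' 1]
      simpa [hg'] using (hsum x).hasSum.mapL (B x)
    exact hs2.tsum_eq
  · refine (tsum_eq_single 0 fun n hn => ?_).trans rfl
    obtain ⟨m, rfl⟩ := Nat.exists_eq_succ_of_ne_zero hn
    simp [linearODETerm]

end LinearODE

/-! ### Planar linear systems -/

/-- The continuous linear map of a `2 × 2` matrix. -/
def mv (M : Matrix (Fin 2) (Fin 2) ℂ) : (Fin 2 → ℂ) →L[ℂ] (Fin 2 → ℂ) :=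
  LinearMap.toContinuousLinearMap (Matrix.toLin' M)

@[simp] theorem mv_apply (M : Matrix (Fin 2) (Fin 2) ℂ) (v : Fin 2 → ℂ) : mv M v = M *ᵥ v := rfl

/-- `mv` as a linear map. -/
def mvLin : Matrix (Fin 2) (Fin 2) ℂ →ₗ[ℂ] ((Fin 2 → ℂ) →L[ℂ] (Fin 2 → ℂ)) :=
  (LinearMap.toContinuousLinearMap (𝕜 := ℂ) (E := Fin 2 → ℂ) (F' := Fin 2 → ℂ)).toLinearMap ∘ₗ
    (Matrix.toLin' (R := ℂ) (m := Fin 2) (n := Fin 2)).toLinearMap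

theorem continuous_mv {X : Type*} [TopologicalSpace X] {M : X → Matrix (Fin 2) (Fin 2) ℂ}
    (hM : Continuous M) : Continuous fun x => mv (M x) :=
  (LinearMap.continuous_of_finiteDimensional mvLin).comp hM

theorem hasDerivAt_vec {φ : ℝ → Fin 2 → ℂ} {v : Fin 2 → ℂ} {x : ℝ} :
    HasDerivAt φ v x ↔ HasDerivAt (fun x => φ x 0) (v 0) x ∧ HasDerivAt (fun x => φ x 1) (v 1) x := by
  rw [hasDerivAt_pi, Fin.forall_fin_two]

theorem hasDerivAt_wr {φ ψ : ℝ → Fin 2 → ℂ} {u v : Fin 2 → ℂ} {x : ℝ} (h1 : HasDerivAt φ u x)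
    (h2 : HasDerivAt ψ v x) :
    HasDerivAt (fun x => wr (φ x) (ψ x)) (wr u (ψ x) + wr (φ x) v) x := by
  rw [hasDerivAt_vec] at h1 h2
  unfold wr
  exact ((h1.1.mul h2.2).sub (h1.2.mul h2.1)).congr_deriv (by ring)

/-- The Wronskian is the area form, and traceless matrices are its infinitesimal symmetries. Both
matrices of the Lax pair are traceless, which makes Wronskians of solutions constant. -/
theorem wr_mulVec {M : Matrix (Fin 2) (Fin 2) ℂ} (hM : M 0 0 + M 1 1 = 0) (u v : Fin 2 → ℂ) :
    wr (M *ᵥ u) v = -wr u (M *ᵥ v) := by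
  simp only [wr, Matrix.mulVec, dotProduct, Fin.sum_univ_two]
  linear_combination (u 0 * v 1 - u 1 * v 0) * hM

theorem wr_smul_left (c : ℂ) (u v : Fin 2 → ℂ) : wr (c • u) v = c * wr u v := by
  simp only [wr, Pi.smul_apply, smul_eq_mul]; ring

theorem wr_smul_right (c : ℂ) (u v : Fin 2 → ℂ) : wr u (c • v) = c * wr u v := by
  simp only [wr, Pi.smul_apply, smul_eq_mul]; ring

theorem wr_self (u : Fin 2 → ℂ) : wr u u = 0 := by
  simp only [wr]; ring

theorem wr_swap (u v : Fin 2 → ℂ) : wr u v = -wr v u := by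
  simp only [wr]; ring

theorem exists_smul_of_wr_eq_zero {u v : Fin 2 → ℂ} (hu : u ≠ 0) (h : wr u v = 0) :
    ∃ c : ℂ, v = c • u := by
  simp only [wr] at h
  by_cases h0 : u 0 = 0
  · have h1 : u 1 ≠ 0 := fun h1 => hu (by ext i; fin_cases i <;> simp [h0, h1])
    refine ⟨v 1 / u 1, ?_⟩
    ext i
    fin_cases i
    · rw [h0] at h
      simp only [zero_mul, zero_sub, neg_eq_zero, mul_eq_zero, h1, false_or] at h
      simp [h0, h]
    · simp [h1]
  · refine ⟨v 0 / u 0, ?_⟩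
    ext i
    fin_cases i
    · simp [h0]
    · simp only [Fin.mk_one, Pi.smul_apply, smul_eq_mul]
      field_simp
      linear_combination h

theorem wr_const_of_hasDerivAt {M : ℝ → Matrix (Fin 2) (Fin 2) ℂ} (hM : ∀ x, M x 0 0 + M x 1 1 = 0)
    {φ ψ : ℝ → Fin 2 → ℂ} (h1 : ∀ x, HasDerivAt φ (M x *ᵥ φ x) x)
    (h2 : ∀ x, HasDerivAt ψ (M x *ᵥ ψ x) x) (x y : ℝ) : wr (φ x) (ψ x) = wr (φ y) (ψ y) := by
  refine is_const_of_deriv_eq_zero (f := fun x => wr (φ x) (ψ x))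
    (fun x => (hasDerivAt_wr (h1 x) (h2 x)).differentiableAt) (fun x => ?_) x y
  rw [(hasDerivAt_wr (h1 x) (h2 x)).deriv, wr_mulVec (hM x)]
  ring

end NonlocalMKdV

end

noncomputable section

namespace NonlocalMKdV

open MeasureTheory Set

/-! ### The propagator of the constant-coefficient system -/

theorem norm_exp_sub_one_le {w : ℂ} (hw : w.re ≤ 0) : ‖Complex.exp w - 1‖ ≤ ‖w‖ := by
  have h := Convex.norm_image_sub_le_of_norm_hasDerivWithin_le (𝕜 := ℂ) (f := Complex.exp)
    (f' := Complex.exp) (C := 1) (s := {w : ℂ | w.re ≤ 0}) (x := 0) (y := w)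
    (fun x _ => (Complex.hasDerivAt_exp x).hasDerivWithinAt)
    (fun x hx => by rw [Complex.norm_exp]; exact Real.exp_le_one_iff.2 hx)
    (convex_halfSpace_re_le 0) (by simp) hw
  simpa using h

/-- The function `∫₀^τ e^{2iμs} ds`. -/
def phaseInt (μ : ℂ) (τ : ℝ) : ℂ := τ * dslope Complex.exp 0 (2 * Complex.I * μ * τ)

theorem phaseInt_zero_left (τ : ℝ) : phaseInt 0 τ = τ := by
  simp [phaseInt, dslope_same]

theorem phaseInt_of_ne {μ : ℂ} (hμ : μ ≠ 0) (τ : ℝ) :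
    phaseInt μ τ = (Complex.exp (2 * Complex.I * μ * τ) - 1) / (2 * Complex.I * μ) := by
  by_cases hτ : (τ : ℂ) = 0
  · simp [phaseInt, hτ]
  · have : 2 * Complex.I * μ * τ ≠ 0 := by simp [hμ, hτ]
    rw [phaseInt, dslope_of_ne _ this, slope_def_field, Complex.exp_zero, sub_zero]
    field_simp

theorem two_I_mul_phaseInt (μ : ℂ) (τ : ℝ) :
    2 * Complex.I * μ * phaseInt μ τ = Complex.exp (2 * Complex.I * μ * τ) - 1 := by
  by_cases hμ : μ = 0
  · simp [hμ]
  · rw [phaseInt_of_ne hμ]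
    field_simp

theorem hasDerivAt_exp_mul (c : ℂ) (τ : ℝ) :
    HasDerivAt (fun τ : ℝ => Complex.exp (c * τ)) (c * Complex.exp (c * τ)) τ := by
  have h1 : HasDerivAt (fun τ : ℝ => c * (τ : ℂ)) c τ := by
    simpa using (Complex.ofRealCLM.hasDerivAt (x := τ)).const_mul c
  exact h1.cexp.congr_deriv (by ring)

theorem phaseInt_deriv (μ : ℂ) (τ : ℝ) :
    HasDerivAt (phaseInt μ) (Complex.exp (2 * Complex.I * μ * τ)) τ := by
  by_cases hμ : μ = 0
  · subst hμ
    rw [show phaseInt 0 = fun τ : ℝ => (τ : ℂ) from funext phaseInt_zero_left]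
    simpa using! Complex.ofRealCLM.hasDerivAt (x := τ)
  · rw [show phaseInt μ = _ from funext (phaseInt_of_ne hμ)]
    refine (((hasDerivAt_exp_mul (2 * Complex.I * μ) τ).sub_const 1).div_const _).congr_deriv ?_
    have : 2 * Complex.I * μ ≠ 0 := by simp [hμ]
    field_simp

theorem phaseInt_add (μ : ℂ) (s t : ℝ) : phaseInt μ (s + t) =
    phaseInt μ s + phaseInt μ t + 2 * Complex.I * μ * phaseInt μ s * phaseInt μ t := by
  by_cases hμ : μ = 0
  · subst hμ; simp [phaseInt_zero_left]
  · simp only [phaseInt_of_ne hμ]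
    push_cast
    rw [mul_add, Complex.exp_add]
    field_simp
    ring

theorem re_two_I_mul (μ : ℂ) (τ : ℝ) : (2 * Complex.I * μ * τ).re = -(2 * μ.im * τ) := by
  simp [mul_assoc]

theorem norm_exp_phase (μ : ℂ) (τ : ℝ) :
    ‖Complex.exp (2 * Complex.I * μ * τ)‖ = Real.exp (-(2 * μ.im * τ)) := by
  rw [Complex.norm_exp, re_two_I_mul]

theorem norm_exp_phase_le {μ : ℂ} (hμ : 0 ≤ μ.im) {τ : ℝ} (hτ : 0 ≤ τ) :
    ‖Complex.exp (2 * Complex.I * μ * τ)‖ ≤ 1 := by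
  rw [norm_exp_phase]
  exact Real.exp_le_one_iff.2 (by have := mul_nonneg hμ hτ; linarith)

/-- This bound survives at μ = 0, that is, at the branch points. The price is linear growth in τ,
which is why a first moment of the potential is needed. -/
theorem norm_phaseInt_le {μ : ℂ} (hμ : 0 ≤ μ.im) {τ : ℝ} (hτ : 0 ≤ τ) : ‖phaseInt μ τ‖ ≤ τ := by
  by_cases h0 : μ = 0
  · subst h0
    rw [phaseInt_zero_left, Complex.norm_real, Real.norm_of_nonneg hτ]
  · rw [phaseInt_of_ne h0, norm_div]
    have h1 : 0 < ‖2 * Complex.I * μ‖ := by simp [h0]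
    rw [div_le_iff₀ h1]
    refine (norm_exp_sub_one_le ?_).trans (le_of_eq ?_)
    · rw [re_two_I_mul]; have := mul_nonneg hμ hτ; linarith
    · rw [norm_mul, Complex.norm_real, Real.norm_of_nonneg hτ, mul_comm]

/-- Without growth in τ, this bound gives control that is uniform for large z. -/
theorem norm_phaseInt_le_inv {μ : ℂ} (hμ : 0 ≤ μ.im) (h0 : μ ≠ 0) {τ : ℝ} (hτ : 0 ≤ τ) :
    ‖phaseInt μ τ‖ ≤ ‖μ‖⁻¹ := by
  rw [phaseInt_of_ne h0, norm_div]
  have h1 : ‖2 * Complex.I * μ‖ = 2 * ‖μ‖ := by simp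
  have h2 : 0 < ‖μ‖ := norm_pos_iff.2 h0
  rw [h1, div_le_iff₀ (by positivity)]
  have := norm_exp_phase_le hμ hτ
  have h3 := norm_sub_le (Complex.exp (2 * Complex.I * μ * τ)) 1
  rw [norm_one] at h3
  have : ‖μ‖⁻¹ * (2 * ‖μ‖) = 2 := by field_simp
  linarith

/-- The quotient by μ has a removable singularity, which `dslope` fills; hence the propagator is
holomorphic in z also where λ vanishes. -/
theorem differentiable_phaseInt (τ : ℝ) : Differentiable ℂ fun μ => phaseInt μ τ := by
  have h1 : Differentiable ℂ (dslope Complex.exp 0) := by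
    rw [← differentiableOn_univ, Complex.differentiableOn_dslope univ_mem]
    exact Complex.differentiable_exp.differentiableOn
  unfold phaseInt
  exact (differentiable_const _).mul (h1.comp (by fun_prop))

/-! ### Normalized Jost solutions -/

/-- The function `λ(z) = (z - κ / z) / 2`. -/
def lamK (κ z : ℂ) : ℂ := (z - κ / z) / 2

/-- The coefficient matrix of the system satisfied by `e^{-iθ}` times the first column. -/
def normMat (p r κ z : ℂ) : Matrix (Fin 2) (Fin 2) ℂ :=
  !![Complex.I * κ / z, p; r, -(Complex.I * z)]

/-- The limit of the normalized first column. -/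
def normVec (r₀ z : ℂ) : Fin 2 → ℂ := ![1, -(Complex.I * r₀ / z)]

/-- Normalized first Jost columns at `+∞`. -/
def IsNormJost (p r : ℝ → ℂ) (p₀ r₀ z : ℂ) (m : ℝ → Fin 2 → ℂ) : Prop :=
  (∀ x, HasDerivAt m (normMat (p x) (r x) (p₀ * r₀) z *ᵥ m x) x) ∧
    Tendsto m atTop (𝓝 (normVec r₀ z))

/-- The closed region in which the first column at `+∞` exists. -/
def regionC (κ : ℂ) : Set ℂ := {z | z ≠ 0 ∧ 0 ≤ (lamK κ z).im}

/-- The open region in which the first column at `+∞` is holomorphic. -/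
def regionO (κ : ℂ) : Set ℂ := {z | z ≠ 0 ∧ 0 < (lamK κ z).im}

theorem regionO_subset (κ : ℂ) : regionO κ ⊆ regionC κ := fun _ h => ⟨h.1, h.2.le⟩

theorem differentiableAt_lamK (κ : ℂ) {z : ℂ} (hz : z ≠ 0) : DifferentiableAt ℂ (lamK κ) z := by
  unfold lamK
  fun_prop (disch := assumption)

theorem isOpen_regionO (κ : ℂ) : IsOpen (regionO κ) := by
  have h : ContinuousOn (fun z => (lamK κ z).im) {0}ᶜ := fun z hz =>
    (Complex.continuous_im.continuousAt.comp
      (differentiableAt_lamK κ hz).continuousAt).continuousWithinAt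
  exact h.isOpen_inter_preimage isOpen_compl_singleton isOpen_Ioi

/-- The off-diagonal perturbation. -/
def pertOp (p r : ℝ → ℂ) (p₀ r₀ : ℂ) (y : ℝ) : (Fin 2 → ℂ) →L[ℂ] (Fin 2 → ℂ) :=
  mv !![0, p y - p₀; r y - r₀, 0]

/-- The kernel `e^{-τN}`. -/
def propagator (p₀ r₀ z : ℂ) (τ : ℝ) : (Fin 2 → ℂ) →L[ℂ] (Fin 2 → ℂ) :=
  ContinuousLinearMap.id ℂ _ - phaseInt (lamK (p₀ * r₀) z) τ • mv (normMat p₀ r₀ (p₀ * r₀) z)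

/-- The normalized first Jost column at `+∞`. -/
def jostSol (p r : ℝ → ℂ) (p₀ r₀ z : ℂ) : ℝ → Fin 2 → ℂ :=
  volterraSol (propagator p₀ r₀ z) (pertOp p r p₀ r₀) (normVec r₀ z)

theorem norm_mv_le {M : Matrix (Fin 2) (Fin 2) ℂ} {c : ℝ} (h : ∀ i, ‖M i 0‖ + ‖M i 1‖ ≤ c) :
    ‖mv M‖ ≤ c := by
  have hc : 0 ≤ c := le_trans (by positivity) (h 0)
  refine ContinuousLinearMap.opNorm_le_bound _ hc fun v => ?_
  rw [pi_norm_le_iff_of_nonneg (by positivity)]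
  intro i
  simp only [mv_apply, Matrix.mulVec, dotProduct, Fin.sum_univ_two]
  calc _ ≤ ‖M i 0 * v 0‖ + ‖M i 1 * v 1‖ := norm_add_le _ _
    _ ≤ ‖M i 0‖ * ‖v‖ + ‖M i 1‖ * ‖v‖ := by
        rw [norm_mul, norm_mul]
        gcongr <;> exact norm_le_pi_norm v _
    _ ≤ c * ‖v‖ := by rw [← add_mul]; gcongr; exact h i

theorem mv_mul (M N : Matrix (Fin 2) (Fin 2) ℂ) : mv M ∘L mv N = mv (M * N) := by
  ext1 v
  exact Matrix.mulVec_mulVec v M N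

theorem mv_smul (c : ℂ) (M : Matrix (Fin 2) (Fin 2) ℂ) : mv (c • M) = c • mv M :=
  map_smul mvLin c M

/-- The limiting matrix has determinant 0 and trace -2iλ, so this is the Cayley–Hamilton identity.
It sums the exponential series of -τN to 1 - (∫₀^τ e^{2iλs} ds) N, the formula used for
`propagator`. -/
theorem normMat_mul_self (p₀ r₀ : ℂ) {z : ℂ} (hz : z ≠ 0) :
    normMat p₀ r₀ (p₀ * r₀) z * normMat p₀ r₀ (p₀ * r₀) z =
      (-(2 * Complex.I * lamK (p₀ * r₀) z)) • normMat p₀ r₀ (p₀ * r₀) z := by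
  have h := Complex.I_sq
  ext i j
  fin_cases i <;> fin_cases j <;>
    simp [normMat, lamK, Matrix.mul_apply, Fin.sum_univ_two] <;> field_simp <;>
    (try simp only [h]) <;> ring_nf

theorem normMat_mulVec_normVec (p₀ r₀ : ℂ) {z : ℂ} (hz : z ≠ 0) :
    normMat p₀ r₀ (p₀ * r₀) z *ᵥ normVec r₀ z = 0 := by
  have h := Complex.I_sq
  ext i
  fin_cases i <;> simp [normMat, normVec, Matrix.mulVec, dotProduct, Fin.sum_univ_two] <;>
    field_simp <;> first | ring1 | linear_combination r₀ * h

/-- Continuously differentiable potentials that tend to `(p₀, r₀)` at `+∞`, with integrable first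
moments. -/
structure JostPotential (p r : ℝ → ℂ) (p₀ r₀ : ℂ) : Prop where
  diffp : Differentiable ℝ p
  diffr : Differentiable ℝ r
  contp : Continuous (deriv p)
  contr : Continuous (deriv r)
  limp : Tendsto p atTop (𝓝 p₀)
  limr : Tendsto r atTop (𝓝 r₀)
  limp' : Tendsto (deriv p) atTop (𝓝 0)
  limr' : Tendsto (deriv r) atTop (𝓝 0)
  intp : ∀ a, IntegrableOn (fun y => (1 + |y|) * ‖p y - p₀‖) (Ioi a)
  intr : ∀ a, IntegrableOn (fun y => (1 + |y|) * ‖r y - r₀‖) (Ioi a)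
  ne_p : p₀ ≠ 0
  ne_r : r₀ ≠ 0

namespace JostPotential

variable {p r : ℝ → ℂ} {p₀ r₀ z : ℂ}

theorem swap (h : JostPotential p r p₀ r₀) : JostPotential r p r₀ p₀ :=
  ⟨h.diffr, h.diffp, h.contr, h.contp, h.limr, h.limp, h.limr', h.limp', h.intr, h.intp, h.ne_r,
    h.ne_p⟩

theorem pertOp_cont (h : JostPotential p r p₀ r₀) : Continuous (pertOp p r p₀ r₀) := by
  have h1 := h.diffp.continuous
  have h2 := h.diffr.continuous
  refine continuous_mv (continuous_matrix fun i j => ?_)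
  fin_cases i <;> fin_cases j <;> simp <;> fun_prop

theorem norm_pertOp_le (p r : ℝ → ℂ) (p₀ r₀ : ℂ) (y : ℝ) :
    ‖pertOp p r p₀ r₀ y‖ ≤ ‖p y - p₀‖ + ‖r y - r₀‖ := by
  refine norm_mv_le fun i => ?_
  fin_cases i <;> simp

theorem volterraData (h : JostPotential p r p₀ r₀) (hz : z ≠ 0) {C : ℝ}
    (hC : ∀ τ, 0 ≤ τ → ‖propagator p₀ r₀ z τ‖ ≤ C * (1 + τ)) :
    VolterraData (propagator p₀ r₀ z) (mv (normMat p₀ r₀ (p₀ * r₀) z)) (pertOp p r p₀ r₀)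
      (normVec r₀ z) C := by
  set N := mv (normMat p₀ r₀ (p₀ * r₀) z) with hN
  set μ := lamK (p₀ * r₀) z with hμ
  have hNN : N ∘L N = (-(2 * Complex.I * μ)) • N := by
    rw [hN, mv_mul, normMat_mul_self _ _ hz, mv_smul]
  refine ⟨fun τ => ?_, fun s t => ?_, ?_, hC, ?_, h.pertOp_cont, fun a => ?_, ?_⟩
  · refine ((phaseInt_deriv μ τ).smul_const N |>.const_sub _).congr_deriv ?_
    rw [propagator, ContinuousLinearMap.comp_sub, ContinuousLinearMap.comp_smul, hNN,
      ContinuousLinearMap.comp_id, smul_smul]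
    have h1 := two_I_mul_phaseInt μ τ
    rw [show N - (phaseInt μ τ * -(2 * Complex.I * μ)) • N =
      (1 + 2 * Complex.I * μ * phaseInt μ τ) • N by module, h1]
    congr 2
    ring
  · simp only [propagator, ContinuousLinearMap.comp_sub, ContinuousLinearMap.sub_comp,
      ContinuousLinearMap.comp_smul, ContinuousLinearMap.smul_comp, ContinuousLinearMap.comp_id,
      ContinuousLinearMap.id_comp, ← hN, ← hμ, hNN, phaseInt_add]
    module
  · simp [propagator, phaseInt]
  · have := (norm_nonneg _).trans (hC 0 le_rfl)
    simpa using this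
  · refine Integrable.mono' ((h.intp a).add (h.intr a)) ?_ (ae_of_all _ fun y => ?_)
    · have := h.pertOp_cont
      exact Continuous.aestronglyMeasurable (by fun_prop)
    · rw [Real.norm_of_nonneg (by positivity)]
      simp only [Pi.add_apply]
      rw [← mul_add]
      gcongr
      exact norm_pertOp_le p r p₀ r₀ y
  · exact normMat_mulVec_normVec p₀ r₀ hz

theorem norm_propagator_le (p₀ r₀ : ℂ) {z : ℂ} (hz : z ∈ regionC (p₀ * r₀)) {τ : ℝ} (hτ : 0 ≤ τ) :
    ‖propagator p₀ r₀ z τ‖ ≤ (1 + ‖mv (normMat p₀ r₀ (p₀ * r₀) z)‖) * (1 + τ) := by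
  refine (norm_sub_le _ _).trans ?_
  rw [norm_smul]
  have h1 := norm_phaseInt_le hz.2 hτ
  have h2 := ContinuousLinearMap.norm_id_le (𝕜 := ℂ) (E := Fin 2 → ℂ)
  have h3 := norm_nonneg (mv (normMat p₀ r₀ (p₀ * r₀) z))
  nlinarith [mul_le_mul_of_nonneg_right h1 h3]

theorem isNormJost (h : JostPotential p r p₀ r₀) (hz : z ∈ regionC (p₀ * r₀)) :
    IsNormJost p r p₀ r₀ z (jostSol p r p₀ r₀ z) := by
  have hV := h.volterraData hz.1 (fun τ hτ => norm_propagator_le p₀ r₀ hz hτ)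
  refine ⟨fun x => (hV.sol_deriv x).congr_deriv ?_, hV.sol_tendsto⟩
  rw [pertOp, mv_apply, mv_apply, ← Matrix.add_mulVec]
  congr 1
  ext i j
  fin_cases i <;> fin_cases j <;> simp [normMat]

theorem differentiableAt_normMat (p₀ r₀ κ : ℂ) (hz : z ≠ 0) :
    DifferentiableAt ℂ (fun z => mv (normMat p₀ r₀ κ z)) z := by
  have h1 : (fun z => mv (normMat p₀ r₀ κ z)) = fun z =>
      (Complex.I * κ / z) • mv !![1, 0; 0, 0] + mv !![0, p₀; r₀, 0] +
        (-(Complex.I * z)) • mv !![0, 0; 0, 1] := by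
    funext z
    ext v i
    fin_cases i <;> simp [normMat, Matrix.mulVec, dotProduct, Fin.sum_univ_two]
  rw [h1]
  fun_prop (disch := assumption)

theorem differentiableAt_normVec (r₀ : ℂ) (hz : z ≠ 0) :
    DifferentiableAt ℂ (fun z => normVec r₀ z) z := by
  rw [differentiableAt_pi]
  intro i
  fin_cases i
  · simp [normVec]
  · simp only [normVec]
    simp
    fun_prop (disch := assumption)

theorem differentiableAt_propagator (p₀ r₀ : ℂ) (hz : z ≠ 0) (τ : ℝ) :
    DifferentiableAt ℂ (fun z => propagator p₀ r₀ z τ) z := by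
  unfold propagator
  have h1 := differentiableAt_lamK (p₀ * r₀) hz
  have h2 := (differentiable_phaseInt τ).differentiableAt.comp z h1
  exact (differentiableAt_const _).sub (h2.smul (differentiableAt_normMat p₀ r₀ _ hz))

/-- A neighbourhood on which the data of the Volterra equation are uniformly bounded. -/
theorem exists_bound_nhds (p₀ r₀ : ℂ) (hz : z ≠ 0) : ∃ U : Set ℂ, IsOpen U ∧ z ∈ U ∧ ∃ C Ce : ℝ,
    ∀ w ∈ U, w ≠ 0 ∧ ‖normVec r₀ w‖ ≤ Ce ∧ (w ∈ regionC (p₀ * r₀) →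
      ∀ τ, 0 ≤ τ → ‖propagator p₀ r₀ w τ‖ ≤ C * (1 + τ)) := by
  set C := 1 + (1 + ‖mv (normMat p₀ r₀ (p₀ * r₀) z)‖)
  set Ce := 1 + ‖normVec r₀ z‖
  have h1 : ∀ᶠ w in 𝓝 z, ‖mv (normMat p₀ r₀ (p₀ * r₀) w)‖ <
      1 + ‖mv (normMat p₀ r₀ (p₀ * r₀) z)‖ :=
    (differentiableAt_normMat p₀ r₀ (p₀ * r₀) hz).continuousAt.norm.eventually_lt_const
      (lt_one_add _)
  have h2 : ∀ᶠ w in 𝓝 z, ‖normVec r₀ w‖ < Ce :=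
    (differentiableAt_normVec r₀ hz).continuousAt.norm.eventually_lt_const (lt_one_add _)
  obtain ⟨U, hU, hUo, hzU⟩ := eventually_nhds_iff.1
    (h1.and (h2.and (isOpen_compl_singleton.eventually_mem hz)))
  refine ⟨U, hUo, hzU, C, Ce, fun w hw => ⟨(hU w hw).2.2, (hU w hw).2.1.le, fun hwR τ hτ => ?_⟩⟩
  refine (norm_propagator_le p₀ r₀ hwR hτ).trans ?_
  have := (hU w hw).1
  simp only [C]
  gcongr

theorem jostSol_continuousOn (h : JostPotential p r p₀ r₀) (x : ℝ) :
    ContinuousOn (fun z => jostSol p r p₀ r₀ z x) (regionC (p₀ * r₀)) := by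
  intro z hz
  obtain ⟨U, hUo, hzU, C, Ce, hU⟩ := exists_bound_nhds p₀ r₀ hz.1
  have key := volterraSol_continuousOn (S := regionC (p₀ * r₀) ∩ U) (C := C) (Ce := Ce)
    (K := propagator p₀ r₀) (D := pertOp p r p₀ r₀) (e := normVec r₀)
    (N := fun z => mv (normMat p₀ r₀ (p₀ * r₀) z))
    (fun w hw => h.volterraData hw.1.1 ((hU w hw.2).2.2 hw.1))
    (fun τ w hw => (differentiableAt_propagator p₀ r₀ hw.1.1 τ).continuousAt.continuousWithinAt)
    (fun w hw => (differentiableAt_normVec r₀ hw.1.1).continuousAt.continuousWithinAt)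
    (fun w hw => (hU w hw.2).2.1) x
  exact (continuousWithinAt_inter (hUo.mem_nhds hzU)).1 (key z ⟨hz, hzU⟩)

theorem jostSol_differentiableOn (h : JostPotential p r p₀ r₀) (x : ℝ) :
    DifferentiableOn ℂ (fun z => jostSol p r p₀ r₀ z x) (regionO (p₀ * r₀)) := by
  intro z hz
  obtain ⟨U, hUo, hzU, C, Ce, hU⟩ := exists_bound_nhds p₀ r₀ hz.1
  have hUo' := (isOpen_regionO (p₀ * r₀)).inter hUo
  have key := volterraSol_differentiableOn (S := regionO (p₀ * r₀) ∩ U) (C := C) (Ce := Ce)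
    (K := propagator p₀ r₀) (D := pertOp p r p₀ r₀) (e := normVec r₀)
    (N := fun z => mv (normMat p₀ r₀ (p₀ * r₀) z)) hUo'
    (fun w hw => h.volterraData hw.1.1 ((hU w hw.2).2.2 (regionO_subset _ hw.1)))
    (fun τ w hw => (differentiableAt_propagator p₀ r₀ hw.1.1 τ).differentiableWithinAt)
    (fun w hw => (differentiableAt_normVec r₀ hw.1.1).differentiableWithinAt)
    (fun w hw => (hU w hw.2).2.1) x
  exact (key.differentiableAt (hUo'.mem_nhds ⟨hz, hzU⟩)).differentiableWithinAt

end JostPotential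

/-! ### Uniqueness -/

theorem wr_trace (M : Matrix (Fin 2) (Fin 2) ℂ) (u v : Fin 2 → ℂ) :
    wr (M *ᵥ u) v + wr u (M *ᵥ v) = (M 0 0 + M 1 1) * wr u v := by
  simp only [wr, Matrix.mulVec, dotProduct, Fin.sum_univ_two]
  ring

theorem tendsto_wr {α : Type*} {l : Filter α} {f g : α → Fin 2 → ℂ} {u v : Fin 2 → ℂ}
    (hf : Tendsto f l (𝓝 u)) (hg : Tendsto g l (𝓝 v)) :
    Tendsto (fun x => wr (f x) (g x)) l (𝓝 (wr u v)) := by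
  rw [tendsto_pi_nhds] at hf hg
  exact ((hf 0).mul (hg 1)).sub ((hf 1).mul (hg 0))

/-- The coefficient matrix has trace -2iλ, so e^{2iλx} times the Wronskian of two solutions is
constant. It tends to 0 because the exponential is bounded at +∞ and both solutions have the same
limit. The solutions are then proportional, and the first component of the limit, equal to 1, fixes
the factor. -/
theorem IsNormJost.unique {p r : ℝ → ℂ} {p₀ r₀ z : ℂ} (hp : Continuous p) (hr : Continuous r)
    (hz : z ∈ regionC (p₀ * r₀)) {m m' : ℝ → Fin 2 → ℂ} (h : IsNormJost p r p₀ r₀ z m)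
    (h' : IsNormJost p r p₀ r₀ z m') : m = m' := by
  set κ := p₀ * r₀
  have hB : Continuous fun x => mv (normMat (p x) (r x) κ z) := by
    refine continuous_mv (continuous_matrix fun i j => ?_)
    fin_cases i <;> fin_cases j <;> simp [normMat] <;> fun_prop
  have hne : m 0 ≠ 0 := by
    intro h0
    have h1 : m = fun _ => 0 := funext fun x => eq_zero_of_linearODE hB h.1 h0 x
    have h2 := h.2
    rw [h1] at h2
    have h3 := congrFun (tendsto_nhds_unique tendsto_const_nhds h2) 0
    simp [normVec] at h3
  have hw : ∀ x, HasDerivAt (fun x : ℝ => Complex.exp (2 * Complex.I * lamK κ z * x) *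
      wr (m x) (m' x)) 0 x := by
    intro x
    refine ((hasDerivAt_exp_mul (2 * Complex.I * lamK κ z) x).mul
      (hasDerivAt_wr (h.1 x) (h'.1 x))).congr_deriv ?_
    rw [wr_trace]
    have : normMat (p x) (r x) κ z 0 0 + normMat (p x) (r x) κ z 1 1 =
        -(2 * Complex.I * lamK κ z) := by
      simp only [normMat, lamK, Matrix.of_apply, Matrix.cons_val', Matrix.cons_val_zero,
        Matrix.cons_val_one, Matrix.cons_val_fin_one]
      ring
    rw [this]
    ring
  have hconst : ∀ x : ℝ, Complex.exp (2 * Complex.I * lamK κ z * x) * wr (m x) (m' x) =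
      wr (m 0) (m' 0) := by
    intro x
    have := is_const_of_deriv_eq_zero (fun x => (hw x).differentiableAt)
      (fun x => (hw x).deriv) x 0
    simpa using this
  have hlim : Tendsto (fun x : ℝ => Complex.exp (2 * Complex.I * lamK κ z * x) *
      wr (m x) (m' x)) atTop (𝓝 0) := by
    have h1 := (tendsto_wr h.2 h'.2).norm
    rw [wr_self, norm_zero] at h1
    refine squeeze_zero_norm' ?_ h1
    filter_upwards [eventually_ge_atTop 0] with x hx
    rw [norm_mul]
    exact mul_le_of_le_one_left (norm_nonneg _) (norm_exp_phase_le hz.2 hx)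
  simp_rw [hconst] at hlim
  have hwr : wr (m 0) (m' 0) = 0 := tendsto_nhds_unique tendsto_const_nhds hlim
  obtain ⟨c, hc⟩ := exists_smul_of_wr_eq_zero hne hwr
  have hd : ∀ x, HasDerivAt (fun x => m' x - c • m x)
      (mv (normMat (p x) (r x) κ z) (m' x - c • m x)) x := fun x =>
    ((h'.1 x).sub ((h.1 x).const_smul c)).congr_deriv (by
      rw [map_sub, map_smul]; rfl)
  have heq : ∀ x, m' x - c • m x = 0 :=
    fun x => eq_zero_of_linearODE hB hd (x₀ := 0) (sub_eq_zero.2 hc) x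
  have hl := h'.2.sub (h.2.const_smul c)
  simp_rw [heq] at hl
  have h3 := congrFun (tendsto_nhds_unique tendsto_const_nhds hl) 0
  simp only [normVec, Pi.zero_apply, Pi.sub_apply, Matrix.cons_val_zero, Pi.smul_apply,
    smul_eq_mul, mul_one] at h3
  funext x
  have h4 := heq x
  rw [show c = 1 by linear_combination h3, one_smul] at h4
  exact (sub_eq_zero.1 h4).symm

end NonlocalMKdV

end

noncomputable section

namespace NonlocalMKdV

open MeasureTheory Set Bornology

/-! ### Asymptotics of the normalized Jost solutions for large spectral parameter -/

theorem exists_bound_Ici {E : Type*} [NormedAddCommGroup E] {f : ℝ → E} (hf : Continuous f) {l : E}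
    (h : Tendsto f atTop (𝓝 l)) (a : ℝ) : ∃ M, 0 ≤ M ∧ ∀ x, a ≤ x → ‖f x‖ ≤ M := by
  have h1 : ∀ᶠ x in atTop, ‖f x‖ < ‖l‖ + 1 := h.norm.eventually_lt_const (lt_add_one _)
  obtain ⟨b, hb⟩ := eventually_atTop.1 h1
  obtain ⟨M, hM⟩ := (isCompact_Icc (a := a) (b := b)).exists_bound_of_continuousOn hf.continuousOn
  refine ⟨max M (‖l‖ + 1), le_trans (by positivity) (le_max_right _ _), fun x hx => ?_⟩
  rcases le_total x b with hxb | hxb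
  · exact (hM x ⟨hx, hxb⟩).trans (le_max_left _ _)
  · exact (hb x hxb).le.trans (le_max_right _ _)

namespace JostPotential

variable {p r : ℝ → ℂ} {p₀ r₀ z : ℂ}

theorem norm_lamK_ge {κ z : ℂ} (hz : 1 + 2 * ‖κ‖ ≤ ‖z‖) : ‖z‖ ≤ 4 * ‖lamK κ z‖ := by
  have h0 := norm_nonneg κ
  have h1 : 1 ≤ ‖z‖ := by linarith
  have h2 : ‖κ / z‖ ≤ 1 / 2 := by
    rw [norm_div, div_le_iff₀ (by linarith)]
    linarith
  have h3 : ‖lamK κ z‖ = ‖z - κ / z‖ / 2 := by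
    rw [lamK, norm_div]; norm_num
  have h4 := norm_sub_norm_le z (κ / z)
  rw [h3]
  linarith

/-- The constant matrix is of size |z|, but in the propagator it is multiplied by a factor of size
1/|λ|, comparable to 1/|z|. The Volterra constants are therefore independent of large z. -/
theorem exists_uniform_bound (h : JostPotential p r p₀ r₀) (a : ℝ) : ∃ M, 0 ≤ M ∧
    ∀ z ∈ regionC (p₀ * r₀), 1 + 2 * ‖p₀ * r₀‖ ≤ ‖z‖ → ∀ x, a ≤ x →
      ‖jostSol p r p₀ r₀ z x‖ ≤ M := by
  set C := 1 + 4 * (1 + ‖p₀‖ + ‖r₀‖) with hC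
  refine ⟨(1 + ‖r₀‖) * Real.exp (C * volterraTail (pertOp p r p₀ r₀) a a), by positivity,
    fun z hzR hz x hx => ?_⟩
  have h0 := norm_nonneg (p₀ * r₀)
  have h1 : 1 ≤ ‖z‖ := by linarith
  have hl := norm_lamK_ge hz
  have hl0 : 0 < ‖lamK (p₀ * r₀) z‖ := by linarith
  have hN : ‖mv (normMat p₀ r₀ (p₀ * r₀) z)‖ ≤ (1 + ‖p₀‖ + ‖r₀‖) * ‖z‖ := by
    have h2 : ‖p₀‖ ≤ ‖p₀‖ * ‖z‖ := le_mul_of_one_le_right (norm_nonneg _) h1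
    have h3 : ‖r₀‖ ≤ ‖r₀‖ * ‖z‖ := le_mul_of_one_le_right (norm_nonneg _) h1
    refine norm_mv_le fun i => ?_
    fin_cases i
    · have h4 : ‖Complex.I * (p₀ * r₀) / z‖ ≤ 1 := by
        rw [norm_div, norm_mul, Complex.norm_I, one_mul, div_le_iff₀ (by linarith)]
        linarith
      simp only [normMat, Fin.zero_eta, Matrix.of_apply, Matrix.cons_val', Matrix.cons_val_zero,
        Matrix.cons_val_one, Matrix.cons_val_fin_one]
      nlinarith [norm_nonneg r₀]
    · simp only [normMat, Fin.mk_one, Matrix.of_apply, Matrix.cons_val', Matrix.cons_val_zero,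
        Matrix.cons_val_one, Matrix.cons_val_fin_one, norm_neg, norm_mul, Complex.norm_I, one_mul]
      nlinarith [norm_nonneg p₀]
  have hK : ∀ τ, 0 ≤ τ → ‖propagator p₀ r₀ z τ‖ ≤ C * (1 + τ) := by
    intro τ hτ
    have h2 : ‖propagator p₀ r₀ z τ‖ ≤ C := by
      refine (norm_sub_le _ _).trans ?_
      rw [norm_smul]
      have h3 := ContinuousLinearMap.norm_id_le (𝕜 := ℂ) (E := Fin 2 → ℂ)
      have h4 := norm_phaseInt_le_inv hzR.2 (norm_pos_iff.1 hl0) hτ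
      have h5 : ‖phaseInt (lamK (p₀ * r₀) z) τ‖ * ‖mv (normMat p₀ r₀ (p₀ * r₀) z)‖ ≤
          ‖lamK (p₀ * r₀) z‖⁻¹ * ((1 + ‖p₀‖ + ‖r₀‖) * ‖z‖) := by gcongr
      have h6 : ‖lamK (p₀ * r₀) z‖⁻¹ * ((1 + ‖p₀‖ + ‖r₀‖) * ‖z‖) ≤ 4 * (1 + ‖p₀‖ + ‖r₀‖) := by
        rw [inv_mul_le_iff₀ hl0]
        nlinarith [norm_nonneg p₀, norm_nonneg r₀]
      linarith
    have : 0 ≤ C := by positivity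
    nlinarith
  refine ((h.volterraData hzR.1 hK).norm_sol_le hx).trans ?_
  gcongr
  rw [pi_norm_le_iff_of_nonneg (by positivity)]
  intro i
  fin_cases i
  · simp [normVec]
  · simp only [normVec, Fin.mk_one, Matrix.cons_val_one, Matrix.cons_val_fin_one, norm_neg,
      norm_div, norm_mul, Complex.norm_I, one_mul]
    rw [div_le_iff₀ (by linarith)]
    nlinarith [norm_nonneg r₀]

theorem deriv_fst {κ : ℂ} {m : ℝ → Fin 2 → ℂ} {x : ℝ}
    (hm : HasDerivAt m (normMat (p x) (r x) κ z *ᵥ m x) x) :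
    HasDerivAt (fun x => m x 0) (Complex.I * κ / z * m x 0 + p x * m x 1) x := by
  have := (hasDerivAt_vec.1 hm).1
  simpa [normMat, Matrix.mulVec, dotProduct, Fin.sum_univ_two] using this

theorem deriv_snd {κ : ℂ} {m : ℝ → Fin 2 → ℂ} {x : ℝ}
    (hm : HasDerivAt m (normMat (p x) (r x) κ z *ᵥ m x) x) :
    HasDerivAt (fun x => m x 1) (r x * m x 0 - Complex.I * z * m x 1) x := by
  have := (hasDerivAt_vec.1 hm).2
  simpa [normMat, Matrix.mulVec, dotProduct, Fin.sum_univ_two, sub_eq_add_neg] using this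

/-- The `L¹` size of the perturbation on `(x, ∞)`. -/
def tailL1 (p r : ℝ → ℂ) (p₀ r₀ : ℂ) (x : ℝ) : ℝ := ∫ y in Ioi x, (‖p y - p₀‖ + ‖r y - r₀‖)

theorem intL1 (h : JostPotential p r p₀ r₀) (a : ℝ) :
    IntegrableOn (fun y => ‖p y - p₀‖ + ‖r y - r₀‖) (Ioi a) := by
  have h1 := h.diffp.continuous
  have h2 := h.diffr.continuous
  refine Integrable.mono' ((h.intp a).add (h.intr a))
    (Continuous.aestronglyMeasurable (by fun_prop)) (ae_of_all _ fun y => ?_)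
  rw [Real.norm_of_nonneg (by positivity)]
  simp only [Pi.add_apply]
  nlinarith [norm_nonneg (p y - p₀), norm_nonneg (r y - r₀), abs_nonneg y]

theorem tendsto_tailL1 : Tendsto (tailL1 p r p₀ r₀) atTop (𝓝 0) :=
  tendsto_integral_Ioi_zero tendsto_id

theorem hasDerivAt_exp_shift (c : ℂ) (x y : ℝ) :
    HasDerivAt (fun y : ℝ => Complex.exp (c * ((y - x : ℝ) : ℂ)))
      (c * Complex.exp (c * ((y - x : ℝ) : ℂ))) y :=
  (hasDerivAt_exp_mul c (y - x)).comp_sub_const y x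

/-- The combination of the components that solves a scalar equation with coefficient `-2iλ`. -/
def osc (r₀ z : ℂ) (m : ℝ → Fin 2 → ℂ) (x : ℝ) : ℂ := m x 1 + Complex.I * r₀ / z * m x 0

/-- The combination `osc` is a left eigenvector of the limiting matrix for the eigenvalue -2iλ, so
only the perturbation acts as a source. -/
theorem osc_deriv {m : ℝ → Fin 2 → ℂ} (hz : z ≠ 0) {x : ℝ}
    (hm : HasDerivAt m (normMat (p x) (r x) (p₀ * r₀) z *ᵥ m x) x) :
    HasDerivAt (osc r₀ z m) (-(2 * Complex.I * lamK (p₀ * r₀) z) * osc r₀ z m x +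
      ((r x - r₀) * m x 0 + Complex.I * r₀ / z * ((p x - p₀) * m x 1))) x := by
  refine ((deriv_snd hm).add ((deriv_fst hm).const_mul (Complex.I * r₀ / z))).congr_deriv ?_
  have h := Complex.I_sq
  simp only [lamK, osc]
  field_simp
  linear_combination (r₀ * m x 0 * z ^ 2) * h

theorem osc_tendsto {m : ℝ → Fin 2 → ℂ} (hm : Tendsto m atTop (𝓝 (normVec r₀ z))) :
    Tendsto (osc r₀ z m) atTop (𝓝 0) := by
  rw [tendsto_pi_nhds] at hm
  have := (hm 1).add ((hm 0).const_mul (Complex.I * r₀ / z))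
  simpa [normVec] using! this

/-- Integration from +∞ keeps the factor e^{2iλ(y-x)} of modulus at most 1 when Im λ ≥ 0, so the L¹
size of the perturbation beyond x controls `osc` uniformly in z. -/
theorem norm_osc_le (h : JostPotential p r p₀ r₀) {m : ℝ → Fin 2 → ℂ}
    (hz : z ∈ regionC (p₀ * r₀)) (hz1 : 1 ≤ ‖z‖)
    (hm : IsNormJost p r p₀ r₀ z m) {x M : ℝ} (hM : ∀ y, x ≤ y → ‖m y‖ ≤ M) :
    ‖osc r₀ z m x‖ ≤ M * (1 + ‖r₀‖) * tailL1 p r p₀ r₀ x := by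
  set c := 2 * Complex.I * lamK (p₀ * r₀) z
  set G : ℝ → ℂ := fun y => (r y - r₀) * m y 0 + Complex.I * r₀ / z * ((p y - p₀) * m y 1) with hG
  have hmc : Continuous m := continuous_iff_continuousAt.2 fun x => (hm.1 x).continuousAt
  have hp := h.diffp.continuous
  have hr := h.diffr.continuous
  have hM0 : 0 ≤ M := (norm_nonneg _).trans (hM x le_rfl)
  have hGb : ∀ y, x ≤ y → ‖G y‖ ≤ M * (1 + ‖r₀‖) * (‖p y - p₀‖ + ‖r y - r₀‖) := by
    intro y hy
    have h0 := (norm_le_pi_norm (m y) 0).trans (hM y hy)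
    have h1 := (norm_le_pi_norm (m y) 1).trans (hM y hy)
    have h2 : ‖Complex.I * r₀ / z‖ ≤ ‖r₀‖ := by
      rw [norm_div, norm_mul, Complex.norm_I, one_mul, div_le_iff₀ (by linarith)]
      exact le_mul_of_one_le_right (norm_nonneg _) hz1
    calc ‖G y‖ ≤ ‖r y - r₀‖ * ‖m y 0‖ + ‖Complex.I * r₀ / z‖ * (‖p y - p₀‖ * ‖m y 1‖) := by
          refine (norm_add_le _ _).trans (le_of_eq ?_)
          rw [norm_mul, norm_mul (Complex.I * r₀ / z), norm_mul (p y - p₀)]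
      _ ≤ ‖r y - r₀‖ * M + ‖r₀‖ * (‖p y - p₀‖ * M) := by gcongr
      _ ≤ _ := by
          have e1 : 0 ≤ ‖r₀‖ * ‖r y - r₀‖ * M := by positivity
          have e2 : 0 ≤ ‖p y - p₀‖ * M := by positivity
          nlinarith
  have hd : ∀ y ∈ Ici x, HasDerivAt (fun y => Complex.exp (c * ((y - x : ℝ) : ℂ)) * osc r₀ z m y)
      (Complex.exp (c * ((y - x : ℝ) : ℂ)) * G y) y := by
    intro y _
    refine ((hasDerivAt_exp_shift c x y).mul (osc_deriv hz.1 (hm.1 y))).congr_deriv ?_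
    simp only [hG, c]
    ring
  have hexp : ∀ y, x ≤ y → ‖Complex.exp (c * ((y - x : ℝ) : ℂ))‖ ≤ 1 := fun y hy =>
    norm_exp_phase_le hz.2 (sub_nonneg.2 hy)
  have hbd : ∀ y, x ≤ y → ‖Complex.exp (c * ((y - x : ℝ) : ℂ)) * G y‖ ≤
      M * (1 + ‖r₀‖) * (‖p y - p₀‖ + ‖r y - r₀‖) := by
    intro y hy
    rw [norm_mul]
    exact (mul_le_of_le_one_left (norm_nonneg _) (hexp y hy)).trans (hGb y hy)
  have hint : IntegrableOn (fun y => Complex.exp (c * ((y - x : ℝ) : ℂ)) * G y) (Ioi x) := by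
    refine Integrable.mono' ((h.intL1 x).const_mul (M * (1 + ‖r₀‖))) ?_ ?_
    · apply Continuous.aestronglyMeasurable
      simp only [hG]
      fun_prop
    · filter_upwards [self_mem_ae_restrict measurableSet_Ioi] with y hy
      exact hbd y (le_of_lt hy)
  have hlim : Tendsto (fun y => Complex.exp (c * ((y - x : ℝ) : ℂ)) * osc r₀ z m y) atTop (𝓝 0) := by
    have h1 := (osc_tendsto hm.2).norm
    rw [norm_zero] at h1
    refine squeeze_zero_norm' ?_ h1
    filter_upwards [eventually_ge_atTop x] with y hy
    rw [norm_mul]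
    exact mul_le_of_le_one_left (norm_nonneg _) (hexp y hy)
  have key := integral_Ioi_of_hasDerivAt_of_tendsto' hd hint hlim
  simp only [sub_self, Complex.ofReal_zero, mul_zero, Complex.exp_zero, one_mul, zero_sub] at key
  rw [← norm_neg, ← key, tailL1, ← integral_const_mul]
  refine norm_integral_le_of_norm_le ((h.intL1 x).const_mul (M * (1 + ‖r₀‖))) ?_
  filter_upwards [self_mem_ae_restrict measurableSet_Ioi] with y hy
  exact hbd y (le_of_lt hy)

/-- A Riemann–Lebesgue estimate with explicit uniformity. Beyond `B` the L¹ tail is used; on [x, B]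
an integration by parts against the oscillating exponential gains 1/λ, which requires only
continuous derivatives of the potential. -/
theorem norm_snd_le (h : JostPotential p r p₀ r₀) {x B : ℝ} (hxB : x ≤ B) {M : ℝ} (hM0 : 0 ≤ M) :
    ∃ c, ∀ z ∈ regionC (p₀ * r₀), 1 + 2 * ‖p₀ * r₀‖ ≤ ‖z‖ → ∀ m, IsNormJost p r p₀ r₀ z m →
      (∀ y, x ≤ y → ‖m y‖ ≤ M) → ‖m x 1‖ ≤ M * (1 + ‖r₀‖) * tailL1 p r p₀ r₀ B + c / ‖z‖ := by
  have hpc := h.diffp.continuous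
  have hrc := h.diffr.continuous
  obtain ⟨Q1, hQ1, hp⟩ := exists_bound_Ici hpc h.limp x
  obtain ⟨Q2, hQ2, hr'⟩ := exists_bound_Ici h.contr h.limr' x
  obtain ⟨Q3, hQ3, hρ⟩ := exists_bound_Ici (f := fun y => r y - r₀) (by fun_prop) (h.limr.sub_const r₀) x
  obtain ⟨Q4, hQ4, hpp⟩ := exists_bound_Ici (f := fun y => p y - p₀) (by fun_prop) (h.limp.sub_const p₀) x
  set κ := p₀ * r₀
  set A := ‖r₀‖ * (Q4 * M) + 2 * (Q2 * M + Q3 * (‖κ‖ * M + Q1 * M)) with hA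
  refine ⟨‖r₀‖ * M + 4 * (Q3 * M) + A * (B - x), fun z hz hzR m hm hM => ?_⟩
  have hκ := norm_nonneg κ
  have hz1 : 1 ≤ ‖z‖ := by linarith
  have hz0 : 0 < ‖z‖ := by linarith
  have hl := norm_lamK_ge hzR
  have hl0 : 0 < ‖lamK κ z‖ := by linarith
  have hlne : lamK κ z ≠ 0 := norm_pos_iff.1 hl0
  set c := 2 * Complex.I * lamK κ z with hc
  have hcne : c ≠ 0 := by simp [hc, hlne]
  have hcn : ‖c‖ = 2 * ‖lamK κ z‖ := by simp [hc]
  have hcinv : ‖c‖⁻¹ ≤ 2 / ‖z‖ := by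
    rw [inv_eq_one_div, div_le_div_iff₀ (by rw [hcn]; positivity) hz0, hcn]
    linarith
  have h0 : ∀ y, x ≤ y → ‖m y 0‖ ≤ M := fun y hy => (norm_le_pi_norm (m y) 0).trans (hM y hy)
  have h1 : ∀ y, x ≤ y → ‖m y 1‖ ≤ M := fun y hy => (norm_le_pi_norm (m y) 1).trans (hM y hy)
  have hrz : ‖Complex.I * r₀ / z‖ ≤ ‖r₀‖ / ‖z‖ := by
    rw [norm_div, norm_mul, Complex.norm_I, one_mul]
  -- Subtracting the boundary term of the integration by parts removes the part of the source that
  -- is not small; the remaining source `E` is of order 1/|z|.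
  set w : ℝ → ℂ := fun y => osc r₀ z m y - (r y - r₀) * m y 0 / c with hw
  set E : ℝ → ℂ := fun y => Complex.I * r₀ / z * ((p y - p₀) * m y 1) -
    (deriv r y * m y 0 + (r y - r₀) * (Complex.I * κ / z * m y 0 + p y * m y 1)) / c with hE
  have hd : ∀ y, HasDerivAt (fun y => Complex.exp (c * ((y - x : ℝ) : ℂ)) * w y)
      (Complex.exp (c * ((y - x : ℝ) : ℂ)) * E y) y := by
    intro y
    have d1 := ((h.diffr y).hasDerivAt.sub_const r₀).mul (deriv_fst (hm.1 y))
    have d2 := (osc_deriv hz.1 (hm.1 y)).sub (d1.div_const c)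
    refine ((hasDerivAt_exp_shift c x y).mul d2).congr_deriv ?_
    simp only [hE, osc, Pi.sub_apply, Pi.mul_apply]
    rw [← hc]
    field_simp
    ring
  have hEb : ∀ y, x ≤ y → ‖E y‖ ≤ A / ‖z‖ := by
    intro y hy
    have e1 : ‖Complex.I * r₀ / z * ((p y - p₀) * m y 1)‖ ≤ ‖r₀‖ / ‖z‖ * (Q4 * M) := by
      rw [norm_mul, norm_mul (p y - p₀)]
      have := hpp y hy
      have := h1 y hy
      gcongr
    have e2 : ‖Complex.I * κ / z * m y 0‖ ≤ ‖κ‖ * M := by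
      rw [norm_mul, norm_div, norm_mul, Complex.norm_I, one_mul]
      have := h0 y hy
      gcongr
      exact div_le_self hκ hz1
    have e3 : ‖deriv r y * m y 0 + (r y - r₀) * (Complex.I * κ / z * m y 0 + p y * m y 1)‖ ≤
        Q2 * M + Q3 * (‖κ‖ * M + Q1 * M) := by
      refine (norm_add_le _ _).trans ?_
      rw [norm_mul, norm_mul (r y - r₀)]
      have := h0 y hy
      have := h1 y hy
      have := hr' y hy
      have := hρ y hy
      have := hp y hy
      have e4 : ‖Complex.I * κ / z * m y 0 + p y * m y 1‖ ≤ ‖κ‖ * M + Q1 * M := by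
        refine (norm_add_le _ _).trans (add_le_add e2 ?_)
        rw [norm_mul]
        gcongr
      gcongr
    refine (norm_sub_le _ _).trans ?_
    rw [norm_div, div_eq_mul_inv _ ‖c‖]
    calc _ ≤ ‖r₀‖ / ‖z‖ * (Q4 * M) + (Q2 * M + Q3 * (‖κ‖ * M + Q1 * M)) * (2 / ‖z‖) := by
          gcongr
      _ = A / ‖z‖ := by rw [hA]; ring
  have hmv := norm_image_sub_le_of_norm_deriv_le_segment'
    (f := fun y => Complex.exp (c * ((y - x : ℝ) : ℂ)) * w y) (C := A / ‖z‖) (a := x) (b := B)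
    (fun y _ => (hd y).hasDerivWithinAt) (fun y hy => by
      rw [norm_mul]
      exact (mul_le_of_le_one_left (norm_nonneg _)
        (norm_exp_phase_le hz.2 (sub_nonneg.2 hy.1))).trans (hEb y hy.1)) B ⟨hxB, le_rfl⟩
  simp only [sub_self, Complex.ofReal_zero, mul_zero, Complex.exp_zero, one_mul] at hmv
  have hρc : ∀ y, x ≤ y → ‖(r y - r₀) * m y 0 / c‖ ≤ Q3 * M * (2 / ‖z‖) := by
    intro y hy
    rw [norm_div, norm_mul, div_eq_mul_inv]
    have := hρ y hy
    have := h0 y hy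
    gcongr
  have hwB : ‖Complex.exp (c * ((B - x : ℝ) : ℂ)) * w B‖ ≤
      M * (1 + ‖r₀‖) * tailL1 p r p₀ r₀ B + Q3 * M * (2 / ‖z‖) := by
    rw [norm_mul]
    refine (mul_le_of_le_one_left (norm_nonneg _)
      (norm_exp_phase_le hz.2 (sub_nonneg.2 hxB))).trans ?_
    exact (norm_sub_le _ _).trans (add_le_add
      (h.norm_osc_le hz hz1 hm fun y hy => hM y (hxB.trans hy)) (hρc B hxB))
  have hwx : ‖w x‖ ≤ M * (1 + ‖r₀‖) * tailL1 p r p₀ r₀ B + Q3 * M * (2 / ‖z‖) +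
      A / ‖z‖ * (B - x) := by
    have := norm_sub_norm_le (w x) (Complex.exp (c * ((B - x : ℝ) : ℂ)) * w B)
    rw [norm_sub_rev (w x)] at this
    linarith
  have hfin : m x 1 = w x + (r x - r₀) * m x 0 / c - Complex.I * r₀ / z * m x 0 := by
    simp only [hw, osc]; ring
  have e5 : ‖Complex.I * r₀ / z * m x 0‖ ≤ ‖r₀‖ / ‖z‖ * M := by
    rw [norm_mul]
    have := h0 x le_rfl
    gcongr
  rw [hfin]
  refine (norm_sub_le _ _).trans ((add_le_add (norm_add_le _ _) le_rfl).trans ?_)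
  have := hρc x le_rfl
  calc _ ≤ M * (1 + ‖r₀‖) * tailL1 p r p₀ r₀ B + Q3 * M * (2 / ‖z‖) +
      A / ‖z‖ * (B - x) + Q3 * M * (2 / ‖z‖) + ‖r₀‖ / ‖z‖ * M := by gcongr
    _ = _ := by ring

theorem eventually_large (κ : ℂ) : ∀ᶠ z in cobounded ℂ ⊓ 𝓟 (regionC κ),
    z ∈ regionC κ ∧ 1 + 2 * ‖κ‖ ≤ ‖z‖ := by
  have h1 : ∀ᶠ z in cobounded ℂ ⊓ 𝓟 (regionC κ), 1 + 2 * ‖κ‖ ≤ ‖z‖ :=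
    (tendsto_norm_cobounded_atTop.mono_left inf_le_left).eventually (eventually_ge_atTop _)
  have h2 : ∀ᶠ z in cobounded ℂ ⊓ 𝓟 (regionC κ), z ∈ regionC κ :=
    (eventually_principal.2 fun z hz => hz).filter_mono inf_le_right
  exact h2.and h1

theorem tendsto_div_cobounded (κ c : ℂ) :
    Tendsto (fun z => c / z) (cobounded ℂ ⊓ 𝓟 (regionC κ)) (𝓝 0) := by
  have h1 : Tendsto (fun z : ℂ => z⁻¹) (cobounded ℂ ⊓ 𝓟 (regionC κ)) (𝓝 0) :=
    tendsto_inv₀_cobounded.mono_left inf_le_left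
  simpa [div_eq_mul_inv] using h1.const_mul c

theorem tendsto_snd (h : JostPotential p r p₀ r₀) (x : ℝ) :
    Tendsto (fun z => jostSol p r p₀ r₀ z x 1) (cobounded ℂ ⊓ 𝓟 (regionC (p₀ * r₀))) (𝓝 0) := by
  obtain ⟨M, hM0, hM⟩ := h.exists_uniform_bound x
  rw [Metric.tendsto_nhds]
  intro η hη
  -- The cut `B` is fixed first, making the tail small uniformly in z; the remaining term is then
  -- small for large z.
  obtain ⟨B, hxB, hB⟩ : ∃ B, x ≤ B ∧ M * (1 + ‖r₀‖) * tailL1 p r p₀ r₀ B < η / 2 := by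
    have h1 := (tendsto_tailL1 (p := p) (r := r) (p₀ := p₀) (r₀ := r₀)).const_mul (M * (1 + ‖r₀‖))
    rw [mul_zero] at h1
    obtain ⟨B, hB⟩ := ((h1.eventually_lt_const (half_pos hη)).and (eventually_ge_atTop x)).exists
    exact ⟨B, hB.2, hB.1⟩
  obtain ⟨c, hc⟩ := h.norm_snd_le hxB hM0
  have h2 : Tendsto (fun z : ℂ => c / ‖z‖) (cobounded ℂ ⊓ 𝓟 (regionC (p₀ * r₀))) (𝓝 0) :=
    tendsto_const_nhds.div_atTop (tendsto_norm_cobounded_atTop.mono_left inf_le_left)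
  filter_upwards [eventually_large (p₀ * r₀), h2.eventually_lt_const (half_pos hη)] with z hz hz2
  rw [dist_zero_right]
  have := hc z hz.1 hz.2 _ (h.isNormJost hz.1) (hM z hz.1 hz.2)
  linarith

/-- The row (1, -i p₀/z) annihilates the limiting matrix, so the corresponding combination of
components has only the perturbation as derivative. The integral of that derivative vanishes in the
limit by dominated convergence, since the second component tends to 0. -/
theorem tendsto_fst (h : JostPotential p r p₀ r₀) (x : ℝ) :
    Tendsto (fun z => jostSol p r p₀ r₀ z x 0) (cobounded ℂ ⊓ 𝓟 (regionC (p₀ * r₀))) (𝓝 1) := by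
  obtain ⟨M, hM0, hM⟩ := h.exists_uniform_bound x
  have hpc := h.diffp.continuous
  have hrc := h.diffr.continuous
  set F := cobounded ℂ ⊓ 𝓟 (regionC (p₀ * r₀)) with hF
  -- Dominated convergence along a filter needs a countable basis.
  have : F.IsCountablyGenerated := by
    rw [hF, ← comap_norm_atTop]
    infer_instance
  set G : ℂ → ℝ → ℂ := fun z y => (p y - p₀) * jostSol p r p₀ r₀ z y 1 -
    Complex.I * p₀ / z * ((r y - r₀) * jostSol p r p₀ r₀ z y 0) with hG
  have hcont : ∀ z ∈ regionC (p₀ * r₀), Continuous (G z) := by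
    intro z hz
    have : Continuous (jostSol p r p₀ r₀ z) :=
      continuous_iff_continuousAt.2 fun x => ((h.isNormJost hz).1 x).continuousAt
    simp only [hG]
    fun_prop
  have hGb : ∀ z ∈ regionC (p₀ * r₀), 1 + 2 * ‖p₀ * r₀‖ ≤ ‖z‖ → ∀ y, x ≤ y →
      ‖G z y‖ ≤ M * (1 + ‖p₀‖) * (‖p y - p₀‖ + ‖r y - r₀‖) := by
    intro z hz hzR y hy
    have hz1 : 1 ≤ ‖z‖ := by linarith [norm_nonneg (p₀ * r₀)]
    have h0 := (norm_le_pi_norm (jostSol p r p₀ r₀ z y) 0).trans (hM z hz hzR y hy)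
    have h1 := (norm_le_pi_norm (jostSol p r p₀ r₀ z y) 1).trans (hM z hz hzR y hy)
    have h2 : ‖Complex.I * p₀ / z‖ ≤ ‖p₀‖ := by
      rw [norm_div, norm_mul, Complex.norm_I, one_mul, div_le_iff₀ (by linarith)]
      exact le_mul_of_one_le_right (norm_nonneg _) hz1
    calc ‖G z y‖ ≤ ‖p y - p₀‖ * ‖jostSol p r p₀ r₀ z y 1‖ +
          ‖Complex.I * p₀ / z‖ * (‖r y - r₀‖ * ‖jostSol p r p₀ r₀ z y 0‖) := by
          refine (norm_sub_le _ _).trans (le_of_eq ?_)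
          rw [norm_mul, norm_mul (Complex.I * p₀ / z), norm_mul (r y - r₀)]
      _ ≤ ‖p y - p₀‖ * M + ‖p₀‖ * (‖r y - r₀‖ * M) := by gcongr
      _ ≤ _ := by
          have e1 : 0 ≤ ‖p₀‖ * ‖p y - p₀‖ * M := by positivity
          have e2 : 0 ≤ ‖r y - r₀‖ * M := by positivity
          nlinarith
  have hform : ∀ z ∈ regionC (p₀ * r₀), 1 + 2 * ‖p₀ * r₀‖ ≤ ‖z‖ →
      jostSol p r p₀ r₀ z x 0 = Complex.I * p₀ / z * jostSol p r p₀ r₀ z x 1 +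
        (1 - p₀ * r₀ / z / z) - ∫ y in Ioi x, G z y := by
    intro z hz hzR
    have hm := h.isNormJost hz
    have hz0 := hz.1
    have hd : ∀ y ∈ Ici x, HasDerivAt (fun y => jostSol p r p₀ r₀ z y 0 -
        Complex.I * p₀ / z * jostSol p r p₀ r₀ z y 1) (G z y) y := by
      intro y _
      refine ((deriv_fst (hm.1 y)).sub
        ((deriv_snd (hm.1 y)).const_mul (Complex.I * p₀ / z))).congr_deriv ?_
      simp only [hG]
      have hI := Complex.I_sq
      field_simp
      linear_combination (p₀ * z * jostSol p r p₀ r₀ z y 1) * hI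
    have hlim : Tendsto (fun y => jostSol p r p₀ r₀ z y 0 -
        Complex.I * p₀ / z * jostSol p r p₀ r₀ z y 1) atTop (𝓝 (1 - p₀ * r₀ / z / z)) := by
      have h2 := hm.2
      rw [tendsto_pi_nhds] at h2
      have h3 := (h2 0).sub ((h2 1).const_mul (Complex.I * p₀ / z))
      have h4 : normVec r₀ z 0 - Complex.I * p₀ / z * normVec r₀ z 1 = 1 - p₀ * r₀ / z / z := by
        have hI := Complex.I_sq
        simp only [normVec, Matrix.cons_val_zero, Matrix.cons_val_one, Matrix.cons_val_fin_one]
        field_simp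
        linear_combination (p₀ * r₀) * hI
      rwa [h4] at h3
    have hint : IntegrableOn (G z) (Ioi x) := by
      refine Integrable.mono' ((h.intL1 x).const_mul (M * (1 + ‖p₀‖)))
        (hcont z hz).aestronglyMeasurable ?_
      filter_upwards [self_mem_ae_restrict measurableSet_Ioi] with y hy
      exact hGb z hz hzR y (le_of_lt hy)
    rw [integral_Ioi_of_hasDerivAt_of_tendsto' hd hint hlim]
    ring
  have hGlim : Tendsto (fun z => ∫ y in Ioi x, G z y) F (𝓝 (∫ y in Ioi x, (0 : ℂ))) := by
    refine tendsto_integral_filter_of_dominated_convergence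
      (fun y => M * (1 + ‖p₀‖) * (‖p y - p₀‖ + ‖r y - r₀‖)) ?_ ?_
      ((h.intL1 x).const_mul _) ?_
    · filter_upwards [eventually_large (p₀ * r₀)] with z hz
      exact (hcont z hz.1).aestronglyMeasurable
    · filter_upwards [eventually_large (p₀ * r₀)] with z hz
      filter_upwards [self_mem_ae_restrict measurableSet_Ioi] with y hy
      exact hGb z hz.1 hz.2 y (le_of_lt hy)
    · filter_upwards [self_mem_ae_restrict measurableSet_Ioi] with y hy
      have h1 := (h.tendsto_snd y).const_mul (p y - p₀)
      rw [mul_zero] at h1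
      have h2 : Tendsto (fun z => Complex.I * p₀ / z * ((r y - r₀) * jostSol p r p₀ r₀ z y 0))
          F (𝓝 0) := by
        have h3 := ((tendsto_div_cobounded (p₀ * r₀) (Complex.I * p₀)).norm).mul_const
          (‖r y - r₀‖ * M)
        rw [norm_zero, zero_mul] at h3
        refine squeeze_zero_norm' ?_ h3
        filter_upwards [eventually_large (p₀ * r₀)] with z hz
        rw [norm_mul, norm_mul (r y - r₀)]
        gcongr
        exact (norm_le_pi_norm (jostSol p r p₀ r₀ z y) 0).trans (hM z hz.1 hz.2 y (le_of_lt hy))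
      simpa using h1.sub h2
  rw [integral_zero] at hGlim
  have hA := (tendsto_div_cobounded (p₀ * r₀) (Complex.I * p₀)).mul (h.tendsto_snd x)
  have hB : Tendsto (fun z => 1 - p₀ * r₀ / z / z) F (𝓝 1) := by
    have h1 := (tendsto_div_cobounded (p₀ * r₀) (p₀ * r₀)).mul
      (tendsto_div_cobounded (p₀ * r₀) 1)
    rw [mul_zero] at h1
    have h2 := h1.const_sub 1
    rw [sub_zero] at h2
    refine h2.congr fun z => ?_
    ring
  have hfin := (hA.add hB).sub hGlim
  rw [mul_zero, zero_add, sub_zero] at hfin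
  refine hfin.congr' ?_
  filter_upwards [eventually_large (p₀ * r₀)] with z hz
  exact (hform z hz.1 hz.2).symm

theorem I_mul_mem_regionC (κ : ℂ) {y : ℝ} (hy : 1 + 2 * ‖κ‖ ≤ y) :
    Complex.I * y ∈ regionC κ ∧ 1 + 2 * ‖κ‖ ≤ ‖Complex.I * y‖ := by
  have h0 := norm_nonneg κ
  have hy0 : 0 < y := by linarith
  have hyc : (y : ℂ) ≠ 0 := by exact_mod_cast hy0.ne'
  refine ⟨⟨by simp [hyc], ?_⟩, ?_⟩
  · have h1 : lamK κ (Complex.I * y) = Complex.I * ((y : ℂ) + κ / y) / 2 := by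
      have hI := Complex.I_sq
      rw [lamK]
      field_simp
      linear_combination (-κ) * hI
    have h2 : (lamK κ (Complex.I * y)).im = (y + κ.re / y) / 2 := by
      rw [h1]
      simp [Complex.div_ofReal_re]
    rw [h2]
    have h3 : -‖κ‖ ≤ κ.re := by
      have := Complex.abs_re_le_norm κ
      exact (abs_le.1 this).1
    have h4 : -1 ≤ κ.re / y := by
      rw [le_div_iff₀ hy0]; linarith
    linarith
  · simp only [norm_mul, Complex.norm_I, one_mul, Complex.norm_real]
    exact hy.trans (le_abs_self _)

/-- On the ray z = iy the second component satisfies m₂' = n with n = r m₁ + y m₂, and n' = y n + E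
with `E` bounded uniformly in y. Integration from +∞ against e^{-y(s-x)} gives n = O(1/y) without
integrability of the derivatives of the potential. Since m₁ → 1, the limit of y m₂ is -r. -/
theorem tendsto_ray (h : JostPotential p r p₀ r₀) (x : ℝ) :
    Tendsto (fun y : ℝ => Complex.I * y * jostSol p r p₀ r₀ (Complex.I * y) x 1) atTop
      (𝓝 (-(Complex.I * r x))) := by
  obtain ⟨M, hM0, hM⟩ := h.exists_uniform_bound x
  have hpc := h.diffp.continuous
  have hrc := h.diffr.continuous
  obtain ⟨Q1, hQ1, hp⟩ := exists_bound_Ici hpc h.limp x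
  obtain ⟨Q2, hQ2, hr'⟩ := exists_bound_Ici h.contr h.limr' x
  obtain ⟨Q3, hQ3, hr⟩ := exists_bound_Ici hrc h.limr x
  set κ := p₀ * r₀
  have hκ := norm_nonneg κ
  set c := Q2 * M + Q3 * (‖κ‖ * M + Q1 * M) with hc
  set n : ℝ → ℝ → ℂ := fun y s => r s * jostSol p r p₀ r₀ (Complex.I * y) s 0 +
    y * jostSol p r p₀ r₀ (Complex.I * y) s 1 with hn
  have hnb : ∀ y : ℝ, 1 + 2 * ‖κ‖ ≤ y → ‖n y x‖ ≤ c / y := by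
    intro y hy
    have hy0 : 0 < y := by linarith
    obtain ⟨hzC, hzR⟩ := I_mul_mem_regionC κ hy
    have hm := h.isNormJost hzC
    set z : ℂ := Complex.I * y with hz
    set m := jostSol p r p₀ r₀ z with hmdef
    have h0 : ∀ s, x ≤ s → ‖m s 0‖ ≤ M := fun s hs =>
      (norm_le_pi_norm (m s) 0).trans (hM z hzC hzR s hs)
    have h1 : ∀ s, x ≤ s → ‖m s 1‖ ≤ M := fun s hs =>
      (norm_le_pi_norm (m s) 1).trans (hM z hzC hzR s hs)
    set E : ℝ → ℂ := fun s => deriv r s * m s 0 + r s * (Complex.I * κ / z * m s 0 + p s * m s 1)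
      with hE
    have hzy : ‖z‖ = y := by simp [hz, abs_of_pos hy0]
    have hEb : ∀ s, x ≤ s → ‖E s‖ ≤ c := by
      intro s hs
      have e2 : ‖Complex.I * κ / z * m s 0‖ ≤ ‖κ‖ * M := by
        rw [norm_mul, norm_div, norm_mul, Complex.norm_I, one_mul]
        have := h0 s hs
        gcongr
        exact div_le_self hκ (by linarith)
      have := h0 s hs
      have := h1 s hs
      have := hr' s hs
      have := hr s hs
      have := hp s hs
      have e4 : ‖Complex.I * κ / z * m s 0 + p s * m s 1‖ ≤ ‖κ‖ * M + Q1 * M := by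
        refine (norm_add_le _ _).trans (add_le_add e2 ?_)
        rw [norm_mul]
        gcongr
      rw [hc]
      refine (norm_add_le _ _).trans ?_
      rw [norm_mul, norm_mul (r s)]
      gcongr
    have hd : ∀ s ∈ Ici x, HasDerivAt (fun s => Complex.exp (-(y : ℂ) * ((s - x : ℝ) : ℂ)) * n y s)
        (Complex.exp (-(y : ℂ) * ((s - x : ℝ) : ℂ)) * E s) s := by
      intro s _
      have d1 := ((h.diffr s).hasDerivAt.mul (deriv_fst (hm.1 s))).add
        ((deriv_snd (hm.1 s)).const_mul (y : ℂ))
      refine ((hasDerivAt_exp_shift (-(y : ℂ)) x s).mul d1).congr_deriv ?_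
      simp only [hE, Pi.add_apply, Pi.mul_apply]
      have hI := Complex.I_sq
      rw [show Complex.I * z = -(y : ℂ) by rw [hz]; linear_combination (y : ℂ) * hI]
      ring
    have hexp : ∀ s, ‖Complex.exp (-(y : ℂ) * ((s - x : ℝ) : ℂ))‖ = Real.exp (-y * (s - x)) := by
      intro s
      rw [Complex.norm_exp, ← Complex.ofReal_neg, ← Complex.ofReal_mul, Complex.ofReal_re]
    have hbderiv : ∀ s ∈ Ici x, HasDerivAt (fun s => -(c / y) * Real.exp (-y * (s - x)))
        (c * Real.exp (-y * (s - x))) s := by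
      intro s _
      have d1 : HasDerivAt (fun s => -y * (s - x)) (-y) s := by
        simpa using ((hasDerivAt_id s).sub_const x).const_mul (-y)
      refine (d1.exp.const_mul (-(c / y))).congr_deriv ?_
      field_simp
    have hexplim : Tendsto (fun s => Real.exp (-y * (s - x))) atTop (𝓝 0) := by
      refine Real.tendsto_exp_atBot.comp ?_
      exact (tendsto_atTop_add_const_right _ _ tendsto_id).const_mul_atTop_of_neg (by linarith)
    have hblim : Tendsto (fun s => -(c / y) * Real.exp (-y * (s - x))) atTop (𝓝 0) := by
      simpa using hexplim.const_mul (-(c / y))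
    have hc0 : 0 ≤ c := by positivity
    have hbint := integrableOn_Ioi_deriv_of_nonneg' hbderiv
      (fun s _ => mul_nonneg hc0 (Real.exp_pos _).le) hblim
    have hbval := integral_Ioi_of_hasDerivAt_of_nonneg' hbderiv
      (fun s _ => mul_nonneg hc0 (Real.exp_pos _).le) hblim
    have hmc : Continuous m := continuous_iff_continuousAt.2 fun x => (hm.1 x).continuousAt
    have hbd : ∀ s, x ≤ s → ‖Complex.exp (-(y : ℂ) * ((s - x : ℝ) : ℂ)) * E s‖ ≤
        c * Real.exp (-y * (s - x)) := by
      intro s hs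
      rw [norm_mul, hexp, mul_comm]
      have := hEb s hs
      gcongr
    have hbd' : ∀ᵐ s ∂volume.restrict (Ioi x),
        ‖Complex.exp (-(y : ℂ) * ((s - x : ℝ) : ℂ)) * E s‖ ≤ c * Real.exp (-y * (s - x)) := by
      filter_upwards [self_mem_ae_restrict measurableSet_Ioi] with s hs
      exact hbd s (le_of_lt hs)
    have hint : IntegrableOn (fun s => Complex.exp (-(y : ℂ) * ((s - x : ℝ) : ℂ)) * E s)
        (Ioi x) := by
      refine Integrable.mono' hbint ?_ hbd'
      have := h.contr
      apply Continuous.aestronglyMeasurable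
      simp only [hE]
      fun_prop
    have hlim : Tendsto (fun s => Complex.exp (-(y : ℂ) * ((s - x : ℝ) : ℂ)) * n y s) atTop
        (𝓝 0) := by
      have h3 := hexplim.mul_const (Q3 * M + y * M)
      rw [zero_mul] at h3
      refine squeeze_zero_norm' ?_ h3
      filter_upwards [eventually_ge_atTop x] with s hs
      rw [norm_mul, hexp]
      gcongr
      refine (norm_add_le _ _).trans ?_
      rw [norm_mul, norm_mul, Complex.norm_real, Real.norm_of_nonneg hy0.le]
      have := h0 s hs
      have := h1 s hs
      have := hr s hs
      gcongr
    have key := integral_Ioi_of_hasDerivAt_of_tendsto' hd hint hlim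
    simp only [sub_self, Complex.ofReal_zero, mul_zero, Complex.exp_zero, one_mul, zero_sub] at key
    rw [← norm_neg, ← key]
    refine (norm_integral_le_of_norm_le hbint hbd').trans (le_of_eq ?_)
    rw [hbval]
    simp
  have hn0 : Tendsto (fun y => n y x) atTop (𝓝 0) := by
    refine squeeze_zero_norm' ?_ (tendsto_const_nhds.div_atTop tendsto_id : Tendsto (fun y : ℝ => c / y) atTop (𝓝 0))
    filter_upwards [eventually_ge_atTop (1 + 2 * ‖κ‖)] with y hy
    exact hnb y hy
  have hray : Tendsto (fun y : ℝ => Complex.I * (y : ℂ)) atTop (cobounded ℂ ⊓ 𝓟 (regionC κ)) := by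
    refine tendsto_inf.2 ⟨?_, tendsto_principal.2 ?_⟩
    · rw [← tendsto_norm_atTop_iff_cobounded]
      refine tendsto_atTop_mono' _ ?_ tendsto_id
      filter_upwards with y
      simpa using le_abs_self y
    · filter_upwards [eventually_ge_atTop (1 + 2 * ‖κ‖)] with y hy
      exact (I_mul_mem_regionC κ hy).1
  have h1 := ((h.tendsto_fst x).comp hray).const_mul (r x)
  have h2 := (hn0.sub h1).const_mul Complex.I
  rw [zero_sub, mul_one, mul_neg] at h2
  refine h2.congr fun y => ?_
  simp only [hn, Function.comp]
  ring

end JostPotential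

end NonlocalMKdV

end

noncomputable section

namespace NonlocalMKdV

open MeasureTheory Set Bornology

/-! ### Symmetries of the normalized Jost solutions -/

/-- Exchange of the two components. -/
def swap2 (v : Fin 2 → ℂ) : Fin 2 → ℂ := ![v 1, v 0]

@[simp] theorem swap2_zero (v : Fin 2 → ℂ) : swap2 v 0 = v 1 := rfl

@[simp] theorem swap2_one (v : Fin 2 → ℂ) : swap2 v 1 = v 0 := rfl

theorem tendsto_vec {α : Type*} {l : Filter α} {f : α → Fin 2 → ℂ} {v : Fin 2 → ℂ} :
    Tendsto f l (𝓝 v) ↔ Tendsto (fun x => f x 0) l (𝓝 (v 0)) ∧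
      Tendsto (fun x => f x 1) l (𝓝 (v 1)) := by
  rw [tendsto_pi_nhds, Fin.forall_fin_two]

theorem lamK_inv {κ z : ℂ} (hκ : κ ≠ 0) : lamK κ (κ / z) = lamK κ (-z) := by
  by_cases hz : z = 0
  · simp [hz, lamK]
  · rw [lamK, lamK]; field_simp; ring

theorem inv_mem_regionC {κ z : ℂ} (hκ : κ ≠ 0) : κ / z ∈ regionC κ ↔ -z ∈ regionC κ := by
  simp only [regionC, mem_ofPred_eq, lamK_inv hκ]
  simp [hκ]

/-- At κ/z the diagonal entries are iz and -iκ/z; at -z they are the same two in the other order.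
Exchanging the components matches them and interchanges the potentials. The scalar factor restores
the normalization. -/
theorem IsNormJost.swap {p r : ℝ → ℂ} {p₀ r₀ z : ℂ} (hp : p₀ ≠ 0) (hr : r₀ ≠ 0) (hz : z ≠ 0)
    {m : ℝ → Fin 2 → ℂ} (hm : IsNormJost r p r₀ p₀ (-z) m) :
    IsNormJost p r p₀ r₀ (p₀ * r₀ / z) (fun x => (-(Complex.I * z / p₀)) • swap2 (m x)) := by
  have hI := Complex.I_sq
  constructor
  · intro x
    have h0 := JostPotential.deriv_fst (hm.1 x)
    have h1 := JostPotential.deriv_snd (hm.1 x)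
    rw [hasDerivAt_vec]
    simp only [Pi.smul_apply, swap2_zero, swap2_one, smul_eq_mul]
    refine ⟨(h1.const_mul _).congr_deriv ?_, (h0.const_mul _).congr_deriv ?_⟩
    · simp [normMat, Matrix.mulVec, dotProduct, Fin.sum_univ_two]
      field_simp
      ring
    · simp [normMat, Matrix.mulVec, dotProduct, Fin.sum_univ_two]
      field_simp
      ring
  · have h2 := tendsto_vec.1 hm.2
    rw [tendsto_vec]
    simp only [Pi.smul_apply, swap2_zero, swap2_one, smul_eq_mul]
    constructor
    · have := h2.2.const_mul (-(Complex.I * z / p₀))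
      convert this using 2
      simp only [normVec, Matrix.cons_val_zero, Matrix.cons_val_one, Matrix.cons_val_fin_one]
      field_simp
      linear_combination hI
    · have := h2.1.const_mul (-(Complex.I * z / p₀))
      convert this using 2
      simp only [normVec, Matrix.cons_val_zero, Matrix.cons_val_one, Matrix.cons_val_fin_one]
      field_simp

namespace JostPotential

variable {p r : ℝ → ℂ} {p₀ r₀ z : ℂ}

theorem jostSol_inv (h : JostPotential p r p₀ r₀) (hz : p₀ * r₀ / z ∈ regionC (p₀ * r₀)) :
    jostSol p r p₀ r₀ (p₀ * r₀ / z) =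
      fun x => (-(Complex.I * z / p₀)) • swap2 (jostSol r p r₀ p₀ (-z) x) := by
  have hz0 : z ≠ 0 := by
    rintro rfl
    simpa using hz.1
  have hz' := (inv_mem_regionC (mul_ne_zero h.ne_p h.ne_r)).1 hz
  rw [mul_comm] at hz'
  exact (h.isNormJost hz).unique h.diffp.continuous h.diffr.continuous hz
    ((h.swap.isNormJost hz').swap h.ne_p h.ne_r hz0)

theorem tendsto_zero_inv (h : JostPotential p r p₀ r₀) :
    Tendsto (fun z => -(p₀ * r₀ / z)) (𝓝[regionC (p₀ * r₀)] 0)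
      (cobounded ℂ ⊓ 𝓟 (regionC (r₀ * p₀))) := by
  have hκ := mul_ne_zero h.ne_p h.ne_r
  refine tendsto_inf.2 ⟨?_, tendsto_principal.2 ?_⟩
  · have h1 : Tendsto (fun z : ℂ => z⁻¹) (𝓝[regionC (p₀ * r₀)] 0) (cobounded ℂ) :=
      tendsto_inv₀_nhdsNE_zero.mono_left (nhdsWithin_mono _ fun z hz => hz.1)
    have h2 := (tendsto_mul_left_cobounded (neg_ne_zero.2 hκ)).comp h1
    refine h2.congr fun z => ?_
    simp [div_eq_mul_inv]
  · filter_upwards [self_mem_nhdsWithin] with z hz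
    have h1 : z = p₀ * r₀ / (p₀ * r₀ / z) := by
      have := hz.1
      have := h.ne_p
      have := h.ne_r
      field_simp
    rw [mul_comm r₀]
    rw [h1] at hz
    exact (inv_mem_regionC hκ).1 hz

/-- Small z corresponds to the large parameter -κ/z of the problem with exchanged potentials, so the
behaviour at 0 is read off from that at infinity. -/
theorem mul_jostSol_eq (h : JostPotential p r p₀ r₀) (hz : z ∈ regionC (p₀ * r₀)) (x : ℝ) :
    z • jostSol p r p₀ r₀ z x =
      (-(Complex.I * r₀)) • swap2 (jostSol r p r₀ p₀ (-(p₀ * r₀ / z)) x) := by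
  have hz0 := hz.1
  have hp := h.ne_p
  have hr := h.ne_r
  have h1 : p₀ * r₀ / (p₀ * r₀ / z) = z := by field_simp
  have h2 := h.jostSol_inv (z := p₀ * r₀ / z) (by rwa [h1])
  rw [h1] at h2
  rw [h2, smul_smul]
  congr 1
  field_simp

theorem tendsto_zero_fst (h : JostPotential p r p₀ r₀) (x : ℝ) :
    Tendsto (fun z => z * jostSol p r p₀ r₀ z x 0) (𝓝[regionC (p₀ * r₀)] 0) (𝓝 0) := by
  have h1 := ((h.swap.tendsto_snd x).comp h.tendsto_zero_inv).const_mul (-(Complex.I * r₀))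
  rw [mul_zero] at h1
  refine h1.congr' ?_
  filter_upwards [self_mem_nhdsWithin] with z hz
  exact (congrFun (h.mul_jostSol_eq hz x) 0).symm

theorem tendsto_zero_snd (h : JostPotential p r p₀ r₀) (x : ℝ) :
    Tendsto (fun z => z * jostSol p r p₀ r₀ z x 1) (𝓝[regionC (p₀ * r₀)] 0)
      (𝓝 (-(Complex.I * r₀))) := by
  have h1 := ((h.swap.tendsto_fst x).comp h.tendsto_zero_inv).const_mul (-(Complex.I * r₀))
  rw [mul_one] at h1
  refine h1.congr' ?_
  filter_upwards [self_mem_nhdsWithin] with z hz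
  exact (congrFun (h.mul_jostSol_eq hz x) 1).symm

end JostPotential

/-! ### The Jost solutions of the nonlocal problem -/

namespace Background

/-- `κ = ε q₀²`. -/
def kap (B : Background) : ℂ := (B.ε : ℂ) * (B.q₀ : ℂ) ^ 2

variable (B : Background)

theorem q₀_pos : 0 < B.q₀ := abs_pos.2 B.qMinus_ne

theorem ε_eq : B.ε = 1 ∨ B.ε = -1 := by
  unfold ε
  rcases B.δ_eq with h | h <;> rcases B.σ_eq with h' | h' <;> simp [h, h']

theorem δ_sq : B.δ ^ 2 = 1 := by
  rcases B.δ_eq with h | h <;> simp [h]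

theorem q₀_sq : B.q₀ ^ 2 = B.qMinus ^ 2 := sq_abs _

theorem qPlus_sq : B.qPlus ^ 2 = B.qMinus ^ 2 := by
  rw [qPlus, mul_pow, B.δ_sq, one_mul]

theorem qPlus_ne : B.qPlus ≠ 0 := by
  intro h
  have := B.qPlus_sq
  rw [h] at this
  exact B.qMinus_ne (by simpa using this.symm)

theorem kap_ne : B.kap ≠ 0 := by
  have h1 : B.ε ≠ 0 := by rcases B.ε_eq with h | h <;> simp [h]
  have h2 := B.q₀_pos.ne'
  simp [kap, h1, h2]

theorem kap_eq : (B.qPlus : ℂ) * ((B.σ : ℂ) * B.qMinus) = B.kap := by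
  rw [kap, ← Complex.ofReal_pow, B.q₀_sq, qPlus, ε]
  push_cast
  ring

theorem kap_eq_ofReal : B.kap = ((B.ε * B.q₀ ^ 2 : ℝ) : ℂ) := by
  rw [kap]; push_cast; rfl

theorem lam_eq (z : ℂ) : B.lam z = lamK B.kap z := rfl

theorem lam_im (z : ℂ) : (lamK B.kap z).im = z.im * (1 + B.ε * B.q₀ ^ 2 / ‖z‖ ^ 2) / 2 := by
  rw [lamK, kap_eq_ofReal, div_eq_mul_inv ((B.ε * B.q₀ ^ 2 : ℝ) : ℂ) z]
  have h1 : ((z - ((B.ε * B.q₀ ^ 2 : ℝ) : ℂ) * z⁻¹) / 2).im =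
      (z - ((B.ε * B.q₀ ^ 2 : ℝ) : ℂ) * z⁻¹).im / 2 := by
    simp
  rw [h1, Complex.sub_im, Complex.im_ofReal_mul, Complex.inv_im, Complex.normSq_eq_norm_sq]
  ring

/-- Since Im λ = Im z (1 + ε q₀²/|z|²)/2, the two descriptions of D⁺ for ε = 1 and ε = -1 are one
condition. -/
theorem mem_DPlus_iff {z : ℂ} : z ∈ B.DPlus ↔ z ∈ regionO B.kap := by
  have hq := B.q₀_pos
  simp only [DPlus, regionO, mem_ofPred_eq, B.lam_im]
  by_cases hz : z = 0
  · simp [hz]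
  have hn : 0 < ‖z‖ := norm_pos_iff.2 hz
  simp only [ne_eq, hz, not_false_eq_true, true_and]
  rcases B.ε_eq with h | h
  · rw [h]
    norm_num
    have hp : 0 < 1 + B.q₀ ^ 2 / ‖z‖ ^ 2 := by positivity
    exact (mul_pos_iff_of_pos_right hp).symm
  · rw [h]
    norm_num
    have e1 : z.im * (1 + -B.q₀ ^ 2 / ‖z‖ ^ 2) =
        ((‖z‖ - B.q₀) * z.im) * ((‖z‖ + B.q₀) / ‖z‖ ^ 2) := by
      field_simp; ring
    rw [e1]
    have hp : 0 < (‖z‖ + B.q₀) / ‖z‖ ^ 2 := by positivity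
    exact (mul_pos_iff_of_pos_right hp).symm

theorem mem_Sigma₀_iff {z : ℂ} :
    z ∈ B.Sigma₀ ↔ z ≠ 0 ∧ (lamK B.kap z).im = 0 ∧ z ^ 2 ≠ B.kap := by
  have hq := B.q₀_pos
  simp only [Sigma₀, mem_ofPred_eq, B.lam_im]
  refine and_congr_right fun hz => and_congr_left fun _ => ?_
  have hn : 0 < ‖z‖ := norm_pos_iff.2 hz
  rw [div_eq_zero_iff, mul_eq_zero]
  simp only [OfNat.ofNat_ne_zero, or_false]
  refine or_congr_right ?_
  rcases B.ε_eq with h | h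
  · rw [h]
    have hp : 1 + 1 * B.q₀ ^ 2 / ‖z‖ ^ 2 ≠ 0 := by positivity
    simp only [hp, iff_false, not_and]
    intro h1
    norm_num at h1
  · rw [h]
    simp only [true_and]
    constructor
    · intro h1; rw [h1]; field_simp; ring
    · intro h1
      have h2 : ‖z‖ ^ 2 = B.q₀ ^ 2 := by field_simp at h1; linarith
      exact (pow_left_inj₀ hn.le hq.le two_ne_zero).1 h2

end Background

end NonlocalMKdV

end

/-! ### The four Jost columns of the nonlocal problem in terms of one column -/

noncomputable section

namespace NonlocalMKdV

open MeasureTheory Set Bornology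

/-- The potential `q(·,t)`. -/
def potP (q : ℝ → ℝ → ℝ) (t x : ℝ) : ℂ := q x t

/-- The potential `σ q(-·,-t)`. -/
def potR (B : Background) (q : ℝ → ℝ → ℝ) (t x : ℝ) : ℂ := (B.σ : ℂ) * q (-x) (-t)

variable {B : Background} {q : ℝ → ℝ → ℝ}

namespace IsSolution

theorem contDiff_x (hq : IsSolution B q) (t : ℝ) : ContDiff ℝ 3 fun x => q x t :=
  hq.contDiff.comp (contDiff_id.prodMk contDiff_const)

theorem tendsto_fixed {F : Filter ℝ} {f : ℝ × ℝ → ℝ} {l : ℝ} {t : ℝ}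
    (h : Tendsto f (F ×ˢ 𝓝 t) (𝓝 l)) : Tendsto (fun x => f (x, t)) F (𝓝 l) :=
  h.comp (tendsto_id.prodMk tendsto_const_nhds)

theorem integrableOn_Ioi_of_Ici {f : ℝ → ℝ} (hf : Continuous f) (h : IntegrableOn f (Ici 0))
    (a : ℝ) : IntegrableOn f (Ioi a) := by
  have h1 : IntegrableOn f (Icc a 0 ∪ Ici 0) := hf.continuousOn.integrableOn_Icc.union h
  refine h1.mono_set fun x hx => ?_
  rcases le_total x 0 with h0 | h0
  · exact Or.inl ⟨le_of_lt hx, h0⟩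
  · exact Or.inr h0

/-- The second potential at +∞ sees `q` at -∞ and at time -t, so both ends of the boundary data
enter the single half-line problem at +∞. -/
theorem jostPotential (hq : IsSolution B q) (t : ℝ) :
    JostPotential (potP q t) (potR B q t) (B.qPlus : ℂ) ((B.σ : ℂ) * (B.qMinus : ℂ)) := by
  have hd : ∀ t x, HasDerivAt (fun x => q x t) (deriv (fun x => q x t) x) x := fun t x =>
    ((hq.contDiff_x t).differentiable (by norm_num) x).hasDerivAt
  have hc : ∀ t, Continuous (deriv fun x => q x t) := fun t =>
    (hq.contDiff_x t).continuous_deriv (by norm_num)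
  have hcq : ∀ t, Continuous fun x => q x t := fun t => (hq.contDiff_x t).continuous
  have hdp : ∀ x, HasDerivAt (potP q t) ((deriv (fun x => q x t) x : ℝ) : ℂ) x := fun x =>
    (hd t x).ofReal_comp
  have hdr : ∀ x, HasDerivAt (potR B q t)
      ((B.σ : ℂ) * ((-(deriv (fun x => q x (-t)) (-x)) : ℝ) : ℂ)) x := by
    intro x
    have h1 : HasDerivAt (fun x => q (-x) (-t)) (-(deriv (fun x => q x (-t)) (-x))) x := by
      have := (hd (-t) (-x)).scomp x (hasDerivAt_neg x)
      rwa [neg_one_smul] at this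
    exact h1.ofReal_comp.const_mul _
  have hp' : deriv (potP q t) = fun x => ((deriv (fun x => q x t) x : ℝ) : ℂ) :=
    funext fun x => (hdp x).deriv
  have hr' : deriv (potR B q t) = fun x =>
      (B.σ : ℂ) * ((-(deriv (fun x => q x (-t)) (-x)) : ℝ) : ℂ) := funext fun x => (hdr x).deriv
  have hlim_plus : Tendsto (fun x => deriv (fun x => q x t) x) atTop (𝓝 0) := by
    have := tendsto_fixed (hq.tendsto_deriv_plus t 1 (by simp))
    simpa using this
  have hlim_minus : Tendsto (fun x => deriv (fun x => q x (-t)) x) atBot (𝓝 0) := by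
    have := tendsto_fixed (hq.tendsto_deriv_minus (-t) 1 (by simp))
    simpa using this
  have hofReal : ∀ {f : ℝ → ℝ} {l : ℝ}, Tendsto f atTop (𝓝 l) →
      Tendsto (fun x => (f x : ℂ)) atTop (𝓝 (l : ℂ)) := fun h =>
    (Complex.continuous_ofReal.tendsto _).comp h
  refine ⟨fun x => (hdp x).differentiableAt, fun x => (hdr x).differentiableAt, ?_, ?_, ?_, ?_, ?_,
    ?_, fun a => ?_, fun a => ?_, ?_, ?_⟩
  · rw [hp']; exact Complex.continuous_ofReal.comp (hc t)
  · rw [hr']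
    have := hc (-t)
    fun_prop
  · exact hofReal (tendsto_fixed (hq.tendsto_plus t))
  · exact (hofReal ((tendsto_fixed (hq.tendsto_minus (-t))).comp tendsto_neg_atTop_atBot)).const_mul _
  · rw [hp']; simpa using hofReal hlim_plus
  · rw [hr']
    simpa using (hofReal ((hlim_minus.comp tendsto_neg_atTop_atBot).neg)).const_mul (B.σ : ℂ)
  · have h1 := integrableOn_Ioi_of_Ici (by have := hcq t; fun_prop) (hq.integrable_plus t) a
    refine IntegrableOn.congr_fun (f := fun y => ‖(1 + |y|) * (q y t - B.qPlus)‖) h1.norm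
      (fun y _ => ?_) measurableSet_Ioi
    simp only []
    rw [norm_mul, Real.norm_of_nonneg (by positivity), potP, ← Complex.ofReal_sub,
      Complex.norm_real]
  · have h0 : IntegrableOn (fun x : ℝ => (1 + |x|) * (q (-x) (-t) - B.qMinus)) (Ici 0) := by
      have := (hq.integrable_minus (-t)).comp_neg
      simpa using! this
    have h1 := integrableOn_Ioi_of_Ici (by have := hcq (-t); fun_prop) h0 a
    refine IntegrableOn.congr_fun (f := fun y => ‖(1 + |y|) * (q (-y) (-t) - B.qMinus)‖) h1.norm
      (fun y _ => ?_) measurableSet_Ioi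
    simp only []
    rw [norm_mul, Real.norm_of_nonneg (by positivity), potR, ← mul_sub, norm_mul,
      ← Complex.ofReal_sub, Complex.norm_real, Complex.norm_real]
    rcases B.σ_eq with h | h <;> simp [h]
  · exact_mod_cast B.qPlus_ne
  · have h1 : B.σ ≠ 0 := by rcases B.σ_eq with h | h <;> simp [h]
    have h2 := B.qMinus_ne
    simp [h1, h2]

end IsSolution

theorem laxX_mulVec (x t : ℝ) (z : ℂ) (v : Fin 2 → ℂ) : laxX B q x t z *ᵥ v =
    ![Complex.I * B.k z * v 0 + q x t * v 1,
      (B.σ : ℂ) * q (-x) (-t) * v 0 - Complex.I * B.k z * v 1] := by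
  ext i
  fin_cases i <;> simp [laxX, Matrix.mulVec, dotProduct, Fin.sum_univ_two, sub_eq_add_neg]

theorem isJost_zero_iff {F : Filter ℝ} {qs t : ℝ} {z : ℂ} {φ : ℝ → Fin 2 → ℂ} :
    IsJost B q F qs 0 t z φ ↔ (∀ x : ℝ, HasDerivAt φ (laxX B q x t z *ᵥ φ x) x) ∧
      Tendsto (fun x => Complex.exp (-(Complex.I * B.θ x t z)) * φ x 0) F (𝓝 1) ∧
      Tendsto (fun x => Complex.exp (-(Complex.I * B.θ x t z)) * φ x 1) F
        (𝓝 (-((B.ε : ℂ) * Complex.I * qs / z))) := by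
  rw [IsJost, tendsto_vec]
  simp [asymE]

theorem isJost_one_iff {F : Filter ℝ} {qs t : ℝ} {z : ℂ} {φ : ℝ → Fin 2 → ℂ} :
    IsJost B q F qs 1 t z φ ↔ (∀ x : ℝ, HasDerivAt φ (laxX B q x t z *ᵥ φ x) x) ∧
      Tendsto (fun x => Complex.exp (Complex.I * B.θ x t z) * φ x 0) F
        (𝓝 (Complex.I * qs / z)) ∧
      Tendsto (fun x => Complex.exp (Complex.I * B.θ x t z) * φ x 1) F (𝓝 1) := by
  rw [IsJost, tendsto_vec]
  simp [asymE]

theorem theta_deriv (x t : ℝ) (z : ℂ) : HasDerivAt (fun x : ℝ => B.θ x t z) (B.lam z) x := by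
  unfold Background.θ
  have h : HasDerivAt (fun x : ℝ => (x : ℂ)) 1 x := Complex.ofRealCLM.hasDerivAt
  simpa using (h.add_const _).const_mul (B.lam z)

theorem theta_neg (x t : ℝ) (z : ℂ) : B.θ (-x) (-t) z = -B.θ x t z := by
  unfold Background.θ; push_cast; ring

theorem k_inv (z : ℂ) : B.k (B.kap / z) = B.k z := by
  have := B.kap_ne
  by_cases hz : z = 0
  · simp [hz, Background.k]
  · simp only [Background.k]
    change (B.kap / z + B.kap / (B.kap / z)) / 2 = (z + B.kap / z) / 2
    field_simp
    ring

theorem lam_inv (z : ℂ) : B.lam (B.kap / z) = -B.lam z := by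
  have := B.kap_ne
  by_cases hz : z = 0
  · simp [hz, Background.lam]
  · simp only [Background.lam]
    change (B.kap / z - B.kap / (B.kap / z)) / 2 = -((z - B.kap / z) / 2)
    field_simp
    ring

theorem theta_inv (x t : ℝ) (z : ℂ) : B.θ x t (B.kap / z) = -B.θ x t z := by
  simp only [Background.θ, k_inv, lam_inv]; ring

theorem laxX_inv (x t : ℝ) (z : ℂ) : laxX B q x t (B.kap / z) = laxX B q x t z := by
  simp only [laxX, k_inv]

/-- The normalized first column of `Φ₊`. -/
def colA (B : Background) (q : ℝ → ℝ → ℝ) (x t : ℝ) (z : ℂ) : Fin 2 → ℂ :=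
  jostSol (potP q t) (potR B q t) (B.qPlus : ℂ) ((B.σ : ℂ) * (B.qMinus : ℂ)) z x

/-- The closed region in which `Φ₊₁` exists. -/
def Background.regC (B : Background) : Set ℂ := regionC B.kap

theorem ε_qPlus : (B.ε : ℂ) * B.qPlus = B.σ * B.qMinus := by
  have : B.ε * B.qPlus = B.σ * B.qMinus := by
    rw [Background.ε, Background.qPlus]
    linear_combination (B.σ * B.qMinus) * B.δ_sq
  exact_mod_cast this

theorem k_sub_lam (z : ℂ) : B.k z - B.lam z = B.kap / z := by
  simp only [Background.k, Background.lam, Background.kap]; ring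

theorem k_add_lam (z : ℂ) : B.k z + B.lam z = z := by
  simp only [Background.k, Background.lam]; ring

/-- The factor e^{-iθ} subtracts iλ from the coefficient matrix, and k - λ = κ/z, k + λ = z turn the
diagonal into that of `normMat`. -/
theorem IsJost.isNormJost {t : ℝ} {z : ℂ} {φ : ℝ → Fin 2 → ℂ}
    (h : IsJost B q atTop B.qPlus 0 t z φ) :
    IsNormJost (potP q t) (potR B q t) (B.qPlus : ℂ) ((B.σ : ℂ) * (B.qMinus : ℂ)) z
      (fun x => Complex.exp (-(Complex.I * B.θ x t z)) • φ x) := by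
  rw [isJost_zero_iff] at h
  refine ⟨fun x => ?_, tendsto_vec.2 ⟨h.2.1, ?_⟩⟩
  · have h1 := (h.1 x)
    rw [laxX_mulVec] at h1
    rw [B.kap_eq]
    have h2 := (((theta_deriv x t z (B := B)).const_mul Complex.I).fun_neg).cexp.smul h1
    refine h2.congr_deriv ?_
    have e1 := k_sub_lam z (B := B)
    have e2 := k_add_lam z (B := B)
    ext i
    fin_cases i
    · simp [normMat, dotProduct, Fin.sum_univ_two, potP]
      linear_combination (Complex.I * Complex.exp (-(Complex.I * B.θ x t z)) * φ x 0) * e1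
    · simp [normMat, dotProduct, Fin.sum_univ_two, potR]
      linear_combination (-(Complex.I * Complex.exp (-(Complex.I * B.θ x t z)) * φ x 1)) * e2
  · have e : normVec ((B.σ : ℂ) * (B.qMinus : ℂ)) z 1 = -((B.ε : ℂ) * Complex.I * B.qPlus / z) := by
      simp only [normVec, Matrix.cons_val_one, Matrix.cons_val_fin_one, ← ε_qPlus]
      ring
    rw [e]
    exact h.2.2

theorem IsNormJost.isJost {t : ℝ} {z : ℂ} {m : ℝ → Fin 2 → ℂ}
    (h : IsNormJost (potP q t) (potR B q t) (B.qPlus : ℂ) ((B.σ : ℂ) * (B.qMinus : ℂ)) z m) :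
    IsJost B q atTop B.qPlus 0 t z (fun x => Complex.exp (Complex.I * B.θ x t z) • m x) := by
  have hE : ∀ x (c : ℂ), Complex.exp (-(Complex.I * B.θ x t z)) *
      (Complex.exp (Complex.I * B.θ x t z) * c) = c := fun x c => by
    rw [← mul_assoc, ← Complex.exp_add]; simp
  rw [isJost_zero_iff]
  have h2 := tendsto_vec.1 h.2
  refine ⟨fun x => ?_, ?_, ?_⟩
  · have h1 := (h.1 x)
    rw [laxX_mulVec]
    rw [B.kap_eq] at h1
    have h2 := ((theta_deriv x t z (B := B)).const_mul Complex.I).cexp.smul h1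
    refine h2.congr_deriv ?_
    have e1 := k_sub_lam z (B := B)
    have e2 := k_add_lam z (B := B)
    ext i
    fin_cases i
    · simp [normMat, dotProduct, Fin.sum_univ_two, potP]
      linear_combination (-(Complex.I * Complex.exp (Complex.I * B.θ x t z) * m x 0)) * e1
    · simp [normMat, dotProduct, Fin.sum_univ_two, potR]
      linear_combination (Complex.I * Complex.exp (Complex.I * B.θ x t z) * m x 1) * e2
  · simpa [hE, normVec] using h2.1
  · simp only [Pi.smul_apply, smul_eq_mul, hE]
    convert h2.2 using 2
    simp only [normVec, Matrix.cons_val_one, Matrix.cons_val_fin_one, ← ε_qPlus]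
    ring

theorem exp_smul_cancel (c : ℂ) (v : Fin 2 → ℂ) :
    Complex.exp c • Complex.exp (-c) • v = v := by
  rw [smul_smul, ← Complex.exp_add, add_neg_cancel, Complex.exp_zero, one_smul]

theorem mem_regC {z : ℂ} : z ∈ B.regC ↔ z ∈ regionC ((B.qPlus : ℂ) * ((B.σ : ℂ) * B.qMinus)) := by
  rw [B.kap_eq]; rfl

theorem IsSolution.isJost_colA (hq : IsSolution B q) (t : ℝ) {z : ℂ} (hz : z ∈ B.regC) :
    IsJost B q atTop B.qPlus 0 t z
      (fun x => Complex.exp (Complex.I * B.θ x t z) • colA B q x t z) :=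
  ((hq.jostPotential t).isNormJost (mem_regC.1 hz)).isJost

theorem IsSolution.jost_unique (hq : IsSolution B q) {t : ℝ} {z : ℂ} (hz : z ∈ B.regC)
    {φ ψ : ℝ → Fin 2 → ℂ} (hφ : IsJost B q atTop B.qPlus 0 t z φ)
    (hψ : IsJost B q atTop B.qPlus 0 t z ψ) : φ = ψ := by
  have hP := hq.jostPotential t
  have h := hφ.isNormJost.unique hP.diffp.continuous hP.diffr.continuous (mem_regC.1 hz)
    hψ.isNormJost
  funext x
  have h1 := congrArg (fun v => Complex.exp (Complex.I * B.θ x t z) • v) (congrFun h x)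
  simpa only [exp_smul_cancel] using h1

/-- The choice operator returns some Jost solution because one exists; uniqueness identifies it. -/
theorem IsSolution.jostPlus_zero (hq : IsSolution B q) (x t : ℝ) {z : ℂ} (hz : z ∈ B.regC) :
    jostPlus B q 0 x t z = Complex.exp (Complex.I * B.θ x t z) • colA B q x t z := by
  have h1 := hq.isJost_colA t hz
  have h2 := Classical.epsilon_spec (p := IsJost B q atTop B.qPlus 0 t z) ⟨_, h1⟩
  exact congrFun (hq.jost_unique hz h2 h1) x

/-- Inversion leaves k, hence the whole system, unchanged and flips the sign of θ. The two
exponential behaviours are exchanged, and the scalar factor adjusts the normalization. -/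
theorem IsJost.inv_of_one {F : Filter ℝ} {qs t : ℝ} (hqs : qs ^ 2 = B.qMinus ^ 2) {z : ℂ}
    (hz : z ≠ 0) {φ : ℝ → Fin 2 → ℂ} (h : IsJost B q F qs 1 t z φ) :
    IsJost B q F qs 0 t (B.kap / z) (fun x => (z / (Complex.I * qs)) • φ x) := by
  rw [isJost_one_iff] at h
  have hI := Complex.I_sq
  have hqs0 : (qs : ℂ) ≠ 0 := by
    have := B.qMinus_ne
    have : qs ≠ 0 := fun h0 => by rw [h0] at hqs; exact this (by simpa using hqs.symm)
    exact_mod_cast this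
  have hk := B.kap_ne
  rw [isJost_zero_iff]
  simp only [theta_inv, laxX_inv, mul_neg, neg_neg, Pi.smul_apply, smul_eq_mul]
  refine ⟨fun x => ?_, ?_, ?_⟩
  · rw [Matrix.mulVec_smul]
    exact (h.1 x).const_smul (z / (Complex.I * qs))
  · have := h.2.1.const_mul (z / (Complex.I * qs))
    convert this using 2
    · ring
    · field_simp
  · have := h.2.2.const_mul (z / (Complex.I * qs))
    convert this using 2
    · ring
    · have e1 : B.kap = B.ε * (qs : ℂ) ^ 2 := by
        rw [Background.kap, ← Complex.ofReal_pow, B.q₀_sq, ← hqs]; push_cast; rfl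
      have e2 : (B.ε : ℂ) ≠ 0 := by
        rcases B.ε_eq with h | h <;> simp [h]
      rw [e1]
      field_simp
      linear_combination (-1) * hI

theorem IsJost.inv_of_zero {F : Filter ℝ} {qs t : ℝ} (hqs : qs ^ 2 = B.qMinus ^ 2) {z : ℂ}
    (hz : z ≠ 0) {φ : ℝ → Fin 2 → ℂ} (h : IsJost B q F qs 0 t z φ) :
    IsJost B q F qs 1 t (B.kap / z) (fun x => (Complex.I * qs * z / B.kap) • φ x) := by
  rw [isJost_zero_iff] at h
  have hI := Complex.I_sq
  have hqs0 : (qs : ℂ) ≠ 0 := by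
    have := B.qMinus_ne
    have : qs ≠ 0 := fun h0 => by rw [h0] at hqs; exact this (by simpa using hqs.symm)
    exact_mod_cast this
  have hk := B.kap_ne
  rw [isJost_one_iff]
  simp only [theta_inv, laxX_inv, mul_neg, Pi.smul_apply, smul_eq_mul]
  refine ⟨fun x => ?_, ?_, ?_⟩
  · rw [Matrix.mulVec_smul]
    exact (h.1 x).const_smul (Complex.I * qs * z / B.kap)
  · have := h.2.1.const_mul (Complex.I * qs * z / B.kap)
    convert this using 2
    · ring
    · field_simp
  · have := h.2.2.const_mul (Complex.I * qs * z / B.kap)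
    convert this using 2
    · ring
    · have e1 : B.kap = B.ε * (qs : ℂ) ^ 2 := by
        rw [Background.kap, ← Complex.ofReal_pow, B.q₀_sq, ← hqs]; push_cast; rfl
      have e2 : (B.ε : ℂ) ≠ 0 := by
        rcases B.ε_eq with h | h <;> simp [h]
      rw [e1]
      field_simp
      linear_combination hI

theorem hasDerivAt_swap2_neg {φ : ℝ → Fin 2 → ℂ} {v : Fin 2 → ℂ} {x : ℝ}
    (h : HasDerivAt φ v (-x)) : HasDerivAt (fun x => swap2 (φ (-x))) (-swap2 v) x := by
  have h1 := h.scomp x (hasDerivAt_neg x)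
  rw [neg_one_smul] at h1
  have h2 := hasDerivAt_vec.1 h1
  exact hasDerivAt_vec.2 ⟨h2.2, h2.1⟩

/-- Reversal of (x,t) interchanges q(x,t) and q(-x,-t). With the exchange of components the
off-diagonal entries match exactly when -σ = 1; this symmetry is special to the focusing sign. -/
theorem laxX_reverse (hσ : B.σ = -1) (x t : ℝ) (z : ℂ) (v : Fin 2 → ℂ) :
    -swap2 (laxX B q (-x) (-t) z *ᵥ v) = laxX B q x t z *ᵥ swap2 v := by
  rw [laxX_mulVec, laxX_mulVec]
  ext i
  fin_cases i
  · simp [hσ]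
  · simp [hσ]; ring

theorem ε_qPlus' (hσ : B.σ = -1) : (B.ε : ℂ) * B.qPlus = -B.qMinus := by
  rw [ε_qPlus, hσ]; push_cast; ring

/-- Reversal maps -∞ to +∞ and changes the sign of θ, while the component exchange turns the second
asymptotic vector into the first. The spectral parameter does not change, so both columns live in
the same region. -/
theorem IsJost.reverse_of_one (hσ : B.σ = -1) {t : ℝ} {z : ℂ} {φ : ℝ → Fin 2 → ℂ}
    (h : IsJost B q atBot B.qMinus 1 (-t) z φ) :
    IsJost B q atTop B.qPlus 0 t z (fun x => swap2 (φ (-x))) := by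
  rw [isJost_one_iff] at h
  rw [isJost_zero_iff]
  have hθ : ∀ x, -(Complex.I * B.θ x t z) = Complex.I * B.θ (-x) (-t) z := fun x => by
    rw [theta_neg]; ring
  refine ⟨fun x => ?_, ?_, ?_⟩
  · rw [← laxX_reverse hσ]
    exact hasDerivAt_swap2_neg (h.1 (-x))
  · simp only [hθ, swap2_zero]
    exact h.2.2.comp tendsto_neg_atTop_atBot
  · simp only [hθ, swap2_one]
    have := h.2.1.comp tendsto_neg_atTop_atBot
    rw [show -((B.ε : ℂ) * Complex.I * B.qPlus / z) = Complex.I * B.qMinus / z by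
      linear_combination (-(Complex.I / z)) * ε_qPlus' hσ]
    exact this

theorem IsJost.reverse_of_zero (hσ : B.σ = -1) {t : ℝ} {z : ℂ} {φ : ℝ → Fin 2 → ℂ}
    (h : IsJost B q atTop B.qPlus 0 (-t) z φ) :
    IsJost B q atBot B.qMinus 1 t z (fun x => swap2 (φ (-x))) := by
  rw [isJost_zero_iff] at h
  rw [isJost_one_iff]
  have hθ : ∀ x, Complex.I * B.θ x t z = -(Complex.I * B.θ (-x) (-t) z) := fun x => by
    rw [theta_neg]; ring
  refine ⟨fun x => ?_, ?_, ?_⟩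
  · rw [← laxX_reverse hσ]
    exact hasDerivAt_swap2_neg (h.1 (-x))
  · simp only [hθ, swap2_zero]
    have := h.2.2.comp tendsto_neg_atBot_atTop
    rw [show Complex.I * B.qMinus / z = -((B.ε : ℂ) * Complex.I * B.qPlus / z) by
      linear_combination (Complex.I / z) * ε_qPlus' hσ]
    exact this
  · simp only [hθ, swap2_one]
    exact h.2.1.comp tendsto_neg_atBot_atTop

theorem inv_inv_kap {z : ℂ} (hz : z ≠ 0) : B.kap / (B.kap / z) = z := by
  have := B.kap_ne
  field_simp

theorem IsSolution.jostPlus_one (hq : IsSolution B q) (x t : ℝ) {z : ℂ} (hz : B.kap / z ∈ B.regC) :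
    jostPlus B q 1 x t z = Complex.exp (-(Complex.I * B.θ x t z)) •
      (Complex.I * B.qPlus / z) • colA B q x t (B.kap / z) := by
  have hk := B.kap_ne
  have hz0 : z ≠ 0 := by
    rintro rfl
    simpa using hz.1
  have hqs : (B.qPlus : ℂ) ≠ 0 := by exact_mod_cast B.qPlus_ne
  have h1 := (hq.isJost_colA t hz).inv_of_zero B.qPlus_sq hz.1
  rw [inv_inv_kap hz0] at h1
  have h2 := Classical.epsilon_spec (p := IsJost B q atTop B.qPlus 1 t z) ⟨_, h1⟩
  have h3 := congrFun (hq.jost_unique hz (h2.inv_of_one B.qPlus_sq hz0) (hq.isJost_colA t hz)) x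
  simp only [theta_inv, mul_neg] at h3
  rw [smul_comm, ← h3, smul_smul]
  have : Complex.I * B.qPlus / z * (z / (Complex.I * B.qPlus)) = 1 := by field_simp
  rw [this, one_smul]
  rfl

theorem swap2_swap2 (v : Fin 2 → ℂ) : swap2 (swap2 v) = v := by ext i; fin_cases i <;> rfl

theorem swap2_smul (c : ℂ) (v : Fin 2 → ℂ) : swap2 (c • v) = c • swap2 v := by
  ext i; fin_cases i <;> rfl

theorem IsSolution.eq_of_isJost_minus (hq : IsSolution B q) (hσ : B.σ = -1) (x t : ℝ) {z : ℂ}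
    (hz : z ∈ B.regC) {φ : ℝ → Fin 2 → ℂ} (h : IsJost B q atBot B.qMinus 1 t z φ) :
    φ x = Complex.exp (-(Complex.I * B.θ x t z)) • swap2 (colA B q (-x) (-t) z) := by
  have h3 : IsJost B q atTop B.qPlus 0 (-t) z (fun x => swap2 (φ (-x))) :=
    IsJost.reverse_of_one hσ (by rwa [neg_neg])
  have h4 := congrFun (hq.jost_unique hz h3 (hq.isJost_colA (-t) hz)) (-x)
  rw [neg_neg, theta_neg, mul_neg] at h4
  have h5 := congrArg swap2 h4
  rwa [swap2_swap2, swap2_smul] at h5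

theorem IsSolution.isJost_minus_one (hq : IsSolution B q) (hσ : B.σ = -1) (t : ℝ) {z : ℂ}
    (hz : z ∈ B.regC) : IsJost B q atBot B.qMinus 1 t z (fun x =>
      Complex.exp (-(Complex.I * B.θ x t z)) • swap2 (colA B q (-x) (-t) z)) := by
  have h1 := (hq.isJost_colA (-t) hz).reverse_of_zero hσ
  rwa [show (fun x => Complex.exp (-(Complex.I * B.θ x t z)) • swap2 (colA B q (-x) (-t) z)) = _
    from (funext fun x => hq.eq_of_isJost_minus hσ x t hz h1).symm]

theorem IsSolution.jostMinus_one (hq : IsSolution B q) (hσ : B.σ = -1) (x t : ℝ) {z : ℂ}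
    (hz : z ∈ B.regC) : jostMinus B q 1 x t z = Complex.exp (-(Complex.I * B.θ x t z)) •
      swap2 (colA B q (-x) (-t) z) :=
  hq.eq_of_isJost_minus hσ x t hz (Classical.epsilon_spec ⟨_, hq.isJost_minus_one hσ t hz⟩)

/-- The normalized first column of `Φ₋`. -/
def colC (B : Background) (q : ℝ → ℝ → ℝ) (x t : ℝ) (z : ℂ) : Fin 2 → ℂ :=
  (B.kap / (Complex.I * B.qMinus * z)) • swap2 (colA B q (-x) (-t) (B.kap / z))

theorem IsSolution.jostMinus_zero (hq : IsSolution B q) (hσ : B.σ = -1) (x t : ℝ) {z : ℂ}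
    (hz : B.kap / z ∈ B.regC) :
    jostMinus B q 0 x t z = Complex.exp (Complex.I * B.θ x t z) • colC B q x t z := by
  have hk := B.kap_ne
  have hz0 : z ≠ 0 := by
    rintro rfl
    simpa using hz.1
  have hqs : (B.qMinus : ℂ) ≠ 0 := by exact_mod_cast B.qMinus_ne
  have h1 := (hq.isJost_minus_one hσ t hz).inv_of_one rfl hz.1
  rw [inv_inv_kap hz0] at h1
  have h2 : IsJost B q atBot B.qMinus 0 t z (fun x => jostMinus B q 0 x t z) :=
    Classical.epsilon_spec (p := IsJost B q atBot B.qMinus 0 t z) ⟨_, h1⟩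
  have h7 := hq.eq_of_isJost_minus hσ x t hz (h2.inv_of_zero rfl hz0)
  rw [theta_inv, mul_neg, neg_neg] at h7
  have h9 := congrArg (fun v => (B.kap / (Complex.I * B.qMinus * z)) • v) h7
  simp only [smul_smul] at h9
  rw [show B.kap / (Complex.I * B.qMinus * z) * (Complex.I * B.qMinus * z / B.kap) = 1 by
    field_simp, one_smul] at h9
  rw [colC, smul_smul, mul_comm]
  exact h9

end NonlocalMKdV

end

noncomputable section

namespace NonlocalMKdV

open MeasureTheory Set Bornology

/-! ### Compatible linear systems -/

section Compatible

variable {E : Type*} [NormedAddCommGroup E] [NormedSpace ℂ E]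

theorem gronwallBound_le {δ K ε L : ℝ} (hK : 1 ≤ K) (hε : 0 ≤ ε) :
    gronwallBound δ K ε L ≤ (δ + ε) * Real.exp (K * L) := by
  rw [gronwallBound_of_K_ne_0 (by linarith)]
  have h1 : ε / K ≤ ε := div_le_self hε hK
  have h2 : 0 ≤ ε / K := by positivity
  have h3 := Real.exp_pos (K * L)
  nlinarith

/-- Compactness makes `Y` continuous at `t₀` uniformly over `S`; the mean value inequality is then
applied after subtracting the linear part. -/
theorem eventually_uniform_taylor {F : Type*} [NormedAddCommGroup F] [NormedSpace ℝ F]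
    {X Y : ℝ → ℝ → F} (hY : Continuous fun p : ℝ × ℝ => Y p.1 p.2)
    (hX : ∀ y t, HasDerivAt (fun t => X y t) (Y y t) t) {S : Set ℝ} (hS : IsCompact S) (t₀ : ℝ)
    {ε : ℝ} (hε : 0 < ε) :
    ∀ᶠ h in 𝓝 (0 : ℝ), ∀ y ∈ S, ‖X y (t₀ + h) - X y t₀ - h • Y y t₀‖ ≤ ε * |h| := by
  have h1 : ∀ᶠ t in 𝓝 t₀, ∀ y ∈ S, ‖Y y t - Y y t₀‖ < ε := by
    refine hS.eventually_forall_of_forall_eventually fun y _ => ?_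
    have hc : Continuous fun p : ℝ × ℝ => ‖Y p.2 p.1 - Y p.2 t₀‖ := by
      have e1 : Continuous fun p : ℝ × ℝ => Y p.2 p.1 :=
        hY.comp (continuous_snd.prodMk continuous_fst)
      have e2 : Continuous fun p : ℝ × ℝ => Y p.2 t₀ :=
        hY.comp (continuous_snd.prodMk continuous_const)
      exact (e1.sub e2).norm
    have := hc.tendsto (t₀, y)
    simp only [sub_self, norm_zero] at this
    exact this.eventually (gt_mem_nhds hε)
  obtain ⟨η, hη, hball⟩ := Metric.eventually_nhds_iff_ball.1 h1
  filter_upwards [Metric.ball_mem_nhds (0 : ℝ) hη] with h hh y hy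
  have hh' : t₀ + h ∈ Metric.ball t₀ η := by
    simpa [Metric.mem_ball, dist_eq_norm] using hh
  have hd : ∀ t ∈ Metric.ball t₀ η, HasDerivWithinAt (fun t => X y t - (t - t₀) • Y y t₀)
      (Y y t - Y y t₀) (Metric.ball t₀ η) t := by
    intro t _
    have h2 := ((hasDerivAt_id t).sub_const t₀).smul_const (Y y t₀)
    rw [one_smul] at h2
    exact ((hX y t).sub h2).hasDerivWithinAt
  have := (convex_ball t₀ η).norm_image_sub_le_of_norm_hasDerivWithin_le hd
    (fun t ht => (hball t ht y hy).le) (Metric.mem_ball_self hη) hh'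
  simp only [add_sub_cancel_left, sub_self, zero_smul, sub_zero, Real.norm_eq_abs] at this
  convert this using 2
  abel

theorem eventually_uniform_sub {F : Type*} [NormedAddCommGroup F]
    {X : ℝ → ℝ → F} (hX : Continuous fun p : ℝ × ℝ => X p.1 p.2) {S : Set ℝ} (hS : IsCompact S) (t₀ : ℝ)
    {ε : ℝ} (hε : 0 < ε) : ∀ᶠ h in 𝓝 (0 : ℝ), ∀ y ∈ S, ‖X y (t₀ + h) - X y t₀‖ ≤ ε := by
  refine hS.eventually_forall_of_forall_eventually fun y _ => ?_
  have hc : Continuous fun p : ℝ × ℝ => ‖X p.2 (t₀ + p.1) - X p.2 t₀‖ := by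
    have e1 : Continuous fun p : ℝ × ℝ => X p.2 (t₀ + p.1) :=
      hX.comp (continuous_snd.prodMk (continuous_const.add continuous_fst))
    have e2 : Continuous fun p : ℝ × ℝ => X p.2 t₀ :=
      hX.comp (continuous_snd.prodMk continuous_const)
    exact (e1.sub e2).norm
  have := hc.tendsto (0, y)
  simp only [add_zero, sub_self, norm_zero] at this
  exact this.eventually (ge_mem_nhds hε)

/-- If `Ψ_x = X Ψ` for all `t`, `X_t = T_x - [X, T]`, and `Ψ_t = T Ψ` holds at `(0, t₀)`, then it
holds at `(x, t₀)`. -/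
theorem hasDerivAt_of_compatible {X Y : ℝ → ℝ → E →L[ℂ] E} {T : ℝ → E →L[ℂ] E}
    (hXc : Continuous fun p : ℝ × ℝ => X p.1 p.2) (hYc : Continuous fun p : ℝ × ℝ => Y p.1 p.2)
    (hX : ∀ y t, HasDerivAt (fun t => X y t) (Y y t) t) {t₀ : ℝ}
    (hT : ∀ y, HasDerivAt T (Y y t₀ + X y t₀ * T y - T y * X y t₀) y) {Ψ : ℝ → ℝ → E}
    (hΨ : ∀ t y, HasDerivAt (fun y => Ψ y t) (X y t (Ψ y t)) y)
    (h0 : HasDerivAt (fun t => Ψ 0 t) (T 0 (Ψ 0 t₀)) t₀) (x : ℝ) :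
    HasDerivAt (fun t => Ψ x t) (T x (Ψ x t₀)) t₀ := by
  rw [hasDerivAt_iff_isLittleO_nhds_zero, Asymptotics.isLittleO_iff] at h0 ⊢
  intro c hc
  have hS : IsCompact (uIcc 0 x) := isCompact_uIcc
  have hTc : Continuous T := continuous_iff_continuousAt.2 fun y => (hT y).continuousAt
  have hΨc : Continuous fun y => Ψ y t₀ := continuous_iff_continuousAt.2 fun y =>
    (hΨ t₀ y).continuousAt
  obtain ⟨M₁, hM₁⟩ := hS.exists_bound_of_continuousOn (f := fun y => X y t₀)
    (hXc.comp (continuous_id.prodMk continuous_const)).continuousOn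
  obtain ⟨M₂, hM₂⟩ := hS.exists_bound_of_continuousOn hΨc.continuousOn
  obtain ⟨M₃, hM₃⟩ := hS.exists_bound_of_continuousOn (hTc.clm_apply hΨc).continuousOn
  have hM₁0 : 0 ≤ M₁ := (norm_nonneg _).trans (hM₁ 0 left_mem_uIcc)
  have hM₂0 : 0 ≤ M₂ := (norm_nonneg _).trans (hM₂ 0 left_mem_uIcc)
  have hM₃0 : 0 ≤ M₃ := (norm_nonneg _).trans (hM₃ 0 left_mem_uIcc)
  set G := Real.exp ((M₁ + 1) * |x - 0|) with hG
  have hG0 : 0 < G := Real.exp_pos _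
  -- Chosen so that the Gronwall bound at the end equals c |h|.
  set ε := c / (G * (1 + M₂ + M₃)) with hε
  have hε0 : 0 < ε := by positivity
  filter_upwards [h0 hε0, eventually_uniform_taylor hYc hX hS t₀ hε0,
    eventually_uniform_sub hXc hS t₀ hε0, eventually_uniform_sub hXc hS t₀ one_pos]
    with h e1 e2 e3 e4
  -- By compatibility the first-order defect in time solves the x-equation at time t₀ + h with a
  -- source of size o(h), uniformly on the interval. It is o(h) at x = 0 by hypothesis, and
  -- Gronwall's inequality carries this to x. Differentiability of Ψ in t away from x = 0 is a
  -- conclusion and is not used.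
  have hD : ∀ y, HasDerivAt (fun y => Ψ y (t₀ + h) - Ψ y t₀ - h • T y (Ψ y t₀))
      (X y (t₀ + h) (Ψ y (t₀ + h) - Ψ y t₀ - h • T y (Ψ y t₀)) +
        ((X y (t₀ + h) - X y t₀ - h • Y y t₀) (Ψ y t₀) +
          h • (X y (t₀ + h) - X y t₀) (T y (Ψ y t₀)))) y := by
    intro y
    have d1 : HasDerivAt (fun y => T y (Ψ y t₀))
        ((Y y t₀ + X y t₀ * T y - T y * X y t₀) (Ψ y t₀) + T y (X y t₀ (Ψ y t₀))) y := by
      let L : (E →L[ℂ] E) →L[ℝ] E →L[ℝ] E :=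
        ((ContinuousLinearMap.restrictScalarsL ℂ E E ℝ ℝ))
      have := (L.hasFDerivAt.comp_hasDerivAt y (hT y)).clm_apply (hΨ t₀ y)
      exact this
    have d2 := ((hΨ (t₀ + h) y).sub (hΨ t₀ y)).sub (d1.const_smul h)
    refine d2.congr_deriv ?_
    have hm : ∀ (A C : E →L[ℂ] E) v, (A * C) v = A (C v) := fun _ _ _ => rfl
    simp only [_root_.sub_apply, _root_.add_apply, hm, _root_.smul_apply, map_sub, smul_sub,
      smul_add]
    have : ∀ v, X y (t₀ + h) (h • v) = h • X y (t₀ + h) v := fun v =>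
      ContinuousLinearMap.map_smul_of_tower _ _ _
    rw [this]
    abel
  have key := norm_le_gronwall_uIcc (x₀ := 0) (x := x) (K := M₁ + 1)
    (ε := ε * (M₂ + M₃) * |h|) (fun y _ => hD y) (fun y hy => by
      refine (norm_add_le _ _).trans (add_le_add ?_ ((norm_add_le _ _).trans ?_))
      · refine ContinuousLinearMap.le_of_opNorm_le _ ?_ _
        calc ‖X y (t₀ + h)‖ = ‖X y t₀ + (X y (t₀ + h) - X y t₀)‖ := by rw [add_sub_cancel]
          _ ≤ _ := (norm_add_le _ _).trans (add_le_add (hM₁ y hy) (e4 y hy))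
      · have i1 : ‖(X y (t₀ + h) - X y t₀ - h • Y y t₀) (Ψ y t₀)‖ ≤ ε * |h| * M₂ :=
          (ContinuousLinearMap.le_of_opNorm_le _ (e2 y hy) _).trans
            (mul_le_mul_of_nonneg_left (hM₂ y hy) (by positivity))
        have i2 : ‖h • (X y (t₀ + h) - X y t₀) (T y (Ψ y t₀))‖ ≤ |h| * (ε * M₃) := by
          rw [norm_smul, Real.norm_eq_abs]
          refine mul_le_mul_of_nonneg_left ?_ (abs_nonneg h)
          exact (ContinuousLinearMap.le_of_opNorm_le _ (e3 y hy) _).trans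
            (mul_le_mul_of_nonneg_left (hM₃ y hy) (by positivity))
        linarith)
  refine key.trans ((gronwallBound_le (by linarith) (by positivity)).trans ?_)
  rw [← hG]
  rw [Real.norm_eq_abs] at e1 ⊢
  calc _ ≤ (ε * |h| + ε * (M₂ + M₃) * |h|) * G := by gcongr
    _ = c * |h| := by rw [hε]; field_simp; ring

end Compatible

theorem mv_of (a b c d : ℂ) : mv !![a, b; c, d] = a • mv !![1, 0; 0, 0] + b • mv !![0, 1; 0, 0]
    + c • mv !![0, 0; 1, 0] + d • mv !![0, 0; 0, 1] := by
  ext v i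
  fin_cases i <;> simp [Matrix.mulVec, dotProduct, Fin.sum_univ_two]

theorem hasDerivAt_mv {a b c d : ℝ → ℂ} {a' b' c' d' : ℂ} {x : ℝ} (ha : HasDerivAt a a' x)
    (hb : HasDerivAt b b' x) (hc : HasDerivAt c c' x) (hd : HasDerivAt d d' x) :
    HasDerivAt (fun x => mv !![a x, b x; c x, d x]) (mv !![a', b'; c', d']) x := by
  simp only [mv_of (a _), mv_of a']
  exact (((ha.smul_const (mv !![1, 0; 0, 0])).add (hb.smul_const (mv !![0, 1; 0, 0]))).add
    (hc.smul_const (mv !![0, 0; 1, 0]))).add (hd.smul_const (mv !![0, 0; 0, 1]))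

end NonlocalMKdV

end

noncomputable section

namespace NonlocalMKdV

open MeasureTheory Set Bornology

variable {B : Background} {q : ℝ → ℝ → ℝ}

/-! ### The time part of the Lax pair -/

/-- The derivative in the first variable. -/
def Dx (f : ℝ → ℝ → ℝ) (x t : ℝ) : ℝ := deriv (fun y => f y t) x

/-- The reversed potential `σ q(-x,-t)`. -/
def revQ (B : Background) (q : ℝ → ℝ → ℝ) (x t : ℝ) : ℝ := B.σ * q (-x) (-t)

theorem hasDerivAt_Dx {n : ℕ} {f : ℝ → ℝ → ℝ} (hf : ContDiff ℝ (n + 1) (Function.uncurry f))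
    (x t : ℝ) : HasDerivAt (fun y => f y t) (Dx f x t) x := by
  have h : ContDiff ℝ (n + 1) fun y => f y t := hf.comp (contDiff_id.prodMk contDiff_const)
  exact (h.differentiable (by simp) x).hasDerivAt

theorem contDiff_Dx {n : ℕ} {f : ℝ → ℝ → ℝ} (hf : ContDiff ℝ (n + 1) (Function.uncurry f)) :
    ContDiff ℝ n (Function.uncurry (Dx f)) := by
  have h1 : ContDiff ℝ n fun p : ℝ × ℝ => fderiv ℝ (Function.uncurry f) p (1, 0) :=
    (hf.fderiv_right (m := n) le_rfl).clm_apply contDiff_const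
  rw [show Function.uncurry (Dx f) = fun p : ℝ × ℝ => fderiv ℝ (Function.uncurry f) p (1, 0) from
    funext fun p => ?_]
  · exact h1
  have h2 := (hf.differentiable (by simp) p).hasFDerivAt
  have h3 : HasDerivAt (fun y : ℝ => (y, p.2)) ((1 : ℝ), (0 : ℝ)) p.1 :=
    (hasDerivAt_id p.1).prodMk (hasDerivAt_const p.1 p.2)
  exact (h2.comp_hasDerivAt p.1 h3).deriv

theorem contDiff_Dt {n : ℕ} {f : ℝ → ℝ → ℝ} (hf : ContDiff ℝ (n + 1) (Function.uncurry f)) :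
    ContDiff ℝ n (Function.uncurry fun x t => deriv (f x) t) := by
  have h1 : ContDiff ℝ n fun p : ℝ × ℝ => fderiv ℝ (Function.uncurry f) p (0, 1) :=
    (hf.fderiv_right (m := n) le_rfl).clm_apply contDiff_const
  rw [show (Function.uncurry fun x t => deriv (f x) t) =
    fun p : ℝ × ℝ => fderiv ℝ (Function.uncurry f) p (0, 1) from funext fun p => ?_]
  · exact h1
  have h2 := (hf.differentiable (by simp) p).hasFDerivAt
  have h3 : HasDerivAt (fun y : ℝ => (p.1, y)) ((0 : ℝ), (1 : ℝ)) p.2 :=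
    (hasDerivAt_const p.2 p.1).prodMk (hasDerivAt_id p.2)
  exact (h2.comp_hasDerivAt p.2 h3).deriv

theorem Dx_revQ (q : ℝ → ℝ → ℝ) (c : ℝ) (x t : ℝ) :
    Dx (fun x t => c * q (-x) (-t)) x t = -c * Dx q (-x) (-t) := by
  unfold Dx
  rw [deriv_const_mul_field, deriv_comp_neg (fun y => q y (-t)) x]
  ring

theorem iteratedDeriv_two_eq (q : ℝ → ℝ → ℝ) (x t : ℝ) :
    iteratedDeriv 2 (fun y => q y t) x = Dx (Dx q) x t := by
  rw [iteratedDeriv_succ, iteratedDeriv_one]; rfl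

theorem iteratedDeriv_three_eq (q : ℝ → ℝ → ℝ) (x t : ℝ) :
    iteratedDeriv 3 (fun y => q y t) x = Dx (Dx (Dx q)) x t := by
  rw [iteratedDeriv_succ, iteratedDeriv_succ, iteratedDeriv_one]; rfl

/-- The matrix of the time part of the Lax pair in terms of the potentials and their
derivatives. -/
def timeMat (k p p₁ p₂ r r₁ r₂ : ℂ) : Matrix (Fin 2) (Fin 2) ℂ :=
  !![4 * Complex.I * k ^ 3 + 2 * Complex.I * k * p * r + (p₁ * r - p * r₁),
     4 * k ^ 2 * p - 2 * Complex.I * k * p₁ - p₂ + 2 * p ^ 2 * r;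
     4 * k ^ 2 * r + 2 * Complex.I * k * r₁ - r₂ + 2 * p * r ^ 2,
     -(4 * Complex.I * k ^ 3 + 2 * Complex.I * k * p * r + (p₁ * r - p * r₁))]

theorem tendsto_mv {α : Type*} {l : Filter α} {a b c d : α → ℂ} {a' b' c' d' : ℂ}
    (ha : Tendsto a l (𝓝 a')) (hb : Tendsto b l (𝓝 b')) (hc : Tendsto c l (𝓝 c'))
    (hd : Tendsto d l (𝓝 d')) :
    Tendsto (fun x => mv !![a x, b x; c x, d x]) l (𝓝 (mv !![a', b'; c', d'])) := by
  simp only [mv_of (a _), mv_of a']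
  exact (((ha.smul_const (mv !![1, 0; 0, 0])).add (hb.smul_const (mv !![0, 1; 0, 0]))).add
    (hc.smul_const (mv !![0, 0; 1, 0]))).add (hd.smul_const (mv !![0, 0; 0, 1]))

theorem tendsto_timeMat {α : Type*} {l : Filter α} {p p₁ p₂ r r₁ r₂ : α → ℂ}
    {k lp lp₁ lp₂ lr lr₁ lr₂ : ℂ} (h₁ : Tendsto p l (𝓝 lp)) (h₂ : Tendsto p₁ l (𝓝 lp₁))
    (h₃ : Tendsto p₂ l (𝓝 lp₂)) (h₄ : Tendsto r l (𝓝 lr)) (h₅ : Tendsto r₁ l (𝓝 lr₁))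
    (h₆ : Tendsto r₂ l (𝓝 lr₂)) :
    Tendsto (fun i => mv (timeMat k (p i) (p₁ i) (p₂ i) (r i) (r₁ i) (r₂ i))) l
      (𝓝 (mv (timeMat k lp lp₁ lp₂ lr lr₁ lr₂))) := by
  have a := ((h₁.const_mul (2 * Complex.I * k)).mul h₄).const_add (4 * Complex.I * k ^ 3)
    |>.add ((h₂.mul h₄).sub (h₁.mul h₅))
  have b := (((h₁.const_mul (4 * k ^ 2)).sub (h₂.const_mul (2 * Complex.I * k))).sub h₃).add
    (((h₁.pow 2).const_mul 2).mul h₄)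
  have d := (((h₄.const_mul (4 * k ^ 2)).add (h₅.const_mul (2 * Complex.I * k))).sub h₆).add
    ((h₁.const_mul 2).mul (h₄.pow 2))
  exact tendsto_mv a b d a.neg

/-- The matrix `T` of the time part `Φ_t = T Φ` of the Lax pair. -/
def laxT (B : Background) (q : ℝ → ℝ → ℝ) (x t : ℝ) (z : ℂ) : Matrix (Fin 2) (Fin 2) ℂ :=
  timeMat (B.k z) (q x t) (Dx q x t) (Dx (Dx q) x t) (revQ B q x t) (Dx (revQ B q) x t)
    (Dx (Dx (revQ B q)) x t)

/-- `Φ` solves both equations of the Lax pair. -/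
def IsLax (B : Background) (q : ℝ → ℝ → ℝ) (z : ℂ) (Φ : ℝ → ℝ → Fin 2 → ℂ) : Prop :=
  (∀ x t, HasDerivAt (fun x => Φ x t) (laxX B q x t z *ᵥ Φ x t) x) ∧
  ∀ x t, HasDerivAt (fun t => Φ x t) (laxT B q x t z *ᵥ Φ x t) t

theorem Dx_rev (x t : ℝ) : Dx (revQ B q) x t = -B.σ * Dx q (-x) (-t) := Dx_revQ q B.σ x t

theorem Dx_Dx_rev (x t : ℝ) : Dx (Dx (revQ B q)) x t = B.σ * Dx (Dx q) (-x) (-t) := by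
  rw [show Dx (revQ B q) = fun x t => -B.σ * Dx q (-x) (-t) from
    funext fun x => funext fun t => Dx_rev x t, Dx_revQ, neg_neg]

theorem Dx_Dx_Dx_rev (x t : ℝ) :
    Dx (Dx (Dx (revQ B q))) x t = -B.σ * Dx (Dx (Dx q)) (-x) (-t) := by
  rw [show Dx (Dx (revQ B q)) = fun x t => B.σ * Dx (Dx q) (-x) (-t) from
    funext fun x => funext fun t => Dx_Dx_rev x t, Dx_revQ]

namespace IsSolution

theorem contDiff_rev (hq : IsSolution B q) : ContDiff ℝ 3 (Function.uncurry (revQ B q)) := by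
  have h : ContDiff ℝ 3 fun p : ℝ × ℝ => Function.uncurry q (-p.1, -p.2) :=
    hq.contDiff.comp (contDiff_fst.neg.prodMk contDiff_snd.neg)
  exact contDiff_const.mul h

theorem deriv_t (hq : IsSolution B q) (x t : ℝ) :
    deriv (q x) t = 6 * q x t * revQ B q x t * Dx q x t - Dx (Dx (Dx q)) x t := by
  have := hq.eqn x t
  rw [iteratedDeriv_three_eq] at this
  change deriv (q x) t - 6 * B.σ * q x t * q (-x) (-t) * Dx q x t + _ = 0 at this
  rw [revQ]
  linarith

/-- All three derivatives q_t, q_x, q_xxx change sign under reversal and the product q(x,t) q(-x,-t)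
does not, so the reversed potential satisfies the companion equation of the zero-curvature pair. -/
theorem deriv_t_rev (hq : IsSolution B q) (x t : ℝ) : deriv (revQ B q x) t =
    6 * q x t * revQ B q x t * Dx (revQ B q) x t - Dx (Dx (Dx (revQ B q))) x t := by
  have h1 : deriv (revQ B q x) t = -B.σ * deriv (q (-x)) (-t) := by
    unfold revQ
    rw [deriv_const_mul_field, deriv_comp_neg (fun y => q (-x) y) t]
    ring
  rw [h1, hq.deriv_t, Dx_Dx_Dx_rev, Dx_rev, revQ, revQ, neg_neg, neg_neg]
  ring

theorem hasDerivAt_t {f : ℝ → ℝ → ℝ} (hf : ContDiff ℝ 3 (Function.uncurry f)) (x t : ℝ) :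
    HasDerivAt (fun t => (f x t : ℂ)) ((deriv (f x) t : ℝ) : ℂ) t := by
  have h : ContDiff ℝ 3 fun t => f x t := hf.comp (contDiff_const.prodMk contDiff_id)
  exact (h.differentiable (by norm_num) t).hasDerivAt.ofReal_comp

theorem continuous_laxT (hq : IsSolution B q) (z : ℂ) :
    Continuous fun p : ℝ × ℝ => mv (laxT B q p.1 p.2 z) := by
  have c3 := hq.contDiff
  have r3 := hq.contDiff_rev
  have c2 := contDiff_Dx (n := 2) c3
  have r2 := contDiff_Dx (n := 2) r3
  have c1 := contDiff_Dx (n := 1) c2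
  have r1 := contDiff_Dx (n := 1) r2
  have e0 : Continuous fun p : ℝ × ℝ => q p.1 p.2 := c3.continuous
  have e1 : Continuous fun p : ℝ × ℝ => Dx q p.1 p.2 := c2.continuous
  have e2 : Continuous fun p : ℝ × ℝ => Dx (Dx q) p.1 p.2 := c1.continuous
  have f0 : Continuous fun p : ℝ × ℝ => revQ B q p.1 p.2 := r3.continuous
  have f1 : Continuous fun p : ℝ × ℝ => Dx (revQ B q) p.1 p.2 := r2.continuous
  have f2 : Continuous fun p : ℝ × ℝ => Dx (Dx (revQ B q)) p.1 p.2 := r1.continuous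
  refine continuous_mv ?_
  unfold laxT timeMat
  refine continuous_matrix fun i j => ?_
  fin_cases i <;> fin_cases j <;> simp <;> fun_prop

theorem continuous_laxX (hq : IsSolution B q) (z : ℂ) :
    Continuous fun p : ℝ × ℝ => mv (laxX B q p.1 p.2 z) := by
  have e0 : Continuous fun p : ℝ × ℝ => q p.1 p.2 := hq.contDiff.continuous
  have f0 : Continuous fun p : ℝ × ℝ => q (-p.1) (-p.2) :=
    e0.comp (continuous_fst.neg.prodMk continuous_snd.neg)
  refine continuous_mv ?_
  unfold laxX
  refine continuous_matrix fun i j => ?_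
  fin_cases i <;> fin_cases j <;> simp <;> fun_prop

theorem laxX_eq (x t : ℝ) (z : ℂ) : laxX B q x t z =
    !![Complex.I * B.k z, (q x t : ℂ); (revQ B q x t : ℂ), -(Complex.I * B.k z)] := by
  rw [laxX, revQ]; push_cast; rfl

theorem hasDerivAt_laxX_t (hq : IsSolution B q) (z : ℂ) (x t : ℝ) :
    HasDerivAt (fun t => mv (laxX B q x t z))
      (mv !![0, ((deriv (q x) t : ℝ) : ℂ); ((deriv (revQ B q x) t : ℝ) : ℂ), 0]) t := by
  simp only [laxX_eq]
  exact hasDerivAt_mv (hasDerivAt_const _ _) (hasDerivAt_t hq.contDiff x t)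
    (hasDerivAt_t hq.contDiff_rev x t) (hasDerivAt_const _ _)

theorem continuous_laxX_t (hq : IsSolution B q) : Continuous fun p : ℝ × ℝ =>
    mv !![0, ((deriv (q p.1) p.2 : ℝ) : ℂ); ((deriv (revQ B q p.1) p.2 : ℝ) : ℂ), 0] := by
  have e0 : Continuous fun p : ℝ × ℝ => deriv (q p.1) p.2 :=
    (contDiff_Dt (n := 2) hq.contDiff).continuous
  have f0 : Continuous fun p : ℝ × ℝ => deriv (revQ B q p.1) p.2 :=
    (contDiff_Dt (n := 2) hq.contDiff_rev).continuous
  refine continuous_mv ?_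
  refine continuous_matrix fun i j => ?_
  fin_cases i <;> fin_cases j <;> simp <;> fun_prop

/-- The zero curvature equation. -/
theorem hasDerivAt_laxT (hq : IsSolution B q) (z : ℂ) (x t : ℝ) :
    HasDerivAt (fun x => mv (laxT B q x t z))
      (mv !![0, ((deriv (q x) t : ℝ) : ℂ); ((deriv (revQ B q x) t : ℝ) : ℂ), 0] +
        mv (laxX B q x t z) * mv (laxT B q x t z) - mv (laxT B q x t z) * mv (laxX B q x t z)) x := by
  have c3 := hq.contDiff
  have r3 := hq.contDiff_rev
  have c2 := contDiff_Dx (n := 2) c3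
  have r2 := contDiff_Dx (n := 2) r3
  have c1 := contDiff_Dx (n := 1) c2
  have r1 := contDiff_Dx (n := 1) r2
  have p0 := (hasDerivAt_Dx (n := 2) c3 x t).ofReal_comp
  have p1 := (hasDerivAt_Dx (n := 1) c2 x t).ofReal_comp
  have p2 := (hasDerivAt_Dx (n := 0) c1 x t).ofReal_comp
  have s0 := (hasDerivAt_Dx (n := 2) r3 x t).ofReal_comp
  have s1 := (hasDerivAt_Dx (n := 1) r2 x t).ofReal_comp
  have s2 := (hasDerivAt_Dx (n := 0) r1 x t).ofReal_comp
  have a1 := ((p0.const_mul (2 * Complex.I * B.k z)).mul s0).const_add (4 * Complex.I * B.k z ^ 3)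
    |>.add ((p1.mul s0).sub (p0.mul s1))
  have b1 := (((p0.const_mul (4 * B.k z ^ 2)).sub (p1.const_mul (2 * Complex.I * B.k z))).sub p2).add
    (((p0.pow 2).const_mul 2).mul s0)
  have d1 := (((s0.const_mul (4 * B.k z ^ 2)).add (s1.const_mul (2 * Complex.I * B.k z))).sub s2).add
    ((p0.const_mul 2).mul (s0.pow 2))
  have key := hasDerivAt_mv a1 b1 d1 a1.neg
  refine key.congr_deriv ?_
  rw [show ∀ M N, mv M * mv N = mv (M * N) from mv_mul, show ∀ M N, mv M * mv N = mv (M * N) from mv_mul]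
  have hadd : ∀ M N, mv M + mv N = mv (M + N) := fun M N => (map_add mvLin M N).symm
  have hsub : ∀ M N, mv M - mv N = mv (M - N) := fun M N => (map_sub mvLin M N).symm
  rw [hadd, hsub]
  congr 1
  have hI : Complex.I ^ 2 = -1 := Complex.I_sq
  rw [laxX_eq, laxT, timeMat, hq.deriv_t, hq.deriv_t_rev]
  push_cast
  ext i j
  fin_cases i <;> fin_cases j <;>
    simp <;> ring_nf <;> simp only [hI] <;> ring

/-- The time equation is solved along x = 0 and the x-equation from every point (0,t); zero
curvature extends the time equation to all x. -/
theorem exists_isLax (hq : IsSolution B q) (z : ℂ) (c : Fin 2 → ℂ) :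
    ∃ Φ : ℝ → ℝ → Fin 2 → ℂ, IsLax B q z Φ ∧ Φ 0 0 = c := by
  have c1 : Continuous fun t : ℝ => mv (laxT B q 0 t z) :=
    Continuous.comp (g := fun p : ℝ × ℝ => mv (laxT B q p.1 p.2 z)) (f := fun t : ℝ => ((0 : ℝ), t))
      (hq.continuous_laxT z) (continuous_const.prodMk continuous_id)
  have c2 : ∀ t : ℝ, Continuous fun x : ℝ => mv (laxX B q x t z) := fun t =>
    Continuous.comp (g := fun p : ℝ × ℝ => mv (laxX B q p.1 p.2 z)) (f := fun x : ℝ => (x, t))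
      (hq.continuous_laxX z) (continuous_id.prodMk continuous_const)
  obtain ⟨g, hg, hg0⟩ := exists_linearODE c1 0 c
  choose f hf hf0 using fun t => exists_linearODE (c2 t) 0 (g t)
  refine ⟨fun x t => f t x, ⟨fun x t => hf t x, fun x t => ?_⟩, (hf0 0).trans hg0⟩
  have a6 : HasDerivAt (fun t => f t 0) (mv (laxT B q 0 t z) (f t 0)) t := by
    simp only [hf0]
    exact hg t
  exact hasDerivAt_of_compatible (hq.continuous_laxX z) hq.continuous_laxX_t
    (fun x t => hq.hasDerivAt_laxX_t z x t) (fun x => hq.hasDerivAt_laxT z x t) hf a6 x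

/-- The limit of `T` as `x → ∞`. -/
def _root_.NonlocalMKdV.limT (B : Background) (z : ℂ) : Matrix (Fin 2) (Fin 2) ℂ :=
  timeMat (B.k z) B.qPlus 0 0 ((B.σ : ℂ) * B.qMinus) 0 0

theorem tendsto_laxT (hq : IsSolution B q) (z : ℂ) (t : ℝ) :
    Tendsto (fun p : ℝ × ℝ => mv (laxT B q p.1 p.2 z)) (atTop ×ˢ 𝓝 t) (𝓝 (mv (limT B z))) := by
  have hneg : Tendsto (fun p : ℝ × ℝ => (-p.1, -p.2)) (atTop ×ˢ 𝓝 t) (atBot ×ˢ 𝓝 (-t)) :=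
    (tendsto_neg_atTop_atBot.comp tendsto_fst).prodMk ((continuous_neg.tendsto t).comp tendsto_snd)
  have hR : ∀ {f : ℝ × ℝ → ℝ} {l : ℝ}, Tendsto f (atTop ×ˢ 𝓝 t) (𝓝 l) →
      Tendsto (fun p => (f p : ℂ)) (atTop ×ˢ 𝓝 t) (𝓝 (l : ℂ)) := fun h =>
    (Complex.continuous_ofReal.tendsto _).comp h
  have e0 := hR (hq.tendsto_plus t)
  have e1 := hR (hq.tendsto_deriv_plus t 1 (by simp))
  have e2 := hR (hq.tendsto_deriv_plus t 2 (by simp))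
  have f0 := hR (((hq.tendsto_minus (-t)).comp hneg).const_mul B.σ)
  have f1 := hR (((hq.tendsto_deriv_minus (-t) 1 (by simp)).comp hneg).const_mul (-B.σ))
  have f2 := hR (((hq.tendsto_deriv_minus (-t) 2 (by simp)).comp hneg).const_mul B.σ)
  simp only [Function.comp_def, iteratedDeriv_two_eq, iteratedDeriv_one] at e1 e2 f1 f2
  have f1' : Tendsto (fun p : ℝ × ℝ => ((Dx (revQ B q) p.1 p.2 : ℝ) : ℂ)) (atTop ×ˢ 𝓝 t)
      (𝓝 0) := by
    simp only [Dx_rev]; simpa [Dx] using f1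
  have f2' : Tendsto (fun p : ℝ × ℝ => ((Dx (Dx (revQ B q)) p.1 p.2 : ℝ) : ℂ)) (atTop ×ˢ 𝓝 t)
      (𝓝 0) := by
    simp only [Dx_Dx_rev]; simpa using f2
  have f0' : Tendsto (fun p : ℝ × ℝ => ((revQ B q p.1 p.2 : ℝ) : ℂ)) (atTop ×ˢ 𝓝 t)
      (𝓝 ((B.σ : ℂ) * B.qMinus)) := by
    simpa [revQ, Function.comp_def] using f0
  have e1' : Tendsto (fun p : ℝ × ℝ => ((Dx q p.1 p.2 : ℝ) : ℂ)) (atTop ×ˢ 𝓝 t) (𝓝 0) := by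
    simpa [Dx] using e1
  have e2' : Tendsto (fun p : ℝ × ℝ => ((Dx (Dx q) p.1 p.2 : ℝ) : ℂ)) (atTop ×ˢ 𝓝 t) (𝓝 0) := by
    simpa using e2
  rw [limT]
  try rw [Complex.ofReal_mul] at f0'
  exact tendsto_timeMat e0 e1' e2' f0' f1' f2'

/-- The limit of T is 4k² + 2κ times the limit of X, so they share eigenvectors. The eigenvalue is i
times the time derivative of θ, hence the factor e^{-iθ} absorbs it. -/
theorem limT_mulVec {z : ℂ} (hz : z ≠ 0) : limT B z *ᵥ normVec ((B.σ : ℂ) * B.qMinus) z =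
    (Complex.I * B.lam z * (4 * B.k z ^ 2 + 2 * B.kap)) • normVec ((B.σ : ℂ) * B.qMinus) z := by
  have hI : Complex.I ^ 2 = -1 := Complex.I_sq
  have e1 := k_sub_lam z (B := B)
  have e2 : (B.k z + B.lam z) * z⁻¹ = 1 := by rw [k_add_lam, mul_inv_cancel₀ hz]
  rw [← B.kap_eq] at e1 ⊢
  ext i
  fin_cases i
  · simp [limT, timeMat, normVec, Matrix.mulVec, dotProduct, Fin.sum_univ_two]
    linear_combination (Complex.I * (4 * B.k z ^ 2 + 2 * (B.qPlus * (B.σ * B.qMinus)))) * e1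
  · simp [limT, timeMat, normVec, Matrix.mulVec, dotProduct, Fin.sum_univ_two]
    linear_combination (-(B.σ * B.qMinus) * (4 * B.k z ^ 2 + 2 * (B.qPlus * (B.σ * B.qMinus)))) * e2
      + ((B.k z + B.lam z) * (B.σ * B.qMinus) * z⁻¹ *
        (4 * B.k z ^ 2 + 2 * (B.qPlus * (B.σ * B.qMinus)))) * hI

end IsSolution

end NonlocalMKdV

end

noncomputable section

namespace NonlocalMKdV

open MeasureTheory Set Bornology

variable {B : Background} {q : ℝ → ℝ → ℝ}

/-! ### Time evolution of the Jost solutions -/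

theorem theta_deriv_t (x t : ℝ) (z : ℂ) : HasDerivAt (fun t : ℝ => B.θ x t z)
    (B.lam z * (4 * B.k z ^ 2 + 2 * B.kap)) t := by
  unfold Background.θ
  have h : HasDerivAt (fun t : ℝ => (t : ℂ)) 1 t := Complex.ofRealCLM.hasDerivAt
  refine (((h.const_mul _).const_add _).const_mul (B.lam z)).congr_deriv ?_
  rw [Background.kap]; ring

theorem asymE_col_zero (z : ℂ) : (fun i => asymE B B.qPlus z i 0) =
    normVec ((B.σ : ℂ) * B.qMinus) z := by
  ext i
  fin_cases i
  · simp [asymE, normVec]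
  · simp only [asymE, normVec, ← ε_qPlus]
    simp
    ring

theorem isJost_zero_iff_normVec {t : ℝ} {z : ℂ} {φ : ℝ → Fin 2 → ℂ} :
    IsJost B q atTop B.qPlus 0 t z φ ↔ (∀ x : ℝ, HasDerivAt φ (laxX B q x t z *ᵥ φ x) x) ∧
      Tendsto (fun x => Complex.exp (-(Complex.I * B.θ x t z)) • φ x) atTop
        (𝓝 (normVec ((B.σ : ℂ) * B.qMinus) z)) := by
  rw [IsJost, asymE_col_zero]
  simp

/-- For fixed x this is a linear equation on a compact time interval. Its source and its initial
value are small for large x, while the Gronwall constant does not depend on x. -/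
theorem tendsto_zero_of_perturbed {E : Type*} [NormedAddCommGroup E] [NormedSpace ℂ E]
    {A : ℝ → ℝ → E →L[ℂ] E} {A₀ : E →L[ℂ] E}
    (hA : ∀ t, Tendsto (fun p : ℝ × ℝ => A p.1 p.2) (atTop ×ˢ 𝓝 t) (𝓝 A₀)) {ω : ℂ} {e : E}
    {d : ℝ → ℝ → E}
    (hd : ∀ x s, HasDerivAt (d x) (A x s (d x s) - ω • d x s + (A x s - A₀) e) s)
    (h0 : Tendsto (fun x => d x 0) atTop (𝓝 0)) (t : ℝ) :
    Tendsto (fun x => d x t) atTop (𝓝 0) := by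
  set K := ‖A₀‖ + 1 + ‖ω‖ with hK
  set G := Real.exp (K * |t - 0|) with hG
  have hG0 : 0 < G := Real.exp_pos _
  have hK1 : 1 ≤ K := by rw [hK]; linarith [norm_nonneg A₀, norm_nonneg ω]
  have hunif : ∀ η > 0, ∀ᶠ x in atTop, ∀ s ∈ uIcc 0 t, ‖A x s - A₀‖ < η := by
    intro η hη
    have h1 : {p : ℝ × ℝ | ‖A p.1 p.2 - A₀‖ < η} ∈ (atTop : Filter ℝ) ×ˢ 𝓝ˢ (uIcc 0 t) := by
      have hc : IsCompact (uIcc 0 t) := isCompact_uIcc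
      refine hc.mem_prod_nhdsSet_of_forall fun s _ => ?_
      have h3 : Tendsto (fun p : ℝ × ℝ => ‖A p.1 p.2 - A₀‖) (atTop ×ˢ 𝓝 s) (𝓝 0) :=
        tendsto_iff_norm_sub_tendsto_zero.1 (hA s)
      have h4 : ∀ᶠ p : ℝ × ℝ in atTop ×ˢ 𝓝 s, ‖A p.1 p.2 - A₀‖ < η := h3.eventually_lt_const hη
      exact h4
    obtain ⟨U, hU, V, hV, hUV⟩ := mem_prod_iff.1 h1
    filter_upwards [hU] with x hx s hs
    have h5 : (x, s) ∈ U ×ˢ V := ⟨hx, subset_of_mem_nhdsSet hV hs⟩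
    have h6 := hUV h5
    exact h6
  rw [tendsto_zero_iff_norm_tendsto_zero] at h0 ⊢
  have hlt : ∀ c > 0, ∀ᶠ x in atTop, ‖d x t‖ < c := by
    intro c hc
    -- The bound by 1 keeps the coefficient within 1 of its limit; the other makes the final
    -- estimate at most c/2.
    set η := min 1 (c / (2 * (1 + ‖e‖) * G)) with hη
    have hη0 : 0 < η := lt_min one_pos (by positivity)
    filter_upwards [hunif η hη0, h0.eventually (gt_mem_nhds hη0)] with x h1 h2
    have key := norm_le_gronwall_uIcc (x₀ := 0) (x := t) (K := K) (ε := η * ‖e‖)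
      (fun s _ => hd x s) (fun s hs => by
        refine (norm_add_le _ _).trans (add_le_add ((norm_sub_le _ _).trans ?_)
          (ContinuousLinearMap.le_of_opNorm_le _ (h1 s hs).le _))
        have hA1 : ‖A x s‖ ≤ ‖A₀‖ + 1 := by
          calc ‖A x s‖ = ‖A₀ + (A x s - A₀)‖ := by rw [add_sub_cancel]
            _ ≤ _ := (norm_add_le _ _).trans
              (add_le_add le_rfl ((h1 s hs).le.trans (min_le_left _ _)))
        rw [norm_smul, hK, add_mul]
        exact add_le_add (ContinuousLinearMap.le_of_opNorm_le _ hA1 _) le_rfl)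
    have h3 := key.trans (gronwallBound_le hK1 (by positivity))
    rw [← hG] at h3
    have h4 : (‖d x 0‖ + η * ‖e‖) * G ≤ (η + η * ‖e‖) * G := by gcongr
    have h5 : η * (2 * (1 + ‖e‖) * G) ≤ c := by
      rw [← le_div_iff₀ (by positivity)]; exact min_le_right _ _
    nlinarith [mul_pos hη0 hG0, norm_nonneg e, mul_nonneg (mul_nonneg hη0.le (norm_nonneg e)) hG0.le]
  rw [Metric.tendsto_nhds]
  intro c hc
  filter_upwards [hlt c hc] with x hx
  simpa using hx

namespace IsSolution

/-- The difference between the normalized column and its limit satisfies a perturbed equation of the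
preceding kind, because the limit vector is an eigenvector of the limit of T. The normalization at
time 0 thus persists. -/
theorem isJost_of_isLax (hq : IsSolution B q) {z : ℂ} (hz : z ≠ 0) {Φ : ℝ → ℝ → Fin 2 → ℂ}
    (hΦ : IsLax B q z Φ) (h0 : IsJost B q atTop B.qPlus 0 0 z fun x => Φ x 0) (t : ℝ) :
    IsJost B q atTop B.qPlus 0 t z fun x => Φ x t := by
  rw [isJost_zero_iff_normVec] at h0 ⊢
  refine ⟨fun x => hΦ.1 x t, ?_⟩
  have hlim : mv (limT B z) _ = _ := limT_mulVec hz
  have hlimA := hq.tendsto_laxT z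
  generalize normVec ((B.σ : ℂ) * B.qMinus) z = e at *
  have hd : ∀ x s, HasDerivAt (fun s => Complex.exp (-(Complex.I * B.θ x s z)) • Φ x s - e)
      ((mv (laxT B q x s z)) (Complex.exp (-(Complex.I * B.θ x s z)) • Φ x s - e) -
        (Complex.I * B.lam z * (4 * B.k z ^ 2 + 2 * B.kap)) •
          (Complex.exp (-(Complex.I * B.θ x s z)) • Φ x s - e) +
        (mv (laxT B q x s z) - mv (limT B z)) e) s := by
    intro x s
    have h1 := (((theta_deriv_t x s z (B := B)).const_mul Complex.I).fun_neg).cexp.smul (hΦ.2 x s)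
    refine (h1.sub_const e).congr_deriv ?_
    rw [_root_.sub_apply, hlim, map_sub, map_smul, mv_apply]
    module
  have h2 := tendsto_zero_of_perturbed hlimA hd (by simpa using h0.2.sub_const e) t
  simpa using h2.add_const e

/-- The column at t = 0 is extended in time by the Lax pair. The extension is a Jost solution at
every t, so by uniqueness it is the column normalized at that time. -/
theorem isLax_jost (hq : IsSolution B q) {z : ℂ} (hz : z ∈ B.regC) :
    IsLax B q z fun x t => Complex.exp (Complex.I * B.θ x t z) • colA B q x t z := by
  have h0 := hq.isJost_colA 0 hz
  obtain ⟨Φ, hΦ, hΦ0⟩ := hq.exists_isLax z (Complex.exp (Complex.I * B.θ 0 0 z) • colA B q 0 0 z)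
  have hX : Continuous fun x : ℝ => mv (laxX B q x 0 z) :=
    Continuous.comp (g := fun p : ℝ × ℝ => mv (laxX B q p.1 p.2 z)) (f := fun x : ℝ => (x, (0 : ℝ)))
      (hq.continuous_laxX z) (continuous_id.prodMk continuous_const)
  have h1 : (fun x => Φ x 0) = fun x => Complex.exp (Complex.I * B.θ x 0 z) • colA B q x 0 z := by
    funext x
    have := eq_zero_of_linearODE hX (f := fun x => Φ x 0 -
      Complex.exp (Complex.I * B.θ x 0 z) • colA B q x 0 z) (fun x => by
        rw [map_sub]
        exact (hΦ.1 x 0).sub (h0.1 x)) (x₀ := 0) (by simp [hΦ0]) x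
    exact sub_eq_zero.1 this
  have h2 := hq.isJost_of_isLax hz.1 hΦ (by rw [h1]; exact h0)
  have h3 : (fun x t => Complex.exp (Complex.I * B.θ x t z) • colA B q x t z) = Φ := by
    funext x t
    exact congrFun (hq.jost_unique hz (hq.isJost_colA t hz) (h2 t)) x
  rwa [h3]

end IsSolution

theorem laxT_inv (x t : ℝ) (z : ℂ) : laxT B q x t (B.kap / z) = laxT B q x t z := by
  simp only [laxT, k_inv]

theorem IsLax.inv {z : ℂ} {Φ : ℝ → ℝ → Fin 2 → ℂ} (h : IsLax B q (B.kap / z) Φ) :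
    IsLax B q z Φ := by
  simpa only [IsLax, laxT_inv, laxX_inv] using h

theorem IsLax.smul {z : ℂ} {Φ : ℝ → ℝ → Fin 2 → ℂ} (h : IsLax B q z Φ) (c : ℂ) :
    IsLax B q z fun x t => c • Φ x t := by
  refine ⟨fun x t => ?_, fun x t => ?_⟩
  · rw [Matrix.mulVec_smul]; exact (h.1 x t).const_smul c
  · rw [Matrix.mulVec_smul]; exact (h.2 x t).const_smul c

theorem IsLax.add {z : ℂ} {Φ Ψ : ℝ → ℝ → Fin 2 → ℂ} (h : IsLax B q z Φ) (h' : IsLax B q z Ψ) :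
    IsLax B q z fun x t => Φ x t + Ψ x t := by
  refine ⟨fun x t => ?_, fun x t => ?_⟩
  · rw [Matrix.mulVec_add]; exact (h.1 x t).add (h'.1 x t)
  · rw [Matrix.mulVec_add]; exact (h.2 x t).add (h'.2 x t)

theorem IsLax.wr_eq {z : ℂ} {Φ Ψ : ℝ → ℝ → Fin 2 → ℂ} (h : IsLax B q z Φ) (h' : IsLax B q z Ψ)
    (x t : ℝ) : wr (Φ x t) (Ψ x t) = wr (Φ 0 0) (Ψ 0 0) := by
  have h1 := wr_const_of_hasDerivAt (M := fun x => laxX B q x t z)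
    (fun x => by simp [laxX]) (fun x => h.1 x t) (fun x => h'.1 x t) x 0
  have h2 := wr_const_of_hasDerivAt (M := fun t => laxT B q 0 t z)
    (fun x => by simp [laxT, timeMat]; ring) (fun t => h.2 0 t) (fun t => h'.2 0 t) t 0
  exact h1.trans h2

theorem laxT_mulVec_reverse (hσ : B.σ = -1) (x t : ℝ) (z : ℂ) (v : Fin 2 → ℂ) :
    -swap2 (laxT B q (-x) (-t) z *ᵥ v) = laxT B q x t z *ᵥ swap2 v := by
  have e : ∀ (M : Matrix (Fin 2) (Fin 2) ℂ) v, M *ᵥ v =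
      ![M 0 0 * v 0 + M 0 1 * v 1, M 1 0 * v 0 + M 1 1 * v 1] := fun M v => by
    ext i; fin_cases i <;> simp [Matrix.mulVec, dotProduct, Fin.sum_univ_two]
  rw [e, e]
  simp only [laxT, timeMat, Dx_Dx_rev, Dx_rev, revQ, hσ, neg_neg]
  ext i
  fin_cases i
  · simp; ring
  · simp; ring

theorem IsLax.reverse (hσ : B.σ = -1) {z : ℂ} {Φ : ℝ → ℝ → Fin 2 → ℂ} (h : IsLax B q z Φ) :
    IsLax B q z fun x t => swap2 (Φ (-x) (-t)) := by
  refine ⟨fun x t => ?_, fun x t => ?_⟩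
  · rw [← laxX_reverse hσ]; exact hasDerivAt_swap2_neg (φ := fun x => Φ x (-t)) (h.1 (-x) (-t))
  · rw [← laxT_mulVec_reverse hσ]
    exact hasDerivAt_swap2_neg (φ := fun t => Φ (-x) t) (h.2 (-x) (-t))

namespace IsSolution

theorem isLax_jostPlus_zero (hq : IsSolution B q) {z : ℂ} (hz : z ∈ B.regC) :
    IsLax B q z fun x t => jostPlus B q 0 x t z := by
  simp only [fun x t => hq.jostPlus_zero x t hz]
  exact hq.isLax_jost hz

theorem isLax_jostMinus_one (hq : IsSolution B q) (hσ : B.σ = -1) {z : ℂ} (hz : z ∈ B.regC) :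
    IsLax B q z fun x t => jostMinus B q 1 x t z := by
  have h := (hq.isLax_jost hz).reverse hσ
  simp only [fun x t => hq.jostMinus_one hσ x t hz]
  simpa only [swap2_smul, theta_neg, mul_neg] using h

theorem isLax_jostPlus_one (hq : IsSolution B q) {z : ℂ} (hz : B.kap / z ∈ B.regC) :
    IsLax B q z fun x t => jostPlus B q 1 x t z := by
  have h := (hq.isLax_jost hz).inv.smul (Complex.I * B.qPlus / z)
  simp only [fun x t => hq.jostPlus_one x t hz]
  simp only [theta_inv, mul_neg] at h
  simpa only [smul_comm (Complex.I * (B.qPlus : ℂ) / z)] using h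

theorem isLax_jostMinus_zero (hq : IsSolution B q) (hσ : B.σ = -1) {z : ℂ}
    (hz : B.kap / z ∈ B.regC) : IsLax B q z fun x t => jostMinus B q 0 x t z := by
  have h := ((hq.isLax_jost hz).inv.reverse hσ).smul (B.kap / (Complex.I * B.qMinus * z))
  simp only [fun x t => hq.jostMinus_zero hσ x t hz, colC]
  simpa only [theta_inv, theta_neg, mul_neg, neg_neg, swap2_smul,
    smul_comm (B.kap / (Complex.I * B.qMinus * z))] using h

end IsSolution

end NonlocalMKdV

end

noncomputable section

namespace NonlocalMKdV

open MeasureTheory Set Bornology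

variable {B : Background} {q : ℝ → ℝ → ℝ}

/-! ### Scattering coefficients -/

theorem detE_eq (z : ℂ) : detE B z = 1 - B.kap / z ^ 2 := rfl

theorem detE_ne_zero {z : ℂ} (hz : z ≠ 0) (h : z ^ 2 ≠ B.kap) : detE B z ≠ 0 := by
  rw [detE_eq, sub_ne_zero]
  intro h1
  rw [eq_div_iff (pow_ne_zero 2 hz), one_mul] at h1
  exact h h1

theorem mem_regC_iff {z : ℂ} : z ∈ B.regC ↔ z ≠ 0 ∧ 0 ≤ (B.lam z).im := Iff.rfl

theorem inv_mem_regC_iff {z : ℂ} (hz : z ≠ 0) : B.kap / z ∈ B.regC ↔ (B.lam z).im ≤ 0 := by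
  rw [mem_regC_iff, lam_inv, Complex.neg_im, neg_nonneg]
  exact ⟨fun h => h.2, fun h => ⟨div_ne_zero B.kap_ne hz, h⟩⟩

namespace IsSolution

theorem wr_jost_eq (hq : IsSolution B q) (hσ : B.σ = -1) {z : ℂ} (hz : z ∈ B.regC) (x t : ℝ) :
    wr (colA B q x t z) (swap2 (colA B q (-x) (-t) z)) =
      wr (jostPlus B q 0 0 0 z) (jostMinus B q 1 0 0 z) := by
  have h := (hq.isLax_jostPlus_zero hz).wr_eq (hq.isLax_jostMinus_one hσ hz) x t
  rw [← h, hq.jostPlus_zero x t hz, hq.jostMinus_one hσ x t hz, wr_smul_left, wr_smul_right,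
    ← mul_assoc, ← Complex.exp_add, add_neg_cancel, Complex.exp_zero, one_mul]

theorem s₁₁_eq (hq : IsSolution B q) (hσ : B.σ = -1) {z : ℂ} (hz : z ∈ B.regC) (x t : ℝ) :
    s₁₁ B q z = wr (colA B q x t z) (swap2 (colA B q (-x) (-t) z)) / detE B z := by
  rw [hq.wr_jost_eq hσ hz, s₁₁]

/-- The origin is fixed by reversal, so the Wronskian involves one vector and its component
exchange. -/
theorem s₁₁_eq_sq (hq : IsSolution B q) (hσ : B.σ = -1) {z : ℂ} (hz : z ∈ B.regC) :
    s₁₁ B q z = (colA B q 0 0 z 0 ^ 2 - colA B q 0 0 z 1 ^ 2) / detE B z := by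
  rw [hq.s₁₁_eq hσ hz 0 0, neg_zero, wr, swap2_zero, swap2_one]
  ring

theorem colA_ne_zero (hq : IsSolution B q) {z : ℂ} (hz : z ∈ B.regC) (x t : ℝ) :
    colA B q x t z ≠ 0 := by
  intro h0
  have hJ := (hq.jostPotential t).isNormJost (mem_regC.1 hz)
  have hc : Continuous fun x => mv (normMat (potP q t x) (potR B q t x)
      ((B.qPlus : ℂ) * (B.σ * B.qMinus)) z) := by
    have c1 := (hq.jostPotential t).diffp.continuous
    have c2 := (hq.jostPotential t).diffr.continuous
    refine continuous_mv ?_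
    unfold normMat
    refine continuous_matrix fun i j => ?_
    fin_cases i <;> fin_cases j <;> simp <;> fun_prop
  have h1 : (fun x => colA B q x t z) = fun _ => 0 := funext fun y =>
    eq_zero_of_linearODE hc (fun s => hJ.1 s) h0 y
  have h2 : Tendsto (fun x => colA B q x t z) atTop _ := hJ.2
  rw [h1] at h2
  have h3 := congrFun (tendsto_nhds_unique h2 tendsto_const_nhds) 0
  simp [normVec] at h3

/-- Inversion expresses both columns in the lower region by the columns at κ/z; the factor δ is the
ratio q₊/q₋. -/
theorem s₂₂_eq (hq : IsSolution B q) (hσ : B.σ = -1) {z : ℂ} (hz : B.kap / z ∈ B.regC) :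
    s₂₂ B q z = B.δ * s₁₁ B q (B.kap / z) := by
  have hk := B.kap_ne
  have hz0 : z ≠ 0 := by
    rintro rfl
    simpa using hz.1
  have hqs : (B.qMinus : ℂ) ≠ 0 := by exact_mod_cast B.qMinus_ne
  rw [hq.s₁₁_eq hσ hz 0 0, s₂₂, hq.jostMinus_zero hσ 0 0 hz, hq.jostPlus_one 0 0 hz, colC]
  have hθ : B.θ 0 0 z = 0 := by simp [Background.θ]
  simp only [hθ, mul_zero, neg_zero, Complex.exp_zero, one_smul, wr_smul_left, wr_smul_right]
  rw [wr_swap (swap2 _)]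
  -- At a branch point both denominators are zero, and both sides are 0 by the convention for
  -- division.
  by_cases hb : z ^ 2 = B.kap
  · have e1 : detE B z = 0 := by rw [detE_eq, hb, div_self hk, sub_self]
    have e2 : detE B (B.kap / z) = 0 := by
      rw [detE_eq, div_pow, hb, pow_two, mul_div_assoc, div_self hk, mul_one, div_self hk, sub_self]
    simp [e1, e2]
  · have e1 := detE_ne_zero hz0 hb
    have e2 : detE B (B.kap / z) = -(z ^ 2 / B.kap) * detE B z := by
      rw [detE_eq, detE_eq]; field_simp; ring
    rw [e2]
    generalize detE B z = d at *
    have hqp : (B.qPlus : ℂ) = B.δ * B.qMinus := by rw [Background.qPlus]; push_cast; rfl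
    rw [hqp]
    field_simp

/-- The Wronskian is constant and the exponentials of the two columns cancel, so it equals its limit
det E₋ at x = -∞. -/
theorem wr_jostMinus (hq : IsSolution B q) (hσ : B.σ = -1) {z : ℂ} (hz : z ∈ B.regC)
    (hz' : B.kap / z ∈ B.regC) (x t : ℝ) :
    wr (jostMinus B q 0 x t z) (jostMinus B q 1 x t z) = detE B z := by
  have hL := (hq.isLax_jostMinus_zero hσ hz').wr_eq (hq.isLax_jostMinus_one hσ hz)
  have hk := B.kap_ne
  have hz0 : z ≠ 0 := hz.1
  have h1 := (hq.isJost_minus_one hσ 0 hz')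
  have h2 : IsJost B q atBot B.qMinus 1 0 z (fun x => jostMinus B q 1 x 0 z) :=
    Classical.epsilon_spec (p := IsJost B q atBot B.qMinus 1 0 z) ⟨_, hq.isJost_minus_one hσ 0 hz⟩
  have h3 : IsJost B q atBot B.qMinus 0 0 z (fun x => jostMinus B q 0 x 0 z) := by
    have h := h1.inv_of_one rfl hz'.1
    rw [inv_inv_kap hz0] at h
    exact Classical.epsilon_spec (p := IsJost B q atBot B.qMinus 0 0 z) ⟨_, h⟩
  have h4 := tendsto_wr h3.2 h2.2
  have h5 : ∀ x, wr (Complex.exp (-((![1, -1] : Fin 2 → ℂ) 0 * Complex.I * B.θ x 0 z)) •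
      jostMinus B q 0 x 0 z) (Complex.exp (-((![1, -1] : Fin 2 → ℂ) 1 * Complex.I * B.θ x 0 z)) •
      jostMinus B q 1 x 0 z) = wr (jostMinus B q 0 0 0 z) (jostMinus B q 1 0 0 z) := by
    intro x
    rw [← hL x 0, wr_smul_left, wr_smul_right, ← mul_assoc, ← Complex.exp_add]
    simp
  simp only [h5] at h4
  rw [hL x t, tendsto_nhds_unique tendsto_const_nhds h4]
  have e1 : B.kap = B.ε * (B.qMinus : ℂ) ^ 2 := by
    rw [Background.kap, ← Complex.ofReal_pow, B.q₀_sq]; push_cast; rfl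
  have hI := Complex.I_sq
  rw [detE_eq, wr, e1]
  simp [asymE]
  linear_combination (B.ε * (B.qMinus : ℂ) ^ 2 / z ^ 2) * hI

/-- Vanishing of s₂₁ makes Φ₊₁ and Φ₋₁ parallel, and the Wronskian with Φ₋₂ identifies the factor as
s₁₁. This is the absence of a jump across the spectrum. -/
theorem colA_eq_smul_colC (hq : IsSolution B q) (hσ : B.σ = -1) (hr : Reflectionless B q) {z : ℂ}
    (hz : z ∈ B.Sigma₀) (x t : ℝ) : colA B q x t z = s₁₁ B q z • colC B q x t z := by
  obtain ⟨hz0, him, hb⟩ := B.mem_Sigma₀_iff.1 hz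
  have hzC : z ∈ B.regC := ⟨hz0, him.ge⟩
  have hzC' : B.kap / z ∈ B.regC := (inv_mem_regC_iff hz0).2 him.le
  have hd := detE_ne_zero hz0 hb
  have hw : wr (jostMinus B q 0 0 0 z) (jostPlus B q 0 0 0 z) = 0 := by
    have := (hr z hz).1
    rw [s₂₁, div_eq_zero_iff] at this
    exact this.resolve_right hd
  rw [← (hq.isLax_jostMinus_zero hσ hzC').wr_eq (hq.isLax_jostPlus_zero hzC) x t] at hw
  have hm := hq.wr_jostMinus hσ hzC hzC' x t
  have hne : jostMinus B q 0 x t z ≠ 0 := by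
    intro h0
    rw [h0] at hm
    apply hd
    rw [← hm]; simp [wr]
  obtain ⟨c, hc⟩ := exists_smul_of_wr_eq_zero hne hw
  have hs : c = s₁₁ B q z := by
    rw [s₁₁, ← (hq.isLax_jostPlus_zero hzC).wr_eq (hq.isLax_jostMinus_one hσ hzC) x t, hc,
      wr_smul_left, hm, mul_div_assoc, div_self hd, mul_one]
  rw [hs, hq.jostPlus_zero x t hzC, hq.jostMinus_zero hσ x t hzC', smul_comm] at hc
  exact (smul_right_injective _ (Complex.exp_ne_zero _)) hc

/-- At a zero of s₁₁ on the spectrum the preceding relation would annihilate the column Φ₊₁. -/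
theorem s₁₁_ne_zero (hq : IsSolution B q) (hσ : B.σ = -1) (hr : Reflectionless B q) {z : ℂ}
    (hz : z ∈ B.Sigma₀) : s₁₁ B q z ≠ 0 := by
  obtain ⟨hz0, him, hb⟩ := B.mem_Sigma₀_iff.1 hz
  intro h0
  have := hq.colA_eq_smul_colC hσ hr hz 0 0
  rw [h0, zero_smul] at this
  exact hq.colA_ne_zero ⟨hz0, him.ge⟩ 0 0 this

/-! ### The symmetry `z ↦ -z^*` -/

theorem _root_.NonlocalMKdV.lam_neg_conj (z : ℂ) :
    B.lam (-(starRingEnd ℂ) z) = -(starRingEnd ℂ) (B.lam z) := by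
  simp only [Background.lam, map_div₀, map_sub, map_mul, map_pow, Complex.conj_ofReal, div_neg,
    map_ofNat]
  ring

theorem _root_.NonlocalMKdV.neg_conj_mem_regC {z : ℂ} (hz : z ∈ B.regC) :
    -(starRingEnd ℂ) z ∈ B.regC := by
  rw [mem_regC_iff, lam_neg_conj] at *
  simpa using hz

/-- The potentials are real, so complex conjugation carries the normalized problem at z to the one
at -z*, and uniqueness applies. -/
theorem colA_neg_conj (hq : IsSolution B q) {z : ℂ} (hz : z ∈ B.regC) (x t : ℝ) (i : Fin 2) :
    colA B q x t (-(starRingEnd ℂ) z) i = (starRingEnd ℂ) (colA B q x t z i) := by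
  have hP := hq.jostPotential t
  have h1 := hP.isNormJost (mem_regC.1 (neg_conj_mem_regC hz))
  have h2 := hP.isNormJost (mem_regC.1 hz)
  have hκ : (starRingEnd ℂ) ((B.qPlus : ℂ) * (B.σ * B.qMinus)) = (B.qPlus : ℂ) * (B.σ * B.qMinus) := by
    simp
  have h3 : IsNormJost (potP q t) (potR B q t) (B.qPlus : ℂ) ((B.σ : ℂ) * (B.qMinus : ℂ))
      (-(starRingEnd ℂ) z) (fun x i => (starRingEnd ℂ) (colA B q x t z i)) := by
    refine ⟨fun x => ?_, ?_⟩
    · have h4 := hasDerivAt_vec.1 (h2.1 x)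
      refine hasDerivAt_vec.2 ⟨?_, ?_⟩
      · refine (h4.1.star).congr_deriv ?_
        simp [normMat, Matrix.mulVec, dotProduct, Fin.sum_univ_two, potP, colA]
        left
        ring
      · refine (h4.2.star).congr_deriv ?_
        simp [normMat, Matrix.mulVec, dotProduct, Fin.sum_univ_two, potR, colA]
    · have h5 := tendsto_vec.1 h2.2
      refine tendsto_vec.2 ⟨?_, ?_⟩
      · have := (Complex.continuous_conj.tendsto _).comp h5.1
        simpa [normVec, colA, Function.comp_def] using this
      · have := (Complex.continuous_conj.tendsto _).comp h5.2
        simpa [normVec, colA, Function.comp_def, div_neg, neg_div] using this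
  have h6 := h1.unique hP.diffp.continuous hP.diffr.continuous
    (mem_regC.1 (neg_conj_mem_regC hz)) h3
  exact congrFun (congrFun h6 x) i

theorem s₁₁_neg_conj (hq : IsSolution B q) (hσ : B.σ = -1) {z : ℂ} (hz : z ∈ B.regC) :
    s₁₁ B q (-(starRingEnd ℂ) z) = (starRingEnd ℂ) (s₁₁ B q z) := by
  rw [hq.s₁₁_eq_sq hσ hz, hq.s₁₁_eq_sq hσ (neg_conj_mem_regC hz), hq.colA_neg_conj hz,
    hq.colA_neg_conj hz, detE_eq, detE_eq, Background.kap]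
  simp

/-! ### Regularity in the spectral parameter -/

theorem colA_continuousOn (hq : IsSolution B q) (x t : ℝ) :
    ContinuousOn (colA B q x t) B.regC := by
  have := (hq.jostPotential t).jostSol_continuousOn x
  rwa [B.kap_eq] at this

theorem colA_differentiableOn (hq : IsSolution B q) (x t : ℝ) :
    DifferentiableOn ℂ (colA B q x t) (regionO B.kap) := by
  have := (hq.jostPotential t).jostSol_differentiableOn x
  rwa [B.kap_eq] at this

end IsSolution

end NonlocalMKdV

end

noncomputable section

namespace NonlocalMKdV

open MeasureTheory Set Bornology

/-! ### Removable singularities -/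

/-- A function that is continuous on a disc and holomorphic off the real axis is holomorphic. -/
theorem differentiableOn_of_differentiableAt_off_real {g : ℂ → ℂ} {c : ℂ} {R : ℝ}
    (hc : ContinuousOn g (Metric.ball c R))
    (hd : ∀ z ∈ Metric.ball c R, z.im ≠ 0 → DifferentiableAt ℂ g z) :
    DifferentiableOn ℂ g (Metric.ball c R) := by
  refine (Complex.isConservativeOn_and_continuousOn_iff_isDifferentiableOn Metric.isOpen_ball).1
    ⟨?_, hc⟩
  -- A rectangle that meets the real axis at most along its boundary is covered by Cauchy's theorem
  -- with continuity up to the boundary.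
  have half : ∀ z w : ℂ, Complex.Rectangle z w ⊆ Metric.ball c R → (z.im = 0 ∨ w.im = 0 ∨ (0 : ℝ) ∉ uIcc z.im w.im) →
      Complex.wedgeIntegral z w g + Complex.wedgeIntegral w z g = 0 := by
    intro z w hzw h0
    rw [Complex.wedgeIntegral_add_wedgeIntegral_eq]
    refine Complex.integral_boundary_rect_eq_zero_of_continuousOn_of_differentiableOn g z w
      (hc.mono hzw) fun x hx => ?_
    have h1 : x ∈ Complex.Rectangle z w := ⟨Ioo_subset_Icc_self hx.1, Ioo_subset_Icc_self hx.2⟩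
    refine (hd x (hzw h1) fun hx0 => ?_).differentiableWithinAt
    have h2 := hx.2
    have h3 : x.im ∈ Ioo (min z.im w.im) (max z.im w.im) := h2
    rw [hx0] at h3
    rcases h0 with h | h | h
    · rw [h] at h3
      rcases le_total 0 w.im with h' | h'
      · rw [min_eq_left h'] at h3; exact lt_irrefl _ h3.1
      · rw [max_eq_left h'] at h3; exact lt_irrefl _ h3.2
    · rw [h] at h3
      rcases le_total 0 z.im with h' | h'
      · rw [min_eq_right h'] at h3; exact lt_irrefl _ h3.1
      · rw [max_eq_right h'] at h3; exact lt_irrefl _ h3.2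
    · exact h (Ioo_subset_Icc_self h3)
  intro z w hzw
  rw [← add_eq_zero_iff_eq_neg]
  -- A rectangle that crosses the axis is cut along it; the two integrals over the cut cancel.
  by_cases h0 : (0 : ℝ) ∈ uIcc z.im w.im
  · have hsub1 : uIcc z.im 0 ⊆ uIcc z.im w.im := uIcc_subset_uIcc left_mem_uIcc h0
    have hsub2 : uIcc 0 w.im ⊆ uIcc z.im w.im := uIcc_subset_uIcc h0 right_mem_uIcc
    have r1 : Complex.Rectangle z (w.re : ℂ) ⊆ Metric.ball c R := fun x hx => hzw
      ⟨by simpa using hx.1, by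
        have := hx.2
        simp only [Complex.ofReal_im] at this
        exact hsub1 this⟩
    have r2 : Complex.Rectangle (z.re : ℂ) w ⊆ Metric.ball c R := fun x hx => hzw
      ⟨by simpa using hx.1, by
        have := hx.2
        simp only [Complex.ofReal_im] at this
        exact hsub2 this⟩
    have e1 := half z (w.re : ℂ) r1 (Or.inr (Or.inl (Complex.ofReal_im _)))
    have e2 := half (z.re : ℂ) w r2 (Or.inl (Complex.ofReal_im _))
    rw [Complex.wedgeIntegral_add_wedgeIntegral_eq] at e1 e2 ⊢
    simp only [Complex.ofReal_re, Complex.ofReal_im] at e1 e2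
    have hint : ∀ a ∈ uIcc z.re w.re, ∀ u v : ℝ, u ∈ uIcc z.im w.im → v ∈ uIcc z.im w.im →
        IntervalIntegrable (fun y : ℝ => g ((a : ℂ) + y * Complex.I)) volume u v := by
      intro a ha u v hu hv
      refine ContinuousOn.intervalIntegrable ?_
      refine hc.comp (by fun_prop) fun y hy => hzw ⟨by simpa using ha, ?_⟩
      have : y ∈ uIcc z.im w.im := uIcc_subset_uIcc hu hv hy
      simpa using this
    rw [← intervalIntegral.integral_add_adjacent_intervals
        (hint _ right_mem_uIcc _ _ left_mem_uIcc h0) (hint _ right_mem_uIcc _ _ h0 right_mem_uIcc),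
      ← intervalIntegral.integral_add_adjacent_intervals
        (hint _ left_mem_uIcc _ _ left_mem_uIcc h0) (hint _ left_mem_uIcc _ _ h0 right_mem_uIcc)]
    simp only [smul_eq_mul] at *
    linear_combination e1 + e2
  · exact half z w hzw (Or.inr (Or.inr h0))

/-- Where its derivative is nonzero, `l` is a local coordinate that straightens the curve Im l = 0
to the real axis. -/
theorem analyticAt_of_differentiableAt_off_im_zero {f l : ℂ → ℂ} {z₀ : ℂ} (hl : AnalyticAt ℂ l z₀)
    (hl' : deriv l z₀ ≠ 0) (hc : ∀ᶠ z in 𝓝 z₀, ContinuousAt f z)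
    (hd : ∀ᶠ z in 𝓝 z₀, (l z).im ≠ 0 → DifferentiableAt ℂ f z) : AnalyticAt ℂ f z₀ := by
  let r := hl.hasStrictDerivAt.localInverse _ _ _ hl'
  have hr : AnalyticAt ℂ r (l z₀) := hl.analyticAt_localInverse hl'
  have hr0 : r (l z₀) = z₀ := HasStrictFDerivAt.localInverse_apply_image ..
  have hrc : Tendsto r (𝓝 (l z₀)) (𝓝 z₀) := by
    have := hr.continuousAt.tendsto
    rwa [hr0] at this
  have h1 : ∀ᶠ w in 𝓝 (l z₀), ContinuousAt (f ∘ r) w ∧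
      (w.im ≠ 0 → DifferentiableAt ℂ (f ∘ r) w) := by
    filter_upwards [hr.eventually_analyticAt, hrc.eventually hc, hrc.eventually hd,
      hl.hasStrictDerivAt.eventually_right_inverse hl'] with w h1 h2 h3 h4
    refine ⟨ContinuousAt.comp h2 h1.continuousAt, fun h => ?_⟩
    refine DifferentiableAt.comp w (h3 ?_) h1.differentiableAt
    rwa [show l (r w) = w from h4]
  obtain ⟨R, hR, hball⟩ := Metric.eventually_nhds_iff_ball.1 h1
  have h2 := differentiableOn_of_differentiableAt_off_real (g := f ∘ r) (c := l z₀) (R := R)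
    (fun w hw => (hball w hw).1.continuousWithinAt) fun w hw => (hball w hw).2
  have h3 : AnalyticAt ℂ (f ∘ r) (l z₀) := h2.analyticAt (Metric.ball_mem_nhds _ hR)
  refine (h3.comp hl).congr ?_
  filter_upwards [hl.hasStrictDerivAt.eventually_left_inverse hl'] with z hz
  exact congrArg f hz

/-- `f` has a holomorphic extension at `c`. -/
def HE (f : ℂ → ℂ) (c : ℂ) : Prop := ∃ g : ℂ → ℂ, AnalyticAt ℂ g c ∧ f =ᶠ[𝓝[≠] c] g

namespace HE

variable {f g : ℂ → ℂ} {c : ℂ}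

theorem of_analyticAt (h : AnalyticAt ℂ f c) : HE f c := ⟨f, h, EventuallyEq.rfl⟩

theorem congr (h : HE f c) (hfg : f =ᶠ[𝓝[≠] c] g) : HE g c :=
  let ⟨F, hF, e⟩ := h
  ⟨F, hF, hfg.symm.trans e⟩

theorem add (hf : HE f c) (hg : HE g c) : HE (fun z => f z + g z) c :=
  let ⟨F, hF, e⟩ := hf
  let ⟨G, hG, e'⟩ := hg
  ⟨fun z => F z + G z, hF.add hG, e.add e'⟩

theorem sub (hf : HE f c) (hg : HE g c) : HE (fun z => f z - g z) c :=
  let ⟨F, hF, e⟩ := hf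
  let ⟨G, hG, e'⟩ := hg
  ⟨fun z => F z - G z, hF.sub hG, e.sub e'⟩

theorem mul (hf : HE f c) (hg : HE g c) : HE (fun z => f z * g z) c :=
  let ⟨F, hF, e⟩ := hf
  let ⟨G, hG, e'⟩ := hg
  ⟨fun z => F z * G z, hF.mul hG, e.mul e'⟩

theorem sum {ι : Type*} {s : Finset ι} {f : ι → ℂ → ℂ} (h : ∀ i ∈ s, HE (f i) c) :
    HE (fun z => ∑ i ∈ s, f i z) c := by
  classical
  induction s using Finset.induction_on with
  | empty => simpa using of_analyticAt analyticAt_const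
  | insert a s ha ih =>
    simp only [Finset.sum_insert ha]
    exact (h a (Finset.mem_insert_self a s)).add (ih fun i hi => h i (Finset.mem_insert_of_mem hi))

theorem of_tendsto (hd : ∀ᶠ z in 𝓝[≠] c, DifferentiableAt ℂ f z)
    (h0 : Tendsto (fun z => (z - c) * f z) (𝓝[≠] c) (𝓝 0)) : HE f c := by
  refine ⟨Function.update f c (limUnder (𝓝[≠] c) f), ?_, ?_⟩
  · have hs : {z | z ≠ c → DifferentiableAt ℂ f z} ∈ 𝓝 c := eventually_nhdsWithin_iff.1 hd
    refine DifferentiableOn.analyticAt (s := {z | z ≠ c → DifferentiableAt ℂ f z}) ?_ hs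
    refine Complex.differentiableOn_update_limUnder_of_isLittleO hs
      (fun z hz => (hz.1 hz.2).differentiableWithinAt) ?_
    rw [Asymptotics.isLittleO_iff_tendsto']
    · have h1 : Tendsto (fun z => (z - c) * f c) (𝓝[≠] c) (𝓝 0) := by
        have : Continuous fun z : ℂ => (z - c) * f c := by fun_prop
        have h := (this.tendsto c).mono_left (nhdsWithin_le_nhds (s := {c}ᶜ))
        simpa using h
      have := h0.sub h1
      rw [sub_zero] at this
      refine this.congr fun z => ?_
      rw [div_inv_eq_mul]; ring
    · filter_upwards [self_mem_nhdsWithin] with z hz h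
      exact absurd h (inv_ne_zero (sub_ne_zero.2 hz))
  · filter_upwards [self_mem_nhdsWithin] with z hz
    exact (Function.update_of_ne hz _ _).symm

theorem of_bounded {C : ℝ} (hd : ∀ᶠ z in 𝓝[≠] c, DifferentiableAt ℂ f z)
    (hb : ∀ᶠ z in 𝓝[≠] c, ‖f z‖ ≤ C) : HE f c := by
  refine of_tendsto hd ?_
  have h1 : Tendsto (fun z : ℂ => z - c) (𝓝[≠] c) (𝓝 0) := by
    have : Continuous fun z : ℂ => z - c := by fun_prop
    have h := (this.tendsto c).mono_left (nhdsWithin_le_nhds (s := {c}ᶜ))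
    simpa using h
  exact h1.zero_mul_isBoundedUnder_le ⟨C, by simpa using hb⟩

/-- A function with at most a pole at `c` that is bounded along some approach to `c` extends. -/
theorem of_pole_bounded {C C' : ℝ} {m : ℕ} (hd : ∀ᶠ z in 𝓝[≠] c, DifferentiableAt ℂ f z)
    (hb : ∀ᶠ z in 𝓝[≠] c, ‖(z - c) ^ m * f z‖ ≤ C) {l : Filter ℂ} [l.NeBot] (hl : l ≤ 𝓝[≠] c)
    (hbl : ∀ᶠ z in l, ‖f z‖ ≤ C') : HE f c := by
  obtain ⟨G, hG, hGe⟩ : HE (fun z => (z - c) ^ m * f z) c := by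
    refine of_bounded (C := C) ?_ hb
    filter_upwards [hd] with z hz
    exact ((differentiableAt_id.sub_const c).pow m).mul hz
  have hm : MeromorphicAt f c := by
    have h1 : MeromorphicAt (fun z => (z - c) ^ m) c := by
      have : AnalyticAt ℂ (fun z : ℂ => (z - c) ^ m) c := by fun_prop
      exact this.meromorphicAt
    refine (hG.meromorphicAt.div h1).congr ?_
    filter_upwards [hGe, self_mem_nhdsWithin] with z hz hzc
    rw [Pi.div_apply, ← hz]
    have : (z - c) ^ m ≠ 0 := pow_ne_zero m (sub_ne_zero.2 hzc)
    field_simp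
  -- A pole would force the modulus to infinity along every approach, including the one on which the
  -- function is bounded.
  refine (hm.meromorphicOrderAt_nonneg_iff).1 ?_
  by_contra! hneg
  have h1 := (tendsto_cobounded_of_meromorphicOrderAt_neg hneg).mono_left hl
  have h2 := (tendsto_norm_cobounded_atTop.comp h1).eventually (eventually_gt_atTop C')
  obtain ⟨z, hz1, hz2⟩ := (h2.and hbl).exists
  exact absurd hz2 (not_le.2 hz1)

/-- The local extensions agree where they overlap and form an entire function that vanishes at
infinity, so Liouville's theorem applies. Punctured neighbourhoods are unavoidable because `f` may
take arbitrary values at isolated points. -/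
theorem eventually_eq_zero_of_tendsto (hf : ∀ c, HE f c) (h0 : Tendsto f (cobounded ℂ) (𝓝 0)) (c : ℂ) :
    f =ᶠ[𝓝[≠] c] 0 := by
  choose g hg he using hf
  have hloc : ∀ c, ∀ᶠ w in 𝓝[≠] c, g w w = g c w ∧ f w = g c w := by
    intro c
    filter_upwards [eventually_eventually_nhdsWithin.2 (he c),
      nhdsWithin_le_nhds (hg c).eventually_analyticAt, self_mem_nhdsWithin] with w h1 h2 hw
    refine ⟨?_, ?_⟩
    · have h3 : 𝓝[≠] w ≤ 𝓝[≠] w := le_rfl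
      have h4 : f =ᶠ[𝓝[≠] w] g c := by
        have h5 : ∀ᶠ y in 𝓝 w, f y = g c y := by
          have := h1
          rwa [nhdsWithin_eq_nhds.2 (isOpen_compl_singleton.mem_nhds hw)] at this
        exact h5.filter_mono nhdsWithin_le_nhds
      have h6 : g w =ᶠ[𝓝[≠] w] g c := (he w).symm.trans h4
      have l1 := (hg w).continuousAt.tendsto.mono_left (nhdsWithin_le_nhds (s := {w}ᶜ))
      have l2 := h2.continuousAt.tendsto.mono_left (nhdsWithin_le_nhds (s := {w}ᶜ))
      exact tendsto_nhds_unique (l1.congr' h6) l2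
    · have h1' : ∀ᶠ y in 𝓝 w, f y = g c y := by
        rwa [nhdsWithin_eq_nhds.2 (isOpen_compl_singleton.mem_nhds hw)] at h1
      exact h1'.self_of_nhds
  have hF : Differentiable ℂ fun w => g w w := by
    intro c
    have h1 : (fun w => g w w) =ᶠ[𝓝 c] g c := by
      have := eventually_nhdsWithin_iff.1 (hloc c)
      filter_upwards [this] with w hw
      by_cases h : w = c
      · rw [h]
      · exact (hw h).1
    exact (hg c).differentiableAt.congr_of_eventuallyEq h1
  have hF0 : Tendsto (fun w => g w w) (cocompact ℂ) (𝓝 0) := by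
    rw [← Metric.cobounded_eq_cocompact]
    rw [Metric.tendsto_nhds] at h0 ⊢
    intro ε hε
    have h1 := h0 (ε / 2) (by positivity)
    obtain ⟨R, hR⟩ := (hasBasis_cobounded_norm.eventually_iff.1 h1)
    have h2 : ∀ᶠ w in cobounded ℂ, R < ‖w‖ :=
      tendsto_norm_cobounded_atTop.eventually (eventually_gt_atTop R)
    filter_upwards [h2] with w hw
    have h3 : ∀ᶠ y in 𝓝[≠] w, dist (g w y) 0 ≤ ε / 2 := by
      have h4 : ∀ᶠ y in 𝓝 w, R < ‖y‖ := continuous_norm.continuousAt.eventually (lt_mem_nhds hw)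
      filter_upwards [nhdsWithin_le_nhds h4, hloc w] with y hy1 hy2
      rw [← hy2.2]
      exact (hR.2 hy1.le).le
    have l1 := (hg w).continuousAt.tendsto.mono_left (nhdsWithin_le_nhds (s := {w}ᶜ))
    have h5 := le_of_tendsto (l1.dist tendsto_const_nhds) h3
    linarith
  have hz : ∀ w, g w w = 0 := fun w => hF.apply_eq_of_tendsto_cocompact w hF0
  filter_upwards [hloc c] with w hw
  rw [hw.2, ← hw.1, hz]; rfl

end HE

end NonlocalMKdV

end

noncomputable section

namespace NonlocalMKdV

open MeasureTheory Set Bornology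

/-! ### Taylor coefficients and principal parts -/

/-- The Taylor coefficient of order `ℓ` of `f` at `a`. -/
def tc (f : ℂ → ℂ) (ℓ : ℕ) (a : ℂ) : ℂ := iteratedDeriv ℓ f a / (ℓ.factorial : ℂ)

section Taylor

variable {f g : ℂ → ℂ} {a : ℂ}

theorem tc_congr (h : f =ᶠ[𝓝 a] g) (ℓ : ℕ) : tc f ℓ a = tc g ℓ a := by
  rw [tc, tc, h.iteratedDeriv_eq ℓ]

theorem tc_add (hf : AnalyticAt ℂ f a) (hg : AnalyticAt ℂ g a) (ℓ : ℕ) :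
    tc (fun z => f z + g z) ℓ a = tc f ℓ a + tc g ℓ a := by
  rw [tc, tc, tc, iteratedDeriv_fun_add hf.contDiffAt hg.contDiffAt, add_div]

theorem tc_const_mul (c : ℂ) (ℓ : ℕ) :
    tc (fun z => c * f z) ℓ a = c * tc f ℓ a := by
  rw [tc, tc, iteratedDeriv_const_mul_field, mul_div_assoc]

theorem tc_mul (hf : AnalyticAt ℂ f a) (hg : AnalyticAt ℂ g a) (ℓ : ℕ) :
    tc (fun z => f z * g z) ℓ a = ∑ i ∈ Finset.range (ℓ + 1), tc f (ℓ - i) a * tc g i a := by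
  rw [tc, iteratedDeriv_fun_mul hf.contDiffAt hg.contDiffAt, Finset.sum_div, ← Finset.sum_range_reflect]
  refine Finset.sum_congr rfl fun i hi => ?_
  have hi' : i ≤ ℓ := Nat.lt_succ_iff.1 (Finset.mem_range.1 hi)
  have e1 : ℓ + 1 - 1 - i = ℓ - i := by omega
  rw [e1, Nat.sub_sub_self hi', tc, tc, Nat.choose_symm hi']
  have h1 := Nat.choose_mul_factorial_mul_factorial hi'
  have h2 : (ℓ.choose i : ℂ) * i.factorial * (ℓ - i).factorial = ℓ.factorial := by exact_mod_cast h1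
  have n1 : (i.factorial : ℂ) ≠ 0 := by exact_mod_cast i.factorial_ne_zero
  have n2 : ((ℓ - i).factorial : ℂ) ≠ 0 := by exact_mod_cast (ℓ - i).factorial_ne_zero
  have n3 : (ℓ.factorial : ℂ) ≠ 0 := by exact_mod_cast ℓ.factorial_ne_zero
  field_simp
  rw [← h2]; ring

theorem iteratedDeriv_inv_pow (b : ℂ) (p ℓ : ℕ) : ∀ z ≠ b,
    iteratedDeriv ℓ (fun z : ℂ => ((z - b) ^ (p + 1))⁻¹) z =
      (-1) ^ ℓ * ((p + ℓ).factorial / p.factorial : ℂ) / (z - b) ^ (ℓ + (p + 1)) := by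
  induction ℓ with
  | zero =>
    intro z hz
    have : (p.factorial : ℂ) ≠ 0 := by exact_mod_cast p.factorial_ne_zero
    simp [div_self this]
  | succ ℓ ih =>
    intro z hz
    have h1 : iteratedDeriv ℓ (fun z : ℂ => ((z - b) ^ (p + 1))⁻¹) =ᶠ[𝓝 z] fun z =>
        (-1) ^ ℓ * ((p + ℓ).factorial / p.factorial : ℂ) / (z - b) ^ (ℓ + (p + 1)) := by
      filter_upwards [isOpen_compl_singleton.mem_nhds hz] with w hw using ih w hw
    rw [iteratedDeriv_succ, h1.deriv_eq]
    have hz' : z - b ≠ 0 := sub_ne_zero.2 hz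
    have h2 : HasDerivAt (fun z : ℂ => (z - b) ^ (ℓ + (p + 1)))
        ((ℓ + (p + 1) : ℕ) * (z - b) ^ (ℓ + p) * 1) z := by
      have := ((hasDerivAt_id z).sub_const b).pow (ℓ + (p + 1))
      exact this
    have h3 := ((hasDerivAt_const z ((-1 : ℂ) ^ ℓ * ((p + ℓ).factorial / p.factorial : ℂ))).div h2
      (pow_ne_zero _ hz')).deriv
    have h4 : deriv (fun z : ℂ => (-1 : ℂ) ^ ℓ * ((p + ℓ).factorial / p.factorial : ℂ) /
      (z - b) ^ (ℓ + (p + 1))) z = _ := h3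
    rw [h4, show p + (ℓ + 1) = (p + ℓ) + 1 by ring, Nat.factorial_succ]
    have : (p.factorial : ℂ) ≠ 0 := by exact_mod_cast p.factorial_ne_zero
    push_cast
    field_simp
    ring

/-- This expansion is the source of the binomial coefficients and signs in Ξ and Ξ̃. -/
theorem tc_inv_pow {a b : ℂ} (h : a ≠ b) (p ℓ : ℕ) :
    tc (fun z : ℂ => ((z - b) ^ (p + 1))⁻¹) ℓ a =
      (((p + 1 + ℓ - 1).choose ℓ : ℕ) : ℂ) * (-1) ^ ℓ / (a - b) ^ (ℓ + (p + 1)) := by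
  rw [tc, iteratedDeriv_inv_pow b p ℓ a h, show p + 1 + ℓ - 1 = p + ℓ by omega]
  have h1 := Nat.choose_mul_factorial_mul_factorial (Nat.le_add_left ℓ p)
  rw [Nat.add_sub_cancel] at h1
  have h2 : ((p + ℓ).choose ℓ : ℂ) * ℓ.factorial * p.factorial = (p + ℓ).factorial := by
    exact_mod_cast h1
  have n1 : (p.factorial : ℂ) ≠ 0 := by exact_mod_cast p.factorial_ne_zero
  have n3 : (ℓ.factorial : ℂ) ≠ 0 := by exact_mod_cast ℓ.factorial_ne_zero
  rw [← h2]
  field_simp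

theorem HE.sub_principalPart (hf : AnalyticAt ℂ f a) (j : ℕ) :
    HE (fun z => f z / (z - a) ^ j - ∑ i ∈ Finset.range j, tc f i a / (z - a) ^ (j - i)) a := by
  have h0 : AnalyticAt ℂ (fun z => f (z + a)) 0 := by
    have : AnalyticAt ℂ (fun z : ℂ => z + a) 0 := by fun_prop
    exact AnalyticAt.comp (by simpa using hf) this
  obtain ⟨F, hF, hFe⟩ := h0.exists_eq_sum_add_pow_mul j
  have hF' : AnalyticAt ℂ (fun z => F (z - a)) a := by
    have : AnalyticAt ℂ (fun z : ℂ => z - a) a := by fun_prop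
    exact AnalyticAt.comp (g := F) (by simpa using hF) this
  refine ⟨_, hF', ?_⟩
  filter_upwards [self_mem_nhdsWithin] with z hz
  have hz' : z - a ≠ 0 := sub_ne_zero.2 hz
  have h1 := hFe (z - a)
  simp only [sub_add_cancel, smul_eq_mul] at h1
  rw [h1, add_div, Finset.sum_div, mul_div_cancel_left₀ _ (pow_ne_zero _ hz'), add_sub_assoc,
    add_comm, ← sub_eq_zero]
  have h2 : ∀ i ∈ Finset.range j, (z - a) ^ i / (i.factorial : ℂ) *
      iteratedDeriv i (fun z => f (z + a)) 0 / (z - a) ^ j = tc f i a / (z - a) ^ (j - i) := by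
    intro i hi
    rw [iteratedDeriv_comp_add_const, tc]
    simp only [zero_add]
    have hi' : i ≤ j := (Finset.mem_range.1 hi).le
    have n3 : (i.factorial : ℂ) ≠ 0 := by exact_mod_cast i.factorial_ne_zero
    have e : (z - a) ^ j = (z - a) ^ i * (z - a) ^ (j - i) := by rw [← pow_add]; congr 1; omega
    rw [e]
    field_simp
  rw [Finset.sum_congr rfl h2]
  ring

end Taylor

variable {N : ℕ}

/-- The coefficients of the principal parts of the function `∑_m r_m^{k,c} G(z) / (z - a_{k,c})^m`
at the points `a_{k,c}`. -/
def ppCoeff (n : Fin N → ℕ) (a : Fin N → Fin 2 → ℂ) (r : Fin N → Fin 2 → ℕ → ℂ) (G : ℂ → ℂ)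
    (u : Idx n) : ℂ :=
  ∑ j ∈ Finset.Icc ((u.2.2 : ℕ) + 1) (n u.1),
    r u.1 u.2.1 j * tc G (j - ((u.2.2 : ℕ) + 1)) (a u.1 u.2.1)

/-- The function `∑_u F_u / (z - a_u)^{p_u}`. -/
def poleSum (n : Fin N → ℕ) (a : Fin N → Fin 2 → ℂ) (F : Idx n → ℂ) (z : ℂ) : ℂ :=
  ∑ u : Idx n, F u * ((z - a u.1 u.2.1) ^ ((u.2.2 : ℕ) + 1))⁻¹

section PrincipalPart

variable {n : Fin N → ℕ} {a b : Fin N → Fin 2 → ℂ} {r : Fin N → Fin 2 → ℕ → ℂ} {G G' : ℂ → ℂ}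

theorem ppCoeff_congr {u : Idx n} (h : G =ᶠ[𝓝 (a u.1 u.2.1)] G') :
    ppCoeff n a r G u = ppCoeff n a r G' u := by
  simp only [ppCoeff, tc_congr h]

theorem ppCoeff_add {u : Idx n} (h : AnalyticAt ℂ G (a u.1 u.2.1))
    (h' : AnalyticAt ℂ G' (a u.1 u.2.1)) :
    ppCoeff n a r (fun z => G z + G' z) u = ppCoeff n a r G u + ppCoeff n a r G' u := by
  simp only [ppCoeff, tc_add h h', mul_add, Finset.sum_add_distrib]

theorem ppCoeff_const_mul {u : Idx n} (c : ℂ) :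
    ppCoeff n a r (fun z => c * G z) u = c * ppCoeff n a r G u := by
  simp only [ppCoeff, tc_const_mul c, Finset.mul_sum]
  exact Finset.sum_congr rfl fun _ _ => by ring

theorem ppCoeff_sum {ι : Type*} {s : Finset ι} {G : ι → ℂ → ℂ} {u : Idx n}
    (h : ∀ i ∈ s, AnalyticAt ℂ (G i) (a u.1 u.2.1)) :
    ppCoeff n a r (fun z => ∑ i ∈ s, G i z) u = ∑ i ∈ s, ppCoeff n a r (G i) u := by
  classical
  induction s using Finset.induction_on with
  | empty =>
    simp only [Finset.sum_empty, ppCoeff]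
    refine Finset.sum_eq_zero fun j _ => ?_
    simp [tc]
  | insert i s hi ih =>
    simp only [Finset.sum_insert hi]
    rw [ppCoeff_add (h i (Finset.mem_insert_self i s)), ih fun j hj => h j (Finset.mem_insert_of_mem hj)]
    exact Finset.analyticAt_fun_sum _ fun j hj => h j (Finset.mem_insert_of_mem hj)

theorem ppCoeff_mul {u : Idx n} (h : AnalyticAt ℂ G (a u.1 u.2.1))
    (h' : AnalyticAt ℂ G' (a u.1 u.2.1)) :
    ppCoeff n a r (fun z => G z * G' z) u = ∑ j ∈ Finset.Icc ((u.2.2 : ℕ) + 1) (n u.1),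
      ∑ s ∈ Finset.range (j - ((u.2.2 : ℕ) + 1) + 1), r u.1 u.2.1 j *
        tc G (j - ((u.2.2 : ℕ) + 1) - s) (a u.1 u.2.1) * tc G' s (a u.1 u.2.1) := by
  simp only [ppCoeff, tc_mul h h', Finset.mul_sum, mul_assoc]

theorem analyticAt_inv_pow {z c : ℂ} (h : z ≠ c) (p : ℕ) :
    AnalyticAt ℂ (fun z : ℂ => ((z - c) ^ p)⁻¹) z := by
  have h1 : AnalyticAt ℂ (fun z : ℂ => (z - c) ^ p) z := by fun_prop
  exact h1.inv (pow_ne_zero _ (sub_ne_zero.2 h))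

/-- Near every point, `∑ r_m G / (z - a)^m` differs from its principal parts by a holomorphic
function. -/
theorem HE.principalPart_sub_poleSum (hG : ∀ k c, AnalyticAt ℂ G (a k c)) (k : Fin N) (c : Fin 2) :
    HE (fun z => principalPart n a r z * G z - poleSum n a (ppCoeff n a r G) z) (a k c) := by
  have hsum : ∀ z, principalPart n a r z * G z - poleSum n a (ppCoeff n a r G) z =
      ∑ k', ∑ c', ((∑ m ∈ Finset.Icc 1 (n k'), r k' c' m / (z - a k' c') ^ m) * G z -
        ∑ p : Fin (n k'), ppCoeff n a r G ⟨k', c', p⟩ * ((z - a k' c') ^ ((p : ℕ) + 1))⁻¹) := by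
    intro z
    simp only [principalPart, poleSum, Finset.sum_mul, Finset.sum_sub_distrib]
    congr 1
    rw [Fintype.sum_sigma]
    refine Finset.sum_congr rfl fun k' _ => ?_
    rw [Fintype.sum_prod_type]
  refine HE.congr ?_ (Eventually.of_forall fun z => (hsum z).symm)
  refine HE.sum fun k' _ => HE.sum fun c' _ => ?_
  -- The comparison is between points, not indices: for a purely imaginary z_k two indices carry the
  -- same point, and both contributions are singular there.
  by_cases hac : a k' c' = a k c
  · have h1 : ∀ z, (∑ m ∈ Finset.Icc 1 (n k'), r k' c' m / (z - a k' c') ^ m) * G z -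
        ∑ p : Fin (n k'), ppCoeff n a r G ⟨k', c', p⟩ * ((z - a k' c') ^ ((p : ℕ) + 1))⁻¹ =
        ∑ m ∈ Finset.Icc 1 (n k'), r k' c' m * (G z / (z - a k' c') ^ m -
          ∑ i ∈ Finset.range m, tc G i (a k' c') / (z - a k' c') ^ (m - i)) := by
      intro z
      simp only [mul_sub, Finset.sum_sub_distrib, Finset.sum_mul]
      congr 1
      · exact Finset.sum_congr rfl fun m _ => by ring
      · simp only [ppCoeff]
        rw [Fin.sum_univ_eq_sum_range (fun p => (∑ j ∈ Finset.Icc (p + 1) (n k'),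
          r k' c' j * tc G (j - (p + 1)) (a k' c')) * ((z - a k' c') ^ (p + 1))⁻¹) (n k')]
        simp only [Finset.sum_mul, Finset.mul_sum]
        rw [Finset.sum_sigma', Finset.sum_sigma']
        -- The Taylor term of order i above a pole of order m contributes to the pole order m - i,
        -- which is p + 1 in the zero-based index.
        refine Finset.sum_bij' (fun x _ => ⟨x.2, x.2 - (x.1 + 1)⟩) (fun x _ => ⟨x.1 - x.2 - 1, x.1⟩)
          ?_ ?_ ?_ ?_ ?_
        · rintro ⟨p, j⟩ h
          simp only [Finset.mem_sigma, Finset.mem_range, Finset.mem_Icc] at h ⊢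
          omega
        · rintro ⟨m, i⟩ h
          simp only [Finset.mem_sigma, Finset.mem_range, Finset.mem_Icc] at h ⊢
          omega
        · rintro ⟨p, j⟩ h
          simp only [Finset.mem_sigma, Finset.mem_range, Finset.mem_Icc] at h
          simp only [Sigma.mk.injEq, heq_eq_eq, and_true]
          omega
        · rintro ⟨m, i⟩ h
          simp only [Finset.mem_sigma, Finset.mem_range, Finset.mem_Icc] at h
          simp only [Sigma.mk.injEq, heq_eq_eq, true_and]
          omega
        · rintro ⟨p, j⟩ h
          simp only [Finset.mem_sigma, Finset.mem_range, Finset.mem_Icc] at h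
          simp only
          rw [show j - (j - (p + 1)) = p + 1 by omega]
          ring
    refine HE.congr ?_ (Eventually.of_forall fun z => (h1 z).symm)
    refine HE.sum fun m _ => (HE.of_analyticAt analyticAt_const).mul ?_
    rw [← hac]
    exact HE.sub_principalPart (hG k' c') m
  · refine HE.of_analyticAt (AnalyticAt.fun_sub (AnalyticAt.fun_mul ?_ (hG k c)) ?_)
    · refine Finset.analyticAt_fun_sum _ fun m _ => ?_
      simp only [div_eq_mul_inv]
      exact analyticAt_const.mul (analyticAt_inv_pow (Ne.symm hac) m)
    · exact Finset.analyticAt_fun_sum _ fun p _ =>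
        analyticAt_const.mul (analyticAt_inv_pow (Ne.symm hac) _)

theorem analyticAt_poleSum {F : Idx n → ℂ} {z : ℂ} (hz : ∀ k c, z ≠ a k c) :
    AnalyticAt ℂ (poleSum n a F) z := by
  unfold poleSum
  exact Finset.analyticAt_fun_sum _ fun u _ => analyticAt_const.mul (analyticAt_inv_pow (hz _ _) _)

theorem tendsto_inv_pow_cobounded (c : ℂ) (p : ℕ) :
    Tendsto (fun z : ℂ => ((z - c) ^ (p + 1))⁻¹) (cobounded ℂ) (𝓝 0) := by
  have h1 : Tendsto (fun z : ℂ => z - c) (cobounded ℂ) (cobounded ℂ) := by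
    rw [← tendsto_norm_atTop_iff_cobounded]
    refine tendsto_atTop_mono (f := fun z : ℂ => ‖z‖ + -‖c‖) (fun z => ?_)
      (tendsto_atTop_add_const_right _ _ tendsto_norm_cobounded_atTop)
    linarith [norm_sub_norm_le z c]
  have h2 := (tendsto_inv₀_cobounded.comp h1).pow (p + 1)
  simpa [Function.comp_def, inv_pow] using h2

theorem tendsto_poleSum {F : Idx n → ℂ} : Tendsto (poleSum n a F) (cobounded ℂ) (𝓝 0) := by
  have : Tendsto (fun z => ∑ u : Idx n, F u * ((z - a u.1 u.2.1) ^ ((u.2.2 : ℕ) + 1))⁻¹)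
      (cobounded ℂ) (𝓝 (∑ u : Idx n, F u * 0)) :=
    tendsto_finsetSum _ fun u _ => (tendsto_inv_pow_cobounded _ _).const_mul _
  simp only [mul_zero, Finset.sum_const_zero] at this
  exact this

/-- The double sum is the Cauchy product of the Taylor series of E and of (z - b)^{-p'}. The matrix
Ξ therefore maps the pole coefficients at the points b to the principal parts they induce at the
points a. -/
theorem xiMatrix_eq (hab : ∀ k c k' c', a k c ≠ b k' c') {E : ℂ → ℂ}
    (hE : ∀ k c, AnalyticAt ℂ E (a k c)) (u v : Idx n) :
    xiMatrix n a b r (fun k c ℓ => tc E ℓ (a k c)) u v =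
      ppCoeff n a r (fun z => E z * ((z - b v.1 v.2.1) ^ ((v.2.2 : ℕ) + 1))⁻¹) u := by
  rw [ppCoeff_mul (hE _ _) (analyticAt_inv_pow (hab _ _ _ _) _), xiMatrix]
  simp only [Matrix.of_apply]
  refine Finset.sum_congr rfl fun j _ => Finset.sum_congr rfl fun s _ => ?_
  rw [tc_inv_pow (hab _ _ _ _)]
  ring

theorem gamma₁_eq (B : Background) (ha : ∀ k c, a k c ≠ 0) {E : ℂ → ℂ}
    (hE : ∀ k c, AnalyticAt ℂ E (a k c)) (u : Idx n) :
    gamma₁ B n a r (fun k c ℓ => tc E ℓ (a k c)) u =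
      ppCoeff n a r (fun z => E z * (Complex.I * B.qMinus * ((z - 0) ^ (0 + 1))⁻¹)) u := by
  have h0 := analyticAt_inv_pow (ha u.1 u.2.1) (0 + 1)
  rw [ppCoeff_mul (hE _ _) (analyticAt_const.fun_mul h0), gamma₁]
  refine Finset.sum_congr rfl fun j _ => Finset.sum_congr rfl fun s _ => ?_
  rw [tc_const_mul, tc_inv_pow (ha _ _)]
  simp
  left
  ring

theorem gamma₂_eq {E : ℂ → ℂ} (u : Idx n) :
    gamma₂ n r (fun k c ℓ => tc E ℓ (a k c)) u = ppCoeff n a r E u := rfl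

theorem ppCoeff_mul_poleSum (hab : ∀ k c k' c', a k c ≠ b k' c') {E : ℂ → ℂ}
    (hE : ∀ k c, AnalyticAt ℂ E (a k c)) (F : Idx n → ℂ) (u : Idx n) :
    ppCoeff n a r (fun z => E z * poleSum n b F z) u =
      (xiMatrix n a b r (fun k c ℓ => tc E ℓ (a k c)) *ᵥ F) u := by
  simp only [poleSum, Finset.mul_sum]
  have h1 : ∀ v : Idx n, AnalyticAt ℂ (fun z => ((z - b v.1 v.2.1) ^ ((v.2.2 : ℕ) + 1))⁻¹)
      (a u.1 u.2.1) := fun v => analyticAt_inv_pow (hab _ _ _ _) _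
  rw [ppCoeff_sum fun v _ => (hE _ _).fun_mul (analyticAt_const.fun_mul (h1 v))]
  rw [Matrix.mulVec, dotProduct]
  refine Finset.sum_congr rfl fun v _ => ?_
  rw [xiMatrix_eq hab hE, mul_comm, ← ppCoeff_const_mul]
  refine congrArg (fun G => ppCoeff n a r G u) (funext fun z => ?_)
  ring

end PrincipalPart

end NonlocalMKdV

end

noncomputable section

namespace NonlocalMKdV

open MeasureTheory Set Bornology

/-! ### The algebraic system -/

theorem det_add_vecMulVec_eq {ι : Type*} [Fintype ι] [DecidableEq ι] {M : Matrix ι ι ℂ}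
    (u w : ι → ℂ) {v : ι → ℂ} (hv : M *ᵥ v = u) :
    (M + Matrix.vecMulVec u w).det = M.det * (1 + w ⬝ᵥ v) := by
  have h1 : M + Matrix.vecMulVec u w = M * (1 + Matrix.vecMulVec v w) := by
    rw [mul_add, mul_one, Matrix.mul_vecMulVec, hv]
  rw [h1, Matrix.det_mul, Matrix.vecMulVec_eq Unit, Matrix.det_one_add_replicateCol_mul_replicateRow]

/-- Each quotient of determinants is 1 + w·M⁻¹u by the matrix determinant lemma; the two ones
account for the subtracted 2. -/
theorem det_formula {ι : Type*} [Fintype ι] [DecidableEq ι] {M : Matrix ι ι ℂ}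
    (hM : M.det ≠ 0) (u u' w : ι → ℂ) {v : ι → ℂ} (hv : M *ᵥ v = u + u') :
    ((M + Matrix.vecMulVec u w).det + (M + Matrix.vecMulVec u' w).det) / M.det - 2 = w ⬝ᵥ v := by
  have hu : IsUnit M.det := isUnit_iff_ne_zero.2 hM
  have h1 : M *ᵥ (M⁻¹ *ᵥ u) = u := by
    rw [Matrix.mulVec_mulVec, Matrix.mul_nonsing_inv _ hu, Matrix.one_mulVec]
  have h2 : M *ᵥ (M⁻¹ *ᵥ u') = u' := by
    rw [Matrix.mulVec_mulVec, Matrix.mul_nonsing_inv _ hu, Matrix.one_mulVec]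
  have h3 : v = M⁻¹ *ᵥ u + M⁻¹ *ᵥ u' := by
    rw [← Matrix.mulVec_add, ← hv, Matrix.mulVec_mulVec, Matrix.nonsing_inv_mul _ hu,
      Matrix.one_mulVec]
  rw [det_add_vecMulVec_eq _ _ h1, det_add_vecMulVec_eq _ _ h2, h3, dotProduct_add]
  field_simp
  ring

variable {N : ℕ} {n : Fin N → ℕ} {a b : Fin N → Fin 2 → ℂ} {r r' : Fin N → Fin 2 → ℕ → ℂ}

/-- A function with known principal parts is a rational function. -/
theorem eventually_eq_add_poleSum {f h G : ℂ → ℂ} (hf : ∀ c, (∀ k c', c ≠ a k c') →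
      HE (fun z => f z - h z) c)
    (hfa : ∀ k c, HE (fun z => f z - principalPart n a r z * G z) (a k c))
    (hh : ∀ k c, AnalyticAt ℂ h (a k c)) (hG : ∀ k c, AnalyticAt ℂ G (a k c))
    (hinf : Tendsto (fun z => f z - h z) (cobounded ℂ) (𝓝 0)) (c : ℂ) :
    f =ᶠ[𝓝[≠] c] fun z => h z + poleSum n a (ppCoeff n a r G) z := by
  have h1 : ∀ c, HE (fun z => f z - h z - poleSum n a (ppCoeff n a r G) z) c := by
    intro c
    by_cases hc : ∀ k c', c ≠ a k c'
    · exact (hf c hc).sub (HE.of_analyticAt (analyticAt_poleSum hc))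
    · push Not at hc
      obtain ⟨k, c', rfl⟩ := hc
      refine (((hfa k c').sub (HE.of_analyticAt (hh k c'))).add
        (HE.principalPart_sub_poleSum (r := r) (n := n) hG k c')).congr
        (Eventually.of_forall fun z => ?_)
      simp only
      ring
  have h2 : Tendsto (fun z => f z - h z - poleSum n a (ppCoeff n a r G) z) (cobounded ℂ) (𝓝 0) := by
    simpa using hinf.sub (tendsto_poleSum (n := n) (a := a) (F := ppCoeff n a r G))
  filter_upwards [HE.eventually_eq_zero_of_tendsto h1 h2 c] with z hz
  have hz' : f z - h z - poleSum n a (ppCoeff n a r G) z = 0 := hz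
  linear_combination hz'

theorem eq_of_eventuallyEq_punctured {f g : ℂ → ℂ} {c : ℂ} (h : f =ᶠ[𝓝[≠] c] g)
    (hf : ContinuousAt f c) (hg : ContinuousAt g c) : f =ᶠ[𝓝 c] g :=
  (ContinuousAt.eventuallyEq_nhds_iff_eventuallyEq_nhdsNE hf hg).1 h

/-- Only the simple-pole terms are of order 1/z at infinity; the row `w₀` selects them. -/
theorem tendsto_mul_poleSum {F : Idx n → ℂ} :
    Tendsto (fun z => z * poleSum n a F z) (cobounded ℂ) (𝓝 (w₀ n ⬝ᵥ F)) := by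
  have h1 : ∀ u : Idx n, Tendsto (fun z : ℂ => z * (F u *
      ((z - a u.1 u.2.1) ^ ((u.2.2 : ℕ) + 1))⁻¹)) (cobounded ℂ) (𝓝 (w₀ n u * F u)) := by
    intro u
    set c := a u.1 u.2.1
    set p := (u.2.2 : ℕ) with hp
    have h2 : Tendsto (fun z : ℂ => (1 + c * ((z - c) ^ (0 + 1))⁻¹)) (cobounded ℂ) (𝓝 1) := by
      simpa using ((tendsto_inv_pow_cobounded c 0).const_mul c).const_add 1
    have h3 : ∀ᶠ z in cobounded ℂ, ‖c‖ < ‖z‖ :=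
      tendsto_norm_cobounded_atTop.eventually (eventually_gt_atTop _)
    have h4 : Tendsto (fun z : ℂ => ((z - c) ^ p)⁻¹) (cobounded ℂ) (𝓝 (w₀ n u)) := by
      rw [w₀, ← hp]
      rcases hpp : p with _ | p'
      · simp
      · simpa using tendsto_inv_pow_cobounded c p'
    have h5 := (h2.mul h4).const_mul (F u)
    rw [one_mul, mul_comm] at h5
    refine h5.congr' ?_
    filter_upwards [h3] with z hz
    have hz0 : z - c ≠ 0 := fun h => by rw [sub_eq_zero.1 h] at hz; exact lt_irrefl _ hz
    rw [pow_succ]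
    field_simp
    ring
  have h2 := tendsto_finsetSum Finset.univ fun u _ => h1 u
  refine h2.congr fun z => ?_
  rw [poleSum, Finset.mul_sum]

/-- Inserting the rational form of g into the principal parts of f gives F = Γ₁ + ΞH, and the
converse insertion gives H = Γ₂ + Ξ̃F. The statement is what remains after F is eliminated. -/
theorem mulVec_eq_of_system (B : Background) (hab : ∀ k c k' c', a k c ≠ b k' c')
    (ha : ∀ k c, a k c ≠ 0) {E E' f g : ℂ → ℂ} (hE : ∀ k c, AnalyticAt ℂ E (a k c))
    (hE' : ∀ k c, AnalyticAt ℂ E' (b k c))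
    (hf : ∀ k c, f =ᶠ[𝓝 (b k c)] fun z => 1 + poleSum n a (ppCoeff n a r fun z => E z * g z) z)
    (hg : ∀ k c, g =ᶠ[𝓝 (a k c)] fun z => Complex.I * B.qMinus / z +
      poleSum n b (ppCoeff n b r' fun z => E' z * f z) z) :
    ((1 : Matrix (Idx n) (Idx n) ℂ) - xiMatrix n b a r' (fun k c ℓ => tc E' ℓ (b k c)) *
        xiMatrix n a b r (fun k c ℓ => tc E ℓ (a k c))) *ᵥ
          (ppCoeff n b r' fun z => E' z * f z) =
      gamma₂ n r' (fun k c ℓ => tc E' ℓ (b k c)) +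
        xiMatrix n b a r' (fun k c ℓ => tc E' ℓ (b k c)) *ᵥ
          gamma₁ B n a r (fun k c ℓ => tc E ℓ (a k c)) := by
  set F := ppCoeff n a r fun z => E z * g z with hFd
  set H := ppCoeff n b r' fun z => E' z * f z with hHd
  set X := xiMatrix n a b r (fun k c ℓ => tc E ℓ (a k c)) with hX
  set X' := xiMatrix n b a r' (fun k c ℓ => tc E' ℓ (b k c)) with hX'
  set g₁ := gamma₁ B n a r (fun k c ℓ => tc E ℓ (a k c)) with hg₁
  set g₂ := gamma₂ n r' (fun k c ℓ => tc E' ℓ (b k c)) with hg₂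
  have hF : F = g₁ + X *ᵥ H := by
    funext u
    have e1 : (fun z => E z * g z) =ᶠ[𝓝 (a u.1 u.2.1)] fun z =>
        E z * (Complex.I * B.qMinus * ((z - 0) ^ (0 + 1))⁻¹) + E z * poleSum n b H z := by
      filter_upwards [hg u.1 u.2.1] with z hz
      rw [hz]
      simp [div_eq_mul_inv]
      ring
    rw [hFd, ppCoeff_congr e1, ppCoeff_add, ← gamma₁_eq B ha hE, ppCoeff_mul_poleSum hab hE]
    · rfl
    · exact (hE _ _).fun_mul (analyticAt_const.fun_mul (analyticAt_inv_pow (ha _ _) _))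
    · exact (hE _ _).fun_mul (analyticAt_poleSum fun k c => hab _ _ _ _)
  have hH : H = g₂ + X' *ᵥ F := by
    funext u
    have e1 : (fun z => E' z * f z) =ᶠ[𝓝 (b u.1 u.2.1)] fun z => E' z + E' z * poleSum n a F z := by
      filter_upwards [hf u.1 u.2.1] with z hz
      rw [hz]
      ring
    rw [hHd, ppCoeff_congr e1, ppCoeff_add (hE' _ _), ← gamma₂_eq,
      ppCoeff_mul_poleSum (fun k c k' c' => (hab k' c' k c).symm) hE']
    · rfl
    · exact (hE' _ _).fun_mul (analyticAt_poleSum fun k c => (hab _ _ _ _).symm)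
  rw [Matrix.sub_mulVec, Matrix.one_mulVec, ← Matrix.mulVec_mulVec]
  have : X *ᵥ H = F - g₁ := by rw [hF]; simp
  rw [this, Matrix.mulVec_sub]
  nth_rewrite 1 [hH]
  abel

end NonlocalMKdV

end

noncomputable section

namespace NonlocalMKdV

open MeasureTheory Set Bornology

variable {B : Background} {q : ℝ → ℝ → ℝ}

/-! ### Gluing along the continuous spectrum -/

/-- The closed region in which `Φ₋₁` exists. -/
def Background.regL (B : Background) : Set ℂ := {z | z ≠ 0 ∧ (B.lam z).im ≤ 0}

open Classical in
/-- The function equal to `U` where `Im λ ≥ 0` and to `V` elsewhere. -/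
def glue (B : Background) (U V : ℂ → ℂ) (z : ℂ) : ℂ := if z ∈ B.regC then U z else V z

theorem differentiableAt_lam {z : ℂ} (hz : z ≠ 0) : DifferentiableAt ℂ B.lam z :=
  differentiableAt_lamK B.kap hz

theorem analyticAt_lam {z : ℂ} (hz : z ≠ 0) : AnalyticAt ℂ B.lam z := by
  refine DifferentiableOn.analyticAt (s := {0}ᶜ) (fun w hw => ?_)
    (isOpen_compl_singleton.mem_nhds hz)
  exact (differentiableAt_lam hw).differentiableWithinAt

theorem deriv_lam {z : ℂ} (hz : z ≠ 0) : deriv B.lam z = (1 + B.kap / z ^ 2) / 2 := by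
  have h1 : HasDerivAt (fun z : ℂ => (z - B.kap / z) / 2) ((1 - B.kap * -(z ^ 2)⁻¹) / 2) z := by
    simp only [div_eq_mul_inv B.kap]
    exact ((hasDerivAt_id z).sub ((hasDerivAt_inv hz).const_mul B.kap)).div_const 2
  have h2 : deriv B.lam z = _ := h1.deriv
  rw [h2]
  ring

theorem lam_eq_zero_iff {z : ℂ} (hz : z ≠ 0) : B.lam z = 0 ↔ z ^ 2 = B.kap := by
  rw [show B.lam z = (z - B.kap / z) / 2 from rfl, div_eq_zero_iff, sub_eq_zero]
  simp only [OfNat.ofNat_ne_zero, or_false]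
  rw [eq_div_iff hz, pow_two]

theorem mem_regC_or_regL {z : ℂ} (hz : z ≠ 0) : z ∈ B.regC ∨ z ∈ B.regL := by
  rcases le_total 0 (B.lam z).im with h | h
  · exact Or.inl ⟨hz, h⟩
  · exact Or.inr ⟨hz, h⟩

theorem eventually_lam_pos {z : ℂ} (hz : z ≠ 0) (h : 0 < (B.lam z).im) :
    ∀ᶠ w in 𝓝 z, w ≠ 0 ∧ 0 < (B.lam w).im :=
  (isOpen_compl_singleton.eventually_mem hz).and ((Complex.continuous_im.continuousAt.comp
    (differentiableAt_lam hz).continuousAt).eventually (lt_mem_nhds h))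

theorem eventually_lam_neg {z : ℂ} (hz : z ≠ 0) (h : (B.lam z).im < 0) :
    ∀ᶠ w in 𝓝 z, w ≠ 0 ∧ (B.lam w).im < 0 :=
  (isOpen_compl_singleton.eventually_mem hz).and ((Complex.continuous_im.continuousAt.comp
    (differentiableAt_lam hz).continuousAt).eventually (gt_mem_nhds h))

section Glue

variable {U V : ℂ → ℂ} {z : ℂ}

theorem glue_of_mem (h : z ∈ B.regC) : glue B U V z = U z := if_pos h

theorem glue_of_neg (h : (B.lam z).im < 0) : glue B U V z = V z :=
  if_neg fun h' => absurd h'.2 (not_le.2 h)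

theorem glue_eventuallyEq_of_pos (hz : z ≠ 0) (h : 0 < (B.lam z).im) : glue B U V =ᶠ[𝓝 z] U := by
  filter_upwards [eventually_lam_pos hz h] with w hw
  exact glue_of_mem ⟨hw.1, hw.2.le⟩

theorem glue_eventuallyEq_of_neg (hz : z ≠ 0) (h : (B.lam z).im < 0) : glue B U V =ᶠ[𝓝 z] V := by
  filter_upwards [eventually_lam_neg hz h] with w hw
  exact glue_of_neg hw.2

/-- On the curve Im λ = 0 the two one-sided limits agree because the pieces coincide there, and the
two closed regions cover a neighbourhood. -/
theorem glue_continuousAt (hz : z ≠ 0) (hU : z ∈ B.regC → ContinuousWithinAt U B.regC z)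
    (hV : z ∈ B.regL → ContinuousWithinAt V B.regL z)
    (hUV : ∀ᶠ w in 𝓝 z, (B.lam w).im = 0 → U w = V w) : ContinuousAt (glue B U V) z := by
  rcases lt_trichotomy (B.lam z).im 0 with h | h | h
  · have h1 : B.regL ∈ 𝓝 z := by
      filter_upwards [eventually_lam_neg hz h] with w hw using ⟨hw.1, hw.2.le⟩
    exact ((hV ⟨hz, h.le⟩).continuousAt h1).congr (glue_eventuallyEq_of_neg hz h).symm
  · have hC : z ∈ B.regC := ⟨hz, h.ge⟩
    have hL : ∀ᶠ w in 𝓝 z, w ∈ B.regL → glue B U V w = V w := by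
      filter_upwards [hUV] with w hw hwL
      rcases lt_or_eq_of_le hwL.2 with h | h
      · exact glue_of_neg h
      · rw [glue_of_mem ⟨hwL.1, h.ge⟩, hw h]
    have hcov : ContinuousWithinAt (glue B U V) (B.regC ∪ B.regL) z :=
      ((hU hC).congr (fun w hw => glue_of_mem hw) (glue_of_mem hC)).union
        ((hV ⟨hz, h.le⟩).congr_of_eventuallyEq (eventually_nhdsWithin_iff.2 hL)
          (hL.self_of_nhds ⟨hz, h.le⟩))
    refine hcov.continuousAt ?_
    filter_upwards [isOpen_compl_singleton.mem_nhds hz] with w hw using mem_regC_or_regL hw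
  · have h1 : B.regC ∈ 𝓝 z := by
      filter_upwards [eventually_lam_pos hz h] with w hw using ⟨hw.1, hw.2.le⟩
    exact ((hU ⟨hz, h.le⟩).continuousAt h1).congr (glue_eventuallyEq_of_pos hz h).symm

end Glue

end NonlocalMKdV

end

/-! ### Continuation of the normalized column across the continuous spectrum -/

noncomputable section

namespace NonlocalMKdV

open MeasureTheory Set Bornology

variable {B : Background} {q : ℝ → ℝ → ℝ} {z : ℂ}

theorem inv_mem_regC (hz : z ∈ B.regL) : B.kap / z ∈ B.regC := (inv_mem_regC_iff hz.1).2 hz.2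

theorem differentiableAt_detE (hz : z ≠ 0) : DifferentiableAt ℂ (detE B) z := by
  have h : DifferentiableAt ℂ (fun z : ℂ => 1 - B.kap / z ^ 2) z :=
    (differentiableAt_const _).sub ((differentiableAt_const _).div
      (differentiableAt_id.pow 2) (pow_ne_zero 2 hz))
  exact h

namespace IsSolution

theorem colA_continuousWithinAt (hq : IsSolution B q) (hz : z ∈ B.regC) (x t : ℝ) (i : Fin 2) :
    ContinuousWithinAt (fun z => colA B q x t z i) B.regC z :=
  (continuous_apply i).continuousAt.comp_continuousWithinAt (hq.colA_continuousOn x t z hz)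

theorem colA_differentiableAt (hq : IsSolution B q) (hz : z ≠ 0) (h : 0 < (B.lam z).im) (x t : ℝ)
    (i : Fin 2) : DifferentiableAt ℂ (fun z => colA B q x t z i) z :=
  differentiableAt_pi.1 ((hq.colA_differentiableOn x t).differentiableAt
    ((isOpen_regionO B.kap).mem_nhds ⟨hz, h⟩)) i

theorem colC_continuousWithinAt (hq : IsSolution B q) (hz : z ∈ B.regL) (x t : ℝ) (i : Fin 2) :
    ContinuousWithinAt (fun z => colC B q x t z i) B.regL z := by
  have hqs : (B.qMinus : ℂ) ≠ 0 := by exact_mod_cast B.qMinus_ne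
  have h1 : ContinuousAt (fun z : ℂ => B.kap / z) z := continuousAt_const.div continuousAt_id hz.1
  have h2 : ∀ j, ContinuousWithinAt (fun z => colA B q (-x) (-t) (B.kap / z) j) B.regL z := fun j =>
    (hq.colA_continuousWithinAt (inv_mem_regC hz) (-x) (-t) j).comp h1.continuousWithinAt
      fun w hw => inv_mem_regC hw
  have h3 : ContinuousAt (fun z : ℂ => B.kap / (Complex.I * B.qMinus * z)) z :=
    continuousAt_const.div (continuousAt_const.mul continuousAt_id)
      (mul_ne_zero (mul_ne_zero Complex.I_ne_zero hqs) hz.1)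
  fin_cases i
  · exact h3.continuousWithinAt.mul (h2 1)
  · exact h3.continuousWithinAt.mul (h2 0)

theorem colC_differentiableAt (hq : IsSolution B q) (hz : z ≠ 0) (h : (B.lam z).im < 0) (x t : ℝ)
    (i : Fin 2) : DifferentiableAt ℂ (fun z => colC B q x t z i) z := by
  have hqs : (B.qMinus : ℂ) ≠ 0 := by exact_mod_cast B.qMinus_ne
  have h1 : DifferentiableAt ℂ (fun z : ℂ => B.kap / z) z :=
    (differentiableAt_const _).div differentiableAt_id hz
  have h2 : ∀ j, DifferentiableAt ℂ (fun z => colA B q (-x) (-t) (B.kap / z) j) z := fun j =>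
    DifferentiableAt.comp (g := fun z => colA B q (-x) (-t) z j) z
      (hq.colA_differentiableAt (div_ne_zero B.kap_ne hz)
        (by rw [lam_inv, Complex.neg_im]; linarith) (-x) (-t) j) h1
  have h3 : DifferentiableAt ℂ (fun z : ℂ => B.kap / (Complex.I * B.qMinus * z)) z :=
    (differentiableAt_const _).div ((differentiableAt_const _).mul differentiableAt_id)
      (mul_ne_zero (mul_ne_zero Complex.I_ne_zero hqs) hz)
  fin_cases i
  · exact h3.mul (h2 1)
  · exact h3.mul (h2 0)

theorem s₁₁_continuousWithinAt (hq : IsSolution B q) (hσ : B.σ = -1) (hz : z ∈ B.regC)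
    (hb : z ^ 2 ≠ B.kap) : ContinuousWithinAt (s₁₁ B q) B.regC z := by
  have h := fun i => hq.colA_continuousWithinAt hz 0 0 i
  refine ((((h 0).pow 2).sub ((h 1).pow 2)).div
    (differentiableAt_detE hz.1).continuousAt.continuousWithinAt (detE_ne_zero hz.1 hb)).congr
    (fun w hw => hq.s₁₁_eq_sq hσ hw) (hq.s₁₁_eq_sq hσ hz)

theorem s₁₁_differentiableAt (hq : IsSolution B q) (hσ : B.σ = -1) (hz : z ≠ 0)
    (h : 0 < (B.lam z).im) : DifferentiableAt ℂ (s₁₁ B q) z := by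
  have h1 := fun i => hq.colA_differentiableAt hz h 0 0 i
  have hb : z ^ 2 ≠ B.kap := fun hb => by
    rw [(lam_eq_zero_iff hz).2 hb] at h; exact lt_irrefl _ h
  refine ((((h1 0).pow 2).sub ((h1 1).pow 2)).div (differentiableAt_detE hz)
    (detE_ne_zero hz hb)).congr_of_eventuallyEq ?_
  filter_upwards [eventually_lam_pos hz h] with w hw using hq.s₁₁_eq_sq hσ ⟨hw.1, hw.2.le⟩

end IsSolution

/-- The first component of `Φ₊₁ e^{-iθ} / s₁₁` continued across the continuous spectrum by the
first component of `Φ₋₁ e^{-iθ}`. -/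
def solF (B : Background) (q : ℝ → ℝ → ℝ) (x t : ℝ) : ℂ → ℂ :=
  glue B (fun z => colA B q x t z 0 / s₁₁ B q z) (fun z => colC B q x t z 0)

/-- The points at which the continuation may be singular, besides `0` and the branch points. -/
def IsPoleSet (B : Background) (q : ℝ → ℝ → ℝ) (P : Set ℂ) : Prop :=
  P.Finite ∧ P ⊆ B.DPlus ∧ ∀ z ∈ B.DPlus, s₁₁ B q z = 0 → z ∈ P

namespace IsSolution

theorem s₁₁_ne_zero_of_notMem (hq : IsSolution B q) (hσ : B.σ = -1) (hr : Reflectionless B q)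
    {P : Set ℂ} (hP : IsPoleSet B q P) (hz : z ∈ B.regC) (hb : z ^ 2 ≠ B.kap) (hzP : z ∉ P) :
    s₁₁ B q z ≠ 0 := by
  rcases lt_or_eq_of_le hz.2 with h | h
  · exact fun h0 => hzP (hP.2.2 z (B.mem_DPlus_iff.2 ⟨hz.1, h⟩) h0)
  · exact hq.s₁₁_ne_zero hσ hr (B.mem_Sigma₀_iff.2 ⟨hz.1, h.symm, hb⟩)

theorem eventually_sq_ne (hb : z ^ 2 ≠ B.kap) : ∀ᶠ w in 𝓝 z, w ^ 2 ≠ B.kap :=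
  (by fun_prop : Continuous fun w : ℂ => w ^ 2).continuousAt.eventually_ne hb

theorem continuousAt_solF (hq : IsSolution B q) (hσ : B.σ = -1) (hr : Reflectionless B q)
    {P : Set ℂ} (hP : IsPoleSet B q P) (hz : z ≠ 0) (hb : z ^ 2 ≠ B.kap) (hzP : z ∉ P) (x t : ℝ) :
    ContinuousAt (solF B q x t) z := by
  refine glue_continuousAt hz (fun h => ?_) (fun h => hq.colC_continuousWithinAt h x t 0) ?_
  · exact (hq.colA_continuousWithinAt h x t 0).div (hq.s₁₁_continuousWithinAt hσ h hb)
      (hq.s₁₁_ne_zero_of_notMem hσ hr hP h hb hzP)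
  · filter_upwards [eventually_sq_ne hb, isOpen_compl_singleton.eventually_mem hz] with w hw hw0 him
    have hwS := B.mem_Sigma₀_iff.2 ⟨hw0, him, hw⟩
    rw [hq.colA_eq_smul_colC hσ hr hwS, Pi.smul_apply, smul_eq_mul,
      mul_div_cancel_left₀ _ (hq.s₁₁_ne_zero hσ hr hwS)]

theorem differentiableAt_solF_of_im_ne (hq : IsSolution B q) (hσ : B.σ = -1)
    (hr : Reflectionless B q) {P : Set ℂ} (hP : IsPoleSet B q P) (hz : z ≠ 0) (hzP : z ∉ P)
    (h : (B.lam z).im ≠ 0) (x t : ℝ) : DifferentiableAt ℂ (solF B q x t) z := by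
  rcases lt_or_gt_of_ne h with h | h
  · exact (hq.colC_differentiableAt hz h x t 0).congr_of_eventuallyEq
      (glue_eventuallyEq_of_neg hz h)
  · have hb : z ^ 2 ≠ B.kap := fun hb => by
      rw [(lam_eq_zero_iff hz).2 hb] at h; exact lt_irrefl _ h
    exact ((hq.colA_differentiableAt hz h x t 0).div (hq.s₁₁_differentiableAt hσ hz h)
      (hq.s₁₁_ne_zero_of_notMem hσ hr hP ⟨hz, h.le⟩ hb hzP)).congr_of_eventuallyEq
      (glue_eventuallyEq_of_pos hz h)

/-- Continuity across Im λ = 0 suffices where λ is a local coordinate. Its critical points z² = -κ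
are excluded here; for ε = -1 they are the points where the real axis meets the circle |z| = q₀. -/
theorem analyticAt_solF (hq : IsSolution B q) (hσ : B.σ = -1) (hr : Reflectionless B q)
    {P : Set ℂ} (hP : IsPoleSet B q P) (hz : z ≠ 0) (hb : z ^ 2 ≠ B.kap) (hb' : z ^ 2 ≠ -B.kap)
    (hzP : z ∉ P) (x t : ℝ) : AnalyticAt ℂ (solF B q x t) z := by
  have hPc : ∀ᶠ w in 𝓝 z, w ∉ P := hP.1.isClosed.isOpen_compl.eventually_mem hzP
  have h0 : ∀ᶠ w in 𝓝 z, w ≠ 0 := isOpen_compl_singleton.eventually_mem hz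
  refine analyticAt_of_differentiableAt_off_im_zero (analyticAt_lam (B := B) hz) ?_ ?_ ?_
  · rw [deriv_lam hz]
    intro h
    apply hb'
    have h2 : z ^ 2 ≠ 0 := pow_ne_zero 2 hz
    field_simp at h
    linear_combination h
  · filter_upwards [hPc, h0, eventually_sq_ne hb] with w h1 h2 h3
      using hq.continuousAt_solF hσ hr hP h2 h3 h1 x t
  · filter_upwards [hPc, h0] with w h1 h2 h3
      using hq.differentiableAt_solF_of_im_ne hσ hr hP h2 h1 h3 x t

theorem _root_.NonlocalMKdV.finite_sq_eq (c : ℂ) : {z : ℂ | z ^ 2 = c}.Finite := by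
  obtain ⟨s, hs⟩ := IsAlgClosed.exists_pow_nat_eq c two_pos
  refine (Set.toFinite {s, -s}).subset fun z hz => ?_
  have : z ^ 2 = s ^ 2 := by rw [hs]; exact hz
  simpa using sq_eq_sq_iff_eq_or_eq_neg.1 this

theorem _root_.NonlocalMKdV.eventually_notMem_finite {S : Set ℂ} (hS : S.Finite) (c : ℂ) : ∀ᶠ w in 𝓝[≠] c, w ∉ S := by
  have h1 : (S \ {c})ᶜ ∈ 𝓝 c :=
    (hS.subset sdiff_subset).isClosed.isOpen_compl.mem_nhds fun h => h.2 rfl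
  filter_upwards [nhdsWithin_le_nhds h1, self_mem_nhdsWithin] with w hw hwc hwS
  exact hw ⟨hwS, hwc⟩

theorem eventually_analyticAt_solF (hq : IsSolution B q) (hσ : B.σ = -1) (hr : Reflectionless B q)
    {P : Set ℂ} (hP : IsPoleSet B q P) (x t : ℝ) (c : ℂ) :
    ∀ᶠ w in 𝓝[≠] c, AnalyticAt ℂ (solF B q x t) w := by
  filter_upwards [eventually_notMem_finite hP.1 c, eventually_notMem_finite (finite_singleton 0) c,
    eventually_notMem_finite (finite_sq_eq B.kap) c,
    eventually_notMem_finite (finite_sq_eq (-B.kap)) c] with w h1 h2 h3 h4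
    using hq.analyticAt_solF hσ hr hP h2 h3 h4 h1 x t

/-- A critical point of λ is an isolated singularity at which the function is still continuous,
hence removable. -/
theorem solF_HE_of_ne (hq : IsSolution B q) (hσ : B.σ = -1) (hr : Reflectionless B q)
    {P : Set ℂ} (hP : IsPoleSet B q P) (hz : z ≠ 0) (hb : z ^ 2 ≠ B.kap)
    (hzP : z ∉ P) (x t : ℝ) : HE (solF B q x t) z := by
  refine HE.of_tendsto ((hq.eventually_analyticAt_solF hσ hr hP x t z).mono
    fun w hw => hw.differentiableAt) ?_
  have h1 := hq.continuousAt_solF hσ hr hP hz hb hzP x t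
  have h2 : ContinuousAt (fun w => (w - z) * solF B q x t w) z := by fun_prop
  have h3 := h2.tendsto.mono_left (nhdsWithin_le_nhds (s := {z}ᶜ))
  simpa using h3

end IsSolution

end NonlocalMKdV

end

noncomputable section

namespace NonlocalMKdV

open MeasureTheory Set Bornology

variable {B : Background} {q : ℝ → ℝ → ℝ} {c : ℂ}

/-! ### The branch points -/

theorem ne_zero_of_sq_eq (hc : c ^ 2 = B.kap) : c ≠ 0 := by
  rintro rfl
  exact B.kap_ne (by simpa using hc.symm)

theorem deriv_lam_branch (hc : c ^ 2 = B.kap) : deriv B.lam c = 1 := by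
  rw [deriv_lam (ne_zero_of_sq_eq hc), hc, div_self B.kap_ne]
  norm_num

/-- A branch point is approached by points at which `λ` has a prescribed direction. -/
theorem branch_neBot (hc : c ^ 2 = B.kap) (v : ℂ) :
    (𝓝[{w | ∃ s : ℝ, 0 < s ∧ B.lam w = s * v}] c).NeBot := by
  have hc0 := ne_zero_of_sq_eq hc
  have h1 := (analyticAt_lam (B := B) hc0).hasStrictDerivAt.map_nhds_eq
    (by rw [deriv_lam_branch hc]; exact one_ne_zero)
  rw [(lam_eq_zero_iff hc0).2 hc] at h1
  have h2 : Tendsto (fun s : ℝ => (s : ℂ) * v) (𝓝[>] 0) (𝓝 0) := by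
    have : Continuous fun s : ℝ => (s : ℂ) * v := by fun_prop
    have h := (this.tendsto 0).mono_left (nhdsWithin_le_nhds (s := Ioi 0))
    simpa using h
  have h3 : ∃ᶠ u in 𝓝 (0 : ℂ), ∃ s : ℝ, 0 < s ∧ u = s * v :=
    h2.frequently (Eventually.frequently (by
      filter_upwards [self_mem_nhdsWithin] with s hs using ⟨s, hs, rfl⟩))
  rw [← h1, frequently_map] at h3
  exact frequently_iff_neBot.1 h3

theorem branch_le (hc : c ^ 2 = B.kap) {v : ℂ} (hv : v ≠ 0) :
    𝓝[{w | ∃ s : ℝ, 0 < s ∧ B.lam w = s * v}] c ≤ 𝓝[≠] c := by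
  refine nhdsWithin_mono _ fun w ⟨s, hs, hw⟩ hwc => ?_
  have hwc' : w = c := hwc
  rw [hwc', (lam_eq_zero_iff (ne_zero_of_sq_eq hc)).2 hc] at hw
  exact mul_ne_zero (by exact_mod_cast hs.ne') hv hw.symm

theorem eventually_mem_Sigma₀ (hc : c ^ 2 = B.kap) :
    ∀ᶠ w in 𝓝[{w | ∃ s : ℝ, 0 < s ∧ B.lam w = s * 1}] c, w ∈ B.Sigma₀ := by
  filter_upwards [branch_le hc one_ne_zero (eventually_notMem_finite (finite_sq_eq B.kap) c),
    branch_le hc one_ne_zero (eventually_notMem_finite (finite_singleton 0) c),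
    self_mem_nhdsWithin] with w h1 h2 ⟨s, hs, h3⟩
  refine B.mem_Sigma₀_iff.2 ⟨h2, ?_, h1⟩
  rw [← B.lam_eq, h3]; simp

theorem branch_mem_regC (hc : c ^ 2 = B.kap) : c ∈ B.regC :=
  ⟨ne_zero_of_sq_eq hc, by
    have := (lam_eq_zero_iff (ne_zero_of_sq_eq hc)).2 hc
    rw [← B.lam_eq, this]; simp⟩

theorem branch_mem_regL (hc : c ^ 2 = B.kap) : c ∈ B.regL :=
  ⟨ne_zero_of_sq_eq hc, by
    have := (lam_eq_zero_iff (ne_zero_of_sq_eq hc)).2 hc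
    rw [this]; simp⟩

theorem eventually_norm_le_of_tendsto {α : Type*} {l : Filter α} {f : α → ℂ} {a : ℂ}
    (h : Tendsto f l (𝓝 a)) : ∃ C, ∀ᶠ z in l, ‖f z‖ ≤ C :=
  ⟨‖a‖ + 1, (h.norm.eventually (gt_mem_nhds (lt_add_one _))).mono fun _ h => h.le⟩

theorem colC_branch (hc : c ^ 2 = B.kap) : colC B q 0 0 c =
    (B.kap / (Complex.I * B.qMinus * c)) • swap2 (colA B q 0 0 c) := by
  have : B.kap / c = c := by
    rw [← hc, pow_two, mul_div_assoc, div_self (ne_zero_of_sq_eq hc), mul_one]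
  rw [colC, this, neg_zero]

namespace IsSolution

/-- On the spectrum near a branch point `colA` and `colC` are parallel, and their Wronskian stays
zero in the limit. Since κ/c = c, the limit of `colC` is proportional to `colA` with its components
exchanged, which gives a relation for one vector. -/
theorem colA_branch (hq : IsSolution B q) (hσ : B.σ = -1) (hr : Reflectionless B q)
    (hc : c ^ 2 = B.kap) : colA B q 0 0 c 0 ^ 2 = colA B q 0 0 c 1 ^ 2 := by
  have hqs : (B.qMinus : ℂ) ≠ 0 := by exact_mod_cast B.qMinus_ne
  have hc0 := ne_zero_of_sq_eq hc
  set l := 𝓝[{w | ∃ s : ℝ, 0 < s ∧ B.lam w = s * 1}] c with hl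
  have : l.NeBot := branch_neBot hc 1
  have hS : ∀ᶠ w in l, w ∈ B.Sigma₀ := eventually_mem_Sigma₀ hc
  have hlc : l ≤ 𝓝 c := nhdsWithin_le_nhds
  have l1 : l ≤ 𝓝[B.regC] c := le_inf hlc (le_principal_iff.2 (hS.mono fun w hw => by
    have := B.mem_Sigma₀_iff.1 hw; exact ⟨this.1, this.2.1.ge⟩))
  have l2 : l ≤ 𝓝[B.regL] c := le_inf hlc (le_principal_iff.2 (hS.mono fun w hw => by
    have := B.mem_Sigma₀_iff.1 hw; exact ⟨this.1, this.2.1.le⟩))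
  have tA := fun i => (hq.colA_continuousWithinAt (branch_mem_regC hc) 0 0 i).tendsto.mono_left l1
  have tC := fun i => (hq.colC_continuousWithinAt (branch_mem_regL hc) 0 0 i).tendsto.mono_left l2
  have t1 := ((tA 0).mul (tC 1)).sub ((tA 1).mul (tC 0))
  have t2 : Tendsto (fun w => colA B q 0 0 w 0 * colC B q 0 0 w 1 -
      colA B q 0 0 w 1 * colC B q 0 0 w 0) l (𝓝 0) := by
    refine (tendsto_const_nhds (x := (0 : ℂ))).congr' ?_
    filter_upwards [hS] with w hw
    rw [hq.colA_eq_smul_colC hσ hr hw]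
    simp only [Pi.smul_apply, smul_eq_mul]
    ring
  have h := tendsto_nhds_unique t1 t2
  rw [colC_branch hc] at h
  simp only [Pi.smul_apply, smul_eq_mul, swap2_zero, swap2_one] at h
  have hk : B.kap / (Complex.I * B.qMinus * c) ≠ 0 :=
    div_ne_zero B.kap_ne (mul_ne_zero (mul_ne_zero Complex.I_ne_zero hqs) hc0)
  have h2 : B.kap / (Complex.I * B.qMinus * c) * (colA B q 0 0 c 0 ^ 2 - colA B q 0 0 c 1 ^ 2) = 0 := by
    rw [← h]; ring
  exact sub_eq_zero.1 ((mul_eq_zero.1 h2).resolve_left hk)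

theorem colA_branch_ne (hq : IsSolution B q) (hσ : B.σ = -1) (hr : Reflectionless B q)
    (hc : c ^ 2 = B.kap) : colA B q 0 0 c 0 ≠ 0 ∧ colA B q 0 0 c 1 ≠ 0 := by
  have h := hq.colA_branch hσ hr hc
  have hne := hq.colA_ne_zero (branch_mem_regC hc) 0 0
  have h01 : colA B q 0 0 c 0 = 0 ↔ colA B q 0 0 c 1 = 0 := by
    rw [← sq_eq_zero_iff, h, sq_eq_zero_iff]
  have h0 : colA B q 0 0 c 0 ≠ 0 := fun h0 => hne (by
    ext i; fin_cases i
    · exact h0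
    · exact h01.1 h0)
  exact ⟨h0, fun h1 => h0 (h01.2 h1)⟩

theorem colC_branch_ne (hq : IsSolution B q) (hσ : B.σ = -1) (hr : Reflectionless B q)
    (hc : c ^ 2 = B.kap) : colC B q 0 0 c 0 ≠ 0 := by
  have hqs : (B.qMinus : ℂ) ≠ 0 := by exact_mod_cast B.qMinus_ne
  rw [colC_branch hc]
  exact mul_ne_zero (div_ne_zero B.kap_ne (mul_ne_zero (mul_ne_zero Complex.I_ne_zero hqs)
    (ne_zero_of_sq_eq hc))) (hq.colA_branch_ne hσ hr hc).2

/-- The quotient of the components does not see the factor s₁₁, whose behaviour at a branch point is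
not known in advance. -/
theorem ratio_eq (hq : IsSolution B q) (hσ : B.σ = -1) (hr : Reflectionless B q) {w : ℂ}
    (hw : w ≠ 0) (h : (B.lam w).im = 0) :
    colA B q 0 0 w 1 / colA B q 0 0 w 0 = colC B q 0 0 w 1 / colC B q 0 0 w 0 := by
  have hqs : (B.qMinus : ℂ) ≠ 0 := by exact_mod_cast B.qMinus_ne
  by_cases hb : w ^ 2 = B.kap
  · obtain ⟨h0, h1⟩ := hq.colA_branch_ne hσ hr hb
    have hk : B.kap / (Complex.I * B.qMinus * w) ≠ 0 :=
      div_ne_zero B.kap_ne (mul_ne_zero (mul_ne_zero Complex.I_ne_zero hqs) hw)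
    rw [colC_branch hb]
    simp only [Pi.smul_apply, smul_eq_mul, swap2_zero, swap2_one]
    rw [mul_div_mul_left _ _ hk, div_eq_div_iff h0 h1]
    have := hq.colA_branch hσ hr hb
    linear_combination -this
  · have hS := B.mem_Sigma₀_iff.2 ⟨hw, h, hb⟩
    rw [hq.colA_eq_smul_colC hσ hr hS]
    simp only [Pi.smul_apply, smul_eq_mul]
    rw [mul_div_mul_left _ _ (hq.s₁₁_ne_zero hσ hr hS)]

theorem analyticAt_ratio (hq : IsSolution B q) (hσ : B.σ = -1) (hr : Reflectionless B q)
    (hc : c ^ 2 = B.kap) : AnalyticAt ℂ (glue B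
      (fun w => colA B q 0 0 w 1 / colA B q 0 0 w 0)
      (fun w => colC B q 0 0 w 1 / colC B q 0 0 w 0)) c := by
  have hc0 := ne_zero_of_sq_eq hc
  have hne : ∀ᶠ w in 𝓝 c, w ≠ 0 := isOpen_compl_singleton.eventually_mem hc0
  have hA : ∀ᶠ w in 𝓝 c, w ∈ B.regC → colA B q 0 0 w 0 ≠ 0 := eventually_nhdsWithin_iff.1
    ((hq.colA_continuousWithinAt (branch_mem_regC hc) 0 0 0).eventually_ne
      (hq.colA_branch_ne hσ hr hc).1)
  have hC : ∀ᶠ w in 𝓝 c, w ∈ B.regL → colC B q 0 0 w 0 ≠ 0 := eventually_nhdsWithin_iff.1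
    ((hq.colC_continuousWithinAt (branch_mem_regL hc) 0 0 0).eventually_ne
      (hq.colC_branch_ne hσ hr hc))
  refine analyticAt_of_differentiableAt_off_im_zero (analyticAt_lam (B := B) hc0)
    (by rw [deriv_lam_branch hc]; exact one_ne_zero) ?_ ?_
  · filter_upwards [hA, hC, hne] with w h1 h2 h3
    refine glue_continuousAt h3 (fun h => ?_) (fun h => ?_) ?_
    · exact (hq.colA_continuousWithinAt h 0 0 1).div (hq.colA_continuousWithinAt h 0 0 0) (h1 h)
    · exact (hq.colC_continuousWithinAt h 0 0 1).div (hq.colC_continuousWithinAt h 0 0 0) (h2 h)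
    · filter_upwards [isOpen_compl_singleton.eventually_mem h3] with v hv hv'
        using hq.ratio_eq hσ hr hv hv'
  · filter_upwards [hA, hC, hne] with w h1 h2 h3 h4
    rcases lt_or_gt_of_ne h4 with h | h
    · exact ((hq.colC_differentiableAt h3 h 0 0 1).div (hq.colC_differentiableAt h3 h 0 0 0)
        (h2 ⟨h3, h.le⟩)).congr_of_eventuallyEq (glue_eventuallyEq_of_neg h3 h)
    · exact ((hq.colA_differentiableAt h3 h 0 0 1).div (hq.colA_differentiableAt h3 h 0 0 0)
        (h1 ⟨h3, h.le⟩)).congr_of_eventuallyEq (glue_eventuallyEq_of_pos h3 h)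

/-- The ratio ρ of the components of `colA` continues analytically through the branch point c, and
s₁₁ = A₀²(1 - ρ²)/det E on the upper side, with A₀ nonzero near c. A zero of finite order of 1 - ρ²
gives `solF` at most a pole. From the region Im λ < 0 the function is a bounded column, so there is
no pole. -/
theorem solF_HE_branch (hq : IsSolution B q) (hσ : B.σ = -1) (hr : Reflectionless B q)
    {P : Set ℂ} (hP : IsPoleSet B q P) (hc : c ^ 2 = B.kap) (x t : ℝ) : HE (solF B q x t) c := by
  have hc0 := ne_zero_of_sq_eq hc
  set ρ := glue B (fun w => colA B q 0 0 w 1 / colA B q 0 0 w 0)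
      (fun w => colC B q 0 0 w 1 / colC B q 0 0 w 0) with hρ
  have hρa : AnalyticAt ℂ (fun w => 1 - ρ w ^ 2) c :=
    analyticAt_const.fun_sub ((hq.analyticAt_ratio hσ hr hc).fun_pow 2)
  have hA : ∀ᶠ w in 𝓝 c, w ∈ B.regC → colA B q 0 0 w 0 ≠ 0 := eventually_nhdsWithin_iff.1
    ((hq.colA_continuousWithinAt (branch_mem_regC hc) 0 0 0).eventually_ne
      (hq.colA_branch_ne hσ hr hc).1)
  have hs : ∀ᶠ w in 𝓝 c, w ∈ B.regC →
      s₁₁ B q w = colA B q 0 0 w 0 ^ 2 * (1 - ρ w ^ 2) / detE B w := by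
    filter_upwards [hA] with w hw hwC
    have h0 := hw hwC
    rw [hq.s₁₁_eq_sq hσ hwC, hρ, glue_of_mem hwC]
    congr 1
    field_simp
  obtain ⟨m, k, hk, hk0, hke⟩ : ∃ m : ℕ, ∃ k : ℂ → ℂ, AnalyticAt ℂ k c ∧ k c ≠ 0 ∧
      ∀ᶠ w in 𝓝 c, 1 - ρ w ^ 2 = (w - c) ^ m • k w := by
    -- If 1 - ρ² vanished identically near c, then s₁₁ would vanish at points of the spectrum
    -- arbitrarily close to c.
    refine (hρa.exists_eventuallyEq_pow_smul_nonzero_iff).2 fun h0 => ?_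
    have := branch_neBot (B := B) hc 1
    obtain ⟨w, hw, hw1, hw2⟩ := ((eventually_mem_Sigma₀ hc).and
      (nhdsWithin_le_nhds (hs.and h0))).exists
    have := B.mem_Sigma₀_iff.1 hw
    refine hq.s₁₁_ne_zero hσ hr hw ?_
    rw [hw1 ⟨this.1, this.2.1.ge⟩, hw2]
    simp
  obtain ⟨C₁, hC₁⟩ : ∃ C, ∀ᶠ w in 𝓝[B.regC] c, ‖colA B q x t w 0 * detE B w /
      (colA B q 0 0 w 0 ^ 2 * k w)‖ ≤ C := by
    have h1 := (hq.colA_continuousWithinAt (branch_mem_regC hc) x t 0).mul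
      (differentiableAt_detE (B := B) hc0).continuousAt.continuousWithinAt
    have h2 := ((hq.colA_continuousWithinAt (branch_mem_regC hc) 0 0 0).pow 2).mul
      hk.continuousAt.continuousWithinAt
    exact eventually_norm_le_of_tendsto (h1.div h2
      (mul_ne_zero (pow_ne_zero 2 (hq.colA_branch_ne hσ hr hc).1) hk0)).tendsto
  obtain ⟨C₂, hC₂⟩ : ∃ C, ∀ᶠ w in 𝓝[B.regL] c, ‖colC B q x t w 0‖ ≤ C :=
    eventually_norm_le_of_tendsto (hq.colC_continuousWithinAt (branch_mem_regL hc) x t 0).tendsto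
  -- The branch point is approached in the direction λ ∈ -iℝ₊, where the glued function is the lower
  -- column.
  have hneg : ∀ᶠ w in 𝓝[{w | ∃ s : ℝ, 0 < s ∧ B.lam w = s * (-Complex.I)}] c,
      ‖solF B q x t w‖ ≤ C₂ := by
    filter_upwards [nhdsWithin_le_nhds (eventually_nhdsWithin_iff.1 hC₂),
      branch_le hc (neg_ne_zero.2 Complex.I_ne_zero)
        (eventually_notMem_finite (finite_singleton 0) c), self_mem_nhdsWithin] with w h1 h2 ⟨s, h3, h4⟩
    have h5 : (B.lam w).im < 0 := by rw [h4]; simpa using h3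
    rw [solF, glue_of_neg h5]
    exact h1 ⟨h2, h5.le⟩
  have := branch_neBot (B := B) hc (-Complex.I)
  refine HE.of_pole_bounded (C := max C₁ C₂) (m := m)
    ((hq.eventually_analyticAt_solF hσ hr hP x t c).mono fun w hw => hw.differentiableAt) ?_
    (branch_le hc (neg_ne_zero.2 Complex.I_ne_zero)) hneg
  have hsm : ∀ᶠ w in 𝓝 c, ‖w - c‖ ≤ 1 := by
    have : Continuous fun w : ℂ => ‖w - c‖ := by fun_prop
    have h := this.tendsto c
    simp only [sub_self, norm_zero] at h
    exact (h.eventually (gt_mem_nhds one_pos)).mono fun _ h => h.le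
  have hknz := hk.continuousAt.eventually_ne hk0
  filter_upwards [nhdsWithin_le_nhds (eventually_nhdsWithin_iff.1 hC₁),
    nhdsWithin_le_nhds (eventually_nhdsWithin_iff.1 hC₂), nhdsWithin_le_nhds hsm,
    nhdsWithin_le_nhds hs, nhdsWithin_le_nhds hke, nhdsWithin_le_nhds hA,
    nhdsWithin_le_nhds hknz, self_mem_nhdsWithin,
    eventually_notMem_finite (finite_singleton 0) c,
    eventually_notMem_finite (finite_sq_eq B.kap) c] with w h1 h2 h3 h4 h5 h6 h7 h8 h9 h10
  rcases le_or_gt 0 (B.lam w).im with h | h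
  · have hwC : w ∈ B.regC := ⟨h9, h⟩
    refine le_max_of_le_left ((h1 hwC).trans' (le_of_eq ?_))
    rw [solF, glue_of_mem hwC, h4 hwC, h5, smul_eq_mul]
    have e1 := h6 hwC
    have e2 : (w - c) ^ m ≠ 0 := pow_ne_zero _ (sub_ne_zero.2 h8)
    have e3 := detE_ne_zero h9 h10
    congr 1
    field_simp
  · rw [solF, glue_of_neg h, norm_mul, norm_pow]
    refine le_max_of_le_right ((mul_le_of_le_one_left (norm_nonneg _)
      (pow_le_one₀ (norm_nonneg _) h3)).trans (h2 ⟨h9, h.le⟩))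

end IsSolution

end NonlocalMKdV

end

noncomputable section

namespace NonlocalMKdV

open MeasureTheory Set Bornology

variable {B : Background} {q : ℝ → ℝ → ℝ} {c : ℂ}

/-! ### Behaviour at zero and at infinity -/

theorem tendsto_inv_cobounded_zero : Tendsto (fun z : ℂ => B.kap / z) (cobounded ℂ) (𝓝[≠] 0) := by
  refine tendsto_nhdsWithin_iff.2 ⟨?_, ?_⟩
  · simpa [div_eq_mul_inv] using (tendsto_inv₀_cobounded (α := ℂ)).const_mul B.kap
  · filter_upwards [tendsto_norm_cobounded_atTop.eventually (eventually_gt_atTop (0 : ℝ))] with z hz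
    exact div_ne_zero B.kap_ne (norm_pos_iff.1 hz)

theorem tendsto_inv_zero_cobounded : Tendsto (fun z : ℂ => B.kap / z) (𝓝[≠] 0) (cobounded ℂ) := by
  have h := (tendsto_inv₀_nhdsNE_zero (α := ℂ))
  rw [← tendsto_norm_atTop_iff_cobounded] at h ⊢
  have h2 := h.const_mul_atTop (norm_pos_iff.2 B.kap_ne)
  refine h2.congr fun z => ?_
  rw [div_eq_mul_inv, norm_mul]

theorem tendsto_glue {U V : ℂ → ℂ} {l : Filter ℂ} {L : Filter ℂ}
    (h0 : ∀ᶠ z in l, z ≠ 0) (hU : Tendsto U (l ⊓ 𝓟 B.regC) L) (hV : Tendsto V (l ⊓ 𝓟 B.regL) L) :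
    Tendsto (glue B U V) l L := by
  classical
  have h1 : Tendsto V (l ⊓ 𝓟 {z | z ∉ B.regC}) L := by
    refine hV.mono_left ?_
    refine le_inf inf_le_left (le_principal_iff.2 ?_)
    filter_upwards [h0.filter_mono inf_le_left,
      (eventually_principal.2 fun z hz => hz : ∀ᶠ z in 𝓟 {z | z ∉ B.regC}, z ∉ B.regC).filter_mono
        inf_le_right] with z hz hz2
    exact (mem_regC_or_regL hz).resolve_left hz2
  exact Tendsto.if hU h1

theorem HE.comp {f φ : ℂ → ℂ} (hf : HE f (φ c)) (hφ : AnalyticAt ℂ φ c)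
    (hne : ∀ᶠ z in 𝓝[≠] c, φ z ≠ φ c) : HE (fun z => f (φ z)) c := by
  obtain ⟨g, hg, he⟩ := hf
  refine ⟨fun z => g (φ z), hg.comp hφ, ?_⟩
  have : Tendsto φ (𝓝[≠] c) (𝓝[≠] (φ c)) := tendsto_nhdsWithin_iff.2
    ⟨hφ.continuousAt.tendsto.mono_left nhdsWithin_le_nhds, hne⟩
  exact this.eventually he

namespace IsSolution

theorem tendsto_colA_cobounded (hq : IsSolution B q) (x t : ℝ) :
    Tendsto (fun z => colA B q x t z 0) (cobounded ℂ ⊓ 𝓟 B.regC) (𝓝 1) ∧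
    Tendsto (fun z => colA B q x t z 1) (cobounded ℂ ⊓ 𝓟 B.regC) (𝓝 0) := by
  have h1 := (hq.jostPotential t).tendsto_fst x
  have h2 := (hq.jostPotential t).tendsto_snd x
  rw [B.kap_eq] at h1 h2
  exact ⟨h1, h2⟩

theorem tendsto_colA_zero (hq : IsSolution B q) (hσ : B.σ = -1) (x t : ℝ) :
    Tendsto (fun z => z * colA B q x t z 0) (𝓝[B.regC] 0) (𝓝 0) ∧
    Tendsto (fun z => z * colA B q x t z 1) (𝓝[B.regC] 0) (𝓝 (Complex.I * B.qMinus)) := by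
  have h1 := (hq.jostPotential t).tendsto_zero_fst x
  have h2 := (hq.jostPotential t).tendsto_zero_snd x
  rw [B.kap_eq] at h1 h2
  have e : -(Complex.I * ((B.σ : ℂ) * B.qMinus)) = Complex.I * B.qMinus := by
    rw [hσ]; push_cast; ring
  rw [e] at h2
  exact ⟨h1, h2⟩

/-- In the upper region both the column component and s₁₁ tend to 1; in the lower region inversion
reduces the limit to the behaviour of `colA` at 0. -/
theorem tendsto_solF_cobounded (hq : IsSolution B q) (hσ : B.σ = -1) (x t : ℝ) :
    Tendsto (solF B q x t) (cobounded ℂ) (𝓝 1) := by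
  have hqs : (B.qMinus : ℂ) ≠ 0 := by exact_mod_cast B.qMinus_ne
  have h0 : ∀ᶠ z in cobounded ℂ, z ≠ (0 : ℂ) := by
    filter_upwards [tendsto_norm_cobounded_atTop.eventually (eventually_gt_atTop (0 : ℝ))] with z hz
    exact norm_pos_iff.1 hz
  refine tendsto_glue h0 ?_ ?_
  · obtain ⟨a0, a1⟩ := hq.tendsto_colA_cobounded 0 0
    have d1 : Tendsto (detE B) (cobounded ℂ ⊓ 𝓟 B.regC) (𝓝 1) := by
      have := ((tendsto_inv_cobounded_zero (B := B)).mono_right nhdsWithin_le_nhds).mul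
        (tendsto_inv₀_cobounded (α := ℂ))
      have h := (this.const_sub 1).mono_left (inf_le_left (b := 𝓟 B.regC))
      simp only [mul_zero, sub_zero] at h
      refine h.congr fun z => ?_
      rw [detE_eq, ← div_eq_mul_inv, pow_two, div_div]
    have s1 : Tendsto (s₁₁ B q) (cobounded ℂ ⊓ 𝓟 B.regC) (𝓝 1) := by
      have := ((a0.pow 2).sub (a1.pow 2)).div d1 one_ne_zero
      norm_num at this
      refine this.congr' ?_
      filter_upwards [(eventually_principal.2 fun z hz => hz :
        ∀ᶠ z in 𝓟 B.regC, z ∈ B.regC).filter_mono inf_le_right] with z hz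
      exact (hq.s₁₁_eq_sq hσ hz).symm
    have h := (hq.tendsto_colA_cobounded x t).1.div s1 one_ne_zero
    rw [div_one] at h
    exact h
  · have h1 : Tendsto (fun z => B.kap / z) (cobounded ℂ ⊓ 𝓟 B.regL) (𝓝[B.regC] 0) := by
      refine tendsto_nhdsWithin_iff.2 ⟨(tendsto_inv_cobounded_zero.mono_right
        nhdsWithin_le_nhds).mono_left inf_le_left, ?_⟩
      filter_upwards [(eventually_principal.2 fun z hz => hz :
        ∀ᶠ z in 𝓟 B.regL, z ∈ B.regL).filter_mono inf_le_right] with z hz using inv_mem_regC hz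
    have h2 := ((hq.tendsto_colA_zero hσ (-x) (-t)).2.comp h1).div_const (Complex.I * B.qMinus)
    rw [div_self (mul_ne_zero Complex.I_ne_zero hqs)] at h2
    refine h2.congr fun z => ?_
    simp only [colC, Pi.smul_apply, smul_eq_mul, swap2_zero, Function.comp_apply]
    ring

theorem tendsto_mul_solF_zero (hq : IsSolution B q) (hσ : B.σ = -1) (x t : ℝ) :
    Tendsto (fun z => z * solF B q x t z) (𝓝[≠] 0) (𝓝 0) := by
  have hqs : (B.qMinus : ℂ) ≠ 0 := by exact_mod_cast B.qMinus_ne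
  have hk := B.kap_ne
  have hle : (𝓝[≠] (0 : ℂ)) ⊓ 𝓟 B.regC ≤ 𝓝[B.regC] 0 := inf_le_inf_right _ inf_le_left
  have e : (fun z => z * solF B q x t z) = glue B
      (fun z => z * (colA B q x t z 0 / s₁₁ B q z)) (fun z => z * colC B q x t z 0) := by
    funext z
    simp only [solF, glue]
    split <;> rfl
  rw [e]
  refine tendsto_glue self_mem_nhdsWithin ?_ ?_
  · obtain ⟨a0, a1⟩ := hq.tendsto_colA_zero hσ 0 0
    have d1 : Tendsto (fun z : ℂ => z ^ 2 - B.kap) (𝓝[B.regC] 0) (𝓝 (-B.kap)) := by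
      have : Continuous fun z : ℂ => z ^ 2 - B.kap := by fun_prop
      have h := (this.tendsto 0).mono_left (nhdsWithin_le_nhds (s := B.regC))
      simpa using h
    have s1 := ((a0.pow 2).sub (a1.pow 2)).div d1 (neg_ne_zero.2 hk)
    -- This is the limit of s₁₁ at 0, equal to -ε; division by s₁₁ is therefore harmless there.
    have hne : (0 ^ 2 - (Complex.I * B.qMinus) ^ 2) / -B.kap ≠ 0 := by
      refine div_ne_zero ?_ (neg_ne_zero.2 hk)
      rw [zero_pow two_ne_zero, zero_sub]
      exact neg_ne_zero.2 (pow_ne_zero 2 (mul_ne_zero Complex.I_ne_zero hqs))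
    have h2 := ((hq.tendsto_colA_zero hσ x t).1.div s1 hne).mono_left hle
    rw [zero_div] at h2
    refine h2.congr' ?_
    filter_upwards [(eventually_principal.2 fun z hz => hz :
        ∀ᶠ z in 𝓟 B.regC, z ∈ B.regC).filter_mono inf_le_right] with z hz
    have e1 : detE B z = (z ^ 2 - B.kap) / z ^ 2 := by
      have hz0 := hz.1
      rw [detE_eq]; field_simp
    simp only [Pi.div_apply]
    rw [hq.s₁₁_eq_sq hσ hz, e1, mul_div_assoc]
    congr 2
    rw [div_div_eq_mul_div]
    ring
  · have h1 : Tendsto (fun z => B.kap / z) (𝓝[≠] 0 ⊓ 𝓟 B.regL) (cobounded ℂ ⊓ 𝓟 B.regC) := by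
      refine tendsto_inf.2 ⟨tendsto_inv_zero_cobounded.mono_left inf_le_left, tendsto_principal.2 ?_⟩
      filter_upwards [(eventually_principal.2 fun z hz => hz :
        ∀ᶠ z in 𝓟 B.regL, z ∈ B.regL).filter_mono inf_le_right] with z hz using inv_mem_regC hz
    have h2 := ((hq.tendsto_colA_cobounded (-x) (-t)).2.comp h1).const_mul
      (B.kap / (Complex.I * B.qMinus))
    rw [mul_zero] at h2
    refine h2.congr' ?_
    filter_upwards [(eventually_principal.2 fun z hz => hz :
        ∀ᶠ z in 𝓟 B.regL, z ∈ B.regL).filter_mono inf_le_right] with z hz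
    have hz0 := hz.1
    simp only [colC, Pi.smul_apply, smul_eq_mul, swap2_zero, Function.comp_apply]
    field_simp

theorem solF_HE (hq : IsSolution B q) (hσ : B.σ = -1) (hr : Reflectionless B q)
    {P : Set ℂ} (hP : IsPoleSet B q P) (hcP : c ∉ P) (x t : ℝ) : HE (solF B q x t) c := by
  by_cases h0 : c = 0
  · rw [h0]
    refine HE.of_tendsto ((hq.eventually_analyticAt_solF hσ hr hP x t 0).mono
      fun w hw => hw.differentiableAt) ?_
    simpa using hq.tendsto_mul_solF_zero hσ x t
  · by_cases hb : c ^ 2 = B.kap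
    · exact hq.solF_HE_branch hσ hr hP hb x t
    · exact hq.solF_HE_of_ne hσ hr hP h0 hb hcP x t

end IsSolution

/-- The first component of `Φ₋₂ e^{iθ}` and its continuation. -/
def solG (B : Background) (q : ℝ → ℝ → ℝ) (x t : ℝ) (z : ℂ) : ℂ :=
  Complex.I * B.qMinus / z * solF B q x t (B.kap / z)

theorem solG_eq_colA {z : ℂ} (hz : z ≠ 0) (h : 0 < (B.lam z).im) (x t : ℝ) :
    solG B q x t z = colA B q (-x) (-t) z 1 := by
  have hqs : (B.qMinus : ℂ) ≠ 0 := by exact_mod_cast B.qMinus_ne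
  have hk := B.kap_ne
  have h1 : (B.lam (B.kap / z)).im < 0 := by rw [lam_inv, Complex.neg_im]; linarith
  rw [solG, solF, glue_of_neg h1, colC, inv_inv_kap hz]
  simp only [Pi.smul_apply, smul_eq_mul, swap2_zero]
  field_simp

theorem solG_eq_jost {z : ℂ} (hz : z ≠ 0) (h : (B.lam z).im < 0) (x t : ℝ) :
    solG B q x t z =
      Complex.I * B.qMinus / z * (colA B q x t (B.kap / z) 0 / s₁₁ B q (B.kap / z)) := by
  rw [solG, solF, glue_of_mem (inv_mem_regC ⟨hz, h.le⟩)]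

theorem analyticAt_inv_kap (hc : c ≠ 0) : AnalyticAt ℂ (fun z => B.kap / z) c :=
  analyticAt_const.fun_div analyticAt_id hc

theorem eventually_inv_kap_ne (hc : c ≠ 0) : ∀ᶠ z in 𝓝[≠] c, B.kap / z ≠ B.kap / c := by
  filter_upwards [self_mem_nhdsWithin,
    eventually_notMem_finite (finite_singleton 0) c] with z hz hz0 h
  apply hz
  rw [Set.mem_singleton_iff, ← inv_inv_kap (B := B) hz0, h, inv_inv_kap hc]

theorem analyticAt_qMinus_div (hc : c ≠ 0) :
    AnalyticAt ℂ (fun z => Complex.I * B.qMinus / z) c :=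
  analyticAt_const.fun_div analyticAt_id hc

namespace IsSolution

theorem solG_HE (hq : IsSolution B q) (hσ : B.σ = -1) (hr : Reflectionless B q)
    {P : Set ℂ} (hP : IsPoleSet B q P) (hc : c ≠ 0) (hcP : B.kap / c ∉ P) (x t : ℝ) :
    HE (solG B q x t) c :=
  (HE.of_analyticAt (analyticAt_qMinus_div hc)).mul
    ((hq.solF_HE hσ hr hP hcP x t).comp (analyticAt_inv_kap hc) (eventually_inv_kap_ne hc))

theorem eventually_analyticAt_solG (hq : IsSolution B q) (hσ : B.σ = -1) (hr : Reflectionless B q)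
    {P : Set ℂ} (hP : IsPoleSet B q P) (x t : ℝ) (c : ℂ) :
    ∀ᶠ w in 𝓝[≠] c, AnalyticAt ℂ (solG B q x t) w := by
  have key : ∀ S : Set ℂ, S.Finite → ∀ᶠ w in 𝓝[≠] c, w ≠ 0 → B.kap / w ∉ S := by
    intro S hS
    filter_upwards [eventually_notMem_finite (hS.image fun w => B.kap / w) c] with w hw hw0 hS
    exact hw ⟨_, hS, inv_inv_kap hw0⟩
  filter_upwards [key _ hP.1, eventually_notMem_finite (finite_singleton 0) c,
    key _ (finite_sq_eq B.kap), key _ (finite_sq_eq (-B.kap))] with w h1 h2 h3 h4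
  have h := hq.analyticAt_solF hσ hr hP (div_ne_zero B.kap_ne h2) (h3 h2) (h4 h2) (h1 h2) x t
  exact (analyticAt_qMinus_div h2).fun_mul
    (AnalyticAt.comp (f := fun z => B.kap / z) h (analyticAt_inv_kap h2))

/-- As z → 0 the argument κ/z tends to infinity, where `solF` tends to 1, so subtracting i q₋/z
removes the pole. -/
theorem solG_HE_zero (hq : IsSolution B q) (hσ : B.σ = -1) (hr : Reflectionless B q)
    {P : Set ℂ} (hP : IsPoleSet B q P) (x t : ℝ) :
    HE (fun z => solG B q x t z - Complex.I * B.qMinus / z) 0 := by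
  refine HE.of_tendsto ?_ ?_
  · filter_upwards [hq.eventually_analyticAt_solG hσ hr hP x t 0, self_mem_nhdsWithin] with w h1 h2
    exact (h1.fun_sub (analyticAt_qMinus_div h2)).differentiableAt
  · have h1 := (((hq.tendsto_solF_cobounded hσ x t).comp
      (tendsto_inv_zero_cobounded (B := B))).sub_const 1).const_mul (Complex.I * B.qMinus)
    rw [sub_self, mul_zero] at h1
    refine h1.congr' ?_
    filter_upwards [self_mem_nhdsWithin] with z hz
    have hz0 : z ≠ 0 := hz
    rw [solG, Function.comp_apply]
    field_simp
    ring

theorem tendsto_solG_cobounded (hq : IsSolution B q) (hσ : B.σ = -1) (x t : ℝ) :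
    Tendsto (solG B q x t) (cobounded ℂ) (𝓝 0) := by
  have h1 := ((hq.tendsto_mul_solF_zero hσ x t).comp
    (tendsto_inv_cobounded_zero (B := B))).const_mul (Complex.I * B.qMinus / B.kap)
  rw [mul_zero] at h1
  refine h1.congr fun z => ?_
  have hk := B.kap_ne
  rw [solG, Function.comp_apply]
  field_simp

theorem solG_analyticAt_of_pos (hq : IsSolution B q) (hc : c ≠ 0) (h : 0 < (B.lam c).im) (x t : ℝ) :
    AnalyticAt ℂ (solG B q x t) c := by
  refine Complex.analyticAt_iff_eventually_differentiableAt.2 ?_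
  filter_upwards [(eventually_lam_pos hc h).eventually_nhds] with w hw
  refine (hq.colA_differentiableAt hw.self_of_nhds.1 hw.self_of_nhds.2
    (-x) (-t) 1).congr_of_eventuallyEq ?_
  filter_upwards [hw] with v hv using solG_eq_colA hv.1 hv.2 x t

theorem solF_analyticAt_of_neg (hq : IsSolution B q) (hc : c ≠ 0) (h : (B.lam c).im < 0) (x t : ℝ) :
    AnalyticAt ℂ (solF B q x t) c := by
  refine Complex.analyticAt_iff_eventually_differentiableAt.2 ?_
  filter_upwards [eventually_lam_neg hc h] with w hw
  exact (hq.colC_differentiableAt hw.1 hw.2 x t 0).congr_of_eventuallyEq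
    (glue_eventuallyEq_of_neg hw.1 hw.2)

/-- In the upper region `solG` is the second component of `colA` at (-x,-t), whose second potential
is σ q(x,t). The limit on the ray thus produces q at (x,t) itself. -/
theorem tendsto_ray_solG (hq : IsSolution B q) (hσ : B.σ = -1) (x t : ℝ) :
    Tendsto (fun y : ℝ => Complex.I * y * solG B q x t (Complex.I * y)) atTop
      (𝓝 (Complex.I * q x t)) := by
  have h1 := (hq.jostPotential (-t)).tendsto_ray (-x)
  have e : -(Complex.I * potR B q (-t) (-x)) = Complex.I * q x t := by
    rw [potR, hσ, neg_neg, neg_neg]; push_cast; ring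
  rw [e] at h1
  refine h1.congr' ?_
  filter_upwards [eventually_gt_atTop B.q₀] with y hy
  have hq0 := B.q₀_pos
  have hy0 : 0 < y := hq0.trans hy
  have hz : Complex.I * (y : ℂ) ≠ 0 := mul_ne_zero Complex.I_ne_zero (by exact_mod_cast hy0.ne')
  have hpos : 0 < (B.lam (Complex.I * y)).im := by
    rw [B.lam_eq, B.lam_im]
    have h2 : ‖Complex.I * (y : ℂ)‖ = y := by
      simp [abs_of_pos hy0]
    have h3 : (Complex.I * (y : ℂ)).im = y := by simp
    rw [h2, h3]
    have h4 : B.q₀ ^ 2 / y ^ 2 < 1 := by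
      rw [div_lt_one (by positivity)]; nlinarith
    have h5 : 0 < 1 + B.ε * B.q₀ ^ 2 / y ^ 2 := by
      have : 0 ≤ B.q₀ ^ 2 / y ^ 2 := by positivity
      rw [mul_div_assoc]
      rcases B.ε_eq with h | h <;> rw [h] <;> linarith
    positivity
  rw [solG_eq_colA hz hpos]
  rfl

end IsSolution

end NonlocalMKdV

end

noncomputable section

namespace NonlocalMKdV

open MeasureTheory Set Bornology

variable {B : Background} {q : ℝ → ℝ → ℝ} {c : ℂ}

/-! ### The determinant formula -/

theorem analyticAt_theta (hc : c ≠ 0) (x t : ℝ) : AnalyticAt ℂ (B.θ x t) c := by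
  have hk : AnalyticAt ℂ B.k c :=
    (analyticAt_id.fun_add (analyticAt_const.fun_div analyticAt_id hc)).fun_div analyticAt_const
      two_ne_zero
  exact (analyticAt_lam hc).fun_mul (analyticAt_const.fun_add
    (((analyticAt_const.fun_mul (hk.fun_pow 2)).fun_add analyticAt_const).fun_mul
      analyticAt_const))

/-- The oscillatory factor `e^{2 s iθ}`. -/
def oscE (B : Background) (s : ℂ) (x t : ℝ) (w : ℂ) : ℂ := Complex.exp (s * 2 * Complex.I * B.θ x t w)

theorem analyticAt_oscE (hc : c ≠ 0) (s : ℂ) (x t : ℝ) : AnalyticAt ℂ (oscE B s x t) c :=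
  AnalyticAt.cexp (analyticAt_const.fun_mul (analyticAt_theta hc x t))

variable {N : ℕ} {z : Fin N → ℂ}

theorem im_lam_poles₁ (hz : ∀ k, z k ∈ B.DPlus) (k : Fin N) (i : Fin 2) :
    poles₁ z k i ≠ 0 ∧ 0 < (B.lam (poles₁ z k i)).im := by
  have h : z k ∈ regionO B.kap := B.mem_DPlus_iff.1 (hz k)
  have h0 : z k ≠ 0 := h.1
  have h1 : 0 < (B.lam (z k)).im := h.2
  fin_cases i
  · exact ⟨h0, h1⟩
  · simp only [poles₁, Fin.mk_one, Matrix.cons_val_one, Matrix.cons_val_fin_one]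
    rw [lam_neg_conj]
    simpa using ⟨h0, h1⟩

theorem poles₂_eq (k : Fin N) (i : Fin 2) : poles₂ B z k i = B.kap / poles₁ z k i := by
  fin_cases i
  · rfl
  · simp only [poles₁, poles₂, Fin.mk_one, Matrix.cons_val_one, Matrix.cons_val_fin_one,
      Background.kap, map_div₀, map_mul, map_pow, Complex.conj_ofReal, div_neg]

theorem im_lam_poles₂ (hz : ∀ k, z k ∈ B.DPlus) (k : Fin N) (i : Fin 2) :
    poles₂ B z k i ≠ 0 ∧ (B.lam (poles₂ B z k i)).im < 0 := by
  obtain ⟨h0, h1⟩ := im_lam_poles₁ hz k i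
  rw [poles₂_eq, lam_inv, Complex.neg_im]
  exact ⟨div_ne_zero B.kap_ne h0, by linarith⟩

theorem isPoleSet (hz : ∀ k, z k ∈ B.DPlus) (hall : ∀ w ∈ B.DPlus, s₁₁ B q w = 0 →
      ∃ k, w = z k ∨ w = -(starRingEnd ℂ) (z k)) :
    IsPoleSet B q (range fun p : Fin N × Fin 2 => poles₁ z p.1 p.2) := by
  refine ⟨finite_range _, ?_, fun w hw h0 => ?_⟩
  · rintro _ ⟨p, rfl⟩
    exact B.mem_DPlus_iff.2 (im_lam_poles₁ hz p.1 p.2)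
  · obtain ⟨k, h | h⟩ := hall w hw h0
    · exact ⟨(k, 0), h.symm⟩
    · exact ⟨(k, 1), h.symm⟩

namespace IsSolution

variable {n : Fin N → ℕ} {r r' : Fin N → Fin 2 → ℕ → ℂ}

/-- Multiplying the cancellation of poles by e^{-iθ} normalizes Φ₊₁ and leaves the factor e^{-2iθ}
in front of the normalized Φ₋₂. -/
theorem solF_HE_pole (hq : IsSolution B q) (hσ : B.σ = -1) (hz : ∀ k, z k ∈ B.DPlus)
    (hr : CancelsPoles (s₁₁ B q) (jostPlus B q 0) (jostMinus B q 1) n (poles₁ z) r)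
    (x t : ℝ) (k : Fin N) (i : Fin 2) :
    HE (fun w => solF B q x t w -
      principalPart n (poles₁ z) r w * (oscE B (-1) x t w * solG B q x t w)) (poles₁ z k i) := by
  obtain ⟨h0, h1⟩ := im_lam_poles₁ hz k i
  obtain ⟨G, hG, he⟩ := hr k i x t
  have hE : AnalyticAt ℂ (fun w => Complex.exp (-(Complex.I * B.θ x t w))) (poles₁ z k i) :=
    AnalyticAt.cexp ((analyticAt_const.fun_mul (analyticAt_theta h0 x t)).fun_neg)
  refine ⟨fun w => Complex.exp (-(Complex.I * B.θ x t w)) * G w 0,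
    hE.fun_mul (analyticAt_pi_iff.1 hG 0), ?_⟩
  filter_upwards [he, nhdsWithin_le_nhds (eventually_lam_pos h0 h1)] with w hw ⟨hw0, hw1⟩
  have hC : w ∈ B.regC := ⟨hw0, hw1.le⟩
  rw [← hw, hq.jostPlus_zero x t hC, hq.jostMinus_one hσ x t hC, solG_eq_colA hw0 hw1, solF,
    glue_of_mem hC, oscE]
  simp only [Pi.sub_apply, Pi.smul_apply, smul_eq_mul, swap2_zero]
  have e1 : Complex.exp (-(Complex.I * B.θ x t w)) * Complex.exp (Complex.I * B.θ x t w) = 1 := by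
    rw [← Complex.exp_add]; simp
  have e2 : Complex.exp (-1 * 2 * Complex.I * B.θ x t w) =
      Complex.exp (-(Complex.I * B.θ x t w)) * Complex.exp (-(Complex.I * B.θ x t w)) := by
    rw [← Complex.exp_add]; congr 1; ring
  rw [e2]
  linear_combination (-(colA B q x t w 0 / s₁₁ B q w)) * e1

theorem solG_HE_pole (hq : IsSolution B q) (hσ : B.σ = -1) (hz : ∀ k, z k ∈ B.DPlus)
    (hr : CancelsPoles (s₂₂ B q) (jostPlus B q 1) (jostMinus B q 0) n (poles₂ B z) r')
    (x t : ℝ) (k : Fin N) (i : Fin 2) :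
    HE (fun w => solG B q x t w -
      principalPart n (poles₂ B z) r' w * (oscE B 1 x t w * solF B q x t w)) (poles₂ B z k i) := by
  obtain ⟨h0, h1⟩ := im_lam_poles₂ hz k i
  obtain ⟨G, hG, he⟩ := hr k i x t
  have hE : AnalyticAt ℂ (fun w => Complex.exp (Complex.I * B.θ x t w)) (poles₂ B z k i) :=
    AnalyticAt.cexp (analyticAt_const.fun_mul (analyticAt_theta h0 x t))
  refine ⟨fun w => Complex.exp (Complex.I * B.θ x t w) * G w 0,
    hE.fun_mul (analyticAt_pi_iff.1 hG 0), ?_⟩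
  filter_upwards [he, nhdsWithin_le_nhds (eventually_lam_neg h0 h1)] with w hw ⟨hw0, hw1⟩
  have hC : B.kap / w ∈ B.regC := inv_mem_regC ⟨hw0, hw1.le⟩
  rw [← hw, hq.jostPlus_one x t hC, hq.jostMinus_zero hσ x t hC, solG_eq_jost hw0 hw1, solF,
    glue_of_neg hw1, oscE, hq.s₂₂_eq hσ hC]
  simp only [Pi.sub_apply, Pi.smul_apply, smul_eq_mul]
  have e1 : Complex.exp (Complex.I * B.θ x t w) * Complex.exp (-(Complex.I * B.θ x t w)) = 1 := by
    rw [← Complex.exp_add]; simp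
  have e2 : Complex.exp (1 * 2 * Complex.I * B.θ x t w) =
      Complex.exp (Complex.I * B.θ x t w) * Complex.exp (Complex.I * B.θ x t w) := by
    rw [← Complex.exp_add]; congr 1; ring
  -- The factor δ of s₂₂ cancels against q₊ = δ q₋.
  have e3 : ((B.δ : ℂ) * s₁₁ B q (B.kap / w))⁻¹ * (Complex.I * B.qPlus / w) =
      Complex.I * B.qMinus / w / s₁₁ B q (B.kap / w) := by
    have hqp : (B.qPlus : ℂ) = B.δ * B.qMinus := by rw [Background.qPlus]; push_cast; rfl
    have hδ : (B.δ : ℂ) ≠ 0 := by rcases B.δ_eq with h | h <;> simp [h]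
    rw [hqp, mul_inv]
    field_simp
  rw [e2]
  linear_combination (-(((B.δ : ℂ) * s₁₁ B q (B.kap / w))⁻¹ * (Complex.I * B.qPlus / w) *
    colA B q x t (B.kap / w) 0)) * e1 - colA B q x t (B.kap / w) 0 * e3

/-- The rational forms of `solF` and `solG` give the linear system for the pole coefficients of
`solG`, and the 1/z term of `solG` along the imaginary axis gives q. -/
theorem determinant_formula (hq : IsSolution B q) (hσ : B.σ = -1) (hrefl : Reflectionless B q)
    (hz : ∀ k, z k ∈ B.DPlus) (hall : ∀ w ∈ B.DPlus, s₁₁ B q w = 0 →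
      ∃ k, w = z k ∨ w = -(starRingEnd ℂ) (z k))
    (hr : IsReflectionData B q z n r r') (x t : ℝ) (hM : (mainMatrix B z n r r' x t).det ≠ 0) :
    (q x t : ℂ) = (B.qMinus : ℂ) - Complex.I *
      (((mainMatrix B z n r r' x t + Matrix.vecMulVec (Gamma₂ B z n r' x t) (w₀ n)).det
        + (mainMatrix B z n r r' x t + Matrix.vecMulVec
          ((XiTilde B z n r' x t).mulVec (Gamma₁ B z n r x t)) (w₀ n)).det)
        / (mainMatrix B z n r r' x t).det - 2) := by
  set P := range fun p : Fin N × Fin 2 => poles₁ z p.1 p.2 with hPdef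
  have hP : IsPoleSet B q P := isPoleSet hz hall
  have ha := im_lam_poles₁ hz
  have hb := im_lam_poles₂ hz
  have hab : ∀ k i k' i', poles₁ z k i ≠ poles₂ B z k' i' := by
    intro k i k' i' h
    have h1 := (ha k i).2
    rw [h] at h1
    exact lt_asymm h1 (hb k' i').2
  have hGa : ∀ k i, AnalyticAt ℂ (fun w => oscE B (-1) x t w * solG B q x t w) (poles₁ z k i) :=
    fun k i => (analyticAt_oscE (ha k i).1 _ x t).fun_mul
      (hq.solG_analyticAt_of_pos (ha k i).1 (ha k i).2 x t)
  have hFb : ∀ k i, AnalyticAt ℂ (fun w => oscE B 1 x t w * solF B q x t w) (poles₂ B z k i) :=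
    fun k i => (analyticAt_oscE (hb k i).1 _ x t).fun_mul
      (hq.solF_analyticAt_of_neg (hb k i).1 (hb k i).2 x t)
  have hF := eventually_eq_add_poleSum (n := n) (a := poles₁ z) (r := r) (f := solF B q x t)
    (h := fun _ => 1) (G := fun w => oscE B (-1) x t w * solG B q x t w)
    (fun c hc => (hq.solF_HE hσ hrefl hP (by rintro ⟨p, hp⟩; exact hc _ _ hp.symm) x t).sub
      (HE.of_analyticAt analyticAt_const))
    (hq.solF_HE_pole hσ hz hr.1 x t) (fun _ _ => analyticAt_const) hGa
    (by simpa using (hq.tendsto_solF_cobounded hσ x t).sub_const 1)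
  have hG := eventually_eq_add_poleSum (n := n) (a := poles₂ B z) (r := r') (f := solG B q x t)
    (h := fun w => Complex.I * B.qMinus / w) (G := fun w => oscE B 1 x t w * solF B q x t w)
    (fun c hc => by
      by_cases h0 : c = 0
      · rw [h0]; exact hq.solG_HE_zero hσ hrefl hP x t
      · refine (hq.solG_HE hσ hrefl hP h0 ?_ x t).sub
          (HE.of_analyticAt (analyticAt_qMinus_div h0))
        rintro ⟨p, hp⟩
        refine hc p.1 p.2 ?_
        simp only at hp
        rw [poles₂_eq, hp, inv_inv_kap h0])
    (hq.solG_HE_pole hσ hz hr.2 x t) (fun k i => analyticAt_qMinus_div (hb k i).1) hFb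
    (by
      have h1 := (tendsto_inv₀_cobounded (α := ℂ)).const_mul (Complex.I * B.qMinus)
      rw [mul_zero] at h1
      simpa [div_eq_mul_inv] using (hq.tendsto_solG_cobounded hσ x t).sub h1)
  set H := ppCoeff n (poles₂ B z) r' (fun w => oscE B 1 x t w * solF B q x t w) with hH
  -- The rational forms hold on punctured neighbourhoods only. Each function is continuous at the
  -- poles of the other, which lie in the opposite region, so there the equalities hold on full
  -- neighbourhoods.
  have hsys := mulVec_eq_of_system B hab (fun k i => (ha k i).1) (n := n) (r := r) (r' := r')
    (E := oscE B (-1) x t) (E' := oscE B 1 x t) (f := solF B q x t) (g := solG B q x t)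
    (fun k i => analyticAt_oscE (ha k i).1 _ x t) (fun k i => analyticAt_oscE (hb k i).1 _ x t)
    (fun k i => eq_of_eventuallyEq_punctured (hF _)
      (hq.solF_analyticAt_of_neg (hb k i).1 (hb k i).2 x t).continuousAt
      (continuousAt_const.add (analyticAt_poleSum fun k' i' =>
        (hab k' i' k i).symm).continuousAt))
    (fun k i => eq_of_eventuallyEq_punctured (hG _)
      (hq.solG_analyticAt_of_pos (ha k i).1 (ha k i).2 x t).continuousAt
      ((analyticAt_qMinus_div (ha k i).1).continuousAt.add (analyticAt_poleSum fun k' i' =>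
        (hab k i k' i')).continuousAt))
  have hdet := det_formula hM (Gamma₂ B z n r' x t)
    ((XiTilde B z n r' x t).mulVec (Gamma₁ B z n r x t)) (w₀ n) (v := H) hsys
  rw [hdet]
  have hlim : Complex.I * (q x t : ℂ) = Complex.I * B.qMinus + w₀ n ⬝ᵥ H := by
    have l1 := hq.tendsto_ray_solG hσ x t
    have hray : Tendsto (fun y : ℝ => Complex.I * (y : ℂ)) atTop (cobounded ℂ) := by
      rw [← tendsto_norm_atTop_iff_cobounded]
      simpa using tendsto_abs_atTop_atTop
    have l2 := ((tendsto_mul_poleSum (n := n) (a := poles₂ B z) (F := H)).comp hray).const_add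
      (Complex.I * B.qMinus)
    refine tendsto_nhds_unique l1 (l2.congr' ?_)
    -- Far out on the ray both sides are continuous, so equality near a point gives equality at the
    -- point.
    have hfin : ∀ᶠ w in cobounded ℂ, w ≠ 0 ∧ (∀ k i, w ≠ poles₂ B z k i) ∧
        AnalyticAt ℂ (solG B q x t) w := by
      have h1 : ∀ S : Set ℂ, S.Finite → ∀ᶠ w in cobounded ℂ, w ∉ S := fun S hS =>
        hS.isBounded
      have h2 := (tendsto_inv_cobounded_zero (B := B)).eventually
        (hq.eventually_analyticAt_solF hσ hrefl hP x t 0)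
      filter_upwards [h1 _ (finite_singleton 0), h2, h1 _ (finite_range
        fun p : Fin N × Fin 2 => poles₂ B z p.1 p.2)] with w h3 h4 h5
      exact ⟨h3, fun k i h => h5 ⟨(k, i), h.symm⟩, (analyticAt_qMinus_div h3).fun_mul
        (AnalyticAt.comp (f := fun z => B.kap / z) h4 (analyticAt_inv_kap h3))⟩
    filter_upwards [hray.eventually hfin] with y ⟨h1, h2, h3⟩
    have h4 := (eq_of_eventuallyEq_punctured (hG (Complex.I * y)) h3.continuousAt
      ((analyticAt_qMinus_div h1).continuousAt.add (analyticAt_poleSum h2).continuousAt)).self_of_nhds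
    rw [h4, mul_add, mul_div_cancel₀ _ h1, Function.comp_apply]
  have hI := Complex.I_sq
  linear_combination (-Complex.I) * hlim + (q x t - B.qMinus : ℂ) * hI

end IsSolution

end NonlocalMKdV

end

noncomputable section

namespace NonlocalMKdV

open MeasureTheory Set Bornology

variable {B : Background} {q : ℝ → ℝ → ℝ} {c : ℂ}

/-! ### Nondegeneracy of the main matrix -/

/-- Every differentiation either brings down x φ' or acts on ψ. Letting ψ vary closes the induction.
-/
theorem exists_iteratedDeriv_eq_polynomial {φ : ℂ → ℂ} {a : ℂ} (hφ : AnalyticAt ℂ φ a) (ℓ : ℕ) :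
    ∀ ψ : ℂ → ℂ, AnalyticAt ℂ ψ a → ∃ p : Polynomial ℂ, ∀ x : ℂ,
      iteratedDeriv ℓ (fun w => Complex.exp (x * φ w) * ψ w) a =
        Complex.exp (x * φ a) * p.eval x := by
  induction ℓ with
  | zero => exact fun ψ _ => ⟨Polynomial.C (ψ a), fun x => by simp⟩
  | succ ℓ ih =>
    intro ψ hψ
    obtain ⟨p₁, h₁⟩ := ih _ (hφ.deriv.fun_mul hψ)
    obtain ⟨p₂, h₂⟩ := ih _ hψ.deriv
    refine ⟨Polynomial.X * p₁ + p₂, fun x => ?_⟩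
    have hE : AnalyticAt ℂ (fun w => Complex.exp (x * φ w)) a :=
      AnalyticAt.cexp (analyticAt_const.fun_mul hφ)
    have hd : deriv (fun w => Complex.exp (x * φ w) * ψ w) =ᶠ[𝓝 a] fun w =>
        x * (Complex.exp (x * φ w) * (deriv φ w * ψ w)) + Complex.exp (x * φ w) * deriv ψ w := by
      filter_upwards [hφ.eventually_analyticAt, hψ.eventually_analyticAt] with w h1 h2
      have h3 := ((h1.differentiableAt.hasDerivAt.const_mul x).cexp.mul
        h2.differentiableAt.hasDerivAt).deriv
      refine h3.trans ?_
      ring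
    rw [iteratedDeriv_succ', hd.iteratedDeriv_eq ℓ, iteratedDeriv_fun_add,
      iteratedDeriv_const_mul_field, h₁, h₂]
    · simp only [Polynomial.eval_add, Polynomial.eval_mul, Polynomial.eval_X]
      ring
    · exact (analyticAt_const.fun_mul (hE.fun_mul (hφ.deriv.fun_mul hψ))).contDiffAt
    · exact (hE.fun_mul hψ.deriv).contDiffAt

theorem tendsto_exp_mul_polynomial {c : ℂ} (hc : 0 < c.re) (p : Polynomial ℂ) :
    Tendsto (fun x : ℝ => Complex.exp (x * c) * p.eval (x : ℂ)) atBot (𝓝 0) := by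
  have h1 : ∀ i : ℕ, Tendsto (fun x : ℝ => Complex.exp (x * c) * (p.coeff i * (x : ℂ) ^ i)) atBot
      (𝓝 0) := by
    intro i
    rw [tendsto_zero_iff_norm_tendsto_zero]
    have h2 := (Real.tendsto_pow_mul_exp_neg_atTop_nhds_zero i).comp
      (tendsto_neg_atBot_atTop.const_mul_atTop hc)
    have h3 := h2.const_mul (‖p.coeff i‖ * (c.re ^ i)⁻¹)
    rw [mul_zero] at h3
    refine h3.congr' ?_
    filter_upwards [eventually_le_atBot 0] with x hx
    simp only [Function.comp_apply, norm_mul, norm_pow, Complex.norm_exp, Complex.norm_real,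
      Real.norm_eq_abs, abs_of_nonpos hx]
    have : ((x : ℂ) * c).re = x * c.re := by simp
    rw [this, mul_pow, show -(c.re * -x) = x * c.re by ring]
    have := (pow_pos hc i).ne'
    field_simp
  have h2 := tendsto_finsetSum (Finset.range (p.natDegree + 1)) fun i _ => h1 i
  simp only [Finset.sum_const_zero] at h2
  refine h2.congr fun x => ?_
  rw [Polynomial.eval_eq_sum_range, Finset.mul_sum]

theorem analyticAt_exp_mul_polynomial (c : ℂ) (p : Polynomial ℂ) (x : ℝ) :
    AnalyticAt ℝ (fun x : ℝ => Complex.exp (x * c) * p.eval (x : ℂ)) x := by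
  have h : AnalyticAt ℂ (fun x : ℂ => Complex.exp (x * c) * p.eval x) (x : ℂ) :=
    (AnalyticAt.cexp (analyticAt_id.fun_mul analyticAt_const)).fun_mul
      (p.differentiable.analyticAt _)
  exact (h.restrictScalars (𝕜 := ℝ)).comp (Complex.ofRealCLM.analyticAt x)

/-- A real-analytic function that vanishes at `-∞`. -/
def DecaysAnalytically (f : ℝ → ℂ) : Prop := (∀ x, AnalyticAt ℝ f x) ∧ Tendsto f atBot (𝓝 0)

namespace DecaysAnalytically

variable {f g : ℝ → ℂ}

theorem const_mul (h : DecaysAnalytically f) (c : ℂ) : DecaysAnalytically fun x => c * f x :=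
  ⟨fun x => analyticAt_const.fun_mul (h.1 x), by simpa using h.2.const_mul c⟩

theorem mul (h : DecaysAnalytically f) (h' : DecaysAnalytically g) :
    DecaysAnalytically fun x => f x * g x :=
  ⟨fun x => (h.1 x).fun_mul (h'.1 x), by simpa using h.2.mul h'.2⟩

theorem sum {ι : Type*} {s : Finset ι} {f : ι → ℝ → ℂ} (h : ∀ i ∈ s, DecaysAnalytically (f i)) :
    DecaysAnalytically fun x => ∑ i ∈ s, f i x :=
  ⟨fun x => Finset.analyticAt_fun_sum _ fun i hi => (h i hi).1 x, by
    simpa using tendsto_finsetSum s fun i hi => (h i hi).2⟩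

/-- The determinant of a real-analytic perturbation of the identity that vanishes at `-∞` is
nonzero on a dense set. -/
theorem dense_det_ne_zero {ι : Type*} [Fintype ι] [DecidableEq ι] {M : ℝ → Matrix ι ι ℂ}
    (h : ∀ i j, DecaysAnalytically fun x => M x i j) : Dense {x | (1 - M x).det ≠ 0} := by
  have hA : ∀ x, AnalyticAt ℝ (fun x => (1 - M x).det) x := by
    intro x
    simp only [Matrix.det_apply', Matrix.sub_apply]
    exact Finset.analyticAt_fun_sum _ fun σ _ => analyticAt_const.fun_mul
      (Finset.analyticAt_fun_prod _ fun i _ => analyticAt_const.fun_sub ((h _ _).1 x))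
  have hL : Tendsto (fun x => (1 - M x).det) atBot (𝓝 1) := by
    have h1 : Tendsto M atBot (𝓝 0) := tendsto_pi_nhds.2 fun i => tendsto_pi_nhds.2 fun j => (h i j).2
    have h2 : Continuous fun A : Matrix ι ι ℂ => (1 - A).det :=
      (continuous_const.sub continuous_id).matrix_det
    have h3 := (h2.tendsto 0).comp h1
    rw [sub_zero, Matrix.det_one] at h3
    exact h3
  by_contra hd
  rw [dense_iff_inter_open] at hd
  push Not at hd
  obtain ⟨U, hU, ⟨x₀, hx₀⟩, hUe⟩ := hd
  -- Vanishing on an open set would force the analytic determinant to vanish identically, against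
  -- its limit 1 at -∞.
  have hz : (fun x => (1 - M x).det) =ᶠ[𝓝 x₀] 0 := by
    filter_upwards [hU.mem_nhds hx₀] with x hx
    by_contra hne
    exact (Set.notMem_empty x) (hUe ▸ ⟨hx, hne⟩)
  have h0 : (fun x => (1 - M x).det) = 0 :=
    AnalyticOnNhd.eq_of_eventuallyEq (fun x _ => hA x) (fun x _ => analyticAt_const) hz
  rw [h0] at hL
  exact zero_ne_one (tendsto_nhds_unique tendsto_const_nhds hL)

end DecaysAnalytically

variable {N : ℕ} {z : Fin N → ℂ} {n : Fin N → ℕ} {r r' : Fin N → Fin 2 → ℕ → ℂ}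

/-- The phase is affine in x with slope λ, so the Taylor coefficients are polynomials in x times
e^{2isλx}, which decay at -∞ under the sign condition. -/
theorem decaysAnalytically_oscCoeff {a : Fin N → Fin 2 → ℂ} {s : ℂ} (t : ℝ) (k : Fin N) (i : Fin 2)
    (ha : a k i ≠ 0) (hs : 0 < (s * 2 * Complex.I * B.lam (a k i)).re) (ℓ : ℕ) :
    DecaysAnalytically fun x => oscCoeff B s a x t k i ℓ := by
  have hl := analyticAt_lam (B := B) ha
  obtain ⟨p, hp⟩ := exists_iteratedDeriv_eq_polynomial
    (φ := fun w => s * 2 * Complex.I * B.lam w) (analyticAt_const.fun_mul hl) ℓ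
    (fun w => Complex.exp (s * 2 * Complex.I * B.θ 0 t w))
    (AnalyticAt.cexp (analyticAt_const.fun_mul (analyticAt_theta ha 0 t)))
  have e : (fun x => oscCoeff B s a x t k i ℓ) = fun x : ℝ => ((ℓ.factorial : ℂ))⁻¹ *
      (Complex.exp (x * (s * 2 * Complex.I * B.lam (a k i))) * p.eval (x : ℂ)) := by
    funext x
    rw [← hp, oscCoeff, div_eq_inv_mul]
    congr 2
    funext w
    rw [← Complex.exp_add, Background.θ, Background.θ]
    congr 1
    push_cast
    ring
  rw [e]
  exact DecaysAnalytically.const_mul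
    ⟨analyticAt_exp_mul_polynomial _ p, tendsto_exp_mul_polynomial hs p⟩ _

theorem decaysAnalytically_xiMatrix {a b : Fin N → Fin 2 → ℂ} {s : ℂ} (t : ℝ)
    (ha : ∀ k i, a k i ≠ 0) (hs : ∀ k i, 0 < (s * 2 * Complex.I * B.lam (a k i)).re) (u v : Idx n) :
    DecaysAnalytically fun x => xiMatrix n a b r (oscCoeff B s a x t) u v := by
  simp only [xiMatrix, Matrix.of_apply]
  refine DecaysAnalytically.sum fun j _ => DecaysAnalytically.sum fun i _ => ?_
  have h := (decaysAnalytically_oscCoeff (B := B) t u.1 u.2.1 (ha u.1 u.2.1) (hs u.1 u.2.1)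
    (j - ((u.2.2 : ℕ) + 1) - i)).const_mul
    ((((v.2.2 : ℕ) + 1 + i - 1).choose i : ℂ) * (-1) ^ i * r u.1 u.2.1 j /
      (a u.1 u.2.1 - b v.1 v.2.1) ^ (i + ((v.2.2 : ℕ) + 1)))
  convert h using 2
  ring

/-- Both exponents have positive real part: -2iλ at the points a, where Im λ > 0, and 2iλ at the
points b, where Im λ < 0. -/
theorem dense_det_mainMatrix_ne_zero (hz : ∀ k, z k ∈ B.DPlus) (t : ℝ) :
    Dense {x : ℝ | (mainMatrix B z n r r' x t).det ≠ 0} := by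
  refine DecaysAnalytically.dense_det_ne_zero (M := fun x => XiTilde B z n r' x t * Xi B z n r x t)
    fun u v => ?_
  simp only [Matrix.mul_apply]
  refine DecaysAnalytically.sum fun w _ => DecaysAnalytically.mul ?_ ?_
  · refine decaysAnalytically_xiMatrix t (fun k i => (im_lam_poles₂ hz k i).1) (fun k i => ?_) u w
    have := (im_lam_poles₂ hz k i).2
    simp
    linarith
  · refine decaysAnalytically_xiMatrix t (fun k i => (im_lam_poles₁ hz k i).1) (fun k i => ?_) w v
    have := (im_lam_poles₁ hz k i).2
    simp
    linarith

end NonlocalMKdV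

end

noncomputable section

namespace NonlocalMKdV

open MeasureTheory Set Bornology

variable {B : Background} {q : ℝ → ℝ → ℝ}

/-! ### Existence of the Laurent data -/

theorem exists_norm_le_of_linearODE {E : Type*} [NormedAddCommGroup E] [NormedSpace ℂ E]
    {A : ℂ → ℝ → E →L[ℂ] E} (hA : Continuous (Function.uncurry A)) (κ₀ : ℂ) (L : ℝ) :
    ∃ M : ℝ, 0 ≤ M ∧ ∀ κ ∈ Metric.closedBall κ₀ 1, ∀ f : ℝ → E,
      (∀ s, HasDerivAt f (A κ s (f s)) s) → ‖f L‖ ≤ M * ‖f 0‖ := by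
  obtain ⟨M, hM⟩ := ((isCompact_closedBall κ₀ 1).prod
    (isCompact_uIcc (a := (0 : ℝ)) (b := L))).exists_bound_of_continuousOn hA.continuousOn
  refine ⟨Real.exp (M * |L - 0|), (Real.exp_pos _).le, fun κ hκ f hf => ?_⟩
  have h := norm_le_gronwall_uIcc (x := L) (x₀ := 0) (K := M) (ε := 0) (fun s _ => hf s)
    (fun s hs => by
      rw [add_zero]
      exact (A κ s).le_of_opNorm_le (hM (κ, s) ⟨hκ, hs⟩) _)
  rwa [gronwallBound_ε0, mul_comm] at h

theorem continuousAt_k {z : ℂ} (hz : z ≠ 0) : ContinuousAt B.k z :=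
  (continuousAt_id.add (continuousAt_const.div continuousAt_id hz)).div continuousAt_const
    two_ne_zero

/-- Following the t-axis and then a line parallel to the x-axis, Gronwall's inequality gives a
constant uniform for spectral parameters near z. Only k enters the system, and k is continuous away
from 0. -/
theorem IsSolution.exists_norm_le_of_isLax (hq : IsSolution B q) {z : ℂ} (hz : z ≠ 0) (x t : ℝ) :
    ∃ M : ℝ, ∀ᶠ w in 𝓝 z, ∀ Φ, IsLax B q w Φ → ‖Φ x t‖ ≤ M * ‖Φ 0 0‖ := by
  have c3 := hq.contDiff
  have r3 := hq.contDiff_rev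
  have c2 := contDiff_Dx (n := 2) c3
  have r2 := contDiff_Dx (n := 2) r3
  have c1 := contDiff_Dx (n := 1) c2
  have r1 := contDiff_Dx (n := 1) r2
  have sl : ∀ {f : ℝ → ℝ → ℝ}, Continuous (Function.uncurry f) →
      Continuous fun p : ℂ × ℝ => f 0 p.2 := fun h =>
    h.comp (continuous_const.prodMk continuous_snd)
  have sx : ∀ {f : ℝ → ℝ → ℝ}, Continuous (Function.uncurry f) →
      Continuous fun p : ℂ × ℝ => f p.2 t := fun h =>
    h.comp (continuous_snd.prodMk continuous_const)
  have hT : Continuous (Function.uncurry fun (κ : ℂ) (s : ℝ) => mv (timeMat κ (q 0 s) (Dx q 0 s)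
      (Dx (Dx q) 0 s) (revQ B q 0 s) (Dx (revQ B q) 0 s) (Dx (Dx (revQ B q)) 0 s))) := by
    have e0 := sl c3.continuous
    have e1 := sl c2.continuous
    have e2 := sl c1.continuous
    have f0 := sl r3.continuous
    have f1 := sl r2.continuous
    have f2 := sl r1.continuous
    refine continuous_mv ?_
    unfold timeMat
    refine continuous_matrix fun i j => ?_
    fin_cases i <;> fin_cases j <;> simp <;> fun_prop
  have hX : Continuous (Function.uncurry fun (κ : ℂ) (s : ℝ) => mv !![Complex.I * κ, (q s t : ℂ);
      (revQ B q s t : ℂ), -(Complex.I * κ)]) := by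
    have e0 := sx c3.continuous
    have f0 := sx r3.continuous
    refine continuous_mv ?_
    refine continuous_matrix fun i j => ?_
    fin_cases i <;> fin_cases j <;> simp <;> fun_prop
  obtain ⟨M₁, hM₁, h₁⟩ := exists_norm_le_of_linearODE hT (B.k z) t
  obtain ⟨M₂, hM₂, h₂⟩ := exists_norm_le_of_linearODE hX (B.k z) x
  refine ⟨M₂ * M₁, ?_⟩
  filter_upwards [(continuousAt_k hz).eventually (Metric.closedBall_mem_nhds (B.k z) one_pos)]
    with w hw Φ hΦ
  have i1 := h₁ _ hw (fun s => Φ 0 s) fun s => hΦ.2 0 s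
  have i2 := h₂ _ hw (fun s => Φ s t) fun s => by
    have := hΦ.1 s t
    rw [IsSolution.laxX_eq] at this
    exact this
  calc ‖Φ x t‖ ≤ M₂ * ‖Φ 0 t‖ := i2
    _ ≤ M₂ * (M₁ * ‖Φ 0 0‖) := mul_le_mul_of_nonneg_left i1 hM₂
    _ = _ := by ring

theorem HE.exists_norm_le {f : ℂ → ℂ} {c : ℂ} (h : HE f c) : ∃ C, ∀ᶠ z in 𝓝[≠] c, ‖f z‖ ≤ C := by
  obtain ⟨g, hg, he⟩ := h
  obtain ⟨C, hC⟩ := eventually_norm_le_of_tendsto hg.continuousAt.tendsto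
  refine ⟨C, ?_⟩
  filter_upwards [he, nhdsWithin_le_nhds hC] with z h1 h2
  rwa [h1]

theorem exists_wr_ne_zero {v : Fin 2 → ℂ} (hv : v ≠ 0) : ∃ u, wr u v ≠ 0 := by
  by_contra! h
  refine hv (funext fun i => ?_)
  have h1 := h ![1, 0]
  have h2 := h ![0, 1]
  simp [wr] at h1 h2
  fin_cases i
  · exact h2
  · exact h1

theorem cramer (u v w : Fin 2 → ℂ) : wr u v • w = wr u w • v + wr w v • u := by
  ext i
  fin_cases i <;> simp [wr] <;> ring

theorem analyticAt_wr {f g : ℂ → Fin 2 → ℂ} {c : ℂ} (hf : AnalyticAt ℂ f c)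
    (hg : AnalyticAt ℂ g c) : AnalyticAt ℂ (fun z => wr (f z) (g z)) c := by
  have hf' := analyticAt_pi_iff.1 hf
  have hg' := analyticAt_pi_iff.1 hg
  exact ((hf' 0).fun_mul (hg' 1)).fun_sub ((hf' 1).fun_mul (hg' 0))

/-- If `wr(φ, ψ) = s γ` and `s` has a zero of order `n` at `a`, then the principal part of `φ / s`
is a scalar multiple of `ψ` by coefficients that do not depend on `(x,t)`. -/
theorem IsSolution.exists_principalPart (hq : IsSolution B q) {a : ℂ} (ha : a ≠ 0)
    {φ ψ : ℝ → ℝ → ℂ → Fin 2 → ℂ} {s γ : ℂ → ℂ} {n : ℕ}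
    (hφL : ∀ᶠ w in 𝓝 a, IsLax B q w fun x t => φ x t w)
    (hψL : ∀ᶠ w in 𝓝 a, IsLax B q w fun x t => ψ x t w)
    (hφ : ∀ x t, AnalyticAt ℂ (φ x t) a) (hψ : ∀ x t, AnalyticAt ℂ (ψ x t) a)
    (hs : AnalyticAt ℂ s a) (hn : analyticOrderAt s a = n) (hγ : AnalyticAt ℂ γ a)
    (hwr : ∀ᶠ w in 𝓝 a, wr (φ 0 0 w) (ψ 0 0 w) = s w * γ w) (hψ0 : ψ 0 0 a ≠ 0) :
    ∃ C : ℕ → ℂ, ∀ x t, ∃ g : ℂ → Fin 2 → ℂ, AnalyticAt ℂ g a ∧ ∀ᶠ w in 𝓝[≠] a,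
      (s w)⁻¹ • φ x t w - (∑ m ∈ Finset.Icc 1 n, C m / (w - a) ^ m) • ψ x t w = g w := by
  obtain ⟨u, hu⟩ := exists_wr_ne_zero hψ0
  obtain ⟨k, hk, hk0, hke⟩ := (hs.analyticOrderAt_eq_natCast).1 hn
  have hD : AnalyticAt ℂ (fun w => wr u (ψ 0 0 w)) a := analyticAt_wr analyticAt_const (hψ 0 0)
  have hDne := hD.continuousAt.eventually_ne hu
  have hkne := hk.continuousAt.eventually_ne hk0
  set h : ℂ → ℂ := fun w => wr u (φ 0 0 w) / (wr u (ψ 0 0 w) * k w) with hh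
  have hha : AnalyticAt ℂ h a := (analyticAt_wr analyticAt_const (hφ 0 0)).fun_div (hD.fun_mul hk)
    (mul_ne_zero hu hk0)
  -- These are the coefficients of the principal part of h/(w - a)^n.
  set C : ℕ → ℂ := fun m => tc h (n - m) a with hC
  set R : ℂ → ℂ := fun w => ∑ m ∈ Finset.Icc 1 n, C m / (w - a) ^ m with hR
  have hRe : ∀ w, R w = ∑ i ∈ Finset.range n, tc h i a / (w - a) ^ (n - i) := by
    intro w
    rw [hR, hC]
    refine Finset.sum_bij' (fun m _ => n - m) (fun i _ => n - i) ?_ ?_ ?_ ?_ ?_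
    · intro m hm
      simp only [Finset.mem_Icc, Finset.mem_range] at *
      omega
    · intro m hm
      simp only [Finset.mem_Icc, Finset.mem_range] at *
      omega
    · intro m hm
      simp only [Finset.mem_Icc] at *
      omega
    · intro m hm
      simp only [Finset.mem_range] at *
      omega
    · intro m hm
      simp only [Finset.mem_Icc] at hm
      rw [Nat.sub_sub_self hm.2]
  have hHE : HE (fun w => h w / (w - a) ^ n - R w) a := by
    simp only [hRe]
    exact HE.sub_principalPart hha n
  set Δ : ℝ → ℝ → ℂ → Fin 2 → ℂ := fun x t w => (s w)⁻¹ • φ x t w - R w • ψ x t w with hΔ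
  have hsne : ∀ᶠ w in 𝓝[≠] a, s w ≠ 0 := by
    filter_upwards [nhdsWithin_le_nhds hke, nhdsWithin_le_nhds hkne, self_mem_nhdsWithin]
      with w h1 h2 h3
    rw [h1, smul_eq_mul]
    exact mul_ne_zero (pow_ne_zero _ (sub_ne_zero.2 h3)) h2
  -- Cramer's rule in the basis (ψ, u): the coefficient of u carries wr(φ, ψ) = s γ, so the division
  -- by s cancels there and the singularity is a multiple of ψ alone.
  have hΔ0 : ∀ᶠ w in 𝓝[≠] a, Δ 0 0 w =
      (h w / (w - a) ^ n - R w) • ψ 0 0 w + (γ w / wr u (ψ 0 0 w)) • u := by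
    filter_upwards [nhdsWithin_le_nhds hke, nhdsWithin_le_nhds hkne, nhdsWithin_le_nhds hDne,
      nhdsWithin_le_nhds hwr, self_mem_nhdsWithin, hsne] with w h1 h2 h3 h4 h5 h6
    have e1 : φ 0 0 w = (wr u (φ 0 0 w) / wr u (ψ 0 0 w)) • ψ 0 0 w +
        (s w * γ w / wr u (ψ 0 0 w)) • u := by
      have := cramer u (ψ 0 0 w) (φ 0 0 w)
      rw [h4] at this
      rw [div_eq_inv_mul, div_eq_inv_mul, ← smul_smul, ← smul_smul, ← smul_add, ← this, smul_smul,
        inv_mul_cancel₀ h3, one_smul]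
    have e2 : (s w)⁻¹ * (wr u (φ 0 0 w) / wr u (ψ 0 0 w)) = h w / (w - a) ^ n := by
      rw [hh, h1, smul_eq_mul]
      field_simp
    have e3 : (s w)⁻¹ * (s w * γ w / wr u (ψ 0 0 w)) = γ w / wr u (ψ 0 0 w) := by
      field_simp
    rw [hΔ]
    simp only
    nth_rewrite 1 [e1]
    rw [smul_add, smul_smul, smul_smul, e2, e3, sub_smul]
    abel
  obtain ⟨K₁, hK₁⟩ := hHE.exists_norm_le
  obtain ⟨K₂, hK₂⟩ : ∃ K, ∀ᶠ w in 𝓝 a, ‖ψ 0 0 w‖ ≤ K :=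
    ⟨_, ((hψ 0 0).continuousAt.norm.eventually (gt_mem_nhds (lt_add_one _))).mono fun _ h => h.le⟩
  obtain ⟨K₃, hK₃⟩ := eventually_norm_le_of_tendsto (hγ.fun_div hD hu).continuousAt.tendsto
  have hb0 : ∀ᶠ w in 𝓝[≠] a, ‖Δ 0 0 w‖ ≤ K₁ * K₂ + K₃ * ‖u‖ := by
    filter_upwards [hΔ0, hK₁, nhdsWithin_le_nhds hK₂, nhdsWithin_le_nhds hK₃] with w h1 h2 h3 h4
    rw [h1]
    refine (norm_add_le _ _).trans (add_le_add ?_ ?_)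
    · rw [norm_smul]
      exact mul_le_mul h2 h3 (norm_nonneg _) ((norm_nonneg _).trans h2)
    · rw [norm_smul]
      exact mul_le_mul_of_nonneg_right h4 (norm_nonneg _)
  -- The scalars 1/s and R do not depend on (x,t), so the difference still solves the Lax pair. Its
  -- bound at (0,0) therefore passes to every (x,t), where the singularity is then removable.
  have hΔL : ∀ᶠ w in 𝓝[≠] a, IsLax B q w fun x t => Δ x t w := by
    filter_upwards [nhdsWithin_le_nhds hφL, nhdsWithin_le_nhds hψL] with w h1 h2
    have := (h1.smul (s w)⁻¹).add (h2.smul (-R w))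
    simpa only [hΔ, sub_eq_add_neg, neg_smul] using this
  refine ⟨C, fun x t => ?_⟩
  obtain ⟨M, hM⟩ := hq.exists_norm_le_of_isLax ha x t
  have hbd : ∀ i, ∀ᶠ w in 𝓝[≠] a, ‖Δ x t w i‖ ≤ max M 0 * (K₁ * K₂ + K₃ * ‖u‖) := by
    intro i
    filter_upwards [nhdsWithin_le_nhds hM, hΔL, hb0] with w h1 h2 h3
    calc ‖Δ x t w i‖ ≤ ‖Δ x t w‖ := norm_le_pi_norm _ _
      _ ≤ M * ‖Δ 0 0 w‖ := h1 _ h2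
      _ ≤ max M 0 * ‖Δ 0 0 w‖ := mul_le_mul_of_nonneg_right (le_max_left _ _) (norm_nonneg _)
      _ ≤ _ := mul_le_mul_of_nonneg_left h3 (le_max_right _ _)
  have hda : ∀ i, ∀ᶠ w in 𝓝[≠] a, DifferentiableAt ℂ (fun w => Δ x t w i) w := by
    intro i
    filter_upwards [nhdsWithin_le_nhds (analyticAt_pi_iff.1 (hφ x t) i).eventually_analyticAt,
      nhdsWithin_le_nhds (analyticAt_pi_iff.1 (hψ x t) i).eventually_analyticAt,
      nhdsWithin_le_nhds hs.eventually_analyticAt, hsne, self_mem_nhdsWithin] with w h1 h2 h3 h4 h5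
    have h6 : AnalyticAt ℂ R w := by
      refine Finset.analyticAt_fun_sum _ fun m _ => ?_
      exact analyticAt_const.fun_div ((analyticAt_id.fun_sub analyticAt_const).fun_pow m)
        (pow_ne_zero _ (sub_ne_zero.2 h5))
    exact (((h3.inv h4).fun_mul h1).fun_sub (h6.fun_mul h2)).differentiableAt
  choose g hg hge using fun i => HE.of_bounded (hda i) (hbd i)
  refine ⟨fun w i => g i w, analyticAt_pi_iff.2 hg, ?_⟩
  filter_upwards [hge 0, hge 1] with w h0 h1
  ext i
  fin_cases i
  · exact h0
  · exact h1

end NonlocalMKdV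

end

/-! ### Analyticity of the Jost columns, orders of the zeros and the global Laurent data -/

noncomputable section

namespace NonlocalMKdV

open MeasureTheory Set Bornology

variable {B : Background} {q : ℝ → ℝ → ℝ} {N : ℕ}

theorem tendsto_neg_conj (a : ℂ) :
    Tendsto (fun w => -(starRingEnd ℂ) w) (𝓝 (-(starRingEnd ℂ) a)) (𝓝 a) := by
  have h : Continuous fun w : ℂ => -(starRingEnd ℂ) w := Complex.continuous_conj.neg
  simpa using h.tendsto (-(starRingEnd ℂ) a)

theorem analyticAt_neg_conj {f : ℂ → ℂ} {a : ℂ} (hf : AnalyticAt ℂ f a) :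
    AnalyticAt ℂ (fun w => (starRingEnd ℂ) (f (-(starRingEnd ℂ) w))) (-(starRingEnd ℂ) a) := by
  refine Complex.analyticAt_iff_eventually_differentiableAt.2 ?_
  filter_upwards [(tendsto_neg_conj a).eventually
    (Complex.analyticAt_iff_eventually_differentiableAt.1 hf)] with w hw
  have h1 : DifferentiableAt ℂ (fun v => f (-v)) ((starRingEnd ℂ) w) :=
    DifferentiableAt.comp (g := f) _ hw differentiableAt_id.fun_neg
  simpa [Function.comp_def] using h1.conj_conj

namespace IsSolution

variable {a : ℂ}

theorem s₁₁_analyticAt (hq : IsSolution B q) (hσ : B.σ = -1) (ha : a ≠ 0)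
    (h : 0 < (B.lam a).im) : AnalyticAt ℂ (s₁₁ B q) a := by
  refine Complex.analyticAt_iff_eventually_differentiableAt.2 ?_
  filter_upwards [eventually_lam_pos ha h] with w hw using hq.s₁₁_differentiableAt hσ hw.1 hw.2

theorem analyticOrderAt_s₁₁_neg_conj (hq : IsSolution B q) (hσ : B.σ = -1) (ha : a ≠ 0)
    (h : 0 < (B.lam a).im) {n : ℕ} (hn : analyticOrderAt (s₁₁ B q) a = n) :
    analyticOrderAt (s₁₁ B q) (-(starRingEnd ℂ) a) = n := by
  have ha' : -(starRingEnd ℂ) a ≠ 0 := by simpa using ha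
  have h' : 0 < (B.lam (-(starRingEnd ℂ) a)).im := by rw [lam_neg_conj]; simpa using h
  obtain ⟨g, hg, hg0, hge⟩ := (hq.s₁₁_analyticAt hσ ha h).analyticOrderAt_eq_natCast.1 hn
  refine (hq.s₁₁_analyticAt hσ ha' h').analyticOrderAt_eq_natCast.2
    -- The sign comes from conjugating (-w* - a)^n, which equals (-1)^n (w + a*)^n after
    -- conjugation.
    ⟨fun w => (-1) ^ n * (starRingEnd ℂ) (g (-(starRingEnd ℂ) w)),
      analyticAt_const.fun_mul (analyticAt_neg_conj hg), by simpa using hg0, ?_⟩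
  filter_upwards [(tendsto_neg_conj a).eventually hge,
    (tendsto_neg_conj a).eventually (eventually_lam_pos ha h)] with w h1 h2
  have h3 := hq.s₁₁_neg_conj hσ (z := -(starRingEnd ℂ) w) ⟨h2.1, h2.2.le⟩
  rw [map_neg, Complex.conj_conj, neg_neg] at h3
  rw [h3, h1]
  simp only [smul_eq_mul, map_mul, map_pow, map_sub, map_neg, Complex.conj_conj, ← mul_assoc,
    ← mul_pow]
  congr 2
  ring

theorem colA_analyticAt (hq : IsSolution B q) (ha : a ≠ 0) (h : 0 < (B.lam a).im) (x t : ℝ) :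
    AnalyticAt ℂ (colA B q x t) a :=
  (hq.colA_differentiableOn x t).analyticAt ((isOpen_regionO B.kap).mem_nhds ⟨ha, h⟩)

theorem jostPlus_zero_analyticAt (hq : IsSolution B q) (ha : a ≠ 0) (h : 0 < (B.lam a).im)
    (x t : ℝ) : AnalyticAt ℂ (jostPlus B q 0 x t) a := by
  have h1 : AnalyticAt ℂ (fun w => Complex.exp (Complex.I * B.θ x t w) • colA B q x t w) a :=
    AnalyticAt.fun_smul (AnalyticAt.cexp (analyticAt_const.fun_mul (analyticAt_theta ha x t)))
      (hq.colA_analyticAt ha h x t)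
  refine h1.congr ?_
  filter_upwards [eventually_lam_pos ha h] with w hw
    using (hq.jostPlus_zero x t ⟨hw.1, hw.2.le⟩).symm

theorem _root_.NonlocalMKdV.analyticAt_swap2 {f : ℂ → Fin 2 → ℂ} (hf : AnalyticAt ℂ f a) :
    AnalyticAt ℂ (fun w => swap2 (f w)) a := by
  have h := analyticAt_pi_iff.1 hf
  refine analyticAt_pi_iff.2 fun i => ?_
  fin_cases i
  · exact h 1
  · exact h 0

theorem jostMinus_one_analyticAt (hq : IsSolution B q) (hσ : B.σ = -1) (ha : a ≠ 0)
    (h : 0 < (B.lam a).im) (x t : ℝ) : AnalyticAt ℂ (jostMinus B q 1 x t) a := by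
  have h1 : AnalyticAt ℂ (fun w => Complex.exp (-(Complex.I * B.θ x t w)) •
      swap2 (colA B q (-x) (-t) w)) a :=
    AnalyticAt.fun_smul (AnalyticAt.cexp (analyticAt_const.fun_mul (analyticAt_theta ha x t)).fun_neg)
      (analyticAt_swap2 (hq.colA_analyticAt ha h (-x) (-t)))
  refine h1.congr ?_
  filter_upwards [eventually_lam_pos ha h] with w hw
    using (hq.jostMinus_one hσ x t ⟨hw.1, hw.2.le⟩).symm

theorem _root_.NonlocalMKdV.lam_inv_pos (h : (B.lam a).im < 0) :
    0 < (B.lam (B.kap / a)).im := by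
  rw [lam_inv, Complex.neg_im]; linarith

theorem colA_inv_analyticAt (hq : IsSolution B q) (ha : a ≠ 0) (h : (B.lam a).im < 0) (x t : ℝ) :
    AnalyticAt ℂ (fun w => colA B q x t (B.kap / w)) a :=
  AnalyticAt.fun_comp (hq.colA_analyticAt (div_ne_zero B.kap_ne ha) (lam_inv_pos h) x t)
    (analyticAt_inv_kap ha)

theorem jostPlus_one_analyticAt (hq : IsSolution B q) (ha : a ≠ 0) (h : (B.lam a).im < 0)
    (x t : ℝ) : AnalyticAt ℂ (jostPlus B q 1 x t) a := by
  have h1 : AnalyticAt ℂ (fun w => Complex.exp (-(Complex.I * B.θ x t w)) •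
      (Complex.I * B.qPlus / w) • colA B q x t (B.kap / w)) a :=
    AnalyticAt.fun_smul (AnalyticAt.cexp (analyticAt_const.fun_mul (analyticAt_theta ha x t)).fun_neg)
      (AnalyticAt.fun_smul (analyticAt_const.fun_div analyticAt_id ha)
        (hq.colA_inv_analyticAt ha h x t))
  refine h1.congr ?_
  filter_upwards [eventually_lam_neg ha h] with w hw
    using (hq.jostPlus_one x t (inv_mem_regC ⟨hw.1, hw.2.le⟩)).symm

theorem jostMinus_zero_analyticAt (hq : IsSolution B q) (hσ : B.σ = -1) (ha : a ≠ 0)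
    (h : (B.lam a).im < 0) (x t : ℝ) : AnalyticAt ℂ (jostMinus B q 0 x t) a := by
  have hqs : (B.qMinus : ℂ) ≠ 0 := by exact_mod_cast B.qMinus_ne
  have h1 : AnalyticAt ℂ (fun w => Complex.exp (Complex.I * B.θ x t w) • colC B q x t w) a :=
    AnalyticAt.fun_smul (AnalyticAt.cexp (analyticAt_const.fun_mul (analyticAt_theta ha x t)))
      (AnalyticAt.fun_smul (analyticAt_const.fun_div (analyticAt_const.fun_mul analyticAt_id)
        (mul_ne_zero (mul_ne_zero Complex.I_ne_zero hqs) ha))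
        (analyticAt_swap2 (hq.colA_inv_analyticAt ha h (-x) (-t))))
  refine h1.congr ?_
  filter_upwards [eventually_lam_neg ha h] with w hw
    using (hq.jostMinus_zero hσ x t (inv_mem_regC ⟨hw.1, hw.2.le⟩)).symm

theorem s₂₂_eventuallyEq (hq : IsSolution B q) (hσ : B.σ = -1) (ha : a ≠ 0)
    (h : (B.lam a).im < 0) : s₂₂ B q =ᶠ[𝓝 a] fun w => B.δ * s₁₁ B q (B.kap / w) := by
  filter_upwards [eventually_lam_neg ha h] with w hw
    using hq.s₂₂_eq hσ (inv_mem_regC ⟨hw.1, hw.2.le⟩)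

theorem s₂₂_analyticAt (hq : IsSolution B q) (hσ : B.σ = -1) (ha : a ≠ 0)
    (h : (B.lam a).im < 0) : AnalyticAt ℂ (s₂₂ B q) a :=
  AnalyticAt.congr (analyticAt_const.fun_mul (AnalyticAt.fun_comp
    (hq.s₁₁_analyticAt hσ (div_ne_zero B.kap_ne ha) (lam_inv_pos h)) (analyticAt_inv_kap ha)))
    (hq.s₂₂_eventuallyEq hσ ha h).symm

/-- The map w ↦ κ/w has nonzero derivative and δ ≠ 0, so composition and scaling preserve the order.
-/
theorem analyticOrderAt_s₂₂ (hq : IsSolution B q) (hσ : B.σ = -1) (ha : a ≠ 0)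
    (h : (B.lam a).im < 0) : analyticOrderAt (s₂₂ B q) a = analyticOrderAt (s₁₁ B q) (B.kap / a) := by
  have hδ : (B.δ : ℂ) ≠ 0 := by rcases B.δ_eq with h | h <;> simp [h]
  have hd : HasDerivAt (fun w : ℂ => B.kap / w) (B.kap * -(a ^ 2)⁻¹) a := by
    simp only [div_eq_mul_inv]
    exact (hasDerivAt_inv ha).const_mul B.kap
  have h1 : AnalyticAt ℂ (s₁₁ B q ∘ fun w => B.kap / w) a := AnalyticAt.comp
    (hq.s₁₁_analyticAt hσ (div_ne_zero B.kap_ne ha) (lam_inv_pos h)) (analyticAt_inv_kap ha)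
  rw [analyticOrderAt_congr (hq.s₂₂_eventuallyEq hσ ha h),
    ← analyticOrderAt_comp_of_deriv_ne_zero (g := fun w => B.kap / w) (analyticAt_inv_kap ha) (by
      rw [hd.deriv]
      exact mul_ne_zero B.kap_ne (neg_ne_zero.2 (inv_ne_zero (pow_ne_zero 2 ha))))]
  have h2 := analyticOrderAt_mul (f := fun _ => (B.δ : ℂ)) analyticAt_const h1
  rw [analyticAt_const.analyticOrderAt_eq_zero.2 hδ, zero_add] at h2
  exact h2

theorem _root_.NonlocalMKdV.swap2_ne_zero {v : Fin 2 → ℂ} (hv : v ≠ 0) : swap2 v ≠ 0 := by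
  intro h
  apply hv
  rw [← swap2_swap2 v, h]
  ext i; fin_cases i <;> rfl

theorem _root_.NonlocalMKdV.analyticAt_detE (ha : a ≠ 0) : AnalyticAt ℂ (detE B) a :=
  analyticAt_const.fun_sub (analyticAt_const.fun_div (analyticAt_id.fun_pow 2) (pow_ne_zero 2 ha))

theorem _root_.NonlocalMKdV.detE_ne_zero_of_im_ne {w : ℂ} (hw : w ≠ 0) (h : (B.lam w).im ≠ 0) :
    detE B w ≠ 0 :=
  detE_ne_zero hw fun hb => h (by rw [(lam_eq_zero_iff hw).2 hb, Complex.zero_im])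

theorem exists_principalPart_upper (hq : IsSolution B q) (hσ : B.σ = -1) (ha : a ≠ 0)
    (h : 0 < (B.lam a).im) {n : ℕ} (hn : analyticOrderAt (s₁₁ B q) a = n) :
    ∃ C : ℕ → ℂ, ∀ x t, ∃ g : ℂ → Fin 2 → ℂ, AnalyticAt ℂ g a ∧ ∀ᶠ w in 𝓝[≠] a,
      (s₁₁ B q w)⁻¹ • jostPlus B q 0 x t w -
        (∑ m ∈ Finset.Icc 1 n, C m / (w - a) ^ m) • jostMinus B q 1 x t w = g w := by
  have hev := eventually_lam_pos ha h
  refine hq.exists_principalPart ha (γ := detE B)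
    (hev.mono fun w hw => hq.isLax_jostPlus_zero ⟨hw.1, hw.2.le⟩)
    (hev.mono fun w hw => hq.isLax_jostMinus_one hσ ⟨hw.1, hw.2.le⟩)
    (hq.jostPlus_zero_analyticAt ha h) (hq.jostMinus_one_analyticAt hσ ha h)
    (hq.s₁₁_analyticAt hσ ha h) hn (analyticAt_detE ha) (hev.mono fun w hw => ?_) ?_
  · rw [s₁₁, div_mul_cancel₀ _ (detE_ne_zero_of_im_ne hw.1 hw.2.ne')]
  · rw [hq.jostMinus_one hσ 0 0 ⟨ha, h.le⟩]
    exact smul_ne_zero (Complex.exp_ne_zero _) (swap2_ne_zero (hq.colA_ne_zero ⟨ha, h.le⟩ _ _))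

theorem exists_principalPart_lower (hq : IsSolution B q) (hσ : B.σ = -1) (ha : a ≠ 0)
    (h : (B.lam a).im < 0) {n : ℕ} (hn : analyticOrderAt (s₂₂ B q) a = n) :
    ∃ C : ℕ → ℂ, ∀ x t, ∃ g : ℂ → Fin 2 → ℂ, AnalyticAt ℂ g a ∧ ∀ᶠ w in 𝓝[≠] a,
      (s₂₂ B q w)⁻¹ • jostPlus B q 1 x t w -
        (∑ m ∈ Finset.Icc 1 n, C m / (w - a) ^ m) • jostMinus B q 0 x t w = g w := by
  have hqs : (B.qMinus : ℂ) ≠ 0 := by exact_mod_cast B.qMinus_ne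
  have hev := eventually_lam_neg ha h
  have hC : B.kap / a ∈ B.regC := inv_mem_regC ⟨ha, h.le⟩
  -- The sign arises because s₂₂ is defined by the Wronskian in the opposite order.
  refine hq.exists_principalPart ha (γ := fun w => -detE B w)
    (hev.mono fun w hw => hq.isLax_jostPlus_one (inv_mem_regC ⟨hw.1, hw.2.le⟩))
    (hev.mono fun w hw => hq.isLax_jostMinus_zero hσ (inv_mem_regC ⟨hw.1, hw.2.le⟩))
    (hq.jostPlus_one_analyticAt ha h) (hq.jostMinus_zero_analyticAt hσ ha h)
    (hq.s₂₂_analyticAt hσ ha h) hn (analyticAt_detE ha).fun_neg (hev.mono fun w hw => ?_) ?_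
  · rw [s₂₂, mul_neg, div_mul_cancel₀ _ (detE_ne_zero_of_im_ne hw.1 hw.2.ne), wr_swap]
  · rw [hq.jostMinus_zero hσ 0 0 hC, colC]
    exact smul_ne_zero (Complex.exp_ne_zero _) (smul_ne_zero (div_ne_zero B.kap_ne
      (mul_ne_zero (mul_ne_zero Complex.I_ne_zero hqs) ha)) (swap2_ne_zero (hq.colA_ne_zero hC _ _)))

end IsSolution

open Classical in
/-- Local principal parts assemble into a global rational function; a pole that is listed twice is
counted once. -/
theorem exists_cancelsPoles {s : ℂ → ℂ} {φ ψ : ℝ → ℝ → ℂ → Fin 2 → ℂ} {n : Fin N → ℕ}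
    {a : Fin N → Fin 2 → ℂ} (ha : ∀ k i k' i', a k i = a k' i' → k = k')
    (hψ : ∀ k i x t, AnalyticAt ℂ (ψ x t) (a k i))
    (h : ∀ k i, ∃ C : ℕ → ℂ, ∀ x t, ∃ g : ℂ → Fin 2 → ℂ, AnalyticAt ℂ g (a k i) ∧
      ∀ᶠ w in 𝓝[≠] (a k i), (s w)⁻¹ • φ x t w -
        (∑ m ∈ Finset.Icc 1 (n k), C m / (w - a k i) ^ m) • ψ x t w = g w) :
    ∃ r, CancelsPoles s φ ψ n a r := by
  choose C hC using h
  refine ⟨fun k i m => if i = 1 ∧ a k 1 = a k 0 then 0 else C k i m, fun k i x t => ?_⟩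
  -- The index `i₀` is the one that carries the data of the point: 0 if the two points of the pair
  -- coincide, and i itself otherwise.
  obtain ⟨i₀, hi₀, hne, hother⟩ : ∃ i₀, a k i₀ = a k i ∧ ¬ (i₀ = 1 ∧ a k 1 = a k 0) ∧
      ∀ i', i' ≠ i₀ → a k i' = a k i → i' = 1 ∧ a k 1 = a k 0 := by
    by_cases hd : a k 1 = a k 0
    · refine ⟨0, ?_, by simp, fun i' hi' _ => ⟨by omega, hd⟩⟩
      fin_cases i
      · rfl
      · exact hd.symm
    · refine ⟨i, rfl, fun h => hd h.2, fun i' hi' he => absurd ?_ hd⟩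
      fin_cases i <;> fin_cases i'
      · exact absurd rfl hi'
      · exact he
      · exact he.symm
      · exact absurd rfl hi'
  obtain ⟨g, hg, hge⟩ := hC k i₀ x t
  rw [hi₀] at hg hge
  set r : Fin N → Fin 2 → ℕ → ℂ := fun k i m => if i = 1 ∧ a k 1 = a k 0 then 0 else C k i m with hr
  set T : Fin N × Fin 2 → ℂ → ℂ := fun p w =>
    ∑ m ∈ Finset.Icc 1 (n p.1), r p.1 p.2 m / (w - a p.1 p.2) ^ m with hT
  have hpp : ∀ w, principalPart n a r w =
      T (k, i₀) w + ∑ p ∈ Finset.univ.erase (k, i₀), T p w := by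
    intro w
    rw [Finset.add_sum_erase _ (fun p => T p w) (Finset.mem_univ _), Fintype.sum_prod_type]
    rfl
  have hT₀ : ∀ w, T (k, i₀) w = ∑ m ∈ Finset.Icc 1 (n k), C k i₀ m / (w - a k i) ^ m := by
    intro w
    simp only [hT, hr, if_neg hne, hi₀]
  have hrest : AnalyticAt ℂ (fun w => ∑ p ∈ Finset.univ.erase (k, i₀), T p w) (a k i) := by
    refine Finset.analyticAt_fun_sum _ fun p hp => ?_
    by_cases hpa : a p.1 p.2 = a k i
    · have hk : p.1 = k := ha _ _ _ _ hpa
      have hp2 : p.2 ≠ i₀ := fun h => (Finset.ne_of_mem_erase hp) (Prod.ext hk h)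
      rw [hk] at hpa
      have h0 := hother _ hp2 hpa
      have : T p = fun _ => 0 := by
        funext w
        simp only [hT, hr, hk, if_pos h0, zero_div, Finset.sum_const_zero]
      rw [this]
      exact analyticAt_const
    · refine Finset.analyticAt_fun_sum _ fun m _ => ?_
      exact analyticAt_const.fun_div ((analyticAt_id.fun_sub analyticAt_const).fun_pow m)
        (pow_ne_zero _ (sub_ne_zero.2 (Ne.symm hpa)))
  refine ⟨fun w => g w - (∑ p ∈ Finset.univ.erase (k, i₀), T p w) • ψ x t w,
    hg.fun_sub (hrest.fun_smul (hψ k i x t)), ?_⟩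
  filter_upwards [hge] with w hw
  rw [hpp, hT₀, ← hw, add_smul]
  abel

theorem poles₁_injective {z : Fin N → ℂ}
    (hdist : ∀ j k, j ≠ k → z j ≠ z k ∧ z j ≠ -(starRingEnd ℂ) (z k)) (k : Fin N) (i : Fin 2)
    (k' : Fin N) (i' : Fin 2) (h : poles₁ z k i = poles₁ z k' i') : k = k' := by
  by_contra hk
  have h1 := hdist k k' hk
  have h2 := hdist k' k (Ne.symm hk)
  fin_cases i <;> fin_cases i' <;> simp [poles₁] at h
  · exact h1.1 h
  · exact h1.2 h
  · exact h2.2 h.symm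
  · exact h1.1 ((starRingEnd ℂ).injective h)

theorem IsSolution.exists_reflectionData (hq : IsSolution B q) (hσ : B.σ = -1) {z : Fin N → ℂ}
    {n : Fin N → ℕ} (hz : ∀ k, z k ∈ B.DPlus)
    (hdist : ∀ j k, j ≠ k → z j ≠ z k ∧ z j ≠ -(starRingEnd ℂ) (z k))
    (hord : ∀ k, analyticOrderAt (s₁₁ B q) (z k) = (n k : ℕ∞)) :
    ∃ r r' : Fin N → Fin 2 → ℕ → ℂ, IsReflectionData B q z n r r' := by
  have ha := im_lam_poles₁ hz
  have hb := im_lam_poles₂ hz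
  have hord₁ : ∀ k i, analyticOrderAt (s₁₁ B q) (poles₁ z k i) = n k := by
    intro k i
    fin_cases i
    · exact hord k
    · exact hq.analyticOrderAt_s₁₁_neg_conj hσ (ha k 0).1 (ha k 0).2 (hord k)
  obtain ⟨r, hr⟩ := exists_cancelsPoles (n := n) (poles₁_injective hdist)
    (fun k i x t => hq.jostMinus_one_analyticAt hσ (ha k i).1 (ha k i).2 x t)
    (fun k i => hq.exists_principalPart_upper hσ (ha k i).1 (ha k i).2 (hord₁ k i))
  obtain ⟨r', hr'⟩ := exists_cancelsPoles (n := n) (a := poles₂ B z)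
    (fun k i k' i' h => poles₁_injective hdist k i k' i' (by
      rw [poles₂_eq, poles₂_eq] at h
      rw [← inv_inv_kap (ha k i).1, h, inv_inv_kap (ha k' i').1]))
    (fun k i x t => hq.jostMinus_zero_analyticAt hσ (hb k i).1 (hb k i).2 x t)
    (fun k i => hq.exists_principalPart_lower hσ (hb k i).1 (hb k i).2 (by
      rw [hq.analyticOrderAt_s₂₂ hσ (hb k i).1 (hb k i).2, poles₂_eq, inv_inv_kap (ha k i).1]
      exact hord₁ k i))
  exact ⟨r, r', hr, hr'⟩

end NonlocalMKdV

end
theorem theorem2 (B : NonlocalMKdV.Background) (hσ : B.σ = -1)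
    (q : ℝ → ℝ → ℝ) (hq : NonlocalMKdV.IsSolution B q)
    (hrefl : NonlocalMKdV.Reflectionless B q)
    (N : ℕ) (z : Fin N → ℂ) (n : Fin N → ℕ) (hn : ∀ k, 1 ≤ n k)
    (hz : ∀ k, z k ∈ B.DPlus)
    (hdist : ∀ j k, j ≠ k → z j ≠ z k ∧ z j ≠ -(starRingEnd ℂ) (z k))
    (hord : ∀ k, analyticOrderAt (NonlocalMKdV.s₁₁ B q) (z k) = (n k : ℕ∞))
    (hall : ∀ w ∈ B.DPlus, NonlocalMKdV.s₁₁ B q w = 0 →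
      ∃ k, w = z k ∨ w = -(starRingEnd ℂ) (z k)) :
    (∃ r r' : Fin N → Fin 2 → ℕ → ℂ, NonlocalMKdV.IsReflectionData B q z n r r') ∧
    ∀ r r' : Fin N → Fin 2 → ℕ → ℂ, NonlocalMKdV.IsReflectionData B q z n r r' →
      (∀ t : ℝ, Dense {x : ℝ | (NonlocalMKdV.mainMatrix B z n r r' x t).det ≠ 0}) ∧
      ∀ x t : ℝ, (NonlocalMKdV.mainMatrix B z n r r' x t).det ≠ 0 →
        (q x t : ℂ) = (B.qMinus : ℂ) - Complex.I *
          (((NonlocalMKdV.mainMatrix B z n r r' x t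
                + Matrix.vecMulVec (NonlocalMKdV.Gamma₂ B z n r' x t)
                    (NonlocalMKdV.w₀ n)).det
              + (NonlocalMKdV.mainMatrix B z n r r' x t
                + Matrix.vecMulVec
                    ((NonlocalMKdV.XiTilde B z n r' x t).mulVec
                      (NonlocalMKdV.Gamma₁ B z n r x t))
                    (NonlocalMKdV.w₀ n)).det)
            / (NonlocalMKdV.mainMatrix B z n r r' x t).det - 2) :=
  ⟨hq.exists_reflectionData hσ hz hdist hord, fun _ _ hr =>
    ⟨fun t => NonlocalMKdV.dense_det_mainMatrix_ne_zero hz t,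
      fun x t hM => hq.determinant_formula hσ hrefl hz hall hr x t hM⟩⟩
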